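/- Let $g\ge 1$. For $\underline a=(a_1,\dots,a_g)$ with real entries let $\mathcal C_{g,g}$ and $\mathcal C_{2g-1,1}$ be the families of curves in $(\mathbb C^*)^2$ given by $F=0$, where respectively $$F_{g,g}=x_1+x_2+x_1^{-g}x_2^{-g}+\sum_{j=1}^g a_j\,x_1^{1-j}x_2^{1-j},\qquad F_{2g-1,1}=x_1+x_2+x_1^{-2g+1}x_2^{-1}+\sum_{j=1}^g a_j\,x_1^{1-j}.$$ *Regulator periods.* Let $R\{f,h\}=\log f\,\frac{dh}{h}-2\pi i\,\log h\cdot\delta_{T_f}$, $T_f=f^{-1}(\mathbb R_{<0})$. If $u,v$ are continuous logarithms of $-x_1,-x_2$ along a closed path $\gamma:[0,1]\to\{F=0\}$, then $$R_\gamma=\int_\gamma R\{-x_1,-x_2\}=\int_0^1u\,dv-(u(1)-u(0))\,v(0),$$ which is well defined modulo $(2\pi i)^2\mathbb Z$. For a term $a_jP_j$ of $F$ with $P_j$ a Laurent monomial, the cycle $\gamma_j$ is $\Gamma\cap\{F=0\}$. Here $\Gamma$ is the 3-chain $\{|U|=\mathrm{const},\ |V|\ge\mathrm{const}\}$ bounding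 on a torus $|x_1|=r$, $|x_2|=s$ on which $F/P_j$ has no zero and has a continuous single-valued logarithm; $U,V$ are toric coordinates and $\gamma_j$ is oriented by $U$ moving counterclockwise. For $\gamma_1$ take $(U,V)=(x_1,x_2)$, and for $\gamma_g$ on $\mathcal C_{g,g}$ take $(U,V)=(x_1^{-1}x_2^{-1},\,x_1^gx_2^{g-1})$. With this orientation $R_{\gamma_j}\sim-2\pi i\log a_j$ as $a_j\to\infty$. *Maximal conifold point.* For each family there is exactly one $\underline{\hat a}\in(\mathbb R^*)^g$ for which $F=0$ has exactly $g$ singular points in $(\mathbb C^*)^2$, all of them nodes. The number $R_{\gamma}(\underline{\hat a})$ is the boundary value at $\tau=1$ of a continuous branch, for $\tau>1$, of $R_\gamma$ on the curves with parameters $\tau^{w_j}\hat a_j$, where $w_j=\frac{2(g-j+1)}{2g+1}$ for $\mathcal C_{g,g}$ and $w_j=\frac{2j}{2g+1}$ for $\mathcal C_{2g-1,1}$. Such branches exist. *Notation.* Let $D_2(z)=\mathrm{Im}\,\mathrm{Li}_2(z)+\arg(1-z)\log|z|$ be the Bloch–Wigner function, $\zeta_n=e^{2\pi i/n}$ and $\mathbb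 Q(1)=2\pi i\,\mathbb Q$. With $z=e^{\pi i/(m+n+1)}$ and $w=\frac{z^m-z^{-m}}{z-z^{-1}}$, put $$\mathcal D_{m,n}=\frac{m+n+1}{\pi}\,D_2(-z^{m+1}w).$$ **Theorem.** (1) At the maximal conifold point of $\mathcal C_{g,g}$, $$\tfrac1{2\pi i}R_{\gamma_1}(\underline{\hat a})\equiv\mathcal D_{g,g},\qquad \tfrac1{2\pi i}R_{\gamma_g}(\underline{\hat a})\equiv\mathcal D_{2g-1,1}\pmod{\mathbb Q(1)},$$ and at the maximal conifold point of $\mathcal C_{2g-1,1}$, $$\tfrac1{2\pi i}R_{\gamma_1}(\underline{\hat a})\equiv\mathcal D_{2g-1,1}\pmod{\mathbb Q(1)}.$$ (2) These values are $$\mathcal D_{g,g}=-\tfrac{2g+1}{\pi}D_2(1+\zeta_{2g+1}^g),\qquad \mathcal D_{2g-1,1}=-\tfrac{2g+1}{\pi}D_2(1+\zeta_{2g+1}).$$ (3) Write $[G]_0$ for the constant term of a Laurent polynomial $G$. For both families, if $\underline a$ is real with $|a_1|>3+\sum_{j\ge2}|a_j|$, then $$\tfrac1{2\pi i}R_{\gamma_1}(\underline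 a)\equiv-\log|a_1|+\sum_{k>0}\frac{(-1)^k}{k}\,\frac{[(F-a_1)^k]_0}{a_1^{k}}\pmod{\mathbb Q(1)},$$ where the cycle $\gamma_1$ exists and the series converges. (4) Let $c_{k,n}$ be the coefficient of $s^n$ in $[(F^{(s)}-\hat a_1)^k]_0$, where $F^{(s)}$ is $F$ at $\underline{\hat a}$ with the term $x_1$ replaced by $s\,x_1$. Then, for $F=F_{g,g}$ and $\varepsilon=(-1)^{g+1}$, $$\log(2g+1)-\sum_{n\ge1}\Bigl(\sum_{k=n}^{3n}\frac{\varepsilon^k\,c_{k,n}}{k(2g+1)^k}\Bigr)=\tfrac{2g+1}{\pi}D_2(1+\zeta_{2g+1}^g),$$ and for $F=F_{2g-1,1}$ and $\varepsilon=1$, $$\log(2g+1)-\sum_{n\ge1}\Bigl(\sum_{k=n}^{3n}\frac{\varepsilon^k\,c_{k,n}}{k(2g+1)^k}\Bigr)=\tfrac{2g+1}{\pi}D_2(1+\zeta_{2g+1}),$$ where the sums over $n$ converge absolutely. -/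

import Mathlib

open Complex

noncomputable section

/-- Laurent polynomials in two variables `x₁, x₂` over `A`; the monomial `x₁ ^ m₁ * x₂ ^ m₂` is
indexed by `m = (m₁, m₂)`, and `[G]₀`, the constant term of `G`, is `G.coeff 0`. -/
abbrev Laurent2 (A : Type*) [Semiring A] := AddMonoidAlgebra A (ℤ × ℤ)

/-- The family `c x₁ + x₂ + x₁^{-g} x₂^{-g} + ∑_{j=1}^g a_j x₁^{1-j} x₂^{1-j}`; the index
`i : Fin g` stands for `j = i + 1`.  The family `F_{g,g}` of the theorem is the case `c = 1`; the
coefficient `c` of `x₁` is kept in order to record the degree in `x₁` of terms of a power. -/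
def famGG {A : Type*} [CommRing A] (g : ℕ) (c : A) (a : Fin g → A) : Laurent2 A :=
  AddMonoidAlgebra.single (1, 0) c + AddMonoidAlgebra.single (0, 1) 1
    + AddMonoidAlgebra.single (-(g : ℤ), -(g : ℤ)) 1
    + ∑ i : Fin g, AddMonoidAlgebra.single (-(i : ℤ), -(i : ℤ)) (a i)

/-- The family `c x₁ + x₂ + x₁^{-2g+1} x₂^{-1} + ∑_{j=1}^g a_j x₁^{1-j}`, with the same
conventions; `F_{2g-1,1}` is the case `c = 1`. -/
def famHyp {A : Type*} [CommRing A] (g : ℕ) (c : A) (a : Fin g → A) : Laurent2 A :=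
  AddMonoidAlgebra.single (1, 0) c + AddMonoidAlgebra.single (0, 1) 1
    + AddMonoidAlgebra.single (1 - 2 * (g : ℤ), -1) 1
    + ∑ i : Fin g, AddMonoidAlgebra.single (-(i : ℤ), 0) (a i)

/-- The value at `(x, y)` of `(x₁ ∂/∂x₁)^k (x₂ ∂/∂x₂)^l F`, for `x, y ≠ 0`. -/
def Laurent2.deltaEval (F : Laurent2 ℝ) (k l : ℕ) (x y : ℂ) : ℂ :=
  F.coeff.sum fun m c => (c : ℂ) * (m.1 : ℂ) ^ k * (m.2 : ℂ) ^ l * (x ^ m.1 * y ^ m.2)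

/-- The value of `F` at `(x, y)`, for `x, y ≠ 0`. -/
def Laurent2.eval (F : Laurent2 ℝ) (x y : ℂ) : ℂ := F.deltaEval 0 0 x y

/-- The singular points of the curve `F = 0` in `(ℂ^*)²`. -/
def singularPoints (F : Laurent2 ℝ) : Set (ℂ × ℂ) :=
  {p | p.1 ≠ 0 ∧ p.2 ≠ 0 ∧ F.eval p.1 p.2 = 0 ∧
    F.deltaEval 1 0 p.1 p.2 = 0 ∧ F.deltaEval 0 1 p.1 p.2 = 0}

/-- The singular point `p` of `F = 0` is a node: the Hessian, in the logarithmic coordinates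
`log x₁, log x₂`, is nondegenerate. -/
def IsNodeAt (F : Laurent2 ℝ) (p : ℂ × ℂ) : Prop :=
  F.deltaEval 1 1 p.1 p.2 ^ 2 - F.deltaEval 2 0 p.1 p.2 * F.deltaEval 0 2 p.1 p.2 ≠ 0

/-- `a` is the maximal conifold point (the one with real coordinates) of a family of genus `g`:
the curve at `a` acquires `g` singular points, all of them nodes. -/
def IsMaximalConifold {g : ℕ} (fam : (Fin g → ℝ) → Laurent2 ℝ) (a : Fin g → ℝ) : Prop :=
  (∀ i, a i ≠ 0) ∧ (singularPoints (fam a)).ncard = g ∧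
    ∀ p ∈ singularPoints (fam a), IsNodeAt (fam a) p

/-- `R` is a value of the regulator period `∫_γ R{-x₁, -x₂}` along the closed path
`γ(t) = (x t, y t)`, `0 ≤ t ≤ 1`, in `(ℂ^*)²`.

The regulator current is `R{f, h} = log f · dh/h - 2πi · log h · δ_{T_f}`, with
`T_f = f⁻¹(ℝ_{<0})` the cut of `log f`.  If `u`, `v` are continuous logarithms of `f`, `h` along
`γ`, then crossing the cut adds `2πi` to `u - log f`, and integrating the `δ`-term by parts turns
`∫_γ R{f, h}` into `∫ u dv - (u(1) - u(0)) v(0)`, modulo `(2πi)² ℤ`, the indeterminacy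
of the regulator.  Changing `u`, `v` or the base point changes the number by an element of
`(2πi)² ℤ` only. -/
def IsRegulatorValue (x y : ℝ → ℂ) (R : ℂ) : Prop :=
  ∃ u v : ℝ → ℂ, ContDiffOn ℝ 1 u (Set.Icc 0 1) ∧ ContDiffOn ℝ 1 v (Set.Icc 0 1) ∧
    (∀ t ∈ Set.Icc (0 : ℝ) 1, exp (u t) = -x t ∧ exp (v t) = -y t) ∧
    R = (∫ t in (0 : ℝ)..1, u t * deriv v t) - (u 1 - u 0) * v 0

/-- On the torus `|x₁| = r`, `|x₂| = s` the quotient `F / (x₁^{m₁} x₂^{m₂})` has no zero and has a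
continuous single-valued logarithm.  (For instance, this holds if the monomial
`x₁^{m₁} x₂^{m₂}` dominates the others on the torus.) -/
def HasLogOnTorus (F : Laurent2 ℝ) (m : ℤ × ℤ) (r s : ℝ) : Prop :=
  ∃ L : ℝ → ℝ → ℂ, Continuous (fun z : ℝ × ℝ => L z.1 z.2) ∧
    (∀ α β, L (α + 2 * Real.pi) β = L α β ∧ L α (β + 2 * Real.pi) = L α β) ∧
    ∀ α β : ℝ, F.eval (r * exp (α * I)) (s * exp (β * I)) =
      (r * exp (α * I)) ^ m.1 * (s * exp (β * I)) ^ m.2 * exp (L α β)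

/-- The closed path `(x t, y t)`, `0 ≤ t ≤ 1`, is the cycle `γ = Γ ∩ {F = 0}` attached to the
monomial `x₁^{m₁} x₂^{m₂}`.  Here `Γ` is the 3-chain
`|U| = const`, `|V| ≥ const` bounding on the torus `|x₁| = r`, `|x₂| = s`, where
`U = x₁^{p₁} x₂^{p₂}` and `V = x₁^{q₁} x₂^{q₂}` are toric coordinates (`p, q` an oriented basis of
`ℤ²`), and the torus is as in `HasLogOnTorus`.  The path traverses `Γ ∩ {F = 0}`
exactly once, with `U` moving counterclockwise. -/
def IsGammaCycle (F : Laurent2 ℝ) (m p q : ℤ × ℤ) (x y : ℝ → ℂ) : Prop :=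
  ∃ r s : ℝ, 0 < r ∧ 0 < s ∧ HasLogOnTorus F m r s ∧
    ContDiffOn ℝ 1 x (Set.Icc 0 1) ∧ ContDiffOn ℝ 1 y (Set.Icc 0 1) ∧
    x 1 = x 0 ∧ y 1 = y 0 ∧
    (∀ t ∈ Set.Icc (0 : ℝ) 1, x t ^ p.1 * y t ^ p.2 =
      ((r ^ p.1 * s ^ p.2 : ℝ) : ℂ) * exp (2 * Real.pi * t * I)) ∧
    ∀ X Y : ℂ, X ≠ 0 → Y ≠ 0 →
      ((‖X ^ p.1 * Y ^ p.2‖ = r ^ p.1 * s ^ p.2 ∧ r ^ q.1 * s ^ q.2 ≤ ‖X ^ q.1 * Y ^ q.2‖ ∧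
          F.eval X Y = 0) ↔
        ∃ t ∈ Set.Icc (0 : ℝ) 1, X = x t ∧ Y = y t)

/-- `R` is a value of the regulator period `R_γ = ∫_γ R{-x₁, -x₂}` on `F = 0`, where `γ` is the
cycle attached to the monomial `m` (computed in the toric coordinates given by `p, q`). -/
def IsRegulatorPeriod (F : Laurent2 ℝ) (m p q : ℤ × ℤ) (R : ℂ) : Prop :=
  ∃ x y : ℝ → ℂ, IsGammaCycle F m p q x y ∧ IsRegulatorValue x y R

/-- `R` is a value at `a` of the regulator period `R_γ`, as a boundary value: there is a
continuous branch `ρ(τ)`, `1 ≤ τ < ∞`, with `ρ(1) = R` which for `τ > 1` is a regulator period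
over `γ` on the curve with parameters `τ ^ (w i) * a i`. -/
def IsRegulatorPeriodAt {g : ℕ} (fam : (Fin g → ℝ) → Laurent2 ℝ) (m p q : ℤ × ℤ) (w : Fin g → ℝ)
    (a : Fin g → ℝ) (R : ℂ) : Prop :=
  ∃ ρ : ℝ → ℂ, ContinuousOn ρ (Set.Ici 1) ∧ ρ 1 = R ∧
    ∀ τ : ℝ, 1 < τ → IsRegulatorPeriod (fam fun i => τ ^ w i * a i) m p q (ρ τ)

/-- Exponents of the approach to a point of moduli from the large complex structure limit side:
up to rescaling `x₁, x₂` the curve with parameters `τ ^ (w i) * a i` is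
`x₁ + x₂ + τ (x₁^{-g} x₂^{-g} + ∑ a_j (x₁ x₂)^{1-j}) = 0`.  In the coordinates
`z₁ = a₂/a₁³`, `z₂ = a₁ a₃/a₂²`, …, `z_g = a_{g-1}/a_g²` of moduli, `z₁` is
multiplied by `τ⁻²` and `z₂, …, z_g` are fixed. -/
def weightGG (g : ℕ) (i : Fin g) : ℝ := 2 * ((g : ℝ) - i) / (2 * g + 1)

/-- The same approach for `F_{2g-1,1}`, to which `F_{g,g}` is torically equivalent under
`a_j ↦ a_{g-j+1}`. -/
def weightHyp (g : ℕ) (i : Fin g) : ℝ := 2 * ((i : ℝ) + 1) / (2 * g + 1)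

/-- The Bloch–Wigner function `D₂(z) = Im Li₂(z) + arg(1 - z) log|z|`, where
`Li₂(z) = -∫₀¹ log(1 - z t) dt/t`. -/
def blochWigner (z : ℂ) : ℝ :=
  (-∫ t in (0 : ℝ)..1, Complex.log (1 - z * t) / t).im + Complex.arg (1 - z) * Real.log ‖z‖

/-- `𝒟_{m,n} = (m+n+1)/π · D₂(-z^{m+1} w)`, with `z = e^{πi/(m+n+1)}` and
`w = (z^m - z^{-m})/(z - z⁻¹)`. -/
def conifoldValue (m n : ℕ) : ℝ :=
  let z : ℂ := exp (Real.pi * I / (m + n + 1))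
  ((m : ℝ) + n + 1) / Real.pi *
    blochWigner (-z ^ (m + 1) * ((z ^ m - (z ^ m)⁻¹) / (z - z⁻¹)))

/-- Congruence modulo `ℚ(1) = 2πi ℚ`. -/
def CongrModQ1 (z w : ℂ) : Prop := ∃ q : ℚ, z - w = 2 * Real.pi * I * q

/-- `ζ_n = e^{2πi/n}`. -/
def zetaRoot (n : ℕ) : ℂ := exp (2 * Real.pi * I / n)

/-- The sum of the terms of degree `n` in the coefficient of `x₁` of the series
`∑_{k>0} ε^k / (k M^k) · [(F - a₁)^k]₀`, where `fam` is the family over `ℝ[s]` with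
`x₁` replaced by `s x₁`.  For the two families of the theorem, and `n > 0`, only
`n ≤ k ≤ 3n` contribute. -/
def gradedTerm {g : ℕ}
    (fam : Polynomial ℝ → (Fin g → Polynomial ℝ) → Laurent2 (Polynomial ℝ))
    (i₀ : Fin g) (a : Fin g → ℝ) (ε M : ℝ) (n : ℕ) : ℝ :=
  ∑ k ∈ Finset.Icc n (3 * n), ε ^ k / (k * M ^ k) *
    (((fam Polynomial.X (fun i => Polynomial.C (a i))
      - AddMonoidAlgebra.single 0 (Polynomial.C (a i₀))) ^ k).coeff 0).coeff n

end

noncomputable section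

open scoped Real
open Real renaming cos → rcos, sin → rsin, log → rlog
open Real (pi_pos norm_of_nonneg norm_eq_abs arccos cos_pos_of_mem_Ioo pi_ne_zero
  sin_pos_of_pos_of_lt_pi two_pi_pos cos_le_cos_of_nonneg_of_le_pi one_sub_sq_div_two_le_cos
  pi_gt_three circleAverage_def sin_pos_of_mem_Ioo cos_arccos cos_le_one abs_cos_le_one
  cos_lt_cos_of_nonneg_of_le_pi_div_two neg_one_le_cos log_prod sin_le continuous_arccos)
open Set (Icc Ioo Ioc Ico Ici Ioi Iio uIcc uIoc uIcc_of_le Ioo_subset_Icc_self Ioc_subset_Icc_self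
  Ico_subset_Icc_self uIoc_of_le uIoo_of_le InjOn prod_mono mem_ofPred_eq)
open Finset (range sum_congr mul_sum prod_congr mem_range sum_eq_single sum_eq_zero sum_sub_distrib
  prod_pow sum_add_distrib prod_mul_distrib sum_neg_distrib prod_ne_zero_iff prod_eq_zero)
open Fin (rev val_rev revPerm revPerm_apply rev_rev)
open AddMonoidAlgebra (single mapRingHom single_zero single_pow coeff_single_mul_eq_mul_coeff
  mapRingHom_single)
open intervalIntegral (integral_add integral_congr integral_add_adjacent_intervals
  integral_const_mul integral_sub integral_const integral_eq_sub_of_hasDerivAt integral_comp_neg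
  integral_congr_uIoo integral_comp_sub_left integral_comp_mul_left intervalIntegral_conj
  hasDerivAt_integral_of_dominated_loc_of_deriv_le integral_neg)
open MeasureTheory (volume intervalIntegral_intervalIntegral_swap)
open Filter (Tendsto)
open Function (Periodic comp_def)
open Laurent2
open scoped ComplexConjugate


notation:max "cis" x:max => exp (x * I)

def circMean {E : Type*} [NormedAddCommGroup E] [NormedSpace ℝ E] (f : ℝ → E) : E :=
  (2 * π)⁻¹ • ∫ β in (0 : ℝ)..2 * π, f β

section circMean

variable {E : Type*} [NormedAddCommGroup E] [NormedSpace ℝ E]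

lemma circMean_const [CompleteSpace E] (c : E) : circMean (fun _ => c) = c := by
  have : (2 * π) ≠ 0 := by positivity
  simp only [circMean, integral_const, sub_zero, smul_smul]
  rw [inv_mul_cancel₀ this, one_smul]

lemma circMean_add {f g : ℝ → E} (hf : Continuous f) (hg : Continuous g) :
    circMean (fun β => f β + g β) = circMean f + circMean g := by
  simp only [circMean]
  rw [integral_add (hf.intervalIntegrable _ _) (hg.intervalIntegrable _ _), smul_add]

lemma circMean_sub {f g : ℝ → E} (hf : Continuous f) (hg : Continuous g) :
    circMean (fun β => f β - g β) = circMean f - circMean g := by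
  simp only [circMean]
  rw [integral_sub (hf.intervalIntegrable _ _) (hg.intervalIntegrable _ _), smul_sub]

lemma circMean_sum {ι : Type*} (s : Finset ι) {f : ι → ℝ → E} (hf : ∀ i ∈ s, Continuous (f i)) :
    circMean (fun β => ∑ i ∈ s, f i β) = ∑ i ∈ s, circMean (f i) := by
  simp only [circMean]
  rw [intervalIntegral.integral_finsetSum fun i hi => (hf i hi).intervalIntegrable _ _,
    Finset.smul_sum]

lemma circMean_const_mul (c : ℂ) (f : ℝ → ℂ) : circMean (fun β => c * f β) = c * circMean f := by
  simp only [circMean, integral_const_mul, mul_smul_comm]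

lemma circMean_const_mul_real (c : ℝ) (f : ℝ → ℝ) :
    circMean (fun β => c * f β) = c * circMean f := by
  simp only [circMean, integral_const_mul, mul_smul_comm]

lemma circMean_add_left_periodic {f : ℝ → E} (hf : Periodic f (2 * π)) (a : ℝ) :
    circMean (fun β => f (a + β)) = circMean f := by
  simp only [circMean]
  rw [intervalIntegral.integral_comp_add_left (fun β => f β), add_zero,
    hf.intervalIntegral_add_eq a 0, zero_add]

lemma circMean_neg_periodic {f : ℝ → E} (hf : Periodic f (2 * π)) :
    circMean (fun β => f (-β)) = circMean f := by
  simp only [circMean]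
  rw [integral_comp_neg (fun β => f β), neg_zero]
  have := hf.intervalIntegral_add_eq (-(2 * π)) 0
  simp_all

lemma circMean_nat_mul_periodic {f : ℝ → E} (hf : Periodic f (2 * π))
    (hc : Continuous f) {n : ℕ} (hn : n ≠ 0) : circMean (fun β => f (n * β)) = circMean f := by
  have hn' : (n : ℝ) ≠ 0 := mod_cast hn
  simp only [circMean]
  rw [integral_comp_mul_left (fun β => f β) hn', mul_zero]
  have := hf.intervalIntegral_add_zsmul_eq (n : ℤ) 0 (fun a b => hc.intervalIntegrable _ _)
  simp only [zero_add, zsmul_eq_mul, Int.cast_natCast] at this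
  rw [this, ← Int.cast_smul_eq_zsmul ℝ, Int.cast_natCast, inv_smul_smul₀ hn']

lemma circMean_int_mul_periodic {f : ℝ → E} (hf : Periodic f (2 * π))
    (hc : Continuous f) {n : ℤ} (hn : n ≠ 0) : circMean (fun β => f (n * β)) = circMean f := by
  rcases Int.natAbs_eq n with h | h
  · have := circMean_nat_mul_periodic hf hc (Int.natAbs_ne_zero.2 hn)
    rw [h]; simpa using this
  · have h1 := circMean_nat_mul_periodic hf hc (Int.natAbs_ne_zero.2 hn)
    have h2 : Periodic (fun β => f (n.natAbs * β)) (2 * π) := by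
      intro β
      simp only [mul_add]
      have := hf.int_mul n.natAbs (n.natAbs * β)
      simpa using this
    have h3 := circMean_neg_periodic h2
    rw [h1] at h3
    rw [h]
    simpa using h3

lemma circMean_congr {f g : ℝ → E} (h : ∀ β, f β = g β) : circMean f = circMean g := by
  rw [funext h]

lemma continuous_circMean {X : Type*} [TopologicalSpace X] [FirstCountableTopology X]
    [LocallyCompactSpace X] {f : X → ℝ → E} (hf : Continuous (fun z : X × ℝ => f z.1 z.2)) :
    Continuous fun x => circMean (f x) :=
  (intervalIntegral.continuous_parametric_intervalIntegral_of_continuous' hf _ _).const_smul _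

lemma circMean_comm [CompleteSpace E] {f : ℝ → ℝ → E}
    (hf : Continuous (fun z : ℝ × ℝ => f z.1 z.2)) :
    circMean (fun α => circMean (fun β => f α β)) = circMean (fun β => circMean (fun α => f α β)) := by
  simp only [circMean, intervalIntegral.integral_smul]
  congr 2
  apply intervalIntegral_intervalIntegral_swap
  rw [uIoc_of_le two_pi_pos.le]
  exact (hf.continuousOn.integrableOn_compact (isCompact_Icc.prod isCompact_Icc)).mono_set
    (prod_mono Ioc_subset_Icc_self Ioc_subset_Icc_self)

end circMean

lemma circMean_re {f : ℝ → ℂ} (hf : Continuous f) :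
    (circMean f).re = circMean fun β => (f β).re := by
  simp only [circMean, Complex.smul_re]
  congr 1
  exact (reCLM.intervalIntegral_comp_comm (hf.intervalIntegrable _ _)).symm

lemma circMean_conj {f : ℝ → ℂ} : circMean (fun β => conj (f β)) = conj (circMean f) := by
  simp only [circMean, intervalIntegral_conj, Complex.real_smul, map_mul, Complex.conj_ofReal]

lemma circMean_log_one_add_mul_exp {u : ℂ} (hu : ‖u‖ < 1) :
    circMean (fun β => log (1 + u * cis β)) = 0 := by
  have key : DiffContOnCl ℂ (fun z => log (1 + u * z)) (Metric.ball 0 |(1 : ℝ)|) := by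
    apply DifferentiableOn.diffContOnCl
    rw [abs_one, closure_ball _ one_ne_zero]
    intro z hz
    have hz' : ‖z‖ ≤ 1 := by simpa using hz
    have h1 : ‖u * z‖ < 1 := by rw [norm_mul]; nlinarith [norm_nonneg u, norm_nonneg z]
    apply DifferentiableAt.differentiableWithinAt
    apply DifferentiableAt.clog (by fun_prop)
    exact mem_slitPlane_of_norm_lt_one h1
  have := key.circleAverage
  simp only [mul_zero, add_zero, log_one] at this
  rw [circleAverage_def] at this
  simpa [circMean, circleMap] using this

lemma circMean_log_one_add_mul_exp_neg {u : ℂ} (hu : ‖u‖ < 1) :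
    circMean (fun β => log (1 + u * exp (-(β * I)))) = 0 := by
  have h := circMean_neg_periodic (f := fun β : ℝ => log (1 + u * cis β)) (by
    intro β
    have : exp (((β + 2 * π : ℝ) : ℂ) * I) = cis β := by
      push_cast; rw [add_mul, exp_add, exp_two_pi_mul_I, mul_one]
    simp only [this])
  rw [circMean_log_one_add_mul_exp hu] at h
  simp_all

lemma exp_add_two_pi_mul_I (β : ℝ) : exp (((β + 2 * π : ℝ) : ℂ) * I) = cis β := by
  push_cast; rw [add_mul, exp_add, exp_two_pi_mul_I, mul_one]

lemma one_add_mem_slitPlane_of_norm_lt_one {z : ℂ} (hz : ‖z‖ < 1) : 1 + z ∈ slitPlane :=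
  mem_slitPlane_of_norm_lt_one hz

lemma IsPreconnected.eq_of_exp_eq_one {X : Type*} [TopologicalSpace X] {S : Set X}
    (hS : IsPreconnected S) {f : X → ℂ} (hf : ContinuousOn f S) (h : ∀ x ∈ S, exp (f x) = 1)
    {x y : X} (hx : x ∈ S) (hy : y ∈ S) : f x = f y := by
  have hT : DiscreteTopology (Set.range ((↑) : ℤ → ℝ)) := by
    exact (Int.isClosedEmbedding_coe_real.isEmbedding.toHomeomorph).symm.isEmbedding.discreteTopology
  have hg : ContinuousOn (fun x => (f x).im / (2 * π)) S :=
    (continuous_im.comp_continuousOn hf).div_const _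
  have key : ∀ x ∈ S, ∃ n : ℤ, f x = n * (2 * π * I) := fun x hx => exp_eq_one_iff.1 (h x hx)
  have hm : Set.MapsTo (fun x => (f x).im / (2 * π)) S (Set.range ((↑) : ℤ → ℝ)) := by
    intro z hz
    obtain ⟨n, hn⟩ := key z hz
    simp_all
  have := hS.constant_of_mapsTo ⟨hT⟩ hg hm hx hy
  obtain ⟨n, hn⟩ := key x hx
  obtain ⟨m, hm⟩ := key y hy
  simp_all

lemma eq_add_of_exp_eq_exp {X : Type*} [TopologicalSpace X] {S : Set X}
    (hS : IsPreconnected S) {f g : X → ℂ} (hf : ContinuousOn f S) (hg : ContinuousOn g S)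
    (h : ∀ x ∈ S, exp (f x) = exp (g x)) (hne : S.Nonempty) :
    ∃ k : ℤ, ∀ x ∈ S, f x = g x + k * (2 * π * I) := by
  obtain ⟨x₀, hx₀⟩ := hne
  obtain ⟨k, hk⟩ := exp_eq_exp_iff_exists_int.1 (h x₀ hx₀)
  refine ⟨k, fun x hx => ?_⟩
  have := hS.eq_of_exp_eq_one (hf.sub hg) (fun x hx => by
    show exp (f x - g x) = 1
    rw [exp_sub, h x hx, div_self (exp_ne_zero _)]) hx hx₀
  simp only [Pi.sub_apply] at this
  linear_combination this + hk

lemma exists_log_prod_sub (R : Multiset ℂ) {ρ : ℝ} (hρ : 0 < ρ) (h : ∀ y ∈ R, ‖y‖ ≠ ρ) :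
    ∃ M : ℝ → ℂ, Continuous M ∧ (∀ β, M (β + 2 * π) = M β) ∧ circMean M = 0 ∧
      ∀ β : ℝ, (R.map fun y => ρ * cis β - y).prod = (ρ * cis β) ^ (R.filter (‖·‖ < ρ)).card *
          ((R.filter (ρ < ‖·‖)).map fun y => -y).prod * exp (M β) := by
  induction R using Multiset.induction with
  | empty => exact ⟨fun _ => 0, by fun_prop, by simp, circMean_const 0, by simp⟩
  | cons y R ih =>
    obtain ⟨M, hMc, hMp, hM0, hM⟩ := ih fun z hz => h z (Multiset.mem_cons_of_mem hz)
    rcases lt_or_gt_of_ne (h y (Multiset.mem_cons_self y R)) with hy | hy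
    · have hu : ‖-y / ρ‖ < 1 := by
        rw [norm_div, norm_neg, norm_real, norm_of_nonneg hρ.le, div_lt_one hρ]; exact hy
      have hs : ∀ β : ℝ, ‖-y / ρ * exp (-(β * I))‖ < 1 := fun β => by
        rw [norm_mul, ← neg_mul, ← ofReal_neg, norm_exp_ofReal_mul_I, mul_one]; exact hu
      have hc : Continuous fun β : ℝ => log (1 + -y / ρ * exp (-(β * I))) :=
        Continuous.clog (by fun_prop) fun β => one_add_mem_slitPlane_of_norm_lt_one (hs β)
      refine ⟨fun β => M β + log (1 + -y / ρ * exp (-(β * I))), hMc.add hc, fun β => ?_, ?_,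
        fun β => ?_⟩
      · show M (β + 2 * π) + log _ = _
        simp only [hMp, exp_neg, exp_add_two_pi_mul_I]
      · rw [circMean_add hMc hc, hM0, circMean_log_one_add_mul_exp_neg hu, add_zero]
      · have e1 : ¬ ρ < ‖y‖ := not_lt.2 hy.le
        rw [Multiset.map_cons, Multiset.prod_cons, hM, Multiset.filter_cons_of_pos (p := fun x => ‖x‖ < ρ) _ hy,
          Multiset.filter_cons_of_neg (p := fun x => ρ < ‖x‖) _ e1, Multiset.card_cons, exp_add,
          exp_log (slitPlane_ne_zero (one_add_mem_slitPlane_of_norm_lt_one (hs β))), pow_succ,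
          exp_neg]
        have : (ρ : ℂ) ≠ 0 := mod_cast hρ.ne'
        field_simp [exp_ne_zero]
        ring
    · have hy0 : y ≠ 0 := by rintro rfl; simp at hy; linarith
      have hu : ‖-(ρ : ℂ) / y‖ < 1 := by
        rw [norm_div, norm_neg, norm_real, norm_of_nonneg hρ.le, div_lt_one (hρ.trans hy)]
        exact hy
      have hs : ∀ β : ℝ, ‖-(ρ : ℂ) / y * cis β‖ < 1 := fun β => by simp_all
      have hc : Continuous fun β : ℝ => log (1 + -(ρ : ℂ) / y * cis β) :=
        Continuous.clog (by fun_prop) fun β => one_add_mem_slitPlane_of_norm_lt_one (hs β)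
      refine ⟨fun β => M β + log (1 + -(ρ : ℂ) / y * cis β), hMc.add hc, fun β => ?_, ?_,
        fun β => ?_⟩
      · show M (β + 2 * π) + log _ = _
        rw [hMp, exp_add_two_pi_mul_I]
      · rw [circMean_add hMc hc, hM0, circMean_log_one_add_mul_exp hu, add_zero]
      · have e1 : ¬ ‖y‖ < ρ := not_lt.2 (le_of_lt hy)
        rw [Multiset.map_cons, Multiset.prod_cons, hM, Multiset.filter_cons_of_neg (p := fun x => ‖x‖ < ρ) _ e1,
          Multiset.filter_cons_of_pos (p := fun x => ρ < ‖x‖) _ hy, Multiset.map_cons, Multiset.prod_cons, exp_add,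
          exp_log (slitPlane_ne_zero (one_add_mem_slitPlane_of_norm_lt_one (hs β)))]
        field_simp
        ring

open Polynomial in
/-- If `P / z ^ n` has a continuous single-valued logarithm on the circle `|z| = ρ`, then `P` has
`n` zeros inside the circle, and the mean of the logarithm is a logarithm of the leading
coefficient times the product of the opposites of the zeros outside. -/
lemma exp_circMean_log {P : ℂ[X]} {n : ℕ} {ρ : ℝ} (hρ : 0 < ρ) {L : ℝ → ℂ} (hL : Continuous L)
    (hLp : ∀ β, L (β + 2 * π) = L β)
    (hP : ∀ β : ℝ, P.eval (ρ * cis β) = (ρ * cis β) ^ n * exp (L β)) :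
    (∀ y ∈ P.roots, ‖y‖ ≠ ρ) ∧ (P.roots.filter (‖·‖ < ρ)).card = n ∧ exp (circMean L) =
        P.leadingCoeff * ((P.roots.filter (ρ < ‖·‖)).map fun y => -y).prod := by
  have hρ' : (ρ : ℂ) ≠ 0 := mod_cast hρ.ne'
  have hP0 : P ≠ 0 := by
    rintro rfl
    simp_all
  have hr : ∀ y ∈ P.roots, ‖y‖ ≠ ρ := by
    intro y hy hyρ
    have h0 : P.eval y = 0 := (mem_roots hP0).1 hy
    have h1 := hP (arg y)
    rw [← hyρ, norm_mul_exp_arg_mul_I, h0] at h1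
    simp_all
  obtain ⟨M, hMc, hMp, hM0, hM⟩ := exists_log_prod_sub P.roots hρ hr
  set k := (P.roots.filter (‖·‖ < ρ)).card with hk
  set K := P.leadingCoeff * ((P.roots.filter (ρ < ‖·‖)).map fun y => -y).prod with hK
  have hK0 : K ≠ 0 := by
    refine mul_ne_zero (leadingCoeff_ne_zero.2 hP0) (Multiset.prod_ne_zero ?_)
    simp only [Multiset.mem_map, Multiset.mem_filter, not_exists, not_and]
    rintro y ⟨_, hy⟩ hy0
    rw [neg_eq_zero.1 hy0, norm_zero] at hy
    linarith
  have hev : ∀ β : ℝ, (ρ * cis β) ^ n * exp (L β) = (ρ * cis β) ^ k * K * exp (M β) := by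
    intro β
    rw [← hP]
    conv_lhs => rw [(IsAlgClosed.splits P).eq_prod_roots]
    rw [eval_mul, eval_C, eval_multiset_prod, Multiset.map_map]
    simp only [comp_def, eval_sub, eval_X, eval_C]
    rw [hM, hK]; ring
  obtain ⟨κ, hκ⟩ : ∃ κ, exp κ = K := ⟨log K, exp_log hK0⟩
  have hD : ∀ β : ℝ, exp (L β - M β - ((k : ℂ) - n) * (rlog ρ + β * I) - κ) = 1 := by
    intro β
    have hl : (ρ : ℂ) * cis β = exp (rlog ρ + β * I) := by
      rw [exp_add, ← ofReal_exp, Real.exp_log hρ]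
    have := hev β
    rw [hl, ← exp_nat_mul, ← exp_nat_mul, ← hκ, ← exp_add, ← exp_add, ← exp_add] at this
    rw [show L β - M β - ((k : ℂ) - n) * (rlog ρ + β * I) - κ =
      (n * (rlog ρ + β * I) + L β) - (k * (rlog ρ + β * I) + κ + M β) by ring, exp_sub,
      this, div_self (exp_ne_zero _)]
  have hDc : Continuous fun β : ℝ => L β - M β - ((k : ℂ) - n) * (rlog ρ + β * I) - κ := by fun_prop
  have hconst : ∀ β : ℝ, L β - M β - ((k : ℂ) - n) * (rlog ρ + β * I) - κ =
      L 0 - M 0 - ((k : ℂ) - n) * (rlog ρ + (0 : ℝ) * I) - κ := fun β =>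
    isPreconnected_univ.eq_of_exp_eq_one hDc.continuousOn (fun x _ => hD x) (Set.mem_univ β)
      (Set.mem_univ 0)
  have hkn : (k : ℂ) = n := by
    have h1 := hconst (0 + 2 * π)
    rw [hLp, hMp] at h1
    have h2 : ((k : ℂ) - n) * (2 * π * I) = 0 := by push_cast at h1; linear_combination -h1
    rcases mul_eq_zero.1 h2 with h | h
    · exact sub_eq_zero.1 h
    · simp [pi_ne_zero] at h
  refine ⟨hr, mod_cast hkn, ?_⟩
  have hLM : ∀ β, L β = M β + (L 0 - M 0) := by grind
  have hmean : circMean L = L 0 - M 0 := by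
    rw [circMean_congr hLM, circMean_add hMc continuous_const, hM0, circMean_const, zero_add]
  have := hD 0
  rw [hkn, sub_self, zero_mul, sub_zero, exp_sub, div_eq_one_iff_eq (exp_ne_zero _), hκ] at this
  rw [hmean, this]

open Polynomial in
lemma exp_circMean_log_eq {P : ℂ[X]} {n : ℕ} {ρ₁ ρ₂ : ℝ} (h₁ : 0 < ρ₁) (h₂ : 0 < ρ₂)
    {L₁ L₂ : ℝ → ℂ} (hc₁ : Continuous L₁) (hc₂ : Continuous L₂)
    (hp₁ : ∀ β, L₁ (β + 2 * π) = L₁ β) (hp₂ : ∀ β, L₂ (β + 2 * π) = L₂ β)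
    (hP₁ : ∀ β : ℝ, P.eval (ρ₁ * cis β) = (ρ₁ * cis β) ^ n * exp (L₁ β))
    (hP₂ : ∀ β : ℝ, P.eval (ρ₂ * cis β) = (ρ₂ * cis β) ^ n * exp (L₂ β)) :
    exp (circMean L₁) = exp (circMean L₂) := by
  wlog hle : ρ₁ ≤ ρ₂ generalizing ρ₁ ρ₂ L₁ L₂
  · exact (this h₂ h₁ hc₂ hc₁ hp₂ hp₁ hP₂ hP₁ (not_le.1 hle).le).symm
  obtain ⟨r1, k1, e1⟩ := exp_circMean_log h₁ hc₁ hp₁ hP₁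
  obtain ⟨r2, k2, e2⟩ := exp_circMean_log h₂ hc₂ hp₂ hP₂
  have hin : P.roots.filter (‖·‖ < ρ₁) = P.roots.filter (‖·‖ < ρ₂) := Multiset.eq_of_le_of_card_le
      (Multiset.monotone_filter_right _ fun y hy => lt_of_lt_of_le hy hle) (by rw [k1, k2])
  have hout : P.roots.filter (ρ₁ < ‖·‖) = P.roots.filter (ρ₂ < ‖·‖) := by
    have g1 : P.roots.filter (ρ₁ < ‖·‖) = P.roots.filter (fun y => ¬ ‖y‖ < ρ₁) :=
      Multiset.filter_congr fun y hy => ⟨fun h => not_lt.2 h.le, fun h =>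
        lt_of_le_of_ne (not_lt.1 h) (r1 y hy).symm⟩
    have g2 : P.roots.filter (ρ₂ < ‖·‖) = P.roots.filter (fun y => ¬ ‖y‖ < ρ₂) :=
      Multiset.filter_congr fun y hy => ⟨fun h => not_lt.2 h.le, fun h =>
        lt_of_le_of_ne (not_lt.1 h) (r2 y hy).symm⟩
    have f1 := Multiset.filter_add_not (fun y : ℂ => ‖y‖ < ρ₁) P.roots
    have f2 := Multiset.filter_add_not (fun y : ℂ => ‖y‖ < ρ₂) P.roots
    rw [hin] at f1
    rw [g1, g2]
    exact add_left_cancel (f1.trans f2.symm)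
  rw [e1, e2, hout]

namespace Laurent2

def weightedEval (f : ℤ × ℤ → ℂ) (x y : ℂ) : Laurent2 ℝ →+ ℂ where
  toFun F := F.coeff.sum fun m c => c * f m * (x ^ m.1 * y ^ m.2)
  map_zero' := by simp
  map_add' F G := by
    rw [AddMonoidAlgebra.coeff_add, Finsupp.sum_add_index']
    · simp
    · intros; push_cast; ring

lemma weightedEval_single (f : ℤ × ℤ → ℂ) (x y : ℂ) (m : ℤ × ℤ) (c : ℝ) :
    weightedEval f x y (single m c) = c * f m * (x ^ m.1 * y ^ m.2) := by
  change Finsupp.sum (single m c).coeff (fun m c => (c : ℂ) * f m * (x ^ m.1 * y ^ m.2)) = _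
  rw [AddMonoidAlgebra.coeff_single, Finsupp.sum_single_index]
  simp

lemma deltaEval_eq (F : Laurent2 ℝ) (k l : ℕ) (x y : ℂ) :
    F.deltaEval k l x y = weightedEval (fun m => m.1 ^ k * m.2 ^ l) x y F := by
  simp [deltaEval, weightedEval, mul_assoc]

lemma deltaEval_single (m : ℤ × ℤ) (c : ℝ) (k l : ℕ) (x y : ℂ) :
    deltaEval (single m c) k l x y = c * m.1 ^ k * m.2 ^ l * (x ^ m.1 * y ^ m.2) := by
  simp [deltaEval_eq, weightedEval_single, mul_assoc]

lemma deltaEval_famGG (g : ℕ) (a : Fin g → ℝ) (k l : ℕ) (x y : ℂ) :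
    deltaEval (famGG g 1 a) k l x y =
      0 ^ l * x + 0 ^ k * y + (-(g : ℂ)) ^ k * (-(g : ℂ)) ^ l * (x ^ (-(g : ℤ)) * y ^ (-(g : ℤ)))
        + ∑ i : Fin g, (a i : ℂ) * (-(i : ℂ)) ^ k * (-(i : ℂ)) ^ l *
          (x ^ (-(i : ℤ)) * y ^ (-(i : ℤ))) := by
  simp [famGG, deltaEval_eq, weightedEval_single, mul_assoc]

lemma eval_famGG (g : ℕ) (a : Fin g → ℝ) (x y : ℂ) :
    (famGG g 1 a).eval x y = x + y + x ^ (-(g : ℤ)) * y ^ (-(g : ℤ))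
        + ∑ i : Fin g, (a i : ℂ) * (x ^ (-(i : ℤ)) * y ^ (-(i : ℤ))) := by
  simp [eval, deltaEval_famGG]

lemma eval_famHyp (g : ℕ) (a : Fin g → ℝ) (x y : ℂ) :
    (famHyp g 1 a).eval x y = x + y + x ^ (1 - 2 * (g : ℤ)) * y⁻¹
        + ∑ i : Fin g, (a i : ℂ) * x ^ (-(i : ℤ)) := by
  simp [eval, famHyp, deltaEval_eq, weightedEval_single]

lemma zpow_mul_zpow_comp {K : Type*} [Field K] {x y : K} (hx : x ≠ 0) (hy : y ≠ 0)
    (a b c d e f : ℤ) : (x ^ a * y ^ b) ^ c * (x ^ d * y ^ e) ^ f =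
      x ^ (a * c + d * f) * y ^ (b * c + e * f) := by
  rw [mul_zpow, mul_zpow, zpow_add₀ hx, zpow_add₀ hy]
  simp only [zpow_mul]
  ring

lemma zpow_mul_zpow_cancel {K : Type*} [Field K] {x y : K} (hx : x ≠ 0) (hy : y ≠ 0)
    {a b c d : ℤ} (h : a * d - b * c = 1) : (x ^ a * y ^ b) ^ d * (x ^ c * y ^ d) ^ (-b) = x ∧
      (x ^ a * y ^ b) ^ (-c) * (x ^ c * y ^ d) ^ a = y := by
  rw [zpow_mul_zpow_comp hx hy, zpow_mul_zpow_comp hx hy,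
    show a * d + c * -b = 1 by linear_combination h, show b * d + d * -b = 0 by ring,
    show a * -c + c * a = 0 by ring, show b * -c + d * a = 1 by linear_combination h]
  simp

lemma zpow_mul_zpow_cancel' {K : Type*} [Field K] {x y : K} (hx : x ≠ 0) (hy : y ≠ 0)
    {a b c d : ℤ} (h : a * d - b * c = 1) : (x ^ d * y ^ (-b)) ^ a * (x ^ (-c) * y ^ a) ^ b = x ∧
      (x ^ d * y ^ (-b)) ^ c * (x ^ (-c) * y ^ a) ^ d = y := by
  simpa only [neg_neg] using zpow_mul_zpow_cancel hx hy (a := d) (b := -b) (c := -c) (d := a)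
    (by linear_combination h)

/-- The two families are related by a monomial change of coordinates. -/
lemma weightedEval_famGG (k : ℕ) (a : Fin (k + 1) → ℝ) (f : ℤ × ℤ → ℂ) (x y : ℂ) (hx : x ≠ 0)
    (hy : y ≠ 0) : weightedEval f x y (famGG (k + 1) 1 a) = x ^ (-k : ℤ) * y ^ (-k : ℤ) *
      weightedEval (fun m => f (-k + -1 * m.1 + (k + 1 : ℕ) * m.2, -k + -1 * m.1 + k * m.2))
        (x ^ (-1 : ℤ) * y ^ (-1 : ℤ)) (x ^ ((k + 1 : ℕ) : ℤ) * y ^ (k : ℤ))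
        (famHyp (k + 1) 1 (a ∘ rev)) := by
  have key : ∀ (m n : ℤ × ℤ) (c : ℝ), -k + -1 * m.1 + (k + 1 : ℕ) * m.2 = n.1 →
      -k + -1 * m.1 + k * m.2 = n.2 → x ^ (-k : ℤ) * y ^ (-k : ℤ) *
      weightedEval (fun m => f (-k + -1 * m.1 + (k + 1 : ℕ) * m.2, -k + -1 * m.1 + k * m.2))
        (x ^ (-1 : ℤ) * y ^ (-1 : ℤ)) (x ^ ((k + 1 : ℕ) : ℤ) * y ^ (k : ℤ)) (single m c) =
      weightedEval f x y (single n c) := by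
    rintro m ⟨_, _⟩ c rfl rfl
    rw [weightedEval_single, weightedEval_single, zpow_mul_zpow_comp hx hy]
    simp only [add_assoc, zpow_add₀ hx, zpow_add₀ hy]
    ring
  simp only [famGG, famHyp, map_add, map_sum, mul_add, mul_sum]
  rw [key (1, 0) (-(k + 1 : ℕ), -(k + 1 : ℕ)) _ (by simp; ring) (by simp; ring),
    key (0, 1) (1, 0) _ (by simp) (by simp),
    key (1 - 2 * (k + 1 : ℕ), -1) (0, 1) _ (by push_cast; ring) (by push_cast; ring)]
  rw [sum_congr rfl fun (i : Fin (k + 1)) _ => key (-(i : ℕ), 0) (-(rev i : ℕ), -(rev i : ℕ)) _ (by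
    simp only [val_rev]; omega) (by simp only [val_rev]; omega), ← Equiv.sum_comp revPerm]
  simp only [revPerm_apply, Function.comp_apply]
  ring

lemma eval_famGG_eq_famHyp {k : ℕ} (a : Fin (k + 1) → ℝ) (x y : ℂ) (hx : x ≠ 0) (hy : y ≠ 0) :
    (famGG (k + 1) 1 a).eval x y = x ^ (-k : ℤ) * y ^ (-k : ℤ) * (famHyp (k + 1) 1 (a ∘ rev)).eval
      (x ^ (-1 : ℤ) * y ^ (-1 : ℤ)) (x ^ ((k + 1 : ℕ) : ℤ) * y ^ (k : ℤ)) := by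
  simpa [eval, deltaEval_eq] using weightedEval_famGG k a (fun _ => 1) x y hx hy

lemma eval_famHyp_eq_famGG {k : ℕ} (a : Fin (k + 1) → ℝ) {x y : ℂ} (hx : x ≠ 0) (hy : y ≠ 0) :
    (famHyp (k + 1) 1 (a ∘ rev)).eval x y = x ^ (-k : ℤ) *
      (famGG (k + 1) 1 a).eval (x ^ (k : ℤ) * y) (x ^ (-(k + 1) : ℤ) * y⁻¹) := by
  have h := eval_famGG_eq_famHyp a (x ^ (k : ℤ) * y ^ (1 : ℤ)) (x ^ (-(k + 1) : ℤ) * y ^ (-1 : ℤ))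
    (by positivity) (by positivity)
  simp only [zpow_mul_zpow_comp hx hy] at h
  rw [zpow_one, zpow_neg_one] at h
  rw [h, ← mul_assoc, ← mul_assoc, ← zpow_add₀ hx]
  push_cast
  ring_nf
  simp

def evalHom (x y : ℂ) (hx : x ≠ 0) (hy : y ≠ 0) : Laurent2 ℝ →ₐ[ℝ] ℂ :=
  AddMonoidAlgebra.lift ℝ ℂ (ℤ × ℤ)
    { toFun := fun m => x ^ m.toAdd.1 * y ^ m.toAdd.2
      map_one' := by simp
      map_mul' := fun m n => by
        simp only [toAdd_mul, Prod.fst_add, Prod.snd_add, zpow_add₀ hx, zpow_add₀ hy]; ring }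

lemma evalHom_apply {x y : ℂ} (hx : x ≠ 0) (hy : y ≠ 0) (F : Laurent2 ℝ) :
    evalHom x y hx hy F = F.eval x y := by
  rw [evalHom, AddMonoidAlgebra.lift_apply, eval, deltaEval]
  refine Finsupp.sum_congr fun m _ => ?_
  simp

lemma eval_eq_sum (F : Laurent2 ℝ) (x y : ℂ) :
    F.eval x y = ∑ m ∈ F.coeff.support, (F.coeff m : ℂ) * (x ^ m.1 * y ^ m.2) := by
  simp [eval, deltaEval, Finsupp.sum]

lemma deltaEval_conj (F : Laurent2 ℝ) (k l : ℕ) (x y : ℂ) : F.deltaEval k l (conj x) (conj y) =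
      conj (F.deltaEval k l x y) := by simp [deltaEval, Finsupp.sum, map_sum]

def onTorus (F : Laurent2 ℝ) (k l : ℕ) (r s : ℝ) (α β : ℝ) : ℂ :=
  F.deltaEval k l (r * cis α) (s * cis β)

lemma onTorus_eq (F : Laurent2 ℝ) (k l : ℕ) (r s : ℝ) (α β : ℝ) :
    F.onTorus k l r s α β = ∑ m ∈ F.coeff.support, (F.coeff m : ℂ) * (m.1 : ℂ) ^ k * (m.2 : ℂ) ^ l *
      ((r : ℂ) ^ m.1 * (s : ℂ) ^ m.2 * exp ((m.1 * α + m.2 * β) * I)) := by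
  simp only [onTorus, deltaEval, Finsupp.sum, mul_zpow, ← exp_int_mul]
  refine sum_congr rfl fun m _ => ?_
  rw [add_mul, exp_add, mul_assoc (m.1 : ℂ), mul_assoc (m.2 : ℂ)]
  ring

lemma continuous_onTorus (F : Laurent2 ℝ) (k l : ℕ) (r s : ℝ) :
    Continuous fun z : ℝ × ℝ => F.onTorus k l r s z.1 z.2 := by
  simp only [onTorus_eq]
  fun_prop

lemma hasDerivAt_onTorus (F : Laurent2 ℝ) (k l : ℕ) (r s α β : ℝ) :
    HasDerivAt (fun α : ℝ => F.onTorus k l r s α β) (I * F.onTorus (k + 1) l r s α β) α := by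
  simp only [onTorus_eq, mul_sum]
  refine HasDerivAt.fun_sum fun m _ => ?_
  have h : HasDerivAt (fun α : ℝ => exp ((m.1 * (α : ℂ) + m.2 * β) * I))
      (exp ((m.1 * (α : ℂ) + m.2 * β) * I) * ((m.1 * 1) * I)) α := by
    apply HasDerivAt.cexp
    exact (((ofRealCLM.hasDerivAt (x := α)).const_mul (m.1 : ℂ)).add_const _).mul_const I
  refine ((h.const_mul ((r : ℂ) ^ m.1 * (s : ℂ) ^ m.2)).const_mul
    ((F.coeff m : ℂ) * (m.1 : ℂ) ^ k * (m.2 : ℂ) ^ l)).congr_deriv ?_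
  ring

lemma onTorus_neg (F : Laurent2 ℝ) (r s α β : ℝ) :
    F.onTorus 0 0 r s (-α) (-β) = conj (F.onTorus 0 0 r s α β) := by
  rw [onTorus, onTorus, ← deltaEval_conj]
  simp [← exp_conj]

lemma onTorus_add_left (F : Laurent2 ℝ) (k l : ℕ) (r s α β : ℝ) :
    F.onTorus k l r s (α + 2 * π) β = F.onTorus k l r s α β := by
  rw [onTorus, exp_add_two_pi_mul_I]; rfl

lemma onTorus_add_right (F : Laurent2 ℝ) (k l : ℕ) (r s α β : ℝ) :
    F.onTorus k l r s α (β + 2 * π) = F.onTorus k l r s α β := by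
  rw [onTorus, exp_add_two_pi_mul_I]; rfl

/-- The mean of `log |F|` over the torus `|x₁| = r`, `|x₂| = s`. -/
def torusMean (F : Laurent2 ℝ) (r s : ℝ) : ℝ :=
  circMean fun α => circMean fun β => rlog ‖F.onTorus 0 0 r s α β‖

def IsMonicInSecond (F : Laurent2 ℝ) (n : ℕ) : Prop :=
  ∀ x : ℂ, x ≠ 0 → ∃ P : Polynomial ℂ, P.Monic ∧ P.natDegree = n + 1 ∧
    ∀ y : ℂ, y ≠ 0 → P.eval y = y ^ n * F.eval x y

open Polynomial in
lemma isMonicInSecond_famGG {g : ℕ} (hg : 0 < g) (a : Fin g → ℝ) :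
    (famGG g 1 a).IsMonicInSecond g := by
  intro x hx
  set Q : ℂ[X] := C x * X ^ g + C (x ^ (-(g : ℤ))) +
    ∑ i : Fin g, C ((a i : ℂ) * x ^ (-(i : ℤ))) * X ^ (g - (i : ℕ)) with hQ
  have hQd : Q.degree < ((g + 1 : ℕ) : WithBot ℕ) := by
    rw [degree_lt_iff_coeff_zero]
    intro m hm
    simp only [hQ, coeff_add, finsetSum_coeff, coeff_C_mul, coeff_X_pow, coeff_C]
    rw [if_neg (by omega), if_neg (by omega), sum_eq_zero]
    · simp
    · intro i _; rw [if_neg (by omega), mul_zero]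
  refine ⟨X ^ (g + 1) + Q, monic_X_pow_add hQd, by
    rw [natDegree_add_eq_left_of_degree_lt (by rwa [degree_X_pow]), natDegree_X_pow], fun y hy => ?_⟩
  rw [eval_famGG]
  simp only [hQ, eval_add, eval_pow, eval_X, eval_mul, eval_C, eval_finsetSum]
  have h1 : y ^ g * y ^ (-(g : ℤ)) = 1 := by
    rw [zpow_neg, zpow_natCast, mul_inv_cancel₀ (pow_ne_zero _ hy)]
  have h2 : ∀ i : Fin g, y ^ g * y ^ (-(i : ℤ)) = y ^ (g - (i : ℕ)) := fun i => by
    rw [← zpow_natCast y g, ← zpow_add₀ hy, ← zpow_natCast]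
    congr 1
    have := i.2
    omega
  have h3 : y ^ g * ∑ i : Fin g, (a i : ℂ) * (x ^ (-(i : ℤ)) * y ^ (-(i : ℤ))) =
      ∑ i : Fin g, (a i : ℂ) * x ^ (-(i : ℤ)) * y ^ (g - (i : ℕ)) := by
    rw [mul_sum]
    exact sum_congr rfl fun i _ => by rw [← h2]; ring
  rw [← h3]
  linear_combination (-x ^ (-(g : ℤ))) * h1

open Polynomial in
lemma isMonicInSecond_famHyp (g : ℕ) (a : Fin g → ℝ) : (famHyp g 1 a).IsMonicInSecond 1 := by
  intro x hx
  refine ⟨X ^ 2 + (C (x + ∑ i : Fin g, (a i : ℂ) * x ^ (-(i : ℤ))) * X +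
    C (x ^ (1 - 2 * (g : ℤ)))), ?_, ?_, fun y hy => ?_⟩
  · exact monic_X_pow_add (lt_of_le_of_lt degree_linear_le (by norm_num))
  · rw [natDegree_add_eq_left_of_degree_lt, natDegree_X_pow]
    rw [degree_X_pow]
    exact lt_of_le_of_lt degree_linear_le (by norm_num)
  · rw [eval_famHyp]
    simp only [eval_add, eval_pow, eval_X, eval_mul, eval_C]
    field_simp
    ring

end Laurent2

lemma hasDerivAt_of_exp_eq {f g : ℝ → ℂ} {g' : ℂ} {x : ℝ} (hf : ContinuousAt f x)
    (h : ∀ᶠ t in nhds x, exp (f t) = g t) (hg : HasDerivAt g g' x) : HasDerivAt f (g' / g x) x := by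
  have hgx : g x = exp (f x) := h.self_of_nhds.symm
  have h1 : HasDerivAt (fun t => f x + log (g t / g x)) (g' / g x) x := by
    have hne : g x ≠ 0 := by rw [hgx]; exact exp_ne_zero _
    have := (hg.div_const (g x)).clog_real (by rw [div_self hne]; exact one_mem_slitPlane)
    simp_all
  refine h1.congr_of_eventuallyEq ?_
  have h2 : ∀ᶠ t in nhds x, ‖f t - f x‖ < π := by
    have : Tendsto (fun t => ‖f t - f x‖) (nhds x) (nhds 0) := by
      have := (hf.tendsto.sub_const (f x)).norm
      simpa using this
    exact this.eventually_lt_const pi_pos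
  filter_upwards [h, h2] with t ht ht2
  rw [← ht, hgx, ← exp_sub, log_exp]
  · ring
  · exact (abs_lt.1 (lt_of_le_of_lt (abs_im_le_norm _) ht2)).1
  · exact (abs_lt.1 (lt_of_le_of_lt (abs_im_le_norm _) ht2)).2.le

lemma hasDerivAt_circMean {f f' : ℝ → ℝ → ℂ} (hf : ∀ α, Continuous (f α))
    (hf' : Continuous fun z : ℝ × ℝ => f' z.1 z.2)
    (h : ∀ α β, HasDerivAt (fun α => f α β) (f' α β) α) (α : ℝ) :
    HasDerivAt (fun α => circMean (f α)) (circMean (f' α)) α := by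
  obtain ⟨K, hK⟩ := (((isCompact_Icc (a := α - 1) (b := α + 1)).prod
    (isCompact_Icc (a := (0 : ℝ)) (b := 2 * π))).exists_bound_of_continuousOn hf'.continuousOn)
  have key := hasDerivAt_integral_of_dominated_loc_of_deriv_le
    (μ := volume) (F := f) (F' := f') (x₀ := α) (a := 0) (b := 2 * π)
    (s := Icc (α - 1) (α + 1)) (bound := fun _ => K) (Icc_mem_nhds (by linarith) (by linarith))
    (.of_forall fun x => (hf x).aestronglyMeasurable) ((hf α).intervalIntegrable _ _)
    ((hf'.comp (by fun_prop : Continuous fun β : ℝ => (α, β))).aestronglyMeasurable)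
    (.of_forall fun β hβ x hx => hK (x, β) ⟨hx, by
      rw [uIoc_of_le two_pi_pos.le] at hβ; exact Ioc_subset_Icc_self hβ⟩)
    intervalIntegrable_const
    (.of_forall fun β _ x _ => h x β)
  exact key.2.const_smul _

/-- `L` is a continuous single-valued logarithm of `F` on the torus `|x₁| = r`, `|x₂| = s`. -/
structure IsTorusLog (F : Laurent2 ℝ) (r s : ℝ) (L : ℝ → ℝ → ℂ) : Prop where
  continuous : Continuous fun z : ℝ × ℝ => L z.1 z.2
  periodic : ∀ α β, L (α + 2 * π) β = L α β ∧ L α (β + 2 * π) = L α β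
  exp_eq : ∀ α β, exp (L α β) = F.onTorus 0 0 r s α β

lemma hasLogOnTorus_zero_iff {F : Laurent2 ℝ} {r s : ℝ} :
    HasLogOnTorus F (0, 0) r s ↔ ∃ L, IsTorusLog F r s L := by
  constructor
  · rintro ⟨L, h1, h2, h3⟩
    exact ⟨L, h1, h2, fun α β => by rw [onTorus, ← eval, h3]; simp⟩
  · rintro ⟨L, h1, h2, h3⟩
    exact ⟨L, h1, h2, fun α β => by rw [h3, onTorus, eval]; simp⟩

namespace IsTorusLog

variable {F : Laurent2 ℝ} {r s : ℝ} {L : ℝ → ℝ → ℂ}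

lemma continuous_left (h : IsTorusLog F r s L) (β : ℝ) : Continuous fun α => L α β :=
  h.continuous.comp (by fun_prop : Continuous fun α : ℝ => (α, β))

lemma continuous_right (h : IsTorusLog F r s L) (α : ℝ) : Continuous (L α) :=
  h.continuous.comp (by fun_prop : Continuous fun β : ℝ => (α, β))

lemma re_eq (h : IsTorusLog F r s L) (α β : ℝ) : (L α β).re = rlog ‖F.onTorus 0 0 r s α β‖ := by
  rw [← h.exp_eq, norm_exp, Real.log_exp]

lemma onTorus_ne_zero (h : IsTorusLog F r s L) (α β : ℝ) : F.onTorus 0 0 r s α β ≠ 0 := by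
  rw [← h.exp_eq]; exact exp_ne_zero _

lemma hasDerivAt (h : IsTorusLog F r s L) (α β : ℝ) : HasDerivAt (fun α => L α β)
      (I * F.onTorus 1 0 r s α β / F.onTorus 0 0 r s α β) α :=
  hasDerivAt_of_exp_eq (h.continuous_left β).continuousAt
    (.of_forall fun t => h.exp_eq t β) (F.hasDerivAt_onTorus 0 0 r s α β)

lemma continuous_deriv (h : IsTorusLog F r s L) : Continuous fun z : ℝ × ℝ =>
      I * F.onTorus 1 0 r s z.1 z.2 / F.onTorus 0 0 r s z.1 z.2 :=
  ((F.continuous_onTorus 1 0 r s).const_mul I).div (F.continuous_onTorus 0 0 r s)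
    fun z => h.onTorus_ne_zero z.1 z.2

lemma contDiff_circMean (h : IsTorusLog F r s L) : ContDiff ℝ 1 fun α => circMean (L α) := by
  have hd := hasDerivAt_circMean h.continuous_right h.continuous_deriv h.hasDerivAt
  rw [contDiff_one_iff_deriv]
  refine ⟨fun α => (hd α).differentiableAt, ?_⟩
  rw [funext fun α => (hd α).deriv]
  exact continuous_circMean h.continuous_deriv

lemma circMean_periodic (h : IsTorusLog F r s L) (α : ℝ) :
    circMean (L (α + 2 * π)) = circMean (L α) := circMean_congr fun β => (h.periodic α β).1

lemma exists_im_zero (h : IsTorusLog F r s L) : ∃ k : ℤ, (L 0 0).im = π * k := by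
  have h1 : exp (L 0 0) = exp (conj (L 0 0)) := by
    rw [exp_conj, h.exp_eq, ← F.onTorus_neg, neg_zero]
  obtain ⟨k, hk⟩ := exp_eq_exp_iff_exists_int.1 h1
  refine ⟨k, ?_⟩
  have := congrArg im hk
  simp at this
  linarith

lemma neg (h : IsTorusLog F r s L) (α β : ℝ) : L α β = conj (L (-α) (-β)) + 2 * (L 0 0).im * I := by
  have hc : Continuous fun z : ℝ × ℝ => L z.1 z.2 - conj (L (-z.1) (-z.2)) :=
    h.continuous.sub (continuous_conj.comp (h.continuous.comp
      (by fun_prop : Continuous fun z : ℝ × ℝ => (-z.1, -z.2))))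
  have := isPreconnected_univ.eq_of_exp_eq_one hc.continuousOn (fun z _ => by
    rw [exp_sub, exp_conj, h.exp_eq, h.exp_eq, F.onTorus_neg, Complex.conj_conj,
      div_self (h.onTorus_ne_zero _ _)]) (Set.mem_univ (α, β)) (Set.mem_univ (0, 0))
  simp only [neg_zero] at this
  rw [Complex.sub_conj] at this
  push_cast at this
  linear_combination this

lemma circMean_circMean (h : IsTorusLog F r s L) :
    circMean (fun α => circMean (L α)) = F.torusMean r s + (L 0 0).im * I := by
  have hc := continuous_circMean h.continuous
  have hmc : Continuous fun z : ℝ × ℝ => (L z.1 z.2).re := continuous_re.comp h.continuous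
  apply Complex.ext
  · rw [circMean_re hc, torusMean]
    simp only [add_re, ofReal_re, mul_re, I_re, mul_zero, ofReal_im, I_im, mul_one, sub_self,
      add_zero]
    refine circMean_congr fun α => ?_
    rw [circMean_re (h.continuous_right α)]
    exact circMean_congr fun β => h.re_eq α β
  · have h1 : ∀ α, circMean (L α) = conj (circMean (L (-α))) + 2 * (L 0 0).im * I := by
      intro α
      have hn : Continuous fun β : ℝ => conj (L (-α) (-β)) :=
        continuous_conj.comp ((h.continuous_right (-α)).comp continuous_neg)
      rw [circMean_congr (h.neg α), circMean_add hn continuous_const, circMean_const, circMean_conj,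
        circMean_neg_periodic fun β => (h.periodic (-α) β).2]
    have hn : Continuous fun α : ℝ => conj (circMean (L (-α))) :=
      continuous_conj.comp (hc.comp continuous_neg)
    have h2 := circMean_congr h1
    rw [circMean_add hn continuous_const, circMean_const, circMean_conj,
      circMean_neg_periodic (f := fun α => circMean (L α)) h.circMean_periodic] at h2
    have h3 := congrArg im h2
    simp at h3 ⊢
    linarith

lemma roots_iff {n : ℕ} (hF : F.IsMonicInSecond n) (hr : 0 < r) (hs : 0 < s)
    (h : IsTorusLog F r s L) (α : ℝ) {Y : ℂ} (hY : Y ≠ 0) :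
    (s ≤ ‖Y‖ ∧ F.eval (r * cis α) Y = 0) ↔ Y = -exp (circMean (L α)) := by
  have hx : (r : ℂ) * cis α ≠ 0 := mul_ne_zero (mod_cast hr.ne') (exp_ne_zero _)
  obtain ⟨P, hPm, hPd, hPe⟩ := hF _ hx
  obtain ⟨h1, h2, h3⟩ := exp_circMean_log (P := P) (n := n) hs (h.continuous_right α)
    (fun β => (h.periodic α β).2) (fun β => by
      rw [hPe _ (mul_ne_zero (mod_cast hs.ne') (exp_ne_zero _)), h.exp_eq]; rfl)
  have hcard : P.roots.card = n + 1 := by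
    rw [← hPd]; exact (IsAlgClosed.splits P).natDegree_eq_card_roots.symm
  have hfilt : (P.roots.filter (s < ‖·‖)).card = 1 := by
    have e := congrArg Multiset.card (Multiset.filter_add_not (fun y : ℂ => ‖y‖ < s) P.roots)
    have e2 : P.roots.filter (fun y => ¬ ‖y‖ < s) = P.roots.filter (s < ‖·‖) :=
      Multiset.filter_congr fun y hy => ⟨fun h => lt_of_le_of_ne (not_lt.1 h) (h1 y hy).symm,
        fun h => not_lt.2 h.le⟩
    simp_all
  obtain ⟨y₀, hy₀⟩ := Multiset.card_eq_one.1 hfilt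
  rw [hy₀, hPm.leadingCoeff] at h3
  simp only [Multiset.map_singleton, Multiset.prod_singleton, one_mul] at h3
  rw [h3, neg_neg]
  have hmem : Y ∈ P.roots ↔ F.eval (r * cis α) Y = 0 := by
    rw [Polynomial.mem_roots hPm.ne_zero, Polynomial.IsRoot, hPe Y hY, mul_eq_zero]
    simp [hY]
  constructor
  · rintro ⟨hY1, hY2⟩
    have hYr := hmem.2 hY2
    have : Y ∈ P.roots.filter (s < ‖·‖) :=
      Multiset.mem_filter.2 ⟨hYr, lt_of_le_of_ne hY1 (h1 Y hYr).symm⟩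
    rw [hy₀] at this
    simpa using this
  · intro hYy
    have : Y ∈ P.roots.filter (s < ‖·‖) := by rw [hy₀, hYy]; simp
    rw [Multiset.mem_filter] at this
    exact ⟨this.2.le, hmem.1 this.1⟩

end IsTorusLog

lemma circMean_comp_two_pi_mul (f : ℝ → ℂ) : ∫ t in (0 : ℝ)..1, f (2 * π * t) = circMean f := by
  rw [integral_comp_mul_left (fun t => f t) two_pi_pos.ne']
  simp [circMean]

lemma intervalIntegrable_deriv_of_contDiffOn {u : ℝ → ℂ} (hu : ContDiffOn ℝ 1 u (Icc 0 1)) :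
    IntervalIntegrable (deriv u) volume 0 1 := by
  have h1 : ContinuousOn (derivWithin u (Icc 0 1)) (Icc 0 1) :=
    hu.continuousOn_derivWithin (uniqueDiffOn_Icc one_pos) le_rfl
  have h2 : IntervalIntegrable (derivWithin u (Icc 0 1)) volume 0 1 := by
    apply ContinuousOn.intervalIntegrable
    rwa [uIcc_of_le zero_le_one]
  refine h2.congr_uIoo fun t ht => ?_
  rw [uIoo_of_le zero_le_one] at ht
  exact derivWithin_of_mem_nhds (Icc_mem_nhds ht.1 ht.2)

lemma integral_mul_deriv_eq_of_contDiffOn {u v : ℝ → ℂ} (hu : ContDiffOn ℝ 1 u (Icc 0 1))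
    (hv : ContDiffOn ℝ 1 v (Icc 0 1)) : ∫ t in (0 : ℝ)..1, u t * deriv v t =
      u 1 * v 1 - u 0 * v 0 - ∫ t in (0 : ℝ)..1, deriv u t * v t := by
  have hd : ∀ {w : ℝ → ℂ}, ContDiffOn ℝ 1 w (Icc 0 1) →
      ∀ t ∈ Ioo (min (0 : ℝ) 1) (max 0 1), HasDerivAt w (deriv w t) t := by
    intro w hw t ht
    rw [min_eq_left zero_le_one, max_eq_right zero_le_one] at ht
    exact ((hw.differentiableOn one_ne_zero).differentiableAt (Icc_mem_nhds ht.1 ht.2)).hasDerivAt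
  apply intervalIntegral.integral_mul_deriv_eq_deriv_mul_of_hasDerivAt _ _ (hd hu) (hd hv)
    (intervalIntegrable_deriv_of_contDiffOn hu) (intervalIntegrable_deriv_of_contDiffOn hv)
  · rw [uIcc_of_le zero_le_one]; exact hu.continuousOn
  · rw [uIcc_of_le zero_le_one]; exact hv.continuousOn

lemma regulator_eq_of_circle {u v : ℝ → ℂ} (hu : ContDiffOn ℝ 1 u (Icc 0 1))
    (hv : ContDiffOn ℝ 1 v (Icc 0 1)) {c : ℂ}
    (hu' : ∀ t ∈ Icc (0 : ℝ) 1, u t = c + 2 * π * t * I) (hv' : v 1 = v 0) :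
    (∫ t in (0 : ℝ)..1, u t * deriv v t) - (u 1 - u 0) * v 0 =
      -(2 * π * I) * ∫ t in (0 : ℝ)..1, v t := by
  rw [integral_mul_deriv_eq_of_contDiffOn hu hv, hv', hu' 1 ⟨zero_le_one, le_rfl⟩,
    hu' 0 ⟨le_rfl, zero_le_one⟩]
  have h : ∫ t in (0 : ℝ)..1, deriv u t * v t = ∫ t in (0 : ℝ)..1, (2 * π * I) * v t := by
    apply integral_congr_uIoo
    intro t ht
    rw [uIoo_of_le zero_le_one] at ht
    have hd : HasDerivAt (fun t : ℝ => c + 2 * π * t * I) (2 * π * 1 * I) t :=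
      (((ofRealCLM.hasDerivAt (x := t)).const_mul (2 * π : ℂ)).mul_const I).const_add c
    have := hd.congr_of_eventuallyEq (f₁ := u) (by
      filter_upwards [Icc_mem_nhds ht.1 ht.2] with t ht using hu' t ht)
    simp only [this.deriv, mul_one]
  rw [h, integral_const_mul]
  push_cast
  ring

lemma exp_two_pi_mul_mul_I_add (t : ℝ) : exp (((2 * π * t : ℝ) : ℂ) * I) =
    exp (2 * π * t * I) := by push_cast; rfl

/-- All values of the regulator period in terms of the mean of `log |F|`. -/
lemma IsRegulatorPeriod.eq {F : Laurent2 ℝ} {n : ℕ} (hF : F.IsMonicInSecond n) {R : ℂ}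
    (h : IsRegulatorPeriod F (0, 0) (1, 0) (0, 1) R) :
    ∃ r s : ℝ, 0 < r ∧ 0 < s ∧ HasLogOnTorus F (0, 0) r s ∧
      ∃ k : ℤ, R = -(2 * π * I) * (F.torusMean r s + π * k * I) := by
  obtain ⟨x, y, ⟨r, s, hr, hs, hL, hxc, hyc, hx1, hy1, hx, hiff⟩, u, v, hu, hv, huv, rfl⟩ := h
  refine ⟨r, s, hr, hs, hL, ?_⟩
  obtain ⟨L, h⟩ := hasLogOnTorus_zero_iff.1 hL
  have hx' : ∀ t ∈ Icc (0 : ℝ) 1, x t = r * exp (((2 * π * t : ℝ) : ℂ) * I) := by simp_all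
  have hy0 : ∀ t ∈ Icc (0 : ℝ) 1, y t ≠ 0 := by
    intro t ht h0
    have := (huv t ht).2
    rw [h0, neg_zero] at this
    exact exp_ne_zero _ this
  have hx0 : ∀ t ∈ Icc (0 : ℝ) 1, x t ≠ 0 := by
    intro t ht h0
    simp_all
  have hy' : ∀ t ∈ Icc (0 : ℝ) 1, exp (v t) = exp (circMean (L (2 * π * t))) := by
    intro t ht
    have := (hiff (x t) (y t) (hx0 t ht) (hy0 t ht)).2 ⟨t, ht, rfl, rfl⟩
    simp only [zpow_one, zpow_zero, mul_one, one_mul] at this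
    have h2 := (h.roots_iff hF hr hs (2 * π * t) (hy0 t ht)).1
      ⟨this.2.1, by rw [← hx' t ht]; exact this.2.2⟩
    rw [(huv t ht).2, h2, neg_neg]
  have hmc : Continuous fun t : ℝ => circMean (L (2 * π * t)) :=
    (continuous_circMean h.continuous).comp (by fun_prop : Continuous fun t : ℝ => 2 * π * t)
  obtain ⟨k, hk⟩ := eq_add_of_exp_eq_exp isPreconnected_Icc hv.continuousOn hmc.continuousOn hy'
    ⟨0, le_rfl, zero_le_one⟩
  obtain ⟨l, hl⟩ := eq_add_of_exp_eq_exp (g := fun t : ℝ => rlog r + π * I +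
      2 * π * t * I) isPreconnected_Icc hu.continuousOn (by fun_prop) (fun t ht => by
    rw [(huv t ht).1, hx' t ht, exp_add, exp_add, exp_pi_mul_I, ← ofReal_exp, Real.exp_log hr,
      exp_two_pi_mul_mul_I_add]
    ring) ⟨0, le_rfl, zero_le_one⟩
  have hper : circMean (L (2 * π * 1)) = circMean (L (2 * π * 0)) := by
    have := h.circMean_periodic 0
    simp_all
  obtain ⟨j, hj⟩ := h.exists_im_zero
  refine ⟨j + 2 * k, ?_⟩
  rw [regulator_eq_of_circle hu hv (c := rlog r + π * I + l * (2 * π * I))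
    (fun t ht => by rw [hl t ht]; ring)
    (by rw [hk 1 ⟨zero_le_one, le_rfl⟩, hk 0 ⟨le_rfl, zero_le_one⟩, hper])]
  congr 1
  have : ∫ t in (0 : ℝ)..1, v t =
      ∫ t in (0 : ℝ)..1, (circMean (L (2 * π * t)) + k * (2 * π * I)) := by
    apply integral_congr
    intro t ht
    simp_all
  rw [this, integral_add (hmc.intervalIntegrable _ _) intervalIntegrable_const,
    circMean_comp_two_pi_mul (fun α => circMean (L α)), h.circMean_circMean, hj]
  simp
  ring

/-- A torus with a logarithm of `F` carries a cycle and a regulator period. -/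
lemma IsTorusLog.isRegulatorPeriod {F : Laurent2 ℝ} {n : ℕ} (hF : F.IsMonicInSecond n)
    {r s : ℝ} (hr : 0 < r) (hs : 0 < s) {L : ℝ → ℝ → ℂ} (h : IsTorusLog F r s L) :
    IsRegulatorPeriod F (0, 0) (1, 0) (0, 1)
      (-(2 * π * I) * (F.torusMean r s + (L 0 0).im * I)) := by
  have hmd : ContDiff ℝ 1 fun t : ℝ => circMean (L (2 * π * t)) :=
    h.contDiff_circMean.comp (by fun_prop : ContDiff ℝ 1 fun t : ℝ => 2 * π * t)
  have hper : circMean (L (2 * π * 1)) = circMean (L (2 * π * 0)) := by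
    have := h.circMean_periodic 0
    simp_all
  have hof : ContDiff ℝ 1 fun t : ℝ => (t : ℂ) := ofRealCLM.contDiff
  have hud : ContDiff ℝ 1 fun t : ℝ => rlog r + π * I + 2 * π * t * I :=
    contDiff_const.add ((contDiff_const.mul hof).mul contDiff_const)
  have hr' : (r : ℂ) ≠ 0 := mod_cast hr.ne'
  refine ⟨fun t => r * exp (((2 * π * t : ℝ) : ℂ) * I), fun t => -exp (circMean (L (2 * π * t))),
    ⟨r, s, hr, hs, hasLogOnTorus_zero_iff.2 ⟨L, h⟩, ?_, ?_, ?_, ?_, ?_, ?_⟩,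
    fun t => rlog r + π * I + 2 * π * t * I,
    fun t => circMean (L (2 * π * t)), hud.contDiffOn, hmd.contDiffOn, ?_, ?_⟩
  · fun_prop
  · exact hmd.cexp.neg.contDiffOn
  · simp
  · simp only [hper]
  · intro t _
    simp
  · intro X Y hX hY
    simp only [zpow_one, zpow_zero, mul_one, one_mul]
    constructor
    · rintro ⟨h1, h2, h3⟩
      obtain ⟨t, ht, hXt⟩ : ∃ t ∈ Icc (0 : ℝ) 1, X = r * exp (((2 * π * t : ℝ) : ℂ) * I) := by
        refine ⟨toIcoMod one_pos 0 (arg X / (2 * π)), ?_, ?_⟩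
        · have := toIcoMod_mem_Ico one_pos 0 (arg X / (2 * π))
          grind
        · rw [toIcoMod, zsmul_eq_mul, mul_one, mul_sub, mul_div_cancel₀ _ two_pi_pos.ne']
          push_cast
          rw [sub_mul, exp_sub, show 2 * (π : ℂ) * (toIcoDiv one_pos 0 (arg X / (2 * π)) : ℤ) * I
            = (toIcoDiv one_pos 0 (arg X / (2 * π)) : ℤ) * (2 * π * I) by ring,
            exp_int_mul_two_pi_mul_I, div_one, ← h1, norm_mul_exp_arg_mul_I]
      refine ⟨t, ht, hXt, ?_⟩
      exact (h.roots_iff hF hr hs (2 * π * t) hY).1 ⟨h2, by rw [← hXt]; exact h3⟩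
    · rintro ⟨t, ht, hXt, hYt⟩
      obtain ⟨h2, h3⟩ := (h.roots_iff hF hr hs (2 * π * t) hY).2 hYt
      refine ⟨?_, h2, by rw [hXt]; exact h3⟩
      rw [hXt, norm_mul, norm_exp_ofReal_mul_I, mul_one, norm_real, norm_of_nonneg hr.le]
  · intro t _
    refine ⟨?_, by rw [neg_neg]⟩
    simp only [exp_two_pi_mul_mul_I_add]
    rw [exp_add, exp_add, exp_pi_mul_I, ← ofReal_exp, Real.exp_log hr]
    ring
  · rw [regulator_eq_of_circle hud.contDiffOn hmd.contDiffOn (fun t _ => rfl) hper,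
      circMean_comp_two_pi_mul (fun α => circMean (L α)), h.circMean_circMean]

lemma IsTorusLog.exists_im_eq {F : Laurent2 ℝ} {r s : ℝ} {L : ℝ → ℝ → ℂ}
    (h : IsTorusLog F r s L) {ε : ℝ} {p : ℝ} (hp : 0 < p) (h0 : F.eval r s = p * cis ε) :
    ∃ L', IsTorusLog F r s L' ∧ (L' 0 0).im = ε := by
  have e0 : exp (L 0 0) = exp (rlog p + ε * I) := by
    rw [h.exp_eq, exp_add, ← ofReal_exp, Real.exp_log hp, ← h0, onTorus]
    simp [eval]
  obtain ⟨k, hk⟩ := exp_eq_exp_iff_exists_int.1 e0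
  refine ⟨fun α β => L α β - k * (2 * π * I), ⟨h.continuous.sub continuous_const,
    fun α β => ⟨by rw [(h.periodic α β).1], by rw [(h.periodic α β).2]⟩, fun α β => ?_⟩, ?_⟩
  · rw [exp_sub, exp_int_mul_two_pi_mul_I, div_one, h.exp_eq]
  · simp [hk]

lemma circMean_circMean_add {f : ℝ → ℝ → ℝ} (hf : Continuous fun z : ℝ × ℝ => f z.1 z.2)
    (h₁ : ∀ α β, f (α + 2 * π) β = f α β) (h₂ : ∀ α β, f α (β + 2 * π) = f α β) (a b : ℝ) :
    circMean (fun α => circMean fun β => circMean fun ω => f (α + a * ω) (β + b * ω)) =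
      circMean fun α => circMean (f α) := by
  have e1 : ∀ α, (circMean fun β => circMean fun ω => f (α + a * ω) (β + b * ω)) =
      circMean fun ω => circMean (f (α + a * ω)) := by
    intro α
    rw [circMean_comm (f := fun β ω => f (α + a * ω) (β + b * ω))
      (hf.comp (by fun_prop : Continuous fun z : ℝ × ℝ => (α + a * z.2, z.1 + b * z.2)))]
    refine circMean_congr fun ω => ?_
    have := circMean_add_left_periodic (f := f (α + a * ω)) (fun β => h₂ _ β) (b * ω)
    grind
  rw [circMean_congr e1]
  have hm := continuous_circMean hf
  rw [circMean_comm (f := fun α ω => circMean (f (α + a * ω)))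
    (hm.comp (by fun_prop : Continuous fun z : ℝ × ℝ => z.1 + a * z.2))]
  have e2 : ∀ ω, (circMean fun α => circMean (f (α + a * ω))) = circMean fun α => circMean (f α) := by
    intro ω
    have := circMean_add_left_periodic (f := fun α => circMean (f α))
      (fun α => circMean_congr fun β => h₁ α β) (a * ω)
    rw [← this]
    exact circMean_congr fun β => by rw [add_comm]
  rw [circMean_congr e2, circMean_const]

open Polynomial in
lemma Laurent2.exists_polynomial_eval (F : Laurent2 ℝ) (a b : ℤ) (x y : ℂ) :
    ∃ (P : ℂ[X]) (n : ℕ), ∀ z : ℂ, z ≠ 0 → P.eval z = z ^ n * F.eval (x * z ^ a) (y * z ^ b) := by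
  obtain ⟨n, hn⟩ : ∃ n : ℕ, ∀ m ∈ F.coeff.support, 0 ≤ (n : ℤ) + (a * m.1 + b * m.2) := by
    refine ⟨∑ m ∈ F.coeff.support, (a * m.1 + b * m.2).natAbs, fun m hm => ?_⟩
    have := Finset.single_le_sum (f := fun m : ℤ × ℤ => (a * m.1 + b * m.2).natAbs)
      (fun _ _ => Nat.zero_le _) hm
    omega
  refine ⟨∑ m ∈ F.coeff.support, C ((F.coeff m : ℂ) * (x ^ m.1 * y ^ m.2)) *
    X ^ ((n : ℤ) + (a * m.1 + b * m.2)).toNat, n, fun z hz => ?_⟩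
  rw [F.eval_eq_sum, eval_finsetSum, mul_sum]
  refine sum_congr rfl fun m hm => ?_
  rw [eval_mul, eval_C, eval_pow, eval_X, ← zpow_natCast, Int.toNat_of_nonneg (hn m hm),
    zpow_add₀ hz, zpow_add₀ hz, zpow_natCast, mul_zpow, mul_zpow, ← zpow_mul, ← zpow_mul]
  ring

lemma Laurent2.continuous_log_onTorus {F : Laurent2 ℝ} {r s : ℝ} {L : ℝ → ℝ → ℂ}
    (h : IsTorusLog F r s L) : Continuous fun z : ℝ × ℝ => rlog ‖F.onTorus 0 0 r s z.1 z.2‖ :=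
  (F.continuous_onTorus 0 0 r s).norm.log fun z => norm_ne_zero_iff.2 (h.onTorus_ne_zero _ _)

/-- Two tori with logarithms that differ by a one-parameter subgroup have the same mean. -/
lemma Laurent2.torusMean_eq_of_direction {F : Laurent2 ℝ} {r s ρ : ℝ} (hρ : 0 < ρ) {a b : ℤ}
    (h₁ : HasLogOnTorus F (0, 0) r s) (h₂ : HasLogOnTorus F (0, 0) (r * ρ ^ a) (s * ρ ^ b)) :
    F.torusMean r s = F.torusMean (r * ρ ^ a) (s * ρ ^ b) := by
  obtain ⟨L₁, h₁⟩ := hasLogOnTorus_zero_iff.1 h₁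
  obtain ⟨L₂, h₂⟩ := hasLogOnTorus_zero_iff.1 h₂
  have key : ∀ α β, (circMean fun ω : ℝ => rlog ‖F.onTorus 0 0 r s (α + a * ω) (β + b * ω)‖) =
      circMean fun ω : ℝ =>
        rlog ‖F.onTorus 0 0 (r * ρ ^ a) (s * ρ ^ b) (α + a * ω) (β + b * ω)‖ := by
    intro α β
    obtain ⟨P, n, hP⟩ := F.exists_polynomial_eval a b (r * cis α) (s * cis β)
    have hcomp : ∀ {r s : ℝ} {L : ℝ → ℝ → ℂ}, IsTorusLog F r s L →
        Continuous (fun ω : ℝ => L (α + a * ω) (β + b * ω)) ∧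
        (∀ ω, L (α + a * (ω + 2 * π)) (β + b * (ω + 2 * π)) = L (α + a * ω) (β + b * ω)) := by
      intro r s L h
      refine ⟨h.continuous.comp (by fun_prop : Continuous fun ω : ℝ => (α + a * ω, β + b * ω)),
        fun ω => ?_⟩
      have p1 : Periodic (fun α => L α (β + b * (ω + 2 * π))) (2 * π) := fun α => (h.periodic α _).1
      have p2 : Periodic (L (α + a * ω)) (2 * π) := fun β => (h.periodic _ β).2
      have e1 := p1.int_mul a (α + a * ω)
      have e2 := p2.int_mul b (β + b * ω)
      grind
    have hP' : ∀ {ρ : ℝ} {L : ℝ → ℝ → ℂ}, 0 < ρ → IsTorusLog F (r * ρ ^ a) (s * ρ ^ b) L →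
        ∀ ω : ℝ, P.eval (ρ * cis ω) = (ρ * cis ω) ^ n * exp (L (α + a * ω) (β + b * ω)) := by
      intro ρ L hρ h ω
      have hexp : ∀ (c t : ℝ) (k : ℤ), (c : ℂ) * cis t * ((ρ : ℂ) * exp ((ω : ℂ) * I)) ^ k =
            ((c * ρ ^ k : ℝ) : ℂ) * exp (((t + k * ω : ℝ) : ℂ) * I) := by
        intro c t k
        rw [mul_zpow, ← exp_int_mul]
        push_cast
        rw [add_mul, exp_add, ← mul_assoc (k : ℂ)]
        ring
      rw [hP _ (mul_ne_zero (mod_cast hρ.ne') (exp_ne_zero _)), h.exp_eq, hexp, hexp]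
      rfl
    have h₁' : IsTorusLog F (r * 1 ^ a) (s * 1 ^ b) L₁ := by simpa using h₁
    have := exp_circMean_log_eq one_pos hρ (hcomp h₁).1 (hcomp h₂).1 (hcomp h₁).2 (hcomp h₂).2
      (hP' one_pos h₁') (hP' hρ h₂)
    have h3 := congrArg (fun z => rlog ‖z‖) this
    simp only [norm_exp, Real.log_exp] at h3
    rw [circMean_re (hcomp h₁).1, circMean_re (hcomp h₂).1] at h3
    simpa only [h₁.re_eq, h₂.re_eq] using h3
  rw [torusMean, torusMean, ← circMean_circMean_add (f := fun α β => rlog ‖F.onTorus 0 0 r s α β‖)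
    (continuous_log_onTorus h₁) (fun α β => by simp only [F.onTorus_add_left])
    (fun α β => by simp only [F.onTorus_add_right]) a b,
    ← circMean_circMean_add (f := fun α β => rlog ‖F.onTorus 0 0 (r * ρ ^ a) (s * ρ ^ b) α β‖)
    (continuous_log_onTorus h₂) (fun α β => by simp only [F.onTorus_add_left])
    (fun α β => by simp only [F.onTorus_add_right]) a b]
  simp_all

lemma Laurent2.eventually_hasLogOnTorus {F : Laurent2 ℝ} {r s : ℝ} (hr : 0 < r)
    (h : HasLogOnTorus F (0, 0) r s) :
    ∀ᶠ t : ℝ in nhds 0, HasLogOnTorus F (0, 0) (r * rexp t) s := by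
  obtain ⟨L, h⟩ := hasLogOnTorus_zero_iff.1 h
  have hcont : Continuous fun z : ℝ × (ℝ × ℝ) => F.onTorus 0 0 (r * rexp z.1) s z.2.1 z.2.2 := by
    simp only [onTorus_eq]
    refine continuous_finsetSum _ fun m _ => ?_
    refine continuous_const.mul ((Continuous.mul (Continuous.zpow₀ (by fun_prop) _ fun z => ?_)
      continuous_const).mul (by fun_prop))
    exact Or.inl (mod_cast (mul_pos hr (Real.exp_pos _)).ne')
  have hcont1 : Continuous fun z : ℝ × (ℝ × ℝ) =>
      F.onTorus 0 0 (r * rexp z.1) s z.2.1 z.2.2 / F.onTorus 0 0 r s z.2.1 z.2.2 :=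
    hcont.div ((F.continuous_onTorus 0 0 r s).comp continuous_snd) fun z => h.onTorus_ne_zero _ _
  have hev : ∀ᶠ t : ℝ in nhds 0, ∀ z ∈ Icc 0 (2 * π) ×ˢ Icc 0 (2 * π),
      F.onTorus 0 0 (r * rexp t) s z.1 z.2 / F.onTorus 0 0 r s z.1 z.2 ∈ slitPlane := by
    apply (isCompact_Icc.prod isCompact_Icc).eventually_forall_of_forall_eventually
    intro z _
    apply hcont1.continuousAt.eventually_mem
    apply isOpen_slitPlane.mem_nhds
    simp only [Real.exp_zero, mul_one]
    rw [div_self (h.onTorus_ne_zero _ _)]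
    exact one_mem_slitPlane
  filter_upwards [hev] with t ht
  have hall : ∀ α β, F.onTorus 0 0 (r * rexp t) s α β / F.onTorus 0 0 r s α β ∈ slitPlane := by
    intro α β
    have p1 : Periodic (fun α => F.onTorus 0 0 (r * rexp t) s α β /
        F.onTorus 0 0 r s α β) (2 * π) := fun α => by simp only [onTorus_add_left]
    obtain ⟨α', hα', e1⟩ := p1.exists_mem_Ico₀ two_pi_pos α
    have p2 : Periodic (fun β => F.onTorus 0 0 (r * rexp t) s α' β /
        F.onTorus 0 0 r s α' β) (2 * π) := fun β => by simp only [onTorus_add_right]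
    obtain ⟨β', hβ', e2⟩ := p2.exists_mem_Ico₀ two_pi_pos β
    rw [e1, e2]
    exact ht (α', β') ⟨Ico_subset_Icc_self hα', Ico_subset_Icc_self hβ'⟩
  refine hasLogOnTorus_zero_iff.2 ⟨fun α β => L α β +
    log (F.onTorus 0 0 (r * rexp t) s α β / F.onTorus 0 0 r s α β), ?_, fun α β => ⟨?_, ?_⟩,
    fun α β => ?_⟩
  · refine h.continuous.add (Continuous.clog ?_ fun z => hall _ _)
    exact (F.continuous_onTorus 0 0 _ s).div (F.continuous_onTorus 0 0 r s)
      fun z => h.onTorus_ne_zero _ _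
  · simp only [(h.periodic α β).1, onTorus_add_left]
  · simp only [(h.periodic α β).2, onTorus_add_right]
  · rw [exp_add, exp_log (slitPlane_ne_zero (hall α β)), h.exp_eq, mul_div_cancel₀]
    exact h.onTorus_ne_zero _ _

lemma Laurent2.torusMean_eq {F : Laurent2 ℝ} {r₁ s₁ r₂ s₂ : ℝ} (hr₁ : 0 < r₁) (hs₁ : 0 < s₁)
    (hr₂ : 0 < r₂) (hs₂ : 0 < s₂) (h₁ : HasLogOnTorus F (0, 0) r₁ s₁)
    (h₂ : HasLogOnTorus F (0, 0) r₂ s₂) : F.torusMean r₁ s₁ = F.torusMean r₂ s₂ := by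
  have step : ∀ {r s t : ℝ}, HasLogOnTorus F (0, 0) r s → HasLogOnTorus F (0, 0) (r * rexp t) s →
      F.torusMean r s = F.torusMean (r * rexp t) s := by
    intro r s t h h'
    have := F.torusMean_eq_of_direction (Real.exp_pos t) (a := 1) (b := 0) h (by simpa using h')
    simpa using this
  by_cases hss : s₁ = s₂
  · subst hss
    have e : r₂ = r₁ * rexp (rlog (r₂ / r₁)) := by
      rw [Real.exp_log (div_pos hr₂ hr₁), mul_div_cancel₀ _ hr₁.ne']
    rw [e] at h₂ ⊢
    exact step h₁ h₂
  · set d₁ := rlog (r₂ / r₁) with hd₁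
    set d₂ := rlog (s₂ / s₁) with hd₂
    have hd₂0 : d₂ ≠ 0 := by
      rw [hd₂]
      refine Real.log_ne_zero_of_pos_of_ne_one (div_pos hs₂ hs₁) ?_
      grind
    obtain ⟨ε, hε, hball⟩ := Metric.eventually_nhds_iff.1 (F.eventually_hasLogOnTorus hr₂ h₂)
    have hd2 : 0 < |d₂| := abs_pos.2 hd₂0
    obtain ⟨q, hq1, hq2⟩ := exists_rat_btwn (show d₁ / d₂ < d₁ / d₂ + ε / |d₂| by
      have := div_pos hε hd2
      linarith)
    have hq : |q * d₂ - d₁| < ε := by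
      rw [show (q : ℝ) * d₂ - d₁ = (q - d₁ / d₂) * d₂ by field_simp, abs_mul,
        abs_of_pos (sub_pos.2 hq1), ← lt_div_iff₀ hd2]
      linarith
    have h3 : HasLogOnTorus F (0, 0) (r₂ * rexp (q * d₂ - d₁)) s₂ := by
      apply hball
      simpa using hq
    rw [step h₂ h3]
    have hden : (q.den : ℝ) ≠ 0 := mod_cast q.den_nz
    have er : r₂ * rexp (q * d₂ - d₁) = r₁ * rexp (d₂ / q.den) ^ q.num := by
      rw [Real.exp_sub, hd₁, Real.exp_log (div_pos hr₂ hr₁), ← Real.rpow_intCast, ← Real.exp_mul, mul_comm (d₂ / _)]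
      rw [show (q.num : ℝ) * (d₂ / q.den) = q * d₂ by rw [Rat.cast_def]; ring]
      field_simp
    have es : s₂ = s₁ * rexp (d₂ / q.den) ^ (q.den : ℤ) := by
      rw [zpow_natCast, ← Real.exp_nat_mul, mul_div_cancel₀ _ hden, hd₂,
        Real.exp_log (div_pos hs₂ hs₁), mul_div_cancel₀ _ hs₁.ne']
    have := F.torusMean_eq_of_direction (Real.exp_pos (d₂ / q.den)) (a := q.num) (b := q.den) h₁
      (by rw [← er, ← es]; exact h3)
    rw [this, ← er, ← es]

lemma congrModQ1_of_eq {R : ℂ} {M : ℝ} {k : ℤ} (h : R = -(2 * π * I) * (M + π * k * I)) :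
    CongrModQ1 (1 / (2 * π * I) * R) ((-M : ℝ) : ℂ) := by
  refine ⟨-k / 2, ?_⟩
  have : (π : ℂ) ≠ 0 := mod_cast pi_ne_zero
  rw [h]
  push_cast
  field_simp
  ring

lemma isRegulatorPeriodAt_of_continuousOn {g : ℕ} {fam : (Fin g → ℝ) → Laurent2 ℝ}
    {m p q : ℤ × ℤ} {w a : Fin g → ℝ} {M : ℝ → ℝ} (hM : ContinuousOn M (Ici 1)) {ε : ℂ}
    (hex : ∀ τ : ℝ, 1 < τ → IsRegulatorPeriod (fam fun i => τ ^ w i * a i) m p q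
      (-(2 * π * I) * M τ + ε))
    (hall : ∀ τ : ℝ, 1 < τ → ∀ R, IsRegulatorPeriod (fam fun i => τ ^ w i * a i) m p q R →
      ∃ k : ℤ, R = -(2 * π * I) * (M τ + π * k * I)) {D : ℝ} (hD : D = -M 1) :
    (∃ R, IsRegulatorPeriodAt fam m p q w a R) ∧
      ∀ R, IsRegulatorPeriodAt fam m p q w a R → CongrModQ1 (1 / (2 * π * I) * R) D := by
  constructor
  · refine ⟨_, fun τ => -(2 * π * I) * M τ + ε, ?_, rfl, hex⟩
    fun_prop
  · rintro _ ⟨ρ, hρ, rfl, h⟩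
    have hpi : (π : ℂ) ≠ 0 := mod_cast pi_ne_zero
    set ψ : ℝ → ℂ := fun τ => (ρ τ / (-(2 * π * I)) - M τ) / (π * I) with hψ
    have hψc : ContinuousOn ψ (Ici 1) :=
      ((hρ.div_const _).sub (continuous_ofReal.comp_continuousOn hM)).div_const _
    have hcl : IsClosed (Set.range ((↑) : ℤ → ℂ)) := Complex.isClosed_range_intCast
    have hmem : ψ 1 ∈ Set.range ((↑) : ℤ → ℂ) := by
      have ht : Tendsto ψ (nhdsWithin 1 (Ioi 1)) (nhds (ψ 1)) :=
        (hψc 1 Set.self_mem_Ici).mono_left (nhdsWithin_mono _ Set.Ioi_subset_Ici_self)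
      refine hcl.mem_of_tendsto ht ?_
      filter_upwards [self_mem_nhdsWithin] with τ hτ
      obtain ⟨k, hk⟩ := hall τ hτ _ (h τ hτ)
      refine ⟨k, ?_⟩
      simp only [hψ, hk]
      field_simp
      ring
    obtain ⟨k, hk⟩ := hmem
    have : ρ 1 = -(2 * π * I) * (M 1 + π * k * I) := by
      rw [hk, hψ]
      field_simp
      ring
    rw [hD]
    exact congrModQ1_of_eq this

open Polynomial in
lemma chebyshevC_coeff_eq_zero (R : Type*) [CommRing R] (n : ℕ) :
    (∀ k, (n < k ∨ (n + k) % 2 = 1) → (Chebyshev.C R n).coeff k = 0) ∧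
      (∀ k, (n + 1 < k ∨ (n + 1 + k) % 2 = 1) → (Chebyshev.C R (n + 1)).coeff k = 0) := by
  induction n with
  | zero =>
    constructor
    · intro k hk
      have : k ≠ 0 := by omega
      simp only [Nat.cast_zero, Chebyshev.C_zero]
      rw [← map_ofNat Polynomial.C 2, coeff_C, if_neg this]
    · intro k hk
      simp only [Nat.cast_zero, zero_add, Chebyshev.C_one, coeff_X]
      rw [if_neg (by omega)]
  | succ n ih =>
    refine ⟨by simpa using ih.2, fun k hk => ?_⟩
    have : Chebyshev.C R ((n + 1 : ℕ) + 1) = X * Chebyshev.C R (n + 1) - Chebyshev.C R n := by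
      rw [← Chebyshev.C_add_two]; push_cast; ring_nf
    rw [this, coeff_sub, ih.1 k (by omega), sub_zero]
    cases k with
    | zero => simp
    | succ k => rw [coeff_X_mul, ih.2 k (by omega)]

open Polynomial in
lemma chebyshevC_coeff_self (R : Type*) [CommRing R] (n : ℕ) :
    (Chebyshev.C R (n + 1)).coeff (n + 1) = 1 := by
  induction n with
  | zero => simp
  | succ n ih =>
    have : Chebyshev.C R ((n + 1 : ℕ) + 1) = X * Chebyshev.C R (n + 1) - Chebyshev.C R n := by
      rw [← Chebyshev.C_add_two]; push_cast; ring_nf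
    rw [this, coeff_sub, coeff_X_mul, ih,
      (chebyshevC_coeff_eq_zero R n).1 _ (Or.inl (by omega)), sub_zero]

def oddPoly (g : ℕ) (b : Fin g → ℝ) : Polynomial ℂ :=
  Polynomial.X ^ (2 * g + 1) + ∑ i : Fin g, Polynomial.C (b i : ℂ) * Polynomial.X ^ (2 * (i : ℕ) + 1)

/-- The coefficients of the Chebyshev polynomial `2 T_{2g+1}(s/2)`. -/
def chebCoeff (g : ℕ) (i : Fin g) : ℝ := (Polynomial.Chebyshev.C ℝ (2 * g + 1)).coeff (2 * i + 1)

notation:max "chebOdd" g:max => oddPoly g (chebCoeff g)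

section oddPoly

open Polynomial

variable (g : ℕ) (b : Fin g → ℝ)

lemma oddPoly_coeff_odd (i : Fin g) : (oddPoly g b).coeff (2 * i + 1) = b i := by
  have := i.2
  simp only [oddPoly, coeff_add, coeff_X_pow, finsetSum_coeff, coeff_C_mul]
  rw [if_neg (by omega), sum_eq_single i]
  · simp
  · grind
  · simp

lemma oddPoly_coeff_top : (oddPoly g b).coeff (2 * g + 1) = 1 := by
  simp only [oddPoly, coeff_add, coeff_X_pow, finsetSum_coeff, coeff_C_mul]
  rw [sum_eq_zero]
  · simp
  · grind

lemma oddPoly_coeff_eq_zero {k : ℕ} (hk : 2 * g + 1 < k ∨ k % 2 = 0) :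
    (oddPoly g b).coeff k = 0 := by
  simp only [oddPoly, coeff_add, coeff_X_pow, finsetSum_coeff, coeff_C_mul]
  rw [if_neg (by omega), sum_eq_zero, add_zero]
  grind

lemma oddPoly_natDegree : (oddPoly g b).natDegree = 2 * g + 1 := by
  refine natDegree_eq_of_le_of_coeff_ne_zero ?_ (by rw [oddPoly_coeff_top]; exact one_ne_zero)
  rw [natDegree_le_iff_coeff_eq_zero]
  exact fun k hk => oddPoly_coeff_eq_zero g b (Or.inl hk)

lemma oddPoly_monic : (oddPoly g b).Monic := by
  rw [Monic, leadingCoeff, oddPoly_natDegree, oddPoly_coeff_top]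

lemma oddPoly_comp_neg : (oddPoly g b).comp (-X) = -oddPoly g b := by
  simp only [oddPoly, add_comp, pow_comp, X_comp, sum_comp, mul_comp, C_comp]
  rw [neg_add, ← sum_neg_distrib]
  congr 1
  · rw [Odd.neg_pow ⟨g, rfl⟩]
  · refine sum_congr rfl fun i _ => ?_
    rw [Odd.neg_pow ⟨i, rfl⟩]; ring

lemma oddPoly_eval_neg (s : ℂ) : (oddPoly g b).eval (-s) = -(oddPoly g b).eval s := by
  have := congrArg (Polynomial.eval s) (oddPoly_comp_neg g b)
  simpa [eval_comp] using this

lemma derivative_oddPoly_eval_neg (s : ℂ) :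
    (derivative (oddPoly g b)).eval (-s) = (derivative (oddPoly g b)).eval s := by
  have := congrArg (fun p => Polynomial.eval s (derivative p)) (oddPoly_comp_neg g b)
  simpa [eval_comp, derivative_comp] using this

lemma oddPoly_eval_zero : (oddPoly g b).eval 0 = 0 := by
  rw [← coeff_zero_eq_eval_zero, oddPoly_coeff_eq_zero g b (Or.inr rfl)]

lemma oddPoly_chebCoeff : chebOdd g = Chebyshev.C ℂ (2 * g + 1) := by
  have hz := (chebyshevC_coeff_eq_zero ℂ (2 * g)).2
  push_cast at hz
  ext k
  by_cases h1 : 2 * g + 1 < k ∨ k % 2 = 0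
  · rw [oddPoly_coeff_eq_zero g _ h1, hz k (by omega)]
  · rcases eq_or_ne k (2 * g + 1) with rfl | h2
    · rw [oddPoly_coeff_top]
      have := chebyshevC_coeff_self ℂ (2 * g)
      push_cast at this
      rw [this]
    · obtain ⟨i, rfl⟩ : ∃ i : ℕ, k = 2 * i + 1 := ⟨k / 2, by omega⟩
      have := oddPoly_coeff_odd g (chebCoeff g) ⟨i, by omega⟩
      simp only at this
      rw [this, chebCoeff, ← Chebyshev.map_C (algebraMap ℝ ℂ), coeff_map]
      rfl

def critSet : Set ℂ := {s | (oddPoly g b).eval s = -2 ∧ (derivative (oddPoly g b)).eval s = 0}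

variable {g b}

lemma derivative_oddPoly_ne_zero : derivative (oddPoly g b) ≠ 0 := by
  intro h
  have := congrArg (fun p => coeff p (2 * g)) h
  simp only [coeff_derivative, oddPoly_coeff_top, coeff_zero, one_mul] at this
  norm_cast at this

lemma critSet_finite : (critSet g b).Finite :=
  Set.Finite.subset (derivative (oddPoly g b)).roots.toFinset.finite_toSet fun s hs => by
    simp only [Finset.mem_coe, Multiset.mem_toFinset]
    exact (mem_roots derivative_oddPoly_ne_zero).2 hs.2

lemma natDegree_derivative_oddPoly : (derivative (oddPoly g b)).natDegree = 2 * g := by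
  rw [natDegree_derivative, oddPoly_natDegree]; rfl

lemma prod_critSet_dvd {Z : Finset ℂ} (hZ : (Z : Set ℂ) ⊆ critSet g b) :
    (∏ s ∈ Z, (X - C s)) * ∏ s ∈ Z, (X + C s) ∣ derivative (oddPoly g b) := by
  classical
  have hdisj : Disjoint Z (Z.image Neg.neg) := by
    rw [Finset.disjoint_left]
    intro s hs hs'
    obtain ⟨t, ht, rfl⟩ := Finset.mem_image.1 hs'
    have h1 := (hZ hs).1
    rw [oddPoly_eval_neg, (hZ ht).1] at h1
    norm_num at h1
  have e : (∏ s ∈ Z, (X - C s)) * ∏ s ∈ Z, (X + C s) = ∏ s ∈ Z ∪ Z.image Neg.neg, (X - C s) := by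
    rw [Finset.prod_union hdisj, Finset.prod_image fun a _ b _ h => neg_injective h]
    simp
  rw [e]
  apply Finset.prod_dvd_of_coprime
  · intro a _ c _ hac
    exact isCoprime_X_sub_C_of_isUnit_sub (sub_ne_zero.2 hac).isUnit
  · intro s hs
    rw [dvd_iff_isRoot, IsRoot]
    rcases Finset.mem_union.1 hs with hs | hs
    · exact (hZ hs).2
    · obtain ⟨t, ht, rfl⟩ := Finset.mem_image.1 hs
      rw [derivative_oddPoly_eval_neg]
      exact (hZ ht).2

lemma prod_mul_prod_monic (Z : Finset ℂ) : ((∏ s ∈ Z, (X - C s)) * ∏ s ∈ Z, (X + C s)).Monic :=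
  (monic_prod_of_monic _ _ fun s _ => monic_X_sub_C s).mul
    (monic_prod_of_monic _ _ fun s _ => monic_X_add_C s)

lemma natDegree_prod_mul_prod (Z : Finset ℂ) :
    ((∏ s ∈ Z, (X - C s)) * ∏ s ∈ Z, (X + C s)).natDegree = 2 * Z.card := by
  rw [(monic_prod_of_monic _ _ fun s _ => monic_X_sub_C s).natDegree_mul
    (monic_prod_of_monic _ _ fun s _ => monic_X_add_C s),
    natDegree_prod_of_monic _ _ fun s _ => monic_X_sub_C s,
    natDegree_prod_of_monic _ _ fun s _ => monic_X_add_C s]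
  simp only [natDegree_X_sub_C, natDegree_X_add_C, Finset.sum_const, smul_eq_mul, mul_one]
  ring

lemma card_le_of_subset_critSet {Z : Finset ℂ} (hZ : (Z : Set ℂ) ⊆ critSet g b) : Z.card ≤ g := by
  have := natDegree_le_of_dvd (prod_critSet_dvd hZ) derivative_oddPoly_ne_zero
  rw [natDegree_prod_mul_prod, natDegree_derivative_oddPoly] at this
  omega

lemma exists_first_integral (h : (critSet g b).ncard = g) :
    ∃ κ : ℂ, ((2 * g + 1 : ℂ[X])) ^ 2 * (oddPoly g b ^ 2 - 4) =
      derivative (oddPoly g b) ^ 2 * (X ^ 2 - C κ) := by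
  set P := oddPoly g b with hP
  set Z := (critSet_finite (g := g) (b := b)).toFinset with hZdef
  have hZ : (Z : Set ℂ) ⊆ critSet g b := by simp [hZdef]
  have hcard : Z.card = g := by rw [← h, Set.ncard_eq_toFinset_card _ critSet_finite]
  set Q := ∏ s ∈ Z, (X - C s) with hQ
  set Q' := ∏ s ∈ Z, (X + C s) with hQ'
  have hQm : Q.Monic := monic_prod_of_monic _ _ fun s _ => monic_X_sub_C s
  -- the derivative
  have hder : derivative P = (2 * g + 1 : ℂ[X]) * (Q * Q') := by
    obtain ⟨k, hk⟩ := prod_critSet_dvd hZ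
    have hk0 : k ≠ 0 := by
      rintro rfl
      rw [mul_zero] at hk
      exact derivative_oddPoly_ne_zero hk
    have hd := natDegree_derivative_oddPoly (g := g) (b := b)
    rw [hk, (prod_mul_prod_monic Z).natDegree_mul' hk0, natDegree_prod_mul_prod, hcard] at hd
    have hkc : k = C (k.coeff 0) := eq_C_of_natDegree_eq_zero (by omega)
    have hl : (derivative P).leadingCoeff = 2 * g + 1 := by
      rw [leadingCoeff, natDegree_derivative_oddPoly, coeff_derivative, hP, oddPoly_coeff_top]
      push_cast; ring
    rw [hP, hk, leadingCoeff_mul, (prod_mul_prod_monic Z).leadingCoeff, one_mul, hkc, leadingCoeff_C] at hl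
    rw [hP, hk, hkc, hl]
    simp only [map_add, map_mul, C_1, map_ofNat, map_natCast]
    ring
  -- the factorization of `P + 2`
  have hQP : Q ^ 2 ∣ P + C 2 := by
    rw [hQ, ← prod_pow]
    apply Finset.prod_dvd_of_coprime
    · intro a _ c _ hac
      exact (isCoprime_X_sub_C_of_isUnit_sub (sub_ne_zero.2 hac).isUnit).pow
    · intro s hs
      have hne : P + C 2 ≠ 0 := by
        intro h0
        have := derivative_oddPoly_ne_zero (g := g) (b := b)
        apply this
        have := congrArg derivative h0
        simpa using this
      rw [← le_rootMultiplicity_iff hne]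
      refine (one_lt_rootMultiplicity_iff_isRoot hne).2 ⟨?_, ?_⟩
      · simp [IsRoot, hP, (hZ hs).1]
      · simp [IsRoot, hP, (hZ hs).2]
  obtain ⟨k, hk⟩ := hQP
  have hPm : (P + C 2).Monic := by
    refine (oddPoly_monic g b).add_of_left ?_
    rw [degree_C two_ne_zero, ← natDegree_pos_iff_degree_pos, oddPoly_natDegree]
    omega
  have hkm : k.Monic := by
    rw [hk] at hPm
    exact (hQm.pow 2).of_mul_monic_left hPm
  have hQd : Q.natDegree = g := by
    rw [hQ, natDegree_prod_of_monic _ _ fun s _ => monic_X_sub_C s]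
    simp [hcard]
  have hkd : k.natDegree = 1 := by
    have := congrArg natDegree hk
    rw [(hQm.pow 2).natDegree_mul hkm, hQm.natDegree_pow, hQd, natDegree_add_C,
      hP, oddPoly_natDegree] at this
    omega
  obtain ⟨c, hc⟩ : ∃ c, k = X + C c := ⟨_, by
    have := eq_X_add_C_of_natDegree_le_one hkd.le
    rw [show k.coeff 1 = 1 by rw [← hkd]; exact hkm.coeff_natDegree] at this
    simpa using this⟩
  have hQc : (Q.comp (-X)) ^ 2 = Q' ^ 2 := by
    rw [hQ, hQ', prod_comp, ← prod_pow, ← prod_pow]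
    refine prod_congr rfl fun s _ => ?_
    simp only [sub_comp, X_comp, C_comp]
    ring
  have hk2 : P - C 2 = Q' ^ 2 * (X - C c) := by
    have := congrArg (fun p => p.comp (-X)) hk
    simp only [add_comp, mul_comp, pow_comp, C_comp, hP, oddPoly_comp_neg, hc, X_comp, hQc] at this
    linear_combination -this
  refine ⟨c ^ 2, ?_⟩
  rw [hder, show P ^ 2 - 4 = (P + C 2) * (P - C 2) by
    rw [← map_ofNat C 4, show (4 : ℂ) = 2 * 2 by norm_num, C_mul]; ring, hk, hk2, hc, C_pow]
  ring

lemma ode_of_first_integral {R : Type*} [CommRing R] [IsDomain R] [CharZero R] {P : R[X]} {κ n : R}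
    (hP : derivative P ≠ 0) (h : C n ^ 2 * (P ^ 2 - 4) = derivative P ^ 2 * (X ^ 2 - C κ)) :
    C n ^ 2 * P = derivative (derivative P) * (X ^ 2 - C κ) + X * derivative P := by
  have h2 := congrArg derivative h
  have e4 : derivative (4 : R[X]) = 0 := derivative_ofNat 4
  simp only [derivative_mul, derivative_pow, derivative_sub, derivative_C, derivative_X, e4] at h2
  have h3 : (2 * derivative P) * (C n ^ 2 * P) = (2 * derivative P) *
      (derivative (derivative P) * (X ^ 2 - C κ) + X * derivative P) := by
    have e2 : (C 2 : R[X]) = 2 := map_ofNat C 2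
    simp [e2] at h2
    linear_combination h2
  exact mul_left_cancel₀ (mul_ne_zero two_ne_zero hP) h3

lemma coeff_of_ode {R : Type*} [CommRing R] {P : R[X]} {κ n : R}
    (h : C n ^ 2 * P = derivative (derivative P) * (X ^ 2 - C κ) + X * derivative P) (j : ℕ) :
    (n ^ 2 - j ^ 2) * P.coeff j = -κ * ((j + 2) * (j + 1)) * P.coeff (j + 2) := by
  have h2 := congrArg (fun p => coeff p j) h
  simp only [mul_sub, coeff_add, coeff_sub, ← C_pow, coeff_C_mul, coeff_mul_C, coeff_derivative] at h2
  have e1 : (derivative (derivative P) * X ^ 2).coeff j = (j : R) * (j - 1) * P.coeff j := by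
    rw [coeff_mul_X_pow']
    split_ifs with hj
    · obtain ⟨i, rfl⟩ := Nat.exists_eq_add_of_le' hj
      simp only [coeff_derivative, Nat.add_sub_cancel]
      push_cast; ring
    · rcases (by omega : j = 0 ∨ j = 1) with rfl | rfl <;> simp
  have e2 : (X * derivative P).coeff j = (j : R) * P.coeff j := by
    cases j with
    | zero => simp
    | succ i => rw [coeff_X_mul, coeff_derivative]; push_cast; ring
  rw [e1, e2] at h2
  push_cast at h2
  rw [show j + 1 + 1 = j + 2 from rfl] at h2
  linear_combination h2

lemma chebyshevC_ode (n : ℤ) : C (n : ℂ) ^ 2 * Chebyshev.C ℂ n =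
    derivative (derivative (Chebyshev.C ℂ n)) * (X ^ 2 - C 4) + X * derivative (Chebyshev.C ℂ n) := by
  have h0 := Chebyshev.C_comp_two_mul_X ℂ n
  have h1 := congrArg derivative h0
  have h2 := congrArg derivative h1
  have e2 : derivative (2 : ℂ[X]) = 0 := derivative_ofNat 2
  have e0 : derivative (0 : ℂ[X]) = 0 := derivative_zero
  simp only [derivative_comp, derivative_mul, e2, derivative_X, zero_mul, mul_one, zero_add] at h1 h2
  have hT := Chebyshev.one_sub_X_sq_mul_derivative_derivative_T_eq_poly_in_T (R := ℂ) n
  apply Polynomial.funext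
  intro s
  have g0 := congrArg (Polynomial.eval (s / 2)) h0
  have g1 := congrArg (Polynomial.eval (s / 2)) h1
  have g2 := congrArg (Polynomial.eval (s / 2)) h2
  have g3 := congrArg (Polynomial.eval (s / 2)) hT
  simp only [eval_comp, eval_mul, eval_sub, eval_X, eval_ofNat, eval_pow,
    eval_one, eval_intCast, Function.iterate_succ, Function.iterate_zero, Function.comp, id,
    mul_div_cancel₀ s (two_ne_zero (α := ℂ))] at g0 g1 g2 g3
  simp only [eval_mul, eval_add, eval_sub, eval_X, eval_pow, eval_C]
  linear_combination (n : ℂ) ^ 2 * g0 - s / 2 * g1 - (s ^ 2 / 4 - 1) * g2 + 2 * g3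

end oddPoly

section conifold

open Polynomial

variable {g : ℕ}

lemma derivative_chebyshevC_eval_cos (n : ℤ) (θ : ℂ) :
    (derivative (Chebyshev.C ℂ n)).eval (2 * cos θ) * sin θ = n * sin (n * θ) := by
  have h1 : HasDerivAt (fun θ : ℂ => (Chebyshev.C ℂ n).eval (2 * cos θ))
      ((derivative (Chebyshev.C ℂ n)).eval (2 * cos θ) * (2 * -sin θ)) θ :=
    HasDerivAt.comp (h₂ := fun z => (Chebyshev.C ℂ n).eval z) θ
      ((Chebyshev.C ℂ n).hasDerivAt (2 * cos θ)) ((hasDerivAt_cos θ).const_mul 2)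
  have h2 : HasDerivAt (fun θ : ℂ => 2 * cos (n * θ)) (2 * (-sin (n * θ) * (n * 1))) θ :=
    ((hasDerivAt_id θ).const_mul (n : ℂ)).ccos.const_mul 2
  simp only [Chebyshev.C_two_mul_complex_cos] at h1
  have := h1.unique h2
  linear_combination -this / 2

/-- The critical points of the Chebyshev polynomial over `-2`. -/
def critPoint (g k : ℕ) : ℂ := ((2 * rcos ((2 * k + 1) * π / (2 * g + 1)) : ℝ) : ℂ)

lemma critPoint_angle_mem {k : ℕ} (hk : k < g) : (2 * (k : ℝ) + 1) * π / (2 * g + 1) ∈ Ioo 0 π := by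
  have h1 : (k : ℝ) + 1 ≤ g := mod_cast hk
  have hpi := pi_pos
  constructor
  · positivity
  · rw [div_lt_iff₀ (by positivity)]
    nlinarith

lemma critPoint_mem {k : ℕ} (hk : k < g) : critPoint g k ∈ critSet g (chebCoeff g) := by
  set θ : ℝ := (2 * k + 1) * π / (2 * g + 1) with hθ
  have hθ' : ((2 * (g : ℤ) + 1 : ℤ) : ℝ) * θ = (2 * k + 1) * π := by rw [hθ]; push_cast; field_simp
  have hc : critPoint g k = 2 * cos (θ : ℂ) := by rw [critPoint, ← hθ]; push_cast; rfl
  rw [critSet, mem_ofPred_eq, oddPoly_chebCoeff, hc]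
  have hθc : ((2 * (g : ℤ) + 1 : ℤ) : ℂ) * θ = π + k * (2 * π) := by
    have := congrArg ((↑) : ℝ → ℂ) hθ'
    push_cast at this ⊢
    rw [this]; ring
  constructor
  · rw [Chebyshev.C_two_mul_complex_cos, hθc, cos_add_nat_mul_two_pi, cos_pi]
    norm_num
  · have h := derivative_chebyshevC_eval_cos (2 * (g : ℤ) + 1) (θ : ℂ)
    rw [hθc, sin_add_nat_mul_two_pi, sin_pi, mul_zero] at h
    have hs : sin (θ : ℂ) ≠ 0 := by
      rw [← ofReal_sin, Ne, ofReal_eq_zero]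
      exact (sin_pos_of_mem_Ioo (critPoint_angle_mem hk)).ne'
    exact (mul_eq_zero.1 h).resolve_right hs

lemma critPoint_injOn : InjOn (critPoint g) (range g : Set ℕ) := by
  intro k hk l hl h
  rw [Finset.coe_range, Set.mem_Iio] at hk hl
  rw [critPoint, critPoint, ofReal_inj] at h
  have := Real.injOn_cos (Ioo_subset_Icc_self (critPoint_angle_mem hk))
    (Ioo_subset_Icc_self (critPoint_angle_mem hl)) (mul_left_cancel₀ two_ne_zero h)
  rw [div_left_inj' (by positivity)] at this
  simp_all

lemma ncard_critSet_chebCoeff : (critSet g (chebCoeff g)).ncard = g := by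
  apply le_antisymm
  · rw [Set.ncard_eq_toFinset_card _ critSet_finite]
    exact card_le_of_subset_critSet (b := chebCoeff g) (by simp)
  · have : ((range g).image (critPoint g) : Set ℂ) ⊆ critSet g (chebCoeff g) := by
      intro s hs
      rw [Finset.coe_image] at hs
      obtain ⟨k, hk, rfl⟩ := hs
      rw [Finset.coe_range] at hk
      exact critPoint_mem hk
    have h2 := Set.ncard_le_ncard this critSet_finite
    rw [Set.ncard_coe_finset, Finset.card_image_of_injOn critPoint_injOn, Finset.card_range] at h2
    exact h2

lemma sq_sub_sq_ne_zero {j : ℕ} (hj : j < 2 * g + 1) : (2 * g + 1 : ℂ) ^ 2 - (j : ℂ) ^ 2 ≠ 0 := by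
  rw [sq_sub_sq]
  refine mul_ne_zero ?_ (sub_ne_zero.2 ?_)
  · norm_cast; omega
  · norm_cast; omega

lemma oddPoly_chebCoeff_ode : C (2 * g + 1 : ℂ) ^ 2 * chebOdd g =
    derivative (derivative (chebOdd g)) * (X ^ 2 - C 4) + X * derivative (chebOdd g) := by
  rw [oddPoly_chebCoeff]
  have := chebyshevC_ode (2 * (g : ℤ) + 1)
  push_cast at this
  exact_mod_cast this

lemma oddPoly_chebCoeff_coeff_ne_zero {i : ℕ} (hi : i ≤ g) : (chebOdd g).coeff (2 * i + 1) ≠ 0 := by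
  induction hi using Nat.decreasingInduction with
  | self => rw [oddPoly_coeff_top]; exact one_ne_zero
  | of_succ i hi ih =>
    have := coeff_of_ode (oddPoly_chebCoeff_ode (g := g)) (2 * i + 1)
    intro h0
    rw [h0, mul_zero] at this
    have h1 : (-4 * (((2 * i + 1 : ℕ) + 2 : ℂ) * ((2 * i + 1 : ℕ) + 1))) ≠ 0 := by
      refine mul_ne_zero (by norm_num) (mul_ne_zero ?_ ?_) <;> norm_cast
    exact (mul_ne_zero h1 ih) this.symm

lemma chebCoeff_ne_zero (i : Fin g) : chebCoeff g i ≠ 0 := by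
  have := oddPoly_chebCoeff_coeff_ne_zero i.2.le
  rw [oddPoly_coeff_odd] at this
  exact_mod_cast this

lemma coeff_of_ode_eq {b : Fin g → ℝ} {κ : ℂ} (h : C (2 * g + 1 : ℂ) ^ 2 * oddPoly g b =
      derivative (derivative (oddPoly g b)) * (X ^ 2 - C κ) + X * derivative (oddPoly g b))
    {i : ℕ} (hi : i ≤ g) :
    (oddPoly g b).coeff (2 * i + 1) = (κ / 4) ^ (g - i) * (chebOdd g).coeff (2 * i + 1) := by
  induction hi using Nat.decreasingInduction with
  | self => rw [oddPoly_coeff_top, oddPoly_coeff_top]; simp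
  | of_succ i hi ih =>
    have h1 := coeff_of_ode (oddPoly_chebCoeff_ode (g := g)) (2 * i + 1)
    have h2 := coeff_of_ode h (2 * i + 1)
    apply mul_left_cancel₀ (sq_sub_sq_ne_zero (g := g) (j := 2 * i + 1) (by omega))
    rw [h2]
    rw [show 2 * i + 1 + 2 = 2 * (i + 1) + 1 by ring] at h1 h2 ⊢
    rw [ih, show g - i = (g - (i + 1)) + 1 by omega, pow_succ]
    grind

lemma oddPoly_coeff_one_sq {b : Fin g → ℝ} {κ : ℂ}
    (h : ((2 * g + 1 : ℂ[X])) ^ 2 * (oddPoly g b ^ 2 - 4) =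
      derivative (oddPoly g b) ^ 2 * (X ^ 2 - C κ)) :
    4 * (2 * g + 1 : ℂ) ^ 2 = (oddPoly g b).coeff 1 ^ 2 * κ := by
  have := congrArg (Polynomial.eval 0) h
  simp only [eval_mul, eval_sub, eval_pow, eval_add, oddPoly_eval_zero, eval_X, eval_C,
    eval_ofNat, eval_natCast, eval_one] at this
  rw [← coeff_zero_eq_eval_zero, coeff_derivative] at this
  grind

lemma ode_of_oddPoly {b : Fin g → ℝ} {κ : ℂ} (h : ((2 * g + 1 : ℂ[X])) ^ 2 * (oddPoly g b ^ 2 - 4) =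
      derivative (oddPoly g b) ^ 2 * (X ^ 2 - C κ)) : C (2 * g + 1 : ℂ) ^ 2 * oddPoly g b =
      derivative (derivative (oddPoly g b)) * (X ^ 2 - C κ) + X * derivative (oddPoly g b) := by
  have eC : ((2 * g + 1 : ℂ[X])) = C (2 * g + 1 : ℂ) := by
    rw [C_add, C_mul, map_ofNat C 2, C_1, map_natCast C g]
  rw [eC] at h
  exact ode_of_first_integral derivative_oddPoly_ne_zero h

lemma critSet_iff (hg : 0 < g) (b : Fin g → ℝ) : ((∀ i, b i ≠ 0) ∧ (critSet g b).ncard = g ∧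
      ∀ s ∈ critSet g b, (derivative (derivative (oddPoly g b))).eval s ≠ 0) ↔ b = chebCoeff g := by
  constructor
  · rintro ⟨-, hcard, -⟩
    obtain ⟨κ, hκ⟩ := exists_first_integral hcard
    obtain ⟨κ', hκ'⟩ := exists_first_integral (ncard_critSet_chebCoeff (g := g))
    have hc := coeff_of_ode_eq (ode_of_oddPoly hκ) (Nat.sub_le g 1)
    have hc' := coeff_of_ode_eq (ode_of_oddPoly hκ') (Nat.sub_le g 1)
    have ho := oddPoly_chebCoeff_coeff_ne_zero (Nat.sub_le g 1)
    rw [Nat.sub_sub_self hg, pow_one] at hc hc'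
    have hκ4 : κ' / 4 = 1 := by grind
    have hκ4' : κ' = 4 := by linear_combination 4 * hκ4
    obtain ⟨t, ht⟩ : ∃ t : ℝ, κ / 4 = t := by
      refine ⟨b ⟨g - 1, by omega⟩ / chebCoeff g ⟨g - 1, by omega⟩, ?_⟩
      have e1 := oddPoly_coeff_odd g b ⟨g - 1, by omega⟩
      have e2 := oddPoly_coeff_odd g (chebCoeff g) ⟨g - 1, by omega⟩
      simp only at e1 e2
      rw [e2] at ho hc
      push_cast
      rw [eq_div_iff ho, ← e1, hc]
    have h1 := oddPoly_coeff_one_sq hκ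
    have h1' := oddPoly_coeff_one_sq hκ'
    have hc1 := coeff_of_ode_eq (ode_of_oddPoly hκ) (Nat.zero_le _)
    have ho1 := oddPoly_chebCoeff_coeff_ne_zero (Nat.zero_le g)
    rw [mul_zero, zero_add] at hc1 ho1
    rw [hκ4'] at h1'
    have hpow : (t : ℂ) ^ (2 * g + 1) = 1 := by
      have : (κ : ℂ) = 4 * t := by rw [← ht]; ring
      rw [hc1, ht, this, h1', Nat.sub_zero] at h1
      have h3 : (chebOdd g).coeff 1 ^ 2 * 4 ≠ 0 := mul_ne_zero (pow_ne_zero _ ho1) (by norm_num)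
      apply mul_left_cancel₀ h3
      linear_combination -h1
    have ht1 : t = 1 := by
      have h : t ^ (2 * g + 1) = 1 ^ (2 * g + 1) := by rw [one_pow]; exact_mod_cast hpow
      exact (Odd.strictMono_pow ⟨g, rfl⟩).injective h
    ext i
    have := coeff_of_ode_eq (ode_of_oddPoly hκ) i.2.le
    rw [oddPoly_coeff_odd, oddPoly_coeff_odd, ht, ht1] at this
    simpa using this
  · rintro rfl
    refine ⟨chebCoeff_ne_zero, ncard_critSet_chebCoeff, fun s hs h0 => ?_⟩
    have := congrArg (Polynomial.eval s) (oddPoly_chebCoeff_ode (g := g))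
    simp only [eval_mul, eval_add, eval_pow, eval_C, hs.1, hs.2, h0, zero_mul, mul_zero, add_zero] at this
    have h2 : (2 * g + 1 : ℂ) ≠ 0 := by norm_cast
    simp [h2] at this

lemma oddPoly_eval (b : Fin g → ℝ) (s : ℂ) :
    (oddPoly g b).eval s = s ^ (2 * g + 1) + ∑ i : Fin g, (b i : ℂ) * s ^ (2 * (i : ℕ) + 1) := by
  simp [oddPoly, eval_finsetSum]

lemma derivative_oddPoly_eval (b : Fin g → ℝ) (s : ℂ) :
    (derivative (oddPoly g b)).eval s = (2 * g + 1) * s ^ (2 * g) +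
      ∑ i : Fin g, (b i : ℂ) * ((2 * i + 1) * s ^ (2 * (i : ℕ))) := by
  simp [oddPoly, eval_finsetSum]

lemma derivative_derivative_oddPoly_eval (b : Fin g → ℝ) (s : ℂ) :
    s * (derivative (derivative (oddPoly g b))).eval s = (2 * g + 1) * (2 * g) * s ^ (2 * g) +
      ∑ i : Fin g, (b i : ℂ) * ((2 * i + 1) * (2 * i) * s ^ (2 * (i : ℕ))) := by
  have h : ∀ k : ℕ, s * ((2 * k : ℂ) * s ^ (2 * k - 1)) = (2 * k) * s ^ (2 * k) := by
    intro k
    rcases k with _ | k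
    · simp
    · grind
  simp only [oddPoly, map_add, map_sum, derivative_X_pow, derivative_C_mul, eval_add,
    eval_finsetSum, eval_mul, eval_C, eval_pow, eval_X, Nat.add_sub_cancel, mul_add, mul_sum]
  grind

end conifold

section singular

variable {g : ℕ} (a : Fin g → ℝ)

lemma deltaEval_famGG_diag (k l : ℕ) {s : ℂ} (hs : s ≠ 0) : (famGG g 1 a).deltaEval k l s⁻¹ s⁻¹ =
      (0 ^ l + 0 ^ k) * s⁻¹ + (-(g : ℂ)) ^ (k + l) * s ^ (2 * g)
        + ∑ i : Fin g, (a i : ℂ) * (-(i : ℂ)) ^ (k + l) * s ^ (2 * (i : ℕ)) := by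
  have h : ∀ n : ℕ, (s⁻¹) ^ (-(n : ℤ)) * (s⁻¹) ^ (-(n : ℤ)) = s ^ (2 * n) := by
    intro n
    rw [inv_zpow, zpow_neg, inv_inv, zpow_natCast, ← pow_add, two_mul]
  rw [deltaEval_famGG, h]
  simp only [h, pow_add, mul_assoc]
  ring

lemma singularPoints_famGG :
    singularPoints (famGG g 1 a) = (fun s : ℂ => (s⁻¹, s⁻¹)) '' critSet g a := by
  have key : ∀ s : ℂ, s ≠ 0 → (((famGG g 1 a).eval s⁻¹ s⁻¹ = 0 ∧
      (famGG g 1 a).deltaEval 1 0 s⁻¹ s⁻¹ = 0 ∧ (famGG g 1 a).deltaEval 0 1 s⁻¹ s⁻¹ = 0) ↔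
      s ∈ critSet g a) := by
    intro s hs
    have e0 : s * (famGG g 1 a).eval s⁻¹ s⁻¹ = 2 + (oddPoly g a).eval s := by
      rw [Laurent2.eval, deltaEval_famGG_diag a 0 0 hs, oddPoly_eval]
      simp only [add_zero, pow_zero, mul_one, one_mul, mul_add, mul_sum, pow_succ]
      grind
    have e1 : (famGG g 1 a).deltaEval 1 0 s⁻¹ s⁻¹ = (famGG g 1 a).deltaEval 0 1 s⁻¹ s⁻¹ := by
      rw [deltaEval_famGG_diag a 1 0 hs, deltaEval_famGG_diag a 0 1 hs]; simp
    have e2 : 2 * (famGG g 1 a).deltaEval 1 0 s⁻¹ s⁻¹ = (famGG g 1 a).eval s⁻¹ s⁻¹ -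
        (Polynomial.derivative (oddPoly g a)).eval s := by
      rw [Laurent2.eval, deltaEval_famGG_diag a 1 0 hs, deltaEval_famGG_diag a 0 0 hs,
        derivative_oddPoly_eval]
      have : ∑ i : Fin g, (a i : ℂ) * ((2 * i + 1) * s ^ (2 * (i : ℕ))) =
          ∑ i : Fin g, (a i : ℂ) * (-(i : ℂ)) ^ (0 + 0) * s ^ (2 * (i : ℕ)) -
          2 * ∑ i : Fin g, (a i : ℂ) * (-(i : ℂ)) ^ (1 + 0) * s ^ (2 * (i : ℕ)) := by
        rw [mul_sum, ← sum_sub_distrib]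
        exact sum_congr rfl fun i _ => by ring
      rw [this]
      simp
      ring
    rw [← e1, critSet, mem_ofPred_eq]
    grind
  ext ⟨x, y⟩
  constructor
  · rintro ⟨hx, hy, h0, h1, h2⟩
    simp only at hx hy h0 h1 h2
    have hxy : x = y := by
      rw [deltaEval_famGG] at h1 h2
      grind
    subst hxy
    refine ⟨x⁻¹, (key x⁻¹ (inv_ne_zero hx)).1 ?_, by simp⟩
    simp only [inv_inv]
    exact ⟨h0, h1, h2⟩
  · rintro ⟨s, hs, h⟩
    have hs0 : s ≠ 0 := by
      rintro rfl
      have := hs.1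
      rw [oddPoly_eval_zero] at this
      norm_num at this
    simp only [Prod.mk.injEq] at h
    obtain ⟨rfl, rfl⟩ := h
    obtain ⟨h0, h1, h2⟩ := (key s hs0).2 hs
    exact ⟨inv_ne_zero hs0, inv_ne_zero hs0, h0, h1, h2⟩

lemma isNodeAt_famGG {s : ℂ} (hs : s ∈ critSet g a) : IsNodeAt (famGG g 1 a) (s⁻¹, s⁻¹) ↔
      (Polynomial.derivative (Polynomial.derivative (oddPoly g a))).eval s ≠ 0 := by
  have hs0 : s ≠ 0 := by
    rintro rfl
    have := hs.1
    rw [oddPoly_eval_zero] at this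
    norm_num at this
  have h1 := hs.2
  rw [derivative_oddPoly_eval] at h1
  have h0 := hs.1
  rw [oddPoly_eval] at h0
  have h2 := derivative_derivative_oddPoly_eval a s
  set A := (g : ℂ) ^ 2 * s ^ (2 * g) + ∑ i : Fin g, (a i : ℂ) * (i : ℂ) ^ 2 * s ^ (2 * (i : ℕ)) with hA
  have e11 : (famGG g 1 a).deltaEval 1 1 s⁻¹ s⁻¹ = A := by
    rw [deltaEval_famGG_diag a 1 1 hs0, hA]; norm_num
  have e20 : (famGG g 1 a).deltaEval 2 0 s⁻¹ s⁻¹ = s⁻¹ + A := by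
    rw [deltaEval_famGG_diag a 2 0 hs0, hA]; norm_num; ring
  have e02 : (famGG g 1 a).deltaEval 0 2 s⁻¹ s⁻¹ = s⁻¹ + A := by
    rw [deltaEval_famGG_diag a 0 2 hs0, hA]; norm_num; ring
  have key : s ^ 2 * (Polynomial.derivative (Polynomial.derivative (oddPoly g a))).eval s =
      2 * s * (s⁻¹ + 2 * A) := by
    have r1 : ∑ i : Fin g, (a i : ℂ) * ((2 * i + 1) * (2 * i) * s ^ (2 * (i : ℕ))) =
        4 * (∑ i : Fin g, (a i : ℂ) * (i : ℂ) ^ 2 * s ^ (2 * (i : ℕ))) +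
        ∑ i : Fin g, (a i : ℂ) * ((2 * i + 1) * s ^ (2 * (i : ℕ))) -
        ∑ i : Fin g, (a i : ℂ) * s ^ (2 * (i : ℕ)) := by
      rw [mul_sum, ← sum_add_distrib, ← sum_sub_distrib]
      exact sum_congr rfl fun i _ => by ring
    have r2 : s * ∑ i : Fin g, (a i : ℂ) * s ^ (2 * (i : ℕ)) =
        ∑ i : Fin g, (a i : ℂ) * s ^ (2 * (i : ℕ) + 1) := by
      rw [mul_sum]
      exact sum_congr rfl fun i _ => by ring
    grind
  rw [IsNodeAt, e11, e20, e02, not_iff_not]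
  grind

lemma isMaximalConifold_famGG_iff (hg : 0 < g) :
    IsMaximalConifold (famGG g 1) a ↔ a = chebCoeff g := by
  rw [← critSet_iff hg, IsMaximalConifold, singularPoints_famGG, Set.ncard_image_of_injective]
  · simp only [Set.forall_mem_image]
    refine and_congr_right fun _ => and_congr_right fun _ => forall₂_congr fun s hs => ?_
    exact isNodeAt_famGG a hs
  · intro s t h
    simpa using h

lemma singularPoints_monomial_map {F G : Laurent2 ℝ} {k p q : ℤ × ℤ}
    (hdet : p.1 * q.2 - p.2 * q.1 = 1)
    (hFG : ∀ (f : ℤ × ℤ → ℂ) (x y : ℂ), x ≠ 0 → y ≠ 0 → weightedEval f x y F =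
      x ^ k.1 * y ^ k.2 * weightedEval
        (fun m => f (k.1 + p.1 * m.1 + q.1 * m.2, k.2 + p.2 * m.1 + q.2 * m.2))
        (x ^ p.1 * y ^ p.2) (x ^ q.1 * y ^ q.2) G) :
    (singularPoints F).ncard = (singularPoints G).ncard ∧
      ((∀ z ∈ singularPoints F, IsNodeAt F z) ↔ ∀ z ∈ singularPoints G, IsNodeAt G z) := by
  have hdC : (p.1 : ℂ) * q.2 - p.2 * q.1 = 1 := mod_cast hdet
  have lin : ∀ {x y : ℂ}, x ≠ 0 → y ≠ 0 → ∀ (i j : ℕ) (c₀ c₁ c₂ c₃ c₄ c₅ : ℂ),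
      (∀ m : ℤ × ℤ, (k.1 + p.1 * m.1 + q.1 * m.2 : ℂ) ^ i * (k.2 + p.2 * m.1 + q.2 * m.2) ^ j =
        c₀ + c₁ * m.1 + c₂ * m.2 + c₃ * m.1 ^ 2 + c₄ * (m.1 * m.2) + c₅ * m.2 ^ 2) →
      ∀ {X Y : ℂ}, x ^ p.1 * y ^ p.2 = X → x ^ q.1 * y ^ q.2 = Y →
      F.deltaEval i j x y = x ^ k.1 * y ^ k.2 * (c₀ * G.eval X Y + c₁ * G.deltaEval 1 0 X Y +
        c₂ * G.deltaEval 0 1 X Y + c₃ * G.deltaEval 2 0 X Y + c₄ * G.deltaEval 1 1 X Y +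
        c₅ * G.deltaEval 0 2 X Y) := by
    rintro x y hx hy i j c₀ c₁ c₂ c₃ c₄ c₅ hc X Y rfl rfl
    rw [deltaEval_eq, hFG _ _ _ hx hy]
    congr 1
    simp only [Laurent2.eval, deltaEval, Finsupp.sum, mul_sum, ← sum_add_distrib]
    refine sum_congr rfl fun m _ => ?_
    have := hc m
    push_cast
    rw [this]
    ring
  have h0 := fun {x y X Y : ℂ} (hx : x ≠ 0) (hy : y ≠ 0) (h1 : x ^ p.1 * y ^ p.2 = X)
      (h2 : x ^ q.1 * y ^ q.2 = Y) =>
    And.intro (lin hx hy 0 0 1 0 0 0 0 0 (fun m => by ring) h1 h2) <| And.intro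
      (lin hx hy 1 0 k.1 p.1 q.1 0 0 0 (fun m => by ring) h1 h2)
      (lin hx hy 0 1 k.2 p.2 q.2 0 0 0 (fun m => by ring) h1 h2)
  have hsing : ∀ {x y X Y : ℂ}, x ≠ 0 → y ≠ 0 → x ^ p.1 * y ^ p.2 = X → x ^ q.1 * y ^ q.2 = Y →
      ((x, y) ∈ singularPoints F ↔ (X, Y) ∈ singularPoints G) := by
    intro x y X Y hx hy h1 h2
    obtain ⟨e0, e1, e2⟩ := h0 hx hy h1 h2
    have hμ : x ^ k.1 * y ^ k.2 ≠ 0 := by positivity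
    have hX : X ≠ 0 := by rw [← h1]; positivity
    have hY : Y ≠ 0 := by rw [← h2]; positivity
    simp only [singularPoints, mem_ofPred_eq, hx, hy, hX, hY, true_and, ne_eq, not_false_eq_true,
      Laurent2.eval, e0, e1, e2, mul_eq_zero, hμ, false_or]
    constructor
    · rintro ⟨a, b, c⟩
      refine ⟨?_, ?_, ?_⟩
      · linear_combination a
      · linear_combination q.2 * b - q.1 * c - (q.2 * k.1 - q.1 * k.2) * a -
          G.deltaEval 1 0 X Y * hdC
      · linear_combination p.1 * c - p.2 * b - (p.1 * k.2 - p.2 * k.1) * a -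
          G.deltaEval 0 1 X Y * hdC
    · rintro ⟨a, b, c⟩
      simp [a, b, c]
  have himg : singularPoints G =
      (fun z => (z.1 ^ p.1 * z.2 ^ p.2, z.1 ^ q.1 * z.2 ^ q.2)) '' singularPoints F := by
    ext ⟨X, Y⟩
    constructor
    · intro h
      have hc := zpow_mul_zpow_cancel' h.1 h.2.1 hdet
      exact ⟨_, (hsing (mul_ne_zero (zpow_ne_zero _ h.1) (zpow_ne_zero _ h.2.1))
        (mul_ne_zero (zpow_ne_zero _ h.1) (zpow_ne_zero _ h.2.1)) hc.1 hc.2).2 h, Prod.ext hc.1 hc.2⟩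
    · rintro ⟨⟨x, y⟩, h, h'⟩
      rw [← h']
      exact (hsing h.1 h.2.1 rfl rfl).1 h
  rw [himg, InjOn.ncard_image]
  · refine ⟨rfl, ?_⟩
    simp only [Set.forall_mem_image]
    refine forall₂_congr fun ⟨x, y⟩ h => not_congr ?_
    obtain ⟨hx, hy, -⟩ := id h
    obtain ⟨-, -, h0, h1, h2⟩ := (hsing hx hy rfl rfl).1 h
    dsimp only at *
    rw [lin hx hy 1 1 (k.1 * k.2) (k.1 * p.2 + k.2 * p.1) (k.1 * q.2 + k.2 * q.1) (p.1 * p.2)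
        (p.1 * q.2 + p.2 * q.1) (q.1 * q.2) (fun m => by ring) rfl rfl,
      lin hx hy 2 0 (k.1 ^ 2) (2 * k.1 * p.1) (2 * k.1 * q.1) (p.1 ^ 2) (2 * p.1 * q.1) (q.1 ^ 2)
        (fun m => by ring) rfl rfl,
      lin hx hy 0 2 (k.2 ^ 2) (2 * k.2 * p.2) (2 * k.2 * q.2) (p.2 ^ 2) (2 * p.2 * q.2) (q.2 ^ 2)
        (fun m => by ring) rfl rfl, h0, h1, h2]
    simp only [mul_zero, zero_add]
    generalize G.deltaEval 2 0 _ _ = A, G.deltaEval 1 1 _ _ = B, G.deltaEval 0 2 _ _ = C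
    have hμ : x ^ k.1 * y ^ k.2 ≠ 0 := by positivity
    generalize x ^ k.1 * y ^ k.2 = μ at hμ
    refine (Eq.congr_left (?_ : _ = μ ^ 2 * (B ^ 2 - A * C))).trans (by simp [hμ])
    linear_combination μ ^ 2 * (B ^ 2 - A * C) * (p.1 * q.2 - p.2 * q.1 + 1) * hdC
  · rintro ⟨x, y⟩ h ⟨x', y'⟩ h' e
    have hc := zpow_mul_zpow_cancel h.1 h.2.1 hdet
    have hc' := zpow_mul_zpow_cancel h'.1 h'.2.1 hdet
    simp only [Prod.mk.injEq] at e hc hc' ⊢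
    rw [e.1, e.2] at hc
    exact ⟨hc.1.symm.trans hc'.1, hc.2.symm.trans hc'.2⟩

lemma isMaximalConifold_famHyp_iff (hg : 0 < g) :
    IsMaximalConifold (famHyp g 1) a ↔ a = chebCoeff g ∘ rev := by
  have e : a = chebCoeff g ∘ rev ↔ a ∘ rev = chebCoeff g := by
    constructor
    · rintro rfl; ext i; simp
    · intro h; ext i; rw [← h]; simp
  have e2 : (∀ i, a i ≠ 0) ↔ ∀ i, (a ∘ rev) i ≠ 0 :=
    ⟨fun h i => h _, fun h i => by simpa using h (rev i)⟩
  obtain ⟨k, rfl⟩ := Nat.exists_eq_add_one.2 hg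
  have h := singularPoints_monomial_map (k := (-k, -k)) (p := (-1, -1)) (q := ((k + 1 : ℕ), k))
    (by push_cast; ring) (weightedEval_famGG k (a ∘ rev))
  rw [show (a ∘ rev) ∘ rev = a by ext i; simp] at h
  rw [e, ← isMaximalConifold_famGG_iff _ hg, IsMaximalConifold, IsMaximalConifold, e2, h.1, h.2]

end singular

open Polynomial in
lemma chebyshevC_sub_eq_prod {n : ℕ} (hn : 0 < n) (S : ℂ) (φ : ℝ) :
    (Chebyshev.C ℂ n).eval S - 2 * rcos (n * φ) =
      ∏ k ∈ range n, (S - 2 * rcos (φ + 2 * π * k / n)) := by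
  have hn' : (n : ℂ) ≠ 0 := mod_cast hn.ne'
  obtain ⟨z, hz⟩ := Complex.cos_surjective (S / 2)
  have hS : S = 2 * cos z := by rw [hz]; ring
  have hcos : ∀ w : ℂ, 2 * cos w = cis w + exp (-(w * I)) := fun w => by rw [cos, neg_mul]; ring
  have hζ := Complex.isPrimitiveRoot_exp n hn.ne'
  have hfac : ∀ e : ℝ, cis z ^ n - cis e ^ n =
      ∏ k ∈ range n, (cis z - exp (2 * π * I / n) ^ k * cis e) := by
    intro e
    have := congrArg (Polynomial.eval (cis z)) (X_pow_sub_C_eq_prod hζ hn (rfl : cis e ^ n = _))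
    simpa [eval_prod] using this
  have hfac' : ∀ e : ℝ, cis z ^ n - cis e ^ n =
      ∏ k ∈ range n, (cis z - (exp (2 * π * I / n))⁻¹ ^ k * cis e) := by
    intro e
    have := congrArg (Polynomial.eval (cis z)) (X_pow_sub_C_eq_prod hζ.inv hn (rfl : cis e ^ n = _))
    simpa [eval_prod] using this
  have hv : cis z ^ n ≠ 0 := pow_ne_zero _ (exp_ne_zero _)
  apply mul_left_cancel₀ hv
  have lhs : cis z ^ n * ((Chebyshev.C ℂ n).eval S - 2 * rcos (n * φ)) =
      (cis z ^ n - cis φ ^ n) * (cis z ^ n - exp ((-φ : ℝ) * I) ^ n) := by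
    rw [hS]
    have := Chebyshev.C_two_mul_complex_cos z n
    simp only [Int.cast_natCast] at this
    rw [this, ofReal_cos, hcos, hcos]
    push_cast
    simp only [← exp_nat_mul, mul_add, mul_sub, sub_mul, ← exp_add]
    ring_nf
  have hpow : cis z ^ n = ∏ k ∈ range n, cis z := by simp
  rw [lhs, hfac φ, hfac' (-φ), ← prod_mul_distrib, hpow, ← prod_mul_distrib]
  refine prod_congr rfl fun k _ => ?_
  rw [hS, hcos, ofReal_cos, hcos, inv_pow, ← exp_nat_mul, ← exp_neg]
  push_cast
  simp only [mul_add, mul_sub, sub_mul, add_mul, ← exp_add]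
  ring_nf

def critRadius (g m : ℕ) : ℝ := 2 * rcos (π * m / (2 * g + 1))

def chebZero (g k : ℕ) : ℝ := 2 * rcos ((2 * k + 1) * π / (2 * (2 * g + 1)))

section radius

open Polynomial

variable {g m : ℕ}

lemma critRadius_angle (hm : m ≤ g) : π * m / (2 * g + 1) ∈ Ico 0 (π / 2) := by
  have h1 : (m : ℝ) ≤ g := mod_cast hm
  have hpi := pi_pos
  refine ⟨by positivity, ?_⟩
  rw [div_lt_iff₀ (by positivity)]
  nlinarith

lemma critRadius_pos (hm : m ≤ g) : 0 < critRadius g m := by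
  have h := critRadius_angle hm
  have := cos_pos_of_mem_Ioo ⟨by linarith [h.1, pi_pos], h.2⟩
  rw [critRadius]; positivity

lemma chebZero_angle {k : ℕ} (hk : k < g) :
    (2 * (k : ℝ) + 1) * π / (2 * (2 * g + 1)) ∈ Ioo 0 (π / 2) := by
  have h1 : (k : ℝ) + 1 ≤ g := mod_cast hk
  have hpi := pi_pos
  refine ⟨by positivity, ?_⟩
  rw [div_lt_iff₀ (by positivity)]
  nlinarith

lemma chebZero_pos {k : ℕ} (hk : k < g) : 0 < chebZero g k := by
  have h := chebZero_angle hk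
  have := cos_pos_of_mem_Ioo ⟨by linarith [h.1, pi_pos], h.2⟩
  rw [chebZero]; positivity

lemma chebZero_gt {k : ℕ} (hkm : k < m) (hm : m ≤ g) : critRadius g m < chebZero g k := by
  rw [critRadius, chebZero]
  have hk := chebZero_angle (lt_of_lt_of_le hkm hm)
  have hr := critRadius_angle hm
  have h1 : (k : ℝ) + 1 ≤ m := mod_cast hkm
  have hpi := pi_pos
  have := cos_lt_cos_of_nonneg_of_le_pi_div_two hk.1.le hr.2.le (by
    rw [div_lt_div_iff₀ (by positivity) (by positivity)]
    have : 0 < (2 * (g : ℝ) + 1) * π := by positivity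
    nlinarith)
  linarith

lemma chebZero_lt {k : ℕ} (hkm : m ≤ k) (hk : k < g) : chebZero g k < critRadius g m := by
  rw [critRadius, chebZero]
  have hk' := chebZero_angle hk
  have hr := critRadius_angle (hkm.trans hk.le)
  have h1 : (m : ℝ) ≤ k := mod_cast hkm
  have hpi := pi_pos
  have := cos_lt_cos_of_nonneg_of_le_pi_div_two hr.1 hk'.2.le (by
    rw [div_lt_div_iff₀ (by positivity) (by positivity)]
    have : 0 < (2 * (g : ℝ) + 1) * π := by positivity
    nlinarith)
  linarith

lemma oddPoly_chebCoeff_eval_cos (θ : ℝ) :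
    (chebOdd g).eval (2 * rcos θ : ℂ) = 2 * rcos ((2 * g + 1) * θ) := by
  have := Chebyshev.C_two_mul_complex_cos (θ : ℂ) (2 * (g : ℤ) + 1)
  rw [oddPoly_chebCoeff, ofReal_cos, this]
  push_cast; rfl

lemma oddPoly_eval_chebZero (k : ℕ) : (chebOdd g).eval (chebZero g k : ℂ) = 0 := by
  have := oddPoly_chebCoeff_eval_cos (g := g) ((2 * k + 1) * π / (2 * (2 * g + 1)))
  rw [chebZero]
  push_cast at this ⊢
  rw [this, show (2 * (g : ℂ) + 1) * ((2 * k + 1) * π / (2 * (2 * g + 1))) =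
    (2 * (k : ℤ) + 1) * π / 2 by
      have : (2 * (g : ℂ) + 1) ≠ 0 := by norm_cast
      push_cast; field_simp]
  rw [mul_eq_zero]
  right
  rw [Complex.cos_eq_zero_iff]
  exact ⟨k, rfl⟩

lemma oddPoly_eval_critRadius : (chebOdd g).eval (critRadius g m : ℂ) = 2 * (-1) ^ m := by
  have := oddPoly_chebCoeff_eval_cos (g := g) (π * m / (2 * g + 1))
  rw [critRadius]
  push_cast at this ⊢
  rw [this, show (2 * (g : ℂ) + 1) * (π * m / (2 * g + 1)) = m * π by
      have : (2 * (g : ℂ) + 1) ≠ 0 := by norm_cast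
      field_simp]
  have := Real.cos_nat_mul_pi m
  rw [← ofReal_natCast, ← ofReal_mul, ← ofReal_cos, this]
  push_cast; rfl

def halfPoly (g : ℕ) (b : Fin g → ℝ) : ℂ[X] := X ^ g + ∑ i : Fin g, C (b i : ℂ) * X ^ (i : ℕ)

notation:max "chebHalf" g:max => halfPoly g (chebCoeff g)

lemma halfPoly_eval (b : Fin g → ℝ) (u : ℂ) :
    (halfPoly g b).eval u = u ^ g + ∑ i : Fin g, (b i : ℂ) * u ^ (i : ℕ) := by
  simp [halfPoly, eval_finsetSum]

lemma mul_halfPoly_eval_sq (b : Fin g → ℝ) (s : ℂ) :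
    s * (halfPoly g b).eval (s ^ 2) = (oddPoly g b).eval s := by
  rw [halfPoly_eval, oddPoly_eval, mul_add, mul_sum]
  congr 1
  · rw [← pow_mul]; ring
  · exact sum_congr rfl fun i _ => by rw [← pow_mul]; ring

lemma halfPoly_degree_lt (b : Fin g → ℝ) :
    (∑ i : Fin g, C (b i : ℂ) * X ^ (i : ℕ)).degree < (g : WithBot ℕ) := by
  rw [degree_lt_iff_coeff_zero]
  intro k hk
  rw [finsetSum_coeff, sum_eq_zero]
  grind

lemma halfPoly_monic (b : Fin g → ℝ) : (halfPoly g b).Monic :=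
  monic_X_pow_add (halfPoly_degree_lt b)

lemma halfPoly_natDegree (b : Fin g → ℝ) : (halfPoly g b).natDegree = g := by
  rw [halfPoly, natDegree_add_eq_left_of_degree_lt (by
    rw [degree_X_pow]; exact halfPoly_degree_lt b), natDegree_X_pow]

lemma chebZero_sq_injOn : InjOn (fun k => ((chebZero g k : ℂ)) ^ 2) (range g : Set ℕ) := by
  intro k hk l hl h
  rw [Finset.coe_range, Set.mem_Iio] at hk hl
  simp only [← ofReal_pow, ofReal_inj] at h
  rw [sq_eq_sq₀ (chebZero_pos hk).le (chebZero_pos hl).le] at h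
  by_contra hne
  rcases lt_or_gt_of_ne hne with h1 | h1
  · have h2 := chebZero_gt (g := g) (k := k) (m := k + 1) (Nat.lt_succ_self k) (by omega)
    have h3 := chebZero_lt (g := g) (m := k + 1) h1 hl
    linarith
  · have h2 := chebZero_gt (g := g) (k := l) (m := l + 1) (Nat.lt_succ_self l) (by omega)
    have h3 := chebZero_lt (g := g) (m := l + 1) h1 hk
    linarith

lemma halfPoly_roots :
    (chebHalf g).roots = (Multiset.range g).map fun k => (chebZero g k : ℂ) ^ 2 := by
  symm
  refine Multiset.eq_of_le_of_card_le ?_ ?_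
  · rw [Multiset.le_iff_subset]
    · intro u hu
      obtain ⟨k, hk, rfl⟩ := Multiset.mem_map.1 hu
      rw [Multiset.mem_range] at hk
      rw [mem_roots (halfPoly_monic _).ne_zero, IsRoot]
      have := mul_halfPoly_eval_sq (chebCoeff g) (chebZero g k : ℂ)
      rw [oddPoly_eval_chebZero, mul_eq_zero] at this
      exact this.resolve_left (mod_cast (chebZero_pos hk).ne')
    · exact Multiset.Nodup.map_on (fun k hk l hl h => chebZero_sq_injOn
        (by simpa using hk) (by simpa using hl) h) (Multiset.nodup_range g)
  · rw [Multiset.card_map, Multiset.card_range]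
    exact (card_roots' _).trans_eq (halfPoly_natDegree _)

lemma halfPoly_eval_eq_prod (u : ℂ) :
    (chebHalf g).eval u = ∏ k ∈ range g, (u - (chebZero g k : ℂ) ^ 2) := by
  conv_lhs => rw [(IsAlgClosed.splits (chebHalf g)).eq_prod_roots_of_monic
    (halfPoly_monic _), halfPoly_roots, eval_multiset_prod]
  simp [Finset.prod, Multiset.map_map]

lemma two_le_norm_oddPoly_eval (hm : m ≤ g) {S : ℂ} (hS : ‖S‖ = critRadius g m) :
    2 ≤ ‖(chebOdd g).eval S‖ := by
  have h2 : (2 : ℝ) = ‖(chebOdd g).eval (critRadius g m : ℂ)‖ := by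
    rw [oddPoly_eval_critRadius]; simp
  rw [h2, ← mul_halfPoly_eval_sq, ← mul_halfPoly_eval_sq, norm_mul, norm_mul, hS,
    halfPoly_eval_eq_prod, halfPoly_eval_eq_prod, norm_prod, norm_prod, norm_real,
    norm_of_nonneg (critRadius_pos hm).le]
  refine mul_le_mul_of_nonneg_left ?_ (critRadius_pos hm).le
  refine Finset.prod_le_prod (fun _ _ => norm_nonneg _) fun k _ => ?_
  have h1 := abs_norm_sub_norm_le (S ^ 2) ((chebZero g k : ℂ) ^ 2)
  rw [norm_pow, hS, norm_pow, norm_real, norm_eq_abs, sq_abs] at h1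
  calc ‖(critRadius g m : ℂ) ^ 2 - (chebZero g k : ℂ) ^ 2‖
      = |critRadius g m ^ 2 - chebZero g k ^ 2| := by
        rw [← ofReal_pow, ← ofReal_pow, ← ofReal_sub, norm_real, norm_eq_abs]
    _ ≤ _ := h1

end radius

def logMaxCos (σ t : ℝ) : ℝ := rlog (max σ |2 * rcos t|)

def sumLogMaxCos (σ : ℝ) (n : ℕ) (ψ : ℝ) : ℝ := ∑ k ∈ range n, logMaxCos σ ((ψ + 2 * π * k) / n)

section logMaxCos

variable {σ : ℝ}

lemma continuous_logMaxCos (hσ : 0 < σ) : Continuous (logMaxCos σ) :=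
  (continuous_const.max (continuous_const.mul Real.continuous_cos).abs).log fun t =>
    (lt_of_lt_of_le hσ (le_max_left _ _)).ne'

lemma logMaxCos_neg (t : ℝ) : logMaxCos σ (-t) = logMaxCos σ t := by
  rw [logMaxCos, Real.cos_neg, logMaxCos]

lemma logMaxCos_periodic : Periodic (logMaxCos σ) (2 * π) := fun t => by
  rw [logMaxCos, Real.cos_add_two_pi, logMaxCos]

lemma logMaxCos_periodic_pi : Periodic (logMaxCos σ) π := fun t => by
  rw [logMaxCos, Real.cos_add_pi, mul_neg, abs_neg, logMaxCos]

lemma continuous_sumLogMaxCos (hσ : 0 < σ) (n : ℕ) : Continuous (sumLogMaxCos σ n) :=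
  continuous_finsetSum _ fun k _ => (continuous_logMaxCos hσ).comp (by fun_prop)

lemma sumLogMaxCos_periodic {n : ℕ} (hn : 0 < n) :
    Periodic (sumLogMaxCos σ n) (2 * π) := fun ψ => by
  have hn' : (n : ℝ) ≠ 0 := mod_cast hn.ne'
  have h1 : ∀ k : ℕ, (ψ + 2 * π + 2 * π * k) / n =
      (ψ + 2 * π * ((k + 1 : ℕ) : ℝ)) / n := fun k => by push_cast; ring
  simp only [sumLogMaxCos, h1]
  have h2 := Finset.sum_range_succ' (fun k : ℕ => logMaxCos σ ((ψ + 2 * π * k) / n)) n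
  have h3 := Finset.sum_range_succ (fun k : ℕ => logMaxCos σ ((ψ + 2 * π * k) / n)) n
  have h4 : (ψ + 2 * π * n) / n = (ψ + 2 * π * ((0 : ℕ) : ℝ)) / n + 2 * π := by
    push_cast; field_simp; ring
  rw [h4, logMaxCos_periodic] at h3
  linarith

lemma sumLogMaxCos_neg {n : ℕ} (hn : 0 < n) (ψ : ℝ) :
    sumLogMaxCos σ n (-ψ) = sumLogMaxCos σ n ψ := by
  have hn' : (n : ℝ) ≠ 0 := mod_cast hn.ne'
  rw [← sumLogMaxCos_periodic hn ψ, sumLogMaxCos, sumLogMaxCos, ← Finset.sum_range_reflect]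
  refine sum_congr rfl fun k hk => ?_
  rw [mem_range] at hk
  rw [← logMaxCos_neg, ← logMaxCos_periodic]
  congr 1
  rw [Nat.sub_sub, Nat.cast_sub (by omega)]
  push_cast
  field_simp
  ring

lemma circMean_sumLogMaxCos (hσ : 0 < σ) {n : ℕ} (hn : 0 < n) :
    circMean (sumLogMaxCos σ n) = n * circMean (logMaxCos σ) := by
  have hn' : (n : ℝ) ≠ 0 := mod_cast hn.ne'
  rw [← circMean_nat_mul_periodic (sumLogMaxCos_periodic hn) (continuous_sumLogMaxCos hσ n) hn.ne']
  have : ∀ β : ℝ, sumLogMaxCos σ n (n * β) =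
      ∑ k ∈ range n, logMaxCos σ (2 * π * k / n + β) := fun β =>
    sum_congr rfl fun k _ => by congr 1; field_simp; ring
  rw [circMean_congr this, circMean_sum (f := fun (k : ℕ) (β : ℝ) =>
    logMaxCos σ (2 * π * k / n + β)) _ fun k _ =>
    (continuous_logMaxCos hσ).comp (by fun_prop : Continuous fun β : ℝ => 2 * π * k / n + β)]
  simp [circMean_add_left_periodic logMaxCos_periodic]

end logMaxCos

lemma circMean_log_norm_sub {σ r : ℝ} (hσ : 0 < σ) :
    circMean (fun θ : ℝ => rlog ‖(σ : ℂ) * cis θ - r‖) = rlog (max σ |r|) := by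
  have h := circleAverage_log_norm_sub_const_eq_log_radius_add_posLog (a := (r : ℂ)) (c := 0) hσ.ne'
  rw [circleAverage_def] at h
  simp only [circleMap, zero_add, zero_sub, norm_neg, norm_real, norm_eq_abs] at h
  rw [circMean, h]
  rcases le_or_gt |r| σ with h1 | h1
  · rw [max_eq_left h1, Real.posLog_eq_zero_iff _ |>.2, add_zero]
    rw [abs_mul, abs_abs, abs_of_pos (inv_pos.2 hσ), inv_mul_le_iff₀ hσ, mul_one]
    exact h1
  · have hr : 0 < |r| := hσ.trans h1
    rw [max_eq_right h1.le, Real.posLog_eq_log, Real.log_mul (inv_pos.2 hσ).ne' hr.ne', Real.log_inv]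
    · ring
    · rw [abs_mul, abs_abs, abs_of_pos (inv_pos.2 hσ), le_inv_mul_iff₀ hσ, mul_one]
      exact h1.le

section cheb

variable {g m : ℕ}

def chebMean (g m : ℕ) (x : ℝ) : ℝ := sumLogMaxCos (critRadius g m) (2 * g + 1) (arccos (-x / 2))

lemma continuous_chebMean (hm : m ≤ g) : Continuous (chebMean g m) :=
  (continuous_sumLogMaxCos (critRadius_pos hm) _).comp (continuous_arccos.comp (by fun_prop))

lemma oddPoly_add_ne_zero (hm : m ≤ g) {x : ℂ} (hx : ‖x‖ < 2) {S : ℂ}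
    (hS : ‖S‖ = critRadius g m) : (chebOdd g).eval S + x ≠ 0 := by
  intro h
  have h1 := two_le_norm_oddPoly_eval hm hS
  rw [eq_neg_of_add_eq_zero_left h, norm_neg] at h1
  linarith

lemma norm_mul_exp {σ : ℝ} (hσ : 0 < σ) (θ : ℝ) : ‖(σ : ℂ) * cis θ‖ = σ := by
  rw [norm_mul, norm_exp_ofReal_mul_I, mul_one, norm_real, norm_of_nonneg hσ.le]

lemma circMean_log_norm_oddPoly_add (hm : m ≤ g) {x : ℝ} (hx : |x| < 2) :
    circMean (fun θ : ℝ => rlog ‖(chebOdd g).eval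
      ((critRadius g m : ℂ) * cis θ) + x‖) = chebMean g m x := by
  have hσ := critRadius_pos hm
  set σ := critRadius g m with hσd
  have hn : 0 < 2 * g + 1 := Nat.succ_pos _
  have hn' : ((2 * g + 1 : ℕ) : ℝ) ≠ 0 := mod_cast hn.ne'
  set ψ := arccos (-x / 2) with hψ
  have hcos : 2 * rcos ψ = -x := by
    rw [hψ, cos_arccos] <;> linarith [(abs_lt.1 hx).1, (abs_lt.1 hx).2]
  have hfac : ∀ S : ℂ, (chebOdd g).eval S + x = ∏ k ∈ range (2 * g + 1),
      (S - ((2 * rcos ((ψ + 2 * π * k) / (2 * g + 1 : ℕ)) : ℝ) : ℂ)) := by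
    intro S
    have := chebyshevC_sub_eq_prod hn S (ψ / (2 * g + 1 : ℕ))
    rw [mul_div_cancel₀ _ hn'] at this
    have e : (x : ℂ) = -(2 * rcos ψ) := by
      have := congrArg ((↑) : ℝ → ℂ) hcos
      push_cast at this ⊢
      linear_combination this
    rw [e, ← sub_eq_add_neg, oddPoly_chebCoeff]
    push_cast at this ⊢
    rw [this]
    simp only [add_div]
  have hne : ∀ θ : ℝ, ∀ k ∈ range (2 * g + 1), (σ : ℂ) * cis θ -
      ((2 * rcos ((ψ + 2 * π * k) / (2 * g + 1 : ℕ)) : ℝ) : ℂ) ≠ 0 := by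
    intro θ k hk h0
    apply oddPoly_add_ne_zero hm (x := x) (by rwa [norm_real]) (norm_mul_exp hσ θ)
    rw [hfac, prod_eq_zero hk h0]
  have hlog : ∀ θ : ℝ, rlog ‖(chebOdd g).eval ((σ : ℂ) * cis θ) + x‖ =
      ∑ k ∈ range (2 * g + 1), rlog ‖(σ : ℂ) * cis θ -
        ((2 * rcos ((ψ + 2 * π * k) / (2 * g + 1 : ℕ)) : ℝ) : ℂ)‖ := by
    intro θ
    rw [hfac, norm_prod, log_prod]
    simp_all
  rw [circMean_congr hlog, circMean_sum _ fun k hk =>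
    (Continuous.norm (by fun_prop)).log fun θ => norm_ne_zero_iff.2 (hne θ k hk), chebMean,
    sumLogMaxCos]
  exact sum_congr rfl fun k _ => circMean_log_norm_sub hσ

lemma chebMean_two_mul_cos (φ : ℝ) : chebMean g m (2 * rcos φ) =
      sumLogMaxCos (critRadius g m) (2 * g + 1) (π - φ) := by
  have hn : 0 < 2 * g + 1 := Nat.succ_pos _
  rw [chebMean, show -(2 * rcos φ) / 2 = rcos (π - φ) by rw [Real.cos_pi_sub]; ring]
  have h : rcos (arccos (rcos (π - φ))) = rcos (π - φ) :=
    cos_arccos (neg_one_le_cos _) (cos_le_one _)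
  set ψ := arccos (rcos (π - φ))
  obtain ⟨k, hk⟩ := Real.cos_eq_cos_iff.1 h
  have hp := (sumLogMaxCos_periodic (σ := critRadius g m) hn).int_mul k
  rcases hk with hk | hk
  · rw [hk, show 2 * (k : ℝ) * π + ψ = ψ + k * (2 * π) by ring, hp]
  · rw [hk, show 2 * (k : ℝ) * π - ψ = -ψ + k * (2 * π) by ring, hp, sumLogMaxCos_neg hn]

lemma circMean_chebMean_two_mul_cos (hm : m ≤ g) : circMean (fun φ => chebMean g m (2 * rcos φ)) =
      (2 * g + 1) * circMean (logMaxCos (critRadius g m)) := by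
  have hn : 0 < 2 * g + 1 := Nat.succ_pos _
  have hp := sumLogMaxCos_periodic (σ := critRadius g m) hn
  rw [circMean_congr fun φ => chebMean_two_mul_cos φ]
  have h1 := circMean_neg_periodic (f := fun φ => sumLogMaxCos (critRadius g m) (2 * g + 1)
    (π + φ)) (fun φ => by
      show sumLogMaxCos _ _ (π + (φ + 2 * π)) = _
      rw [← add_assoc, hp])
  rw [circMean_add_left_periodic hp] at h1
  simp only [← sub_eq_add_neg] at h1
  rw [h1, circMean_sumLogMaxCos (critRadius_pos hm) hn]
  push_cast; rfl

lemma circMean_logMaxCos (hm : m ≤ g) : circMean (logMaxCos (critRadius g m)) = 2 / π *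
      ((∫ t in (0 : ℝ)..π * m / (2 * g + 1), rlog (2 * rcos t)) +
        (π / 2 - π * m / (2 * g + 1)) * rlog (critRadius g m)) := by
  have hσ := critRadius_pos hm
  set t₀ := π * m / (2 * g + 1) with ht₀
  have hang := critRadius_angle hm
  rw [← ht₀] at hang
  have hpi := pi_pos
  have hc := continuous_logMaxCos hσ
  have hI : ∀ a b, IntervalIntegrable (logMaxCos (critRadius g m)) volume a b :=
    fun a b => hc.intervalIntegrable a b
  have hper := (logMaxCos_periodic_pi (σ := critRadius g m))
  have e1 : ∫ t in (0 : ℝ)..2 * π, logMaxCos (critRadius g m) t =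
      2 * ∫ t in (-(π / 2))..(π / 2), logMaxCos (critRadius g m) t := by
    have := hper.intervalIntegral_add_zsmul_eq 2 0 hI
    simp only [zero_add, zsmul_eq_mul, Int.cast_ofNat] at this
    rw [this]
    have h2 := hper.intervalIntegral_add_eq 0 (-(π / 2))
    rw [zero_add] at h2
    rw [h2]
    congr 2
    ring
  have e2 : ∫ t in (-(π / 2))..(π / 2), logMaxCos (critRadius g m) t =
      2 * ∫ t in (0 : ℝ)..(π / 2), logMaxCos (critRadius g m) t := by
    rw [← integral_add_adjacent_intervals (hI _ 0) (hI 0 _)]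
    have := integral_comp_neg (a := 0) (b := π / 2) (fun t => logMaxCos (critRadius g m) t)
    simp only [logMaxCos_neg, neg_zero] at this
    rw [← this]; ring
  have e3 : ∫ t in (0 : ℝ)..t₀, logMaxCos (critRadius g m) t =
      ∫ t in (0 : ℝ)..t₀, rlog (2 * rcos t) := by
    apply integral_congr
    intro t ht
    rw [uIcc_of_le hang.1] at ht
    have h1 : critRadius g m ≤ 2 * rcos t := by
      rw [critRadius, ← ht₀]
      have := cos_le_cos_of_nonneg_of_le_pi ht.1 (by linarith [hang.2]) ht.2
      linarith
    simp only [logMaxCos]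
    grind
  have e4 : ∫ t in t₀..(π / 2), logMaxCos (critRadius g m) t =
      (π / 2 - t₀) * rlog (critRadius g m) := by
    have : ∫ t in t₀..(π / 2), logMaxCos (critRadius g m) t =
        ∫ t in t₀..(π / 2), rlog (critRadius g m) := by
      apply integral_congr
      intro t ht
      rw [uIcc_of_le hang.2.le] at ht
      have h1 : 2 * rcos t ≤ critRadius g m := by
        rw [critRadius, ← ht₀]
        have := cos_le_cos_of_nonneg_of_le_pi hang.1 (by linarith [ht.2]) ht.1
        linarith
      have h0 : 0 ≤ rcos t := Real.cos_nonneg_of_mem_Icc ⟨by linarith [hang.1, ht.1], ht.2⟩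
      simp only [logMaxCos]
      grind
    rw [this, integral_const, smul_eq_mul]
  rw [circMean, e1, e2, ← integral_add_adjacent_intervals (hI _ t₀) (hI t₀ _), e3, e4, smul_eq_mul]
  field_simp

lemma mul_circMean_logMaxCos_sub (hm : m ≤ g) :
    (2 * g + 1) * circMean (logMaxCos (critRadius g m)) -
      (2 * g + 1 - 2 * m) * rlog (critRadius g m) = 2 * (2 * g + 1) / π *
        ∫ t in (0 : ℝ)..π * m / (2 * g + 1), rlog (2 * rcos t) := by
  have hpi := pi_ne_zero
  have hN : (2 * (g : ℝ) + 1) ≠ 0 := by positivity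
  rw [circMean_logMaxCos hm]
  field_simp
  ring

end cheb

def dilog (z : ℂ) : ℂ := -∫ t in (0 : ℝ)..1, log (1 - z * t) / t

lemma blochWigner_eq (z : ℂ) : blochWigner z = (dilog z).im + arg (1 - z) * rlog ‖z‖ := rfl

section dilog

variable {z : ℂ}

lemma one_sub_mul_mem_slitPlane (hz : 1 - z ∈ slitPlane) {t : ℝ} (ht : t ∈ Icc (0 : ℝ) 1) :
    1 - z * t ∈ slitPlane := by
  have := starConvex_one_slitPlane hz (a := 1 - t) (b := t) (by linarith [ht.2]) ht.1 (by ring)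
  convert this using 1
  simp only [real_smul]
  push_cast; ring

lemma hasDerivAt_log_one_sub_mul (hz : 1 - z ∈ slitPlane) {t : ℝ} (ht : t ∈ Icc (0 : ℝ) 1) :
    HasDerivAt (fun t : ℝ => log (1 - z * t)) (-z / (1 - z * t)) t := by
  have h : HasDerivAt (fun t : ℝ => 1 - z * (t : ℂ)) (-(z * 1)) t :=
    ((ofRealCLM.hasDerivAt (x := t)).const_mul z).const_sub 1
  simpa using h.clog_real (one_sub_mul_mem_slitPlane hz ht)

lemma intervalIntegrable_dilog (hz : 1 - z ∈ slitPlane) :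
    IntervalIntegrable (fun t : ℝ => log (1 - z * t) / t) volume 0 1 := by
  set f : ℝ → ℂ := fun t => log (1 - z * t) with hf
  have hd : ∀ t ∈ Icc (0 : ℝ) 1, HasDerivAt f (-z / (1 - z * t)) t :=
    fun t ht => hasDerivAt_log_one_sub_mul hz ht
  have hc : ContinuousOn (dslope f 0) (uIcc 0 1) := by
    rw [uIcc_of_le zero_le_one]
    intro t ht
    rcases eq_or_ne t 0 with rfl | h0
    · exact (continuousAt_dslope_same.2 (hd 0 ht).differentiableAt).continuousWithinAt
    · exact ((continuousAt_dslope_of_ne h0).2 (hd t ht).continuousAt).continuousWithinAt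
  refine hc.intervalIntegrable.congr_uIoo fun t ht => ?_
  rw [uIoo_of_le zero_le_one] at ht
  rw [dslope_of_ne _ ht.1.ne', slope_def_module]
  simp only [hf, sub_zero, ofReal_zero, mul_zero, log_one, real_smul]
  push_cast
  rw [div_eq_inv_mul]

lemma hasDerivAt_dilog' (hz : 1 - z ∈ slitPlane) :
    HasDerivAt dilog (∫ t in (0 : ℝ)..1, 1 / (1 - z * t)) z := by
  have hopen : {w : ℂ | 1 - w ∈ slitPlane} ∈ nhds z :=
    (isOpen_slitPlane.preimage (by fun_prop : Continuous fun w : ℂ => 1 - w)).mem_nhds hz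
  obtain ⟨ε, hε, hball⟩ := Metric.nhds_basis_closedBall.mem_iff.1 hopen
  have hcont : ContinuousOn (fun p : ℂ × ℝ => -1 / (1 - p.1 * p.2))
      (Metric.closedBall z ε ×ˢ Icc 0 1) := by
    apply ContinuousOn.div (by fun_prop) (by fun_prop)
    rintro ⟨w, t⟩ ⟨hw, ht⟩
    exact slitPlane_ne_zero (one_sub_mul_mem_slitPlane (hball hw) ht)
  obtain ⟨K, hK⟩ := ((isCompact_closedBall z ε).prod isCompact_Icc).exists_bound_of_continuousOn hcont
  have hmeas : ∀ w : ℂ, Measurable fun t : ℝ => log (1 - w * t) / t := fun w =>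
    (measurable_log.comp (by fun_prop : Measurable fun t : ℝ => 1 - w * (t : ℂ))).div (by fun_prop)
  have key := hasDerivAt_integral_of_dominated_loc_of_deriv_le
    (μ := volume) (F := fun w t => log (1 - w * t) / t)
    (F' := fun w t => -1 / (1 - w * t)) (x₀ := z) (a := 0) (b := 1)
    (s := Metric.closedBall z ε) (bound := fun _ => K) (Metric.closedBall_mem_nhds z hε)
    (.of_forall fun w => (hmeas w).aestronglyMeasurable) (intervalIntegrable_dilog hz)
    ((by fun_prop : Measurable fun t : ℝ => -1 / (1 - z * (t : ℂ))).aestronglyMeasurable)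
    (.of_forall fun t ht w hw => hK (w, t) ⟨hw, by grind⟩) intervalIntegrable_const
    (.of_forall fun t ht w hw => by
      rw [uIoc_of_le zero_le_one] at ht
      have ht0 : (t : ℂ) ≠ 0 := mod_cast ht.1.ne'
      have h1 : HasDerivAt (fun w : ℂ => 1 - w * (t : ℂ)) (-(1 * (t : ℂ))) w :=
        ((hasDerivAt_id w).mul_const _).const_sub 1
      have h2 := one_sub_mul_mem_slitPlane (hball hw) (Ioc_subset_Icc_self ht)
      have := (h1.clog h2).div_const (t : ℂ)
      grind)
  refine key.2.neg.congr_deriv ?_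
  rw [← integral_neg]
  congr 1; ext t; ring

lemma integral_one_div_one_sub_mul (hz : 1 - z ∈ slitPlane) (hz0 : z ≠ 0) :
    ∫ t in (0 : ℝ)..1, 1 / (1 - z * t) = -log (1 - z) / z := by
  have := integral_eq_sub_of_hasDerivAt (a := 0) (b := 1)
    (f := fun t : ℝ => -log (1 - z * t) / z) (f' := fun t : ℝ => 1 / (1 - z * (t : ℂ)))
    (fun t ht => by
      rw [uIcc_of_le zero_le_one] at ht
      have h2 := slitPlane_ne_zero (one_sub_mul_mem_slitPlane hz ht)
      refine ((hasDerivAt_log_one_sub_mul hz ht).neg.div_const z).congr_deriv ?_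
      field_simp)
    (ContinuousOn.intervalIntegrable (by
      rw [uIcc_of_le zero_le_one]
      apply ContinuousOn.div (by fun_prop) (by fun_prop)
      exact fun t ht => slitPlane_ne_zero (one_sub_mul_mem_slitPlane hz ht)))
  rw [this]
  simp

lemma hasDerivAt_dilog (hz : 1 - z ∈ slitPlane) (hz0 : z ≠ 0) :
    HasDerivAt dilog (-log (1 - z) / z) z := by
  rw [← integral_one_div_one_sub_mul hz hz0]
  exact hasDerivAt_dilog' hz

lemma dilog_zero : dilog 0 = 0 := by simp [dilog]

lemma dilog_conj (hz : 1 - z ∈ slitPlane) : dilog (conj z) = conj (dilog z) := by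
  rw [dilog, dilog, map_neg, ← intervalIntegral_conj]
  congr 1
  apply integral_congr
  intro t ht
  rw [uIcc_of_le zero_le_one] at ht
  simp only [map_div₀, conj_ofReal]
  rw [← log_conj _ (mem_slitPlane_iff_arg.1 (one_sub_mul_mem_slitPlane hz ht)).1]
  simp

lemma blochWigner_conj (hz : 1 - z ∈ slitPlane) : blochWigner (conj z) = -blochWigner z := by
  rw [blochWigner_eq, blochWigner_eq, dilog_conj hz, conj_im, norm_conj,
    show 1 - conj z = conj (1 - z) by simp, arg_conj, if_neg (mem_slitPlane_iff_arg.1 hz).1]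
  ring

lemma hasDerivAt_blochWigner {f : ℝ → ℂ} {f' : ℂ} {t : ℝ} (hf : HasDerivAt f f' t)
    (h1 : 1 - f t ∈ slitPlane) (h0 : f t ≠ 0) : HasDerivAt (fun t => blochWigner (f t))
      (-rlog ‖1 - f t‖ * (f' / f t).im + rlog ‖f t‖ * (-f' / (1 - f t)).im) t := by
  have hd : HasDerivAt (fun t => (dilog (f t)).im) ((-log (1 - f t) / f t * f').im) t :=
    imCLM.hasFDerivAt.comp_hasDerivAt t ((hasDerivAt_dilog h1 h0).comp t hf)
  have ha : HasDerivAt (fun t => arg (1 - f t)) ((-f' / (1 - f t)).im) t := by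
    have := imCLM.hasFDerivAt.comp_hasDerivAt t ((hf.const_sub 1).clog_real h1)
    simpa [comp_def, log_im] using this
  have hl : HasDerivAt (fun t => rlog ‖f t‖) ((f' / f t).re) t := by
    have hg : HasDerivAt (fun s => f s / f t) (f' / f t) t := hf.div_const _
    have := reCLM.hasFDerivAt.comp_hasDerivAt t (hg.clog_real (by
      rw [div_self h0]; exact one_mem_slitPlane))
    have h2 : HasDerivAt (fun s => rlog ‖f s / f t‖ + rlog ‖f t‖) ((f' / f t).re) t := by
      refine HasDerivAt.add_const _ ?_
      rw [div_self h0, div_one] at this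
      simpa [comp_def, log_re] using this
    refine h2.congr_of_eventuallyEq ?_
    filter_upwards [hf.continuousAt.eventually_ne h0] with s hs
    rw [norm_div, Real.log_div (norm_ne_zero_iff.2 hs) (norm_ne_zero_iff.2 h0)]
    ring
  refine (hd.add (ha.mul hl)).congr_deriv ?_
  rw [show -log (1 - f t) / f t * f' = -(log (1 - f t) * (f' / f t)) by ring, neg_im, mul_im,
    log_re, log_im]
  ring

end dilog

lemma integral_log_two_mul_cos : ∫ t in (0 : ℝ)..π / 2, rlog (2 * rcos t) = 0 := by
  have h1 : ∫ t in (0 : ℝ)..π / 2, rlog (2 * rcos t) =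
      ∫ t in (0 : ℝ)..π / 2, (rlog 2 + rlog (rcos t)) := by
    apply integral_congr_uIoo
    intro t ht
    rw [uIoo_of_le (by positivity)] at ht
    have := cos_pos_of_mem_Ioo ⟨by linarith [ht.1, pi_pos], ht.2⟩
    simp only
    rw [Real.log_mul two_ne_zero this.ne']
  have h2 : ∫ t in (0 : ℝ)..π / 2, rlog (rcos t) = ∫ t in (0 : ℝ)..π / 2, rlog (rsin t) := by
    have := integral_comp_sub_left (a := 0) (b := π / 2) (fun t => rlog (rsin t)) (π / 2)
    simp only [Real.sin_pi_div_two_sub, sub_self, sub_zero] at this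
    exact this
  have h3 : IntervalIntegrable (fun t => rlog (rcos t)) volume 0
      (π / 2) := intervalIntegrable_log_cos
  rw [h1, integral_add intervalIntegrable_const h3, h2,
    integral_log_sin_zero_pi_div_two, integral_const, smul_eq_mul]
  ring

lemma intervalIntegrable_log_two_mul_cos (a b : ℝ) :
    IntervalIntegrable (fun t => rlog (2 * rcos t)) volume a b :=
  (show AnalyticOnNhd ℝ (fun t => 2 * rcos t) (uIcc a b) from fun t _ =>
    analyticAt_const.mul Real.analyticAt_cos).meromorphicOn.intervalIntegrable_log

lemma norm_one_add_exp {θ : ℝ} (hθ : θ ∈ Ioo (-π) π) : ‖1 + cis θ‖ = 2 * rcos (θ / 2) := by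
  have h : 1 + cis θ = (2 * rcos (θ / 2) : ℝ) * exp ((θ / 2 : ℝ) * I) := by
    push_cast
    rw [cos, mul_div_cancel₀ _ two_ne_zero, add_mul, ← exp_add, ← exp_add]
    ring_nf
    rw [exp_zero]; ring
  have := cos_pos_of_mem_Ioo ⟨by linarith [hθ.1], by linarith [hθ.2]⟩ (x := θ / 2)
  rw [h, norm_mul_exp (by positivity)]


lemma intervalIntegrable_log_two_mul_cos_half (a b : ℝ) :
    IntervalIntegrable (fun t => rlog (2 * rcos (t / 2))) volume a b :=
  (show AnalyticOnNhd ℝ (fun t => 2 * rcos (t / 2)) (uIcc a b) from fun t _ => by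
    fun_prop).meromorphicOn.intervalIntegrable_log

lemma integral_log_two_mul_cos_half (a b : ℝ) : ∫ t in a..b, rlog (2 * rcos (t / 2)) =
      2 * ∫ t in a / 2..b / 2, rlog (2 * rcos t) := by
  have := intervalIntegral.integral_comp_div (a := a) (b := b)
    (fun t => rlog (2 * rcos t)) (c := 2) two_ne_zero
  rw [this, smul_eq_mul]

lemma hasDerivAt_exp_mul_I (t : ℝ) : HasDerivAt (fun t : ℝ => cis t) (cis t * I) t := by
  simpa using ((ofRealCLM.hasDerivAt (x := t)).mul_const I).cexp

lemma one_add_exp_mem_slitPlane {θ : ℝ} (hθ : θ ∈ Ioo (-π) π) : 1 + cis θ ∈ slitPlane := by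
  left
  rw [add_re, one_re, exp_ofReal_mul_I_re]
  have h2 := cos_pos_of_mem_Ioo ⟨by linarith [hθ.1], by linarith [hθ.2]⟩ (x := θ / 2)
  have h3 := Real.cos_sq (θ / 2)
  rw [mul_div_cancel₀ _ two_ne_zero] at h3
  nlinarith [pow_pos h2 2]

lemma blochWigner_inv_one_add_exp {θ : ℝ} (h0 : 0 ≤ θ) (hπ : θ < π) :
    blochWigner (1 + cis θ)⁻¹ = -(2 * ∫ t in (0 : ℝ)..θ / 2, rlog (2 * rcos t)) := by
  have hd : ∀ t ∈ Icc 0 θ, HasDerivAt (fun t : ℝ => blochWigner (1 + cis t)⁻¹)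
      (-rlog (2 * rcos (t / 2))) t := by
    intro t ht
    have ht' : t ∈ Ioo (-π) π := ⟨by linarith [ht.1, pi_pos], by linarith [ht.2]⟩
    have hne := slitPlane_ne_zero (one_add_exp_mem_slitPlane ht')
    have hc : conj (1 + cis t)⁻¹ = 1 - (1 + cis t)⁻¹ := by
      have h2 : 1 + (cis t)⁻¹ ≠ 0 := by grind
      rw [map_inv₀, map_add, map_one, ← exp_conj, map_mul, conj_ofReal, conj_I, mul_neg, exp_neg]
      have h3 := exp_ne_zero (t * I)
      grind
    have hre : ((1 + cis t)⁻¹).re = 1 / 2 := by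
      have := congrArg re hc
      rw [conj_re, sub_re, one_re] at this
      linarith
    have hf := ((hasDerivAt_exp_mul_I t).const_add 1).inv hne
    refine (hasDerivAt_blochWigner hf (Or.inl ?_) (inv_ne_zero hne)).congr_deriv ?_
    · rw [sub_re, one_re, Pi.inv_apply, hre]; norm_num
    · simp only [Pi.inv_apply]
      have hn : ‖1 - (1 + cis t)⁻¹‖ = ‖(1 + cis t)⁻¹‖ := by rw [← hc, norm_conj]
      have e1 : -(cis t * I) / (1 + cis t) ^ 2 / (1 + cis t)⁻¹ =
          -(1 - (1 + cis t)⁻¹) * I := by field_simp; ring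
      have hne2 : 1 - (1 + cis t)⁻¹ ≠ 0 := by grind
      have e2 : -(-(cis t * I) / (1 + cis t) ^ 2) / (1 - (1 + cis t)⁻¹) = (1 + cis t)⁻¹ * I := by
        rw [div_eq_iff hne2]; field_simp; ring
      rw [e1, e2, hn, norm_inv, norm_one_add_exp ht', Real.log_inv]
      simp only [mul_im, neg_re, sub_re, one_re, I_im, I_re, mul_one, mul_zero, add_zero, hre]
      ring
  have := integral_eq_sub_of_hasDerivAt (a := 0) (b := θ)
    (fun t ht => hd t (by rwa [uIcc_of_le h0] at ht))
    (intervalIntegrable_log_two_mul_cos_half 0 θ).neg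
  rw [integral_neg, integral_log_two_mul_cos_half, zero_div] at this
  have h1 : blochWigner (1 + 1)⁻¹ = 0 := by
    have h2 := blochWigner_conj (z := (1 + 1)⁻¹) (by norm_num [slitPlane])
    simp only [map_inv₀, map_add, map_one] at h2
    linarith
  simp_all

lemma continuousAt_blochWigner_zero : ContinuousAt blochWigner 0 := by
  have h1 : ContinuousAt (fun z => (dilog z).im) 0 :=
    continuous_im.continuousAt.comp (hasDerivAt_dilog' (z := 0) (by simp)).continuousAt
  have h2 : ContinuousAt (fun z : ℂ => arg (1 - z) * rlog ‖z‖) 0 := by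
    have hO : (fun z : ℂ => log (1 - z)) =O[nhds 0] fun z => z := by
      have := ((hasDerivAt_id (0 : ℂ)).const_sub 1).clog (by simp)
      have h3 := this.differentiableAt.isBigO_sub
      simpa using h3
    have hO2 : (fun z : ℂ => arg (1 - z) * rlog ‖z‖) =O[nhds 0] fun z => ‖z‖ * rlog ‖z‖ := by
      refine Asymptotics.IsBigO.mul ?_ (Asymptotics.isBigO_refl _ _)
      refine Asymptotics.IsBigO.trans ?_ hO.norm_right
      refine Asymptotics.isBigO_of_le _ fun z => ?_
      rw [← log_im]
      exact abs_im_le_norm _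
    have h4 : Tendsto (fun z : ℂ => ‖z‖ * rlog ‖z‖) (nhds 0) (nhds 0) := by
      have := (Real.continuous_mul_log.comp continuous_norm).tendsto (0 : ℂ)
      simpa [comp_def] using this
    have h5 := hO2.trans_tendsto h4
    rw [ContinuousAt]
    simpa using h5
  exact h1.add h2

lemma blochWigner_one_add_exp {θ : ℝ} (h0 : 0 < θ) (hπ : θ < π) :
    blochWigner (1 + cis θ) = 2 * ∫ t in (0 : ℝ)..θ / 2, rlog (2 * rcos t) := by
  have hd : ∀ t ∈ Ico θ π, HasDerivAt (fun t : ℝ => blochWigner (1 + cis t))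
      (rlog (2 * rcos (t / 2))) t := by
    intro t ht
    have ht' : t ∈ Ioo (-π) π := ⟨by linarith [ht.1, pi_pos], ht.2⟩
    have hne := slitPlane_ne_zero (one_add_exp_mem_slitPlane ht')
    have hf := (hasDerivAt_exp_mul_I t).const_add 1
    refine (hasDerivAt_blochWigner hf (Or.inr ?_) hne).congr_deriv ?_
    · have := sin_pos_of_mem_Ioo ⟨by linarith [ht.1], ht.2⟩ (x := t)
      simp [exp_ofReal_mul_I_im, this.ne']
    · rw [show 1 - (1 + cis t) = -cis t by ring, norm_neg, norm_exp_ofReal_mul_I,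
        neg_div_neg_eq, mul_div_cancel_left₀ _ (exp_ne_zero _), norm_one_add_exp ht']
      simp
  have hc : ContinuousOn (fun t : ℝ => blochWigner (1 + cis t)) (Icc θ π) := by
    intro t ht
    rcases eq_or_lt_of_le ht.2 with rfl | h
    · apply ContinuousAt.continuousWithinAt
      have h1 : ContinuousAt (fun t : ℝ => 1 + cis t) π := by fun_prop
      refine ContinuousAt.comp (f := fun t : ℝ => 1 + cis t) (g := blochWigner) ?_ h1
      rw [exp_pi_mul_I, add_neg_cancel]
      exact continuousAt_blochWigner_zero
    · exact (hd t ⟨ht.1, h⟩).continuousAt.continuousWithinAt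
  have := intervalIntegral.integral_eq_sub_of_hasDerivAt_of_le hπ.le hc
    (fun t ht => hd t ⟨ht.1.le, ht.2⟩) (intervalIntegrable_log_two_mul_cos_half θ π)
  have hz : blochWigner (1 + cis π) = 0 := by
    rw [exp_pi_mul_I, add_neg_cancel, blochWigner_eq, dilog_zero]; simp
  rw [hz, integral_log_two_mul_cos_half] at this
  have hsplit := integral_add_adjacent_intervals (intervalIntegrable_log_two_mul_cos 0 (θ / 2))
    (intervalIntegrable_log_two_mul_cos (θ / 2) (π / 2))
  rw [integral_log_two_mul_cos] at hsplit
  linarith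

section values

variable {g : ℕ}

lemma blochWigner_one_add_zetaRoot_pow {m : ℕ} (h0 : 0 < m) (hm : m ≤ g) :
    blochWigner (1 + zetaRoot (2 * g + 1) ^ m) =
      2 * ∫ t in (0 : ℝ)..π * m / (2 * g + 1), rlog (2 * rcos t) := by
  have hang := critRadius_angle hm
  have hpos : 0 < π * m / (2 * g + 1) := by positivity
  have h := blochWigner_one_add_exp (θ := 2 * (π * m / (2 * g + 1))) (by linarith)
    (by linarith [hang.2])
  rw [mul_div_cancel_left₀ _ two_ne_zero] at h
  rw [← h, zetaRoot, ← exp_nat_mul]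
  congr 3
  push_cast
  ring

lemma exp_angle_pow (g : ℕ) : exp (π * I / (2 * g + 1)) ^ (2 * g + 1) = -1 := by
  rw [← exp_nat_mul, ← exp_pi_mul_I]
  congr 1
  have : (2 * (g : ℂ) + 1) ≠ 0 := by norm_cast
  push_cast
  field_simp

lemma exp_angle_sq_ne_one (hg : 0 < g) : exp (π * I / (2 * g + 1)) ^ 2 ≠ 1 := by
  have := (Complex.isPrimitiveRoot_exp (2 * g + 1) (Nat.succ_ne_zero _)).ne_one (by omega)
  rwa [← exp_nat_mul, show ((2 : ℕ) : ℂ) * (π * I / (2 * g + 1)) =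
    2 * π * I / (2 * g + 1 : ℕ) by push_cast; ring]

lemma conifoldValue_gg (hg : 0 < g) : conifoldValue g g =
    -((2 * (g : ℝ) + 1) / π * blochWigner (1 + zetaRoot (2 * g + 1) ^ g)) := by
  have hz := exp_angle_pow g
  have hz2 := exp_angle_sq_ne_one hg
  have hang := critRadius_angle (le_refl g)
  have hpos : 0 < π * g / (2 * g + 1) := by positivity
  have hB := blochWigner_inv_one_add_exp (θ := 2 * (π * g / (2 * g + 1))) (by linarith)
    (by linarith [hang.2])
  rw [mul_div_cancel_left₀ _ two_ne_zero] at hB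
  rw [blochWigner_one_add_zetaRoot_pow hg le_rfl, conifoldValue]
  have e1 : (π * I / ((g : ℂ) + g + 1)) = π * I / (2 * g + 1) := by ring
  simp only [e1]
  have e2 : exp (((2 * (π * g / (2 * g + 1)) : ℝ) : ℂ) * I) =
      exp (π * I / (2 * g + 1)) ^ (2 * g) := by rw [← exp_nat_mul]; congr 1; push_cast; ring
  rw [e2] at hB
  set z := exp (π * I / (2 * g + 1)) with hzd
  have hz0 : z ≠ 0 := exp_ne_zero _
  have h1 : z - z⁻¹ ≠ 0 := by grind
  have h3 : z ^ (2 * g) = -z⁻¹ := by grind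
  have h4 : 1 + z ^ (2 * g) ≠ 0 := by grind
  have harg : -z ^ (g + 1) * ((z ^ g - (z ^ g)⁻¹) / (z - z⁻¹)) = (1 + z ^ (2 * g))⁻¹ := by
    have hzg : z ^ g ≠ 0 := pow_ne_zero _ hz0
    apply eq_inv_of_mul_eq_one_left
    rw [mul_div_assoc', div_mul_eq_mul_div, div_eq_one_iff_eq h1]
    have e5 : z ^ (g + 1) * z ^ g = -1 := by rw [← hz]; ring
    grind
  rw [harg, hB]
  ring

lemma conifoldValue_hyp (hg : 0 < g) : conifoldValue (2 * g - 1) 1 =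
    -((2 * (g : ℝ) + 1) / π * blochWigner (1 + zetaRoot (2 * g + 1))) := by
  have hz := exp_angle_pow g
  have hz2 := exp_angle_sq_ne_one hg
  have hang := critRadius_angle (m := 1) hg
  have hpi := pi_pos
  have hcast : ((2 * g - 1 : ℕ) : ℂ) = 2 * g - 1 := by simp_all
  have hcast' : ((2 * g - 1 : ℕ) : ℝ) = 2 * g - 1 := by simp_all
  rw [conifoldValue]
  have e1 : (π * I / (((2 * g - 1 : ℕ) : ℂ) + (1 : ℕ) + 1)) = π * I / (2 * g + 1) := by
    rw [hcast]; push_cast; ring_nf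
  have hζ : zetaRoot (2 * g + 1) = exp (π * I / (2 * g + 1)) ^ 2 := by
    rw [zetaRoot, ← exp_nat_mul]; congr 1; push_cast; ring
  have hconj : conj (exp (π * I / (2 * g + 1))) = (exp (π * I / (2 * g + 1)))⁻¹ := by
    rw [← exp_neg, ← exp_conj]; congr 1
    have e2 : conj (2 : ℂ) = 2 := conj_ofReal 2
    simp [e2]
    ring
  have him : (1 - (1 + zetaRoot (2 * g + 1))) ∈ slitPlane := by
    right
    have hlt : 2 * (π * ((1 : ℕ) : ℝ) / (2 * g + 1)) < π := by linarith [hang.2]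
    have := sin_pos_of_mem_Ioo ⟨by positivity, hlt⟩
    have e : zetaRoot (2 * g + 1) = exp (((2 * (π * ((1 : ℕ) : ℝ) / (2 * g + 1)) : ℝ) : ℂ) * I) := by
      rw [zetaRoot]; congr 1; push_cast; ring
    rw [e, sub_im, add_im, one_im, exp_ofReal_mul_I_im]
    intro h
    linarith
  have hb := blochWigner_conj him
  grind

end values

lemma exists_isTorusLog_of_norm_sub_lt {F : Laurent2 ℝ} {r s : ℝ} {G : ℝ → ℝ → ℂ}
    (hG : Continuous fun z : ℝ × ℝ => G z.1 z.2)
    (hp : ∀ α β, G (α + 2 * π) β = G α β ∧ G α (β + 2 * π) = G α β)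
    (h : ∀ α β, ‖F.onTorus 0 0 r s α β - exp (G α β)‖ < ‖exp (G α β)‖) :
    ∃ L, IsTorusLog F r s L := by
  have hlt : ∀ α β, ‖(F.onTorus 0 0 r s α β - exp (G α β)) / exp (G α β)‖ < 1 := fun α β => by
    rw [norm_div, div_lt_one (norm_pos_iff.2 (exp_ne_zero _))]; exact h α β
  refine ⟨fun α β => G α β + log (1 + (F.onTorus 0 0 r s α β - exp (G α β)) / exp (G α β)),
    ?_, ?_, ?_⟩
  · refine hG.add (Continuous.clog ?_ fun z => one_add_mem_slitPlane_of_norm_lt_one (hlt _ _))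
    exact continuous_const.add (((F.continuous_onTorus 0 0 r s).sub hG.cexp).div hG.cexp
      fun z => exp_ne_zero _)
  · intro α β
    simp only [(hp α β).1, (hp α β).2, F.onTorus_add_left, F.onTorus_add_right, and_self]
  · intro α β
    rw [exp_add, exp_log (slitPlane_ne_zero (one_add_mem_slitPlane_of_norm_lt_one (hlt _ _)))]
    field_simp [exp_ne_zero]
    ring

lemma circMean_circMean_sub_neg {f : ℝ → ℝ → ℝ} (hf : Continuous fun z : ℝ × ℝ => f z.1 z.2)
    (h₁ : ∀ α β, f (α + 2 * π) β = f α β) (h₂ : ∀ α β, f α (β + 2 * π) = f α β) :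
    circMean (fun α => circMean (f α)) =
      circMean fun θ => circMean fun φ => f (φ - θ) (-θ - φ) := by
  have e1 : ∀ θ, circMean (fun φ => f (φ - θ) (-θ - φ)) = circMean fun φ => f φ (-2 * θ - φ) := by
    intro θ
    rw [← circMean_add_left_periodic (f := fun φ => f (φ - θ) (-θ - φ)) (fun φ => by grind) θ]
    exact circMean_congr fun φ => by congr 1 <;> ring
  rw [circMean_congr e1, circMean_comm (f := fun θ φ => f φ (-2 * θ - φ))
    (hf.comp (by fun_prop : Continuous fun z : ℝ × ℝ => (z.2, -2 * z.1 - z.2)))]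
  refine circMean_congr fun φ => ?_
  have hc : Continuous (f φ) := hf.comp (by fun_prop : Continuous fun β : ℝ => (φ, β))
  have := circMean_int_mul_periodic (f := fun θ => f φ (-φ + θ))
    (fun θ => by simp only [← add_assoc, h₂]) (hc.comp (by fun_prop)) (n := -2) (by norm_num)
  rw [circMean_add_left_periodic (h₂ φ)] at this
  grind

lemma circMean_circMean_two_mul {f : ℝ → ℝ → ℝ} (hf : Continuous fun z : ℝ × ℝ => f z.1 z.2)
    (h₁ : ∀ α β, f (α + 2 * π) β = f α β) (h₂ : ∀ α β, f α (β + 2 * π) = f α β) (k : ℝ) :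
    circMean (fun α => circMean (f α)) =
      circMean fun θ => circMean fun φ => f (2 * θ) (k * θ + φ) := by
  rw [circMean_congr fun θ => circMean_add_left_periodic (h₂ (2 * θ)) (k * θ)]
  have := circMean_int_mul_periodic (f := fun α => circMean (f α))
    (fun α => circMean_congr fun β => h₁ α β) (continuous_circMean hf) (n := 2) (by norm_num)
  simp_all

lemma circMean_circMean_const_add (c : ℝ) {G : ℝ → ℝ → ℝ} {H : ℝ → ℝ}
    (hG : Continuous fun z : ℝ × ℝ => G z.1 z.2) (hH : Continuous H)
    (h : ∀ φ, circMean (fun θ => G θ φ) = H φ) :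
    circMean (fun θ => circMean fun φ => c + G θ φ) = c + circMean H := by
  rw [circMean_comm (f := fun θ φ => c + G θ φ) (continuous_const.add hG)]
  have : ∀ φ, circMean (fun θ => c + G θ φ) = c + H φ := fun φ => by
    rw [circMean_add (f := fun _ => c) (g := fun θ => G θ φ) continuous_const
      (hG.comp (by fun_prop : Continuous fun θ : ℝ => (θ, φ))), circMean_const, h]
  rw [circMean_congr this, circMean_add (f := fun _ => c) continuous_const hH, circMean_const]

section torus

open Polynomial

variable {g m : ℕ}

lemma exists_log_halfPoly (hm : m ≤ g) :
    ∃ (p : ℝ) (M : ℝ → ℂ), Continuous M ∧ (∀ β, M (β + 2 * π) = M β) ∧ p ≠ 0 ∧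
      ∀ β : ℝ, (chebHalf g).eval ((critRadius g m ^ 2 : ℝ) * cis β) =
        ((critRadius g m ^ 2 : ℝ) * cis β) ^ (g - m) * (p * exp (M β)) := by
  have hσ := critRadius_pos hm
  set R := (chebHalf g).roots with hR
  have hn : ∀ k : ℕ, ‖(chebZero g k : ℂ) ^ 2‖ = chebZero g k ^ 2 := fun k => by simp
  have hlt : ∀ k ∈ Multiset.range g, (‖(chebZero g k : ℂ) ^ 2‖ < critRadius g m ^ 2 ↔ m ≤ k) := by
    intro k hk
    rw [Multiset.mem_range] at hk
    rw [hn, sq_lt_sq₀ (chebZero_pos hk).le hσ.le]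
    refine ⟨fun h => ?_, fun h => chebZero_lt h hk⟩
    by_contra hc
    exact absurd h (chebZero_gt (not_le.1 hc) hm).not_gt
  have hgt : ∀ k ∈ Multiset.range g, (critRadius g m ^ 2 < ‖(chebZero g k : ℂ) ^ 2‖ ↔ k < m) := by
    intro k hk
    rw [Multiset.mem_range] at hk
    rw [hn, sq_lt_sq₀ hσ.le (chebZero_pos hk).le]
    refine ⟨fun h => ?_, fun h => chebZero_gt h hm⟩
    by_contra hc
    exact absurd h (chebZero_lt (not_lt.1 hc) hk).not_gt
  obtain ⟨M, hM, hMp, -, hprod⟩ := exists_log_prod_sub R (ρ := critRadius g m ^ 2) (by positivity) (by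
    intro y hy
    rw [hR, halfPoly_roots] at hy
    obtain ⟨k, hk, rfl⟩ := Multiset.mem_map.1 hy
    grind)
  have hcard : (R.filter (‖·‖ < critRadius g m ^ 2)).card = g - m := by
    rw [hR, halfPoly_roots, Multiset.filter_map, Multiset.card_map,
      Multiset.filter_congr (p := (‖·‖ < critRadius g m ^ 2) ∘ fun k => (chebZero g k : ℂ) ^ 2)
        (q := fun k => m ≤ k) (fun k hk => hlt k hk)]
    have : (Multiset.range g).filter (fun k => m ≤ k) = (Finset.Ico m g).1 := by
      have : (range g).filter (fun k => m ≤ k) = Finset.Ico m g := by ext k; simp [and_comm]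
      rw [← this]; rfl
    rw [this, Finset.card_val, Nat.card_Ico]
  have hout : ((R.filter (critRadius g m ^ 2 < ‖·‖)).map fun y => -y).prod =
      ((∏ k ∈ range m, -(chebZero g k) ^ 2 : ℝ) : ℂ) := by
    rw [hR, halfPoly_roots, Multiset.filter_map,
      Multiset.filter_congr (p := (critRadius g m ^ 2 < ‖·‖) ∘ fun k => (chebZero g k : ℂ) ^ 2)
        (q := fun k => k < m) (fun k hk => hgt k hk)]
    have : (Multiset.range g).filter (fun k => k < m) = (range m).1 := by
      have : (range g).filter (fun k => k < m) = range m := by ext k; simp; omega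
      rw [← this]; rfl
    rw [this, Multiset.map_map]
    push_cast
    rfl
  refine ⟨∏ k ∈ range m, -(chebZero g k) ^ 2, M, hM, hMp, ?_, fun β => ?_⟩
  rotate_left
  · rw [← mul_assoc, ← hout, ← hcard, ← hprod β]
    rw [(IsAlgClosed.splits (chebHalf g)).eq_prod_roots_of_monic
      (halfPoly_monic _), eval_multiset_prod, Multiset.map_map]
    simp [← hR]
  · exact prod_ne_zero_iff.2 fun k hk => neg_ne_zero.2 (pow_ne_zero _
      (chebZero_pos ((mem_range.1 hk).trans_le hm)).ne')

/-- The value at `τ ≥ 1` of the mean of `log |F|` along the approach to the conifold point. -/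
def conifoldMean (g m : ℕ) (τ : ℝ) : ℝ :=
  2 * m / (2 * g + 1) * rlog τ - (2 * g + 1 - 2 * m) * rlog (critRadius g m) +
    circMean fun φ => chebMean g m (2 * rcos φ / τ)

lemma continuousOn_conifoldMean (hm : m ≤ g) : ContinuousOn (conifoldMean g m) (Ici 1) := by
  have h1 : ContinuousOn (fun τ : ℝ => circMean fun φ => chebMean g m (2 * rcos φ * τ⁻¹))
      (Ici 1) := by
    have : Continuous fun u : ℝ => circMean fun φ => chebMean g m (2 * rcos φ * u) :=
      continuous_circMean (f := fun u φ => chebMean g m (2 * rcos φ * u))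
        ((continuous_chebMean hm).comp (by fun_prop))
    exact this.comp_continuousOn (continuousOn_inv₀.mono fun τ hτ =>
      (lt_of_lt_of_le one_pos (Set.mem_Ici.1 hτ)).ne')
  refine ContinuousOn.add (ContinuousOn.sub (continuousOn_const.mul
    (Real.continuousOn_log.mono fun τ hτ => (lt_of_lt_of_le one_pos (Set.mem_Ici.1 hτ)).ne'))
    continuousOn_const) h1

lemma neg_conifoldMean_one (hm0 : 0 < m) (hm : m ≤ g) : -conifoldMean g m 1 =
      -((2 * (g : ℝ) + 1) / π * blochWigner (1 + zetaRoot (2 * g + 1) ^ m)) := by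
  have h := mul_circMean_logMaxCos_sub hm
  rw [conifoldMean, blochWigner_one_add_zetaRoot_pow hm0 hm]
  simp only [div_one, Real.log_one, mul_zero, zero_sub]
  rw [circMean_chebMean_two_mul_cos hm]
  rw [neg_add_eq_sub, h]
  ring

lemma circMean_log_norm_conifold (hm : m ≤ g) {τ : ℝ} (hτ : 1 < τ) {A : ℝ} (hA : 0 < A)
    {f : ℝ → ℝ → ℂ} (hf : ∀ θ φ, ‖f θ φ‖ = A * ‖2 * rcos φ + τ * (chebOdd g).eval
      ((critRadius g m : ℂ) * cis θ)‖) : circMean (fun θ => circMean fun φ => rlog ‖f θ φ‖) =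
      rlog A + rlog τ + circMean fun φ => chebMean g m (2 * rcos φ / τ) := by
  have hτ0 : 0 < τ := one_pos.trans hτ
  have habs : ∀ φ : ℝ, |2 * rcos φ / τ| < 2 := fun φ => by
    rw [abs_div, abs_mul, abs_of_pos hτ0, div_lt_iff₀ hτ0, abs_two]
    nlinarith [abs_cos_le_one φ]
  have hne : ∀ θ φ : ℝ, (chebOdd g).eval ((critRadius g m : ℂ) * cis θ) +
      ((2 * rcos φ / τ : ℝ) : ℂ) ≠ 0 := fun θ φ =>
    oddPoly_add_ne_zero hm (by rw [norm_real]; exact habs φ) (norm_mul_exp (critRadius_pos hm) θ)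
  have hlog : ∀ θ φ, rlog ‖f θ φ‖ = (rlog A + rlog τ) +
      rlog ‖(chebOdd g).eval ((critRadius g m : ℂ) * cis θ) +
        ((2 * rcos φ / τ : ℝ) : ℂ)‖ := fun θ φ => by
    have e : (2 * rcos φ + τ * (chebOdd g).eval
      ((critRadius g m : ℂ) * cis θ) : ℂ) = τ * ((chebOdd g).eval
        ((critRadius g m : ℂ) * cis θ) + ((2 * rcos φ / τ : ℝ) : ℂ)) := by
      push_cast
      have : (τ : ℂ) ≠ 0 := mod_cast hτ0.ne'
      field_simp
      ring
    rw [hf, e, norm_mul, norm_real, norm_of_nonneg hτ0.le, Real.log_mul hA.ne'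
      (mul_ne_zero hτ0.ne' (norm_ne_zero_iff.2 (hne θ φ))),
      Real.log_mul hτ0.ne' (norm_ne_zero_iff.2 (hne θ φ)), add_assoc]
  have hcont : Continuous fun z : ℝ × ℝ => rlog ‖(chebOdd g).eval
      ((critRadius g m : ℂ) * cis z.1) + ((2 * rcos z.2 / τ : ℝ) : ℂ)‖ := by
    refine Continuous.log (Continuous.norm (Continuous.add ?_ ?_)) fun z =>
      norm_ne_zero_iff.2 (hne z.1 z.2)
    · fun_prop
    · fun_prop
  simp only [hlog]
  exact circMean_circMean_const_add _ hcont ((continuous_chebMean hm).comp (by fun_prop))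
    fun φ => circMean_log_norm_oddPoly_add hm (habs φ)

end torus

section specialTorus

open Polynomial

variable {g : ℕ}

lemma eval_famGG_scaled (b : Fin g → ℝ) {l : ℝ} (hl : l ≠ 0) {x y : ℂ} (hx : x ≠ 0) (hy : y ≠ 0) :
    (famGG g 1 fun i => l ^ (2 * (g - (i : ℕ))) * b i).eval x y =
      x + y + l ^ (2 * g) * (halfPoly g b).eval (l ^ 2 * x * y)⁻¹ := by
  have hl' : (l : ℂ) ≠ 0 := mod_cast hl
  have key : ∀ i ≤ g, (l : ℂ) ^ (2 * g) * ((l ^ 2 * x * y)⁻¹) ^ i =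
      l ^ (2 * (g - i)) * (x ^ (-(i : ℤ)) * y ^ (-(i : ℤ))) := by
    intro i hi
    obtain ⟨k, rfl⟩ := Nat.exists_eq_add_of_le hi
    rw [Nat.add_sub_cancel_left, zpow_neg, zpow_neg, zpow_natCast, zpow_natCast, inv_pow, mul_pow,
      mul_pow, ← pow_mul]
    field_simp
    ring
  rw [eval_famGG, halfPoly_eval, mul_add, mul_sum, key g le_rfl, Nat.sub_self,
    mul_zero, pow_zero, one_mul, add_assoc (x + y)]
  congr 2
  refine sum_congr rfl fun i _ => ?_
  rw [mul_left_comm (_ ^ _) (b i : ℂ), key i i.2.le]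
  push_cast; ring

lemma eval_famHyp_scaled (hg : 0 < g) (b : Fin g → ℝ) {l : ℝ} (hl : l ≠ 0) {x y : ℂ} (hx : x ≠ 0)
    (hy : y ≠ 0) : (famHyp g 1 fun i => l ^ (2 * ((i : ℕ) + 1)) * b (rev i)).eval x y =
      y + x ^ (1 - 2 * (g : ℤ)) * y⁻¹ +
        l ^ (2 * g) * x ^ (1 - (g : ℤ)) * (halfPoly g b).eval (x / l ^ 2) := by
  obtain ⟨k, rfl⟩ := Nat.exists_eq_add_one.2 hg
  have h := eval_famHyp_eq_famGG (fun i => l ^ (2 * (k + 1 - (i : ℕ))) * b i) hx hy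
  rw [eval_famGG_scaled b hl (by positivity) (by positivity)] at h
  have hl' : (l : ℂ) ≠ 0 := mod_cast hl
  have hz : x ^ (-(k + 1) : ℤ) = x ^ (-k : ℤ) * x⁻¹ := by rw [neg_add, zpow_add₀ hx, zpow_neg_one]
  rw [show (l ^ 2 * (x ^ (k : ℤ) * y) * (x ^ (-(k + 1) : ℤ) * y⁻¹))⁻¹ = x / l ^ 2 by
    rw [hz, zpow_neg]; field_simp, hz, mul_add, mul_add] at h
  convert h using 2
  · congr 1
    funext i
    simp only [Function.comp_apply, val_rev]
    congr 3
    omega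
  · rw [show (1 - 2 * ((k + 1 : ℕ) : ℤ)) = -k + -k + -1 by push_cast; ring, zpow_add₀ hx,
      zpow_add₀ hx, zpow_neg_one, zpow_neg]
    field_simp
  · rw [show (1 - ((k + 1 : ℕ) : ℤ)) = -k by push_cast; ring]
    ring

lemma eval_famGG_param (b : Fin g → ℝ) {l : ℝ} (hl : l ≠ 0) {S ξ : ℂ} (hS : S ≠ 0) (hξ : ξ ≠ 0) :
    (famGG g 1 fun i => l ^ (2 * (g - (i : ℕ))) * b i).eval ((l * S)⁻¹ * ξ) ((l * S)⁻¹ * ξ⁻¹) =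
      (l * S)⁻¹ * (ξ + ξ⁻¹ + l ^ (2 * g + 1) * (oddPoly g b).eval S) := by
  have hl' : (l : ℂ) ≠ 0 := mod_cast hl
  have h0 : ((l : ℂ) * S)⁻¹ ≠ 0 := inv_ne_zero (mul_ne_zero hl' hS)
  rw [eval_famGG_scaled b hl (mul_ne_zero h0 hξ) (mul_ne_zero h0 (inv_ne_zero hξ)),
    show ((l : ℂ) ^ 2 * ((l * S)⁻¹ * ξ) * ((l * S)⁻¹ * ξ⁻¹))⁻¹ = S ^ 2 by field_simp,
    ← mul_halfPoly_eval_sq]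
  field_simp
  ring

lemma eval_famHyp_param (hg : 0 < g) (b : Fin g → ℝ) {l : ℝ} (hl : l ≠ 0) {S ξ : ℂ} (hS : S ≠ 0) (hξ : ξ ≠ 0) :
    (famHyp g 1 fun i => l ^ (2 * ((i : ℕ) + 1)) * b (rev i)).eval ((l * S) ^ 2)
        ((l * S) ^ (1 - 2 * (g : ℤ)) * ξ) =
      (l * S) ^ (1 - 2 * (g : ℤ)) * (ξ + ξ⁻¹ + l ^ (2 * g + 1) * (oddPoly g b).eval S) := by
  have hl' : (l : ℂ) ≠ 0 := mod_cast hl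
  have h0 : (l : ℂ) * S ≠ 0 := mul_ne_zero hl' hS
  have e1 : ((l * S) ^ 2 : ℂ) ^ (1 - 2 * (g : ℤ)) =
      (l * S) ^ (1 - 2 * (g : ℤ)) * (l * S) ^ (1 - 2 * (g : ℤ)) := by rw [← mul_zpow, ← sq]
  have e2 : ((l * S) ^ 2 : ℂ) ^ (1 - (g : ℤ)) = (l * S) ^ (1 - 2 * (g : ℤ)) * (l * S) := by
    rw [← zpow_natCast, ← zpow_mul, ← zpow_add_one₀ h0]
    congr 1; push_cast; ring
  have hz : ((l : ℂ) * S) ^ (1 - 2 * (g : ℤ)) ≠ 0 := zpow_ne_zero _ h0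
  rw [eval_famHyp_scaled hg b hl (pow_ne_zero 2 h0) (mul_ne_zero hz hξ), e1, e2,
    show ((l : ℂ) * S) ^ 2 / l ^ 2 = S ^ 2 by field_simp, ← mul_halfPoly_eval_sq]
  field_simp
  ring

lemma two_div_le_norm_halfPoly {m : ℕ} (hm : m ≤ g) (β : ℝ) : 2 / critRadius g m ≤
      ‖(chebHalf g).eval ((critRadius g m ^ 2 : ℝ) * cis β)‖ := by
  have hσ := critRadius_pos hm
  have hS : ‖(critRadius g m : ℂ) * exp ((β / 2 : ℝ) * I)‖ = critRadius g m := norm_mul_exp hσ _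
  have h := two_le_norm_oddPoly_eval hm hS
  rw [← mul_halfPoly_eval_sq, norm_mul, hS, mul_pow, ← exp_nat_mul] at h
  rw [div_le_iff₀ hσ, mul_comm]
  rwa [show ((2 : ℕ) : ℂ) * ((β / 2 : ℝ) * I) = β * I by push_cast; ring, ← ofReal_pow] at h

lemma exp_add_inv_exp (φ : ℝ) : cis φ + (cis φ)⁻¹ = 2 * rcos φ := by
  rw [← exp_neg, ofReal_cos, cos, neg_mul]; ring

lemma exists_rpow_inv {τ : ℝ} (hτ : 1 < τ) (g : ℕ) :
    ∃ l : ℝ, 0 < l ∧ l ^ (2 * g + 1) = τ ∧ rlog l = rlog τ / (2 * g + 1) ∧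
      (∀ i : Fin g, τ ^ weightGG g i = l ^ (2 * (g - (i : ℕ)))) ∧
      ∀ i : Fin g, τ ^ weightHyp g i = l ^ (2 * ((i : ℕ) + 1)) := by
  have hτ0 : 0 < τ := one_pos.trans hτ
  have hN : (2 * (g : ℝ) + 1) ≠ 0 := by positivity
  refine ⟨τ ^ (1 / (2 * (g : ℝ) + 1)), by positivity, ?_, ?_, fun i => ?_, fun i => ?_⟩
  · rw [← Real.rpow_natCast, ← Real.rpow_mul hτ0.le]
    simp_all
  · rw [Real.log_rpow hτ0]; ring
  · rw [← Real.rpow_natCast, ← Real.rpow_mul hτ0.le, weightGG]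
    push_cast [Nat.cast_sub i.2.le]
    congr 1; ring
  · rw [← Real.rpow_natCast, ← Real.rpow_mul hτ0.le, weightHyp]
    push_cast
    congr 1; ring

def HasTorusMean (F : Laurent2 ℝ) (ε M : ℝ) : Prop :=
  ∃ r s : ℝ, 0 < r ∧ 0 < s ∧ ∃ L, IsTorusLog F r s L ∧ (L 0 0).im = ε ∧ F.torusMean r s = M

lemma HasTorusMean.isRegulatorPeriod {F : Laurent2 ℝ} {n : ℕ} (hF : F.IsMonicInSecond n)
    {ε M : ℝ} (h : HasTorusMean F ε M) :
    IsRegulatorPeriod F (0, 0) (1, 0) (0, 1) (-(2 * π * I) * (M + ε * I)) := by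
  obtain ⟨r, s, hr, hs, L, hL, h1, h2⟩ := h
  have := hL.isRegulatorPeriod hF hr hs
  rwa [h1, h2] at this

lemma HasTorusMean.eq_of_isRegulatorPeriod {F : Laurent2 ℝ} {n : ℕ} (hF : F.IsMonicInSecond n)
    {ε M : ℝ} (h : HasTorusMean F ε M) {R : ℂ} (hR : IsRegulatorPeriod F (0, 0) (1, 0) (0, 1) R) :
    ∃ k : ℤ, R = -(2 * π * I) * (M + π * k * I) := by
  obtain ⟨r, s, hr, hs, L, hL, h1, h2⟩ := h
  obtain ⟨r', s', hr', hs', hlog, k, hk⟩ := hR.eq hF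
  refine ⟨k, ?_⟩
  rw [hk, ← h2, torusMean_eq hr hs hr' hs' (hasLogOnTorus_zero_iff.2 ⟨L, hL⟩) hlog]

lemma hasTorusMean_of_isTorusLog {F : Laurent2 ℝ} {r s : ℝ} (hr : 0 < r) (hs : 0 < s)
    (h : ∃ L, IsTorusLog F r s L) {A τ : ℝ} {m : ℕ} (hτ : 1 < τ) (hA : 0 < A)
    (h0 : F.eval r s = A * (2 + τ * (2 * (-1) ^ m))) :
    HasTorusMean F (π * m) (F.torusMean r s) := by
  obtain ⟨L, hL⟩ := h
  obtain ⟨L', hL', hε⟩ := hL.exists_im_eq (ε := π * m) (p := A * (2 * τ + 2 * (-1) ^ m)) (by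
      rcases neg_one_pow_eq_or ℝ m with h | h <;> rw [h] <;> nlinarith) (by
      rw [h0, show ((π * m : ℝ) : ℂ) * I = (m : ℂ) * (π * I) by push_cast; ring,
        exp_nat_mul, exp_pi_mul_I]
      push_cast
      rcases neg_one_pow_eq_or ℂ m with h | h <;> rw [h] <;> ring)
  exact ⟨r, s, hr, hs, L', hL', hε, rfl⟩

lemma hasTorusMean_famGG {τ : ℝ} (hτ : 1 < τ) :
    HasTorusMean (famGG g 1 fun i => τ ^ weightGG g i * chebCoeff g i) (π * g)
      (conifoldMean g g τ) := by
  obtain ⟨l, hl, hlτ, hlog, hw, -⟩ := exists_rpow_inv hτ g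
  have hl' : (l : ℂ) ≠ 0 := mod_cast hl.ne'
  simp only [hw]
  set F := famGG g 1 fun i => l ^ (2 * (g - (i : ℕ))) * chebCoeff g i with hF
  have hσ := critRadius_pos (g := g) le_rfl
  set σ := critRadius g g with hσd
  have hσ' : (σ : ℂ) ≠ 0 := mod_cast hσ.ne'
  set r : ℝ := (l * σ)⁻¹ with hr
  have hr0 : 0 < r := by positivity
  obtain ⟨p, M, hM, hMp, hp, hhalf⟩ := exists_log_halfPoly (g := g) le_rfl
  have hdom : ∃ L, IsTorusLog F r r L := by
    refine exists_isTorusLog_of_norm_sub_lt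
      (G := fun α β => log (l ^ (2 * g) * p) + M (-(α + β))) ?_ ?_ ?_
    · fun_prop
    · intro α β
      have := hMp (-(α + β) - 2 * π)
      rw [sub_add_cancel] at this
      constructor <;> congr 1 <;> rw [this] <;> congr 1 <;> ring
    · intro α β
      have hp' : (l : ℂ) ^ (2 * g) * p ≠ 0 := mul_ne_zero (pow_ne_zero _ hl') (mod_cast hp)
      have hpt : ((l : ℂ) ^ 2 * (r * cis α) * (r * cis β))⁻¹ =
          (σ ^ 2 : ℝ) * exp ((-(α + β) : ℝ) * I) := by
        push_cast
        rw [neg_mul, exp_neg, add_mul, exp_add, hr]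
        push_cast
        field_simp
      have hE : exp (log (l ^ (2 * g) * p) + M (-(α + β))) =
          l ^ (2 * g) * (chebHalf g).eval ((σ ^ 2 : ℝ) * exp ((-(α + β) : ℝ) * I)) := by
        rw [exp_add, exp_log hp', hhalf, Nat.sub_self, pow_zero, one_mul, mul_assoc]
      have hr1 : (r : ℂ) ≠ 0 := mod_cast hr0.ne'
      rw [hE, onTorus, ← Laurent2.eval, hF, eval_famGG_scaled _ hl.ne'
        (mul_ne_zero hr1 (exp_ne_zero _)) (mul_ne_zero hr1 (exp_ne_zero _)), hpt,
        add_sub_cancel_right, norm_mul, norm_pow, norm_real, norm_of_nonneg hl.le]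
      calc _ ≤ r + r := (norm_add_le _ _).trans (by rw [norm_mul_exp hr0, norm_mul_exp hr0])
        _ < l ^ (2 * g) * (2 / σ) := by
          rw [hr, mul_inv, ← two_mul, div_eq_mul_inv, ← mul_assoc, ← mul_assoc]
          refine mul_lt_mul_of_pos_right ?_ (inv_pos.2 hσ)
          rw [← div_eq_mul_inv, div_lt_iff₀ hl, mul_comm (l ^ _), mul_assoc, ← pow_succ, hlτ]
          linarith
        _ ≤ _ := mul_le_mul_of_nonneg_left (two_div_le_norm_halfPoly le_rfl _) (by positivity)
  have hparam : ∀ θ φ : ℝ, F.onTorus 0 0 r r (φ - θ) (-θ - φ) = (l * (σ * cis θ))⁻¹ *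
      (2 * rcos φ + τ * (chebOdd g).eval (σ * cis θ)) := by
    intro θ φ
    have hS : (σ : ℂ) * cis θ ≠ 0 := mul_ne_zero hσ' (exp_ne_zero _)
    have := eval_famGG_param (chebCoeff g) hl.ne' hS (exp_ne_zero (φ * I))
    rw [exp_add_inv_exp] at this
    rw [← hlτ, ofReal_pow, ← this, onTorus, ← Laurent2.eval]
    congr 1
    · rw [hr, ofReal_sub, sub_mul, exp_sub]; push_cast; field_simp
    · rw [hr, ofReal_sub, sub_mul, exp_sub, ofReal_neg, neg_mul, exp_neg]; push_cast; field_simp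
  have hmean : F.torusMean r r = conifoldMean g g τ := by
    obtain ⟨L, hL⟩ := hdom
    rw [torusMean, circMean_circMean_sub_neg
      (f := fun α β => rlog ‖F.onTorus 0 0 r r α β‖) (continuous_log_onTorus hL)
      (fun α β => by simp only [onTorus_add_left]) (fun α β => by simp only [onTorus_add_right]),
      circMean_log_norm_conifold le_rfl hτ hr0 (fun θ φ => by
        rw [hparam, norm_mul, norm_inv, norm_mul, norm_mul_exp hσ, norm_real,
          norm_of_nonneg hl.le]),
      conifoldMean, hr, Real.log_inv, Real.log_mul hl.ne' hσ.ne', hlog]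
    congr 1
    field_simp
    ring
  rw [← hmean]
  refine hasTorusMean_of_isTorusLog hr0 hr0 hdom hτ hr0 ?_
  have := hparam 0 0
  rw [onTorus, ← Laurent2.eval] at this
  simp only [sub_zero, neg_zero, ofReal_zero, zero_mul, exp_zero, mul_one, Real.cos_zero,
    ofReal_one] at this
  rw [this, hσd, oddPoly_eval_critRadius, hr]
  push_cast
  rfl

lemma hasTorusMean_famHyp (hg : 0 < g) {τ : ℝ} (hτ : 1 < τ) :
    HasTorusMean (famHyp g 1 fun i => τ ^ weightHyp g i * chebCoeff g (rev i)) (π * 1)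
      (conifoldMean g 1 τ) := by
  obtain ⟨l, hl, hlτ, hlog, -, hw⟩ := exists_rpow_inv hτ g
  have hl' : (l : ℂ) ≠ 0 := mod_cast hl.ne'
  simp only [hw]
  set F := famHyp g 1 fun i => l ^ (2 * ((i : ℕ) + 1)) * chebCoeff g (rev i) with hF
  have hσ := critRadius_pos (g := g) hg
  set σ := critRadius g 1 with hσd
  have hσ' : (σ : ℂ) ≠ 0 := mod_cast hσ.ne'
  set r : ℝ := (l * σ) ^ 2 with hr
  set s : ℝ := (l * σ) ^ (1 - 2 * (g : ℤ)) with hs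
  have hr0 : 0 < r := by positivity
  have hs0 : 0 < s := by positivity
  have hr1 : (r : ℂ) ≠ 0 := mod_cast hr0.ne'
  obtain ⟨p, M, hM, hMp, hp, hhalf⟩ := exists_log_halfPoly (g := g) hg
  have hdom : ∃ L, IsTorusLog F r s L := by
    refine exists_isTorusLog_of_norm_sub_lt (G := fun α _ => log (l ^ 2 * p) + M α) ?_ ?_ ?_
    · fun_prop
    · intro α β
      simp only [hMp, and_self]
    · intro α β
      have hp' : (l : ℂ) ^ 2 * p ≠ 0 := mul_ne_zero (pow_ne_zero _ hl') (mod_cast hp)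
      have hx : (r : ℂ) * cis α ≠ 0 := mul_ne_zero hr1 (exp_ne_zero _)
      have hy : (s : ℂ) * cis β ≠ 0 := mul_ne_zero (mod_cast hs0.ne') (exp_ne_zero _)
      have hpt : (r : ℂ) * cis α / l ^ 2 = (σ ^ 2 : ℝ) * cis α := by rw [hr]; push_cast; field_simp
      have hE : exp (log (l ^ 2 * p) + M α) = l ^ (2 * g) * (r * cis α) ^ (1 - (g : ℤ)) *
            (chebHalf g).eval ((σ ^ 2 : ℝ) * cis α) := by
        rw [exp_add, exp_log hp', hhalf, ← hpt, div_pow]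
        have : ((r : ℂ) * cis α) ^ (1 - (g : ℤ)) * (r * cis α) ^ (g - 1) = 1 := by
          rw [← zpow_natCast, ← zpow_add₀ hx, Nat.cast_sub hg]; simp
        calc _ = (l : ℂ) ^ 2 * (p * exp (M α)) *
              (((r : ℂ) * cis α) ^ (1 - (g : ℤ)) * (r * cis α) ^ (g - 1)) := by rw [this]; ring
          _ = _ := by
            obtain ⟨k, rfl⟩ : ∃ k, g = k + 1 := ⟨g - 1, by omega⟩
            rw [Nat.add_sub_cancel]
            field_simp
            ring
      rw [hE, onTorus, ← Laurent2.eval, hF, eval_famHyp_scaled hg _ hl.ne' hx hy, hpt,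
        add_sub_cancel_right]
      have hls : 0 < l * σ := by positivity
      have hn1 : ‖((r : ℂ) * cis α) ^ (1 - 2 * (g : ℤ)) * (s * cis β)⁻¹‖ = s := by
        rw [norm_mul, norm_zpow, norm_inv, norm_mul_exp hr0, norm_mul_exp hs0, hr, hs, sq, mul_zpow]
        field_simp
      have hn2 : ‖(l : ℂ) ^ (2 * g) * ((r : ℂ) * cis α) ^ (1 - (g : ℤ))‖ = l ^ (2 * g) * (s * (l * σ)) := by
        rw [norm_mul, norm_zpow, norm_pow, norm_mul_exp hr0, norm_real, norm_of_nonneg hl.le,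
          hr, hs, ← zpow_natCast (l * σ), ← zpow_mul, ← zpow_add_one₀ hls.ne']
        congr 2; push_cast; ring
      rw [norm_mul, hn2]
      calc _ ≤ s + s := (norm_add_le _ _).trans (by rw [norm_mul_exp hs0, hn1])
        _ < l ^ (2 * g) * (s * (l * σ)) * (2 / σ) := by
          rw [show l ^ (2 * g) * (s * (l * σ)) * (2 / σ) = l ^ (2 * g + 1) * (2 * s) by
            field_simp; ring, hlτ]
          nlinarith
        _ ≤ _ := mul_le_mul_of_nonneg_left (two_div_le_norm_halfPoly hg _) (by positivity)
  have hparam : ∀ θ φ : ℝ, F.onTorus 0 0 r s (2 * θ) ((1 - 2 * (g : ℤ) : ℤ) * θ + φ) =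
      (l * (σ * cis θ)) ^ (1 - 2 * (g : ℤ)) * (2 * rcos φ + τ * (chebOdd g).eval (σ * cis θ)) := by
    intro θ φ
    have hS : (σ : ℂ) * cis θ ≠ 0 := mul_ne_zero hσ' (exp_ne_zero _)
    have := eval_famHyp_param hg (chebCoeff g) hl.ne' hS (exp_ne_zero (φ * I))
    rw [exp_add_inv_exp] at this
    rw [← hlτ, ofReal_pow, ← this, onTorus, ← Laurent2.eval]
    congr 1
    · rw [hr, ← mul_assoc, mul_pow _ (exp _), ← exp_nat_mul]
      push_cast
      rw [mul_assoc 2 (θ : ℂ)]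
    · rw [hs, ← mul_assoc, mul_zpow (_ * _) (exp _), ← exp_int_mul, ofReal_add, add_mul, exp_add]
      push_cast
      simp only [mul_assoc]
  have hmean : F.torusMean r s = conifoldMean g 1 τ := by
    obtain ⟨L, hL⟩ := hdom
    rw [torusMean, circMean_circMean_two_mul
      (f := fun α β => rlog ‖F.onTorus 0 0 r s α β‖) (continuous_log_onTorus hL)
      (fun α β => by simp only [onTorus_add_left])
      (fun α β => by simp only [onTorus_add_right]) ((1 - 2 * (g : ℤ) : ℤ) : ℝ),
      circMean_log_norm_conifold hg hτ hs0 (fun θ φ => by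
        rw [hparam, norm_mul, norm_zpow, norm_mul, norm_mul_exp hσ, norm_real,
          norm_of_nonneg hl.le]),
      conifoldMean, hs, Real.log_zpow, Real.log_mul hl.ne' hσ.ne', hlog]
    congr 1
    push_cast
    field_simp
    ring
  rw [← hmean]
  have := hasTorusMean_of_isTorusLog (m := 1) hr0 hs0 hdom hτ hs0 ?_
  · simpa using this
  have := hparam 0 0
  rw [onTorus, ← Laurent2.eval] at this
  simp only [ofReal_zero, zero_mul, exp_zero, mul_one, Real.cos_zero,
    ofReal_one, mul_zero, add_zero] at this
  rw [this, hσd, oddPoly_eval_critRadius, hs]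
  push_cast
  rfl

end specialTorus

lemma isRegulatorPeriodAt_famGG {g : ℕ} (hg : 0 < g) :
    (∃ R, IsRegulatorPeriodAt (famGG g 1) (0, 0) (1, 0) (0, 1) (weightGG g) (chebCoeff g) R) ∧
      ∀ R, IsRegulatorPeriodAt (famGG g 1) (0, 0) (1, 0) (0, 1) (weightGG g) (chebCoeff g) R →
        CongrModQ1 (1 / (2 * π * I) * R) (conifoldValue g g) :=
  isRegulatorPeriodAt_of_continuousOn (continuousOn_conifoldMean le_rfl)
    (ε := -(2 * π * I) * ((π * g : ℝ) * I)) (fun τ hτ => by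
      have := (hasTorusMean_famGG (g := g) hτ).isRegulatorPeriod (isMonicInSecond_famGG hg _)
      rwa [mul_add] at this)
    (fun τ hτ R hR => (hasTorusMean_famGG (g := g) hτ).eq_of_isRegulatorPeriod
      (isMonicInSecond_famGG hg _) hR)
    (by rw [neg_conifoldMean_one hg le_rfl, conifoldValue_gg hg])

lemma isRegulatorPeriodAt_famHyp {g : ℕ} (hg : 0 < g) :
    (∃ R, IsRegulatorPeriodAt (famHyp g 1) (0, 0) (1, 0) (0, 1) (weightHyp g)
      (chebCoeff g ∘ rev) R) ∧
      ∀ R, IsRegulatorPeriodAt (famHyp g 1) (0, 0) (1, 0) (0, 1) (weightHyp g)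
          (chebCoeff g ∘ rev) R → CongrModQ1 (1 / (2 * π * I) * R) (conifoldValue (2 * g - 1) 1) :=
  isRegulatorPeriodAt_of_continuousOn (continuousOn_conifoldMean (m := 1) hg)
    (ε := -(2 * π * I) * ((π * 1 : ℝ) * I)) (fun τ hτ => by
      have := (hasTorusMean_famHyp hg hτ).isRegulatorPeriod (isMonicInSecond_famHyp g _)
      rwa [mul_add] at this)
    (fun τ hτ R hR => (hasTorusMean_famHyp hg hτ).eq_of_isRegulatorPeriod
      (isMonicInSecond_famHyp g _) hR)
    (by rw [neg_conifoldMean_one one_pos hg, conifoldValue_hyp hg, pow_one])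

lemma regulator_linear {u v : ℝ → ℂ} (hu : ContDiffOn ℝ 1 u (Icc 0 1))
    (hv : ContDiffOn ℝ 1 v (Icc 0 1)) {α β γ δ : ℂ} (hdet : α * δ - β * γ = 1) (c d : ℂ) :
    (∫ t in (0 : ℝ)..1, (α * u t + β * v t + c) * deriv (fun t => γ * u t + δ * v t + d) t) -
        ((α * u 1 + β * v 1 + c) - (α * u 0 + β * v 0 + c)) * (γ * u 0 + δ * v 0 + d) =
      ((∫ t in (0 : ℝ)..1, u t * deriv v t) - (u 1 - u 0) * v 0) +
        (α * γ * (u 1 - u 0) ^ 2 / 2 + β * δ * (v 1 - v 0) ^ 2 / 2 +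
          β * γ * (u 1 - u 0) * (v 1 - v 0) + c * (γ * (u 1 - u 0) + δ * (v 1 - v 0)) -
          d * (α * (u 1 - u 0) + β * (v 1 - v 0))) := by
  have hi : ∀ {w : ℝ → ℂ}, ContDiffOn ℝ 1 w (Icc 0 1) →
      ∀ {w' : ℝ → ℂ}, ContDiffOn ℝ 1 w' (Icc 0 1) →
        IntervalIntegrable (fun t => w t * deriv w' t) volume 0 1 :=
    fun hw _ hw' => (intervalIntegrable_deriv_of_contDiffOn hw').continuousOn_mul (by
      rw [uIcc_of_le zero_le_one]; exact hw.continuousOn)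
  have hd : ∀ {w : ℝ → ℂ}, ContDiffOn ℝ 1 w (Icc 0 1) → ∀ t ∈ Ioo (0 : ℝ) 1,
      HasDerivAt w (deriv w t) t := fun hw t ht =>
    ((hw.differentiableOn one_ne_zero).differentiableAt (Icc_mem_nhds ht.1 ht.2)).hasDerivAt
  have huu := integral_mul_deriv_eq_of_contDiffOn hu hu
  have hvv := integral_mul_deriv_eq_of_contDiffOn hv hv
  have hvu := integral_mul_deriv_eq_of_contDiffOn hv hu
  have hcu := integral_mul_deriv_eq_of_contDiffOn (contDiffOn_const (c := (1 : ℂ))) hu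
  have hcv := integral_mul_deriv_eq_of_contDiffOn (contDiffOn_const (c := (1 : ℂ))) hv
  simp only [deriv_const', zero_mul, intervalIntegral.integral_zero, one_mul, sub_zero] at hcu hcv
  simp only [mul_comm (deriv _ _)] at huu hvv hvu
  have e : ∫ t in (0 : ℝ)..1, (α * u t + β * v t + c) * deriv (fun t => γ * u t + δ * v t + d) t =
      ∫ t in (0 : ℝ)..1, (α * γ * (u t * deriv u t) + α * δ * (u t * deriv v t) +
        β * γ * (v t * deriv u t) + β * δ * (v t * deriv v t) + c * γ * deriv u t +
          c * δ * deriv v t) := by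
    apply integral_congr_uIoo
    intro t ht
    rw [uIoo_of_le zero_le_one] at ht
    have := (((hd hu t ht).const_mul γ).add ((hd hv t ht).const_mul δ)).add_const d
    have h2 : deriv (fun t => γ * u t + δ * v t + d) t = γ * deriv u t + δ * deriv v t := this.deriv
    simp only [h2]
    ring
  have i1 := (hi hu hu).const_mul (α * γ)
  have i2 := (hi hu hv).const_mul (α * δ)
  have i3 := (hi hv hu).const_mul (β * γ)
  have i4 := (hi hv hv).const_mul (β * δ)
  have i5 := (intervalIntegrable_deriv_of_contDiffOn hu).const_mul (c * γ)
  have i6 := (intervalIntegrable_deriv_of_contDiffOn hv).const_mul (c * δ)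
  rw [e, integral_add ((((i1.add i2).add i3).add i4).add i5) i6,
    integral_add (((i1.add i2).add i3).add i4) i5, integral_add ((i1.add i2).add i3) i4,
    integral_add (i1.add i2) i3, integral_add i1 i2]
  simp only [integral_const_mul]
  rw [hcu, hcv, hvu]
  set J := ∫ t in (0 : ℝ)..1, u t * deriv v t
  linear_combination (α * γ / 2) * huu + (β * δ / 2) * hvv + (J - (u 1 - u 0) * v 0) * hdet

lemma sub_eq_int_mul_of_exp_eq {a b : ℂ} (h : exp a = exp b) : ∃ n : ℤ, a - b = 2 * π * I * n := by
  obtain ⟨n, hn⟩ := exp_eq_exp_iff_exists_int.1 h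
  exact ⟨n, by rw [hn]; ring⟩

lemma HasLogOnTorus.of_monomial_map {F G : Laurent2 ℝ} {k m m' p q : ℤ × ℤ} {r s : ℝ}
    (hr : 0 < r) (hs : 0 < s) (hFG : ∀ x y : ℂ, x ≠ 0 → y ≠ 0 → F.eval x y =
      x ^ k.1 * y ^ k.2 * G.eval (x ^ p.1 * y ^ p.2) (x ^ q.1 * y ^ q.2))
    (hm : m.1 = k.1 + p.1 * m'.1 + q.1 * m'.2 ∧ m.2 = k.2 + p.2 * m'.1 + q.2 * m'.2)
    (h : HasLogOnTorus G m' (r ^ p.1 * s ^ p.2) (r ^ q.1 * s ^ q.2)) : HasLogOnTorus F m r s := by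
  obtain ⟨L, hc, hp, hL⟩ := h
  refine ⟨fun α β => L (p.1 * α + p.2 * β) (q.1 * α + q.2 * β), hc.comp (by fun_prop :
    Continuous fun z : ℝ × ℝ => (p.1 * z.1 + p.2 * z.2, q.1 * z.1 + q.2 * z.2)), ?_, ?_⟩
  · have h1 : ∀ (n : ℤ) (α β : ℝ), L (α + n * (2 * π)) β = L α β := fun n α β =>
      (show Periodic (fun α => L α β) (2 * π) from fun α => (hp α β).1).int_mul n α
    have h2 : ∀ (n : ℤ) (α β : ℝ), L α (β + n * (2 * π)) = L α β := fun n α β =>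
      (show Periodic (L α) (2 * π) from fun β => (hp α β).2).int_mul n β
    intro α β
    constructor
    · refine Eq.trans ?_ ((h1 p.1 _ _).trans (h2 q.1 _ _))
      exact congrArg₂ L (by ring) (by ring)
    · refine Eq.trans ?_ ((h1 p.2 _ _).trans (h2 q.2 _ _))
      exact congrArg₂ L (by ring) (by ring)
  · intro α β
    have hr' : (r : ℂ) ≠ 0 := mod_cast hr.ne'
    have hs' : (s : ℂ) ≠ 0 := mod_cast hs.ne'
    have hx : (r : ℂ) * cis α ≠ 0 := mul_ne_zero hr' (exp_ne_zero _)
    have hy : (s : ℂ) * cis β ≠ 0 := mul_ne_zero hs' (exp_ne_zero _)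
    have e : ∀ n : ℤ × ℤ, ((r : ℂ) * cis α) ^ n.1 * (s * cis β) ^ n.2 =
        ((r ^ n.1 * s ^ n.2 : ℝ) : ℂ) * exp ((n.1 * α + n.2 * β : ℝ) * I) := fun n => by
      rw [mul_zpow, mul_zpow, ← exp_int_mul, ← exp_int_mul]
      push_cast
      rw [add_mul, exp_add]
      ring_nf
    rw [hFG _ _ hx hy, e p, e q, hL, ← e p, ← e q, hm.1, hm.2, zpow_add₀ hx, zpow_add₀ hx,
      zpow_add₀ hy, zpow_add₀ hy, mul_zpow (_ ^ _), mul_zpow (_ ^ _)]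
    simp only [← zpow_mul]
    ring

/-- Changing the logarithms along a path realizes every change of `R` by `(2πi)² n`. -/
lemma IsRegulatorPeriod.add_int {F : Laurent2 ℝ} {m p q : ℤ × ℤ} {R : ℂ}
    (h : IsRegulatorPeriod F m p q R) (n : ℤ) :
    IsRegulatorPeriod F m p q (R + (2 * π * I) ^ 2 * n) := by
  obtain ⟨x, y, h, u, v, hu, hv, huv, rfl⟩ := h
  have h0 : (0 : ℝ) ∈ Icc (0 : ℝ) 1 := ⟨le_rfl, zero_le_one⟩
  have h1 : (1 : ℝ) ∈ Icc (0 : ℝ) 1 := ⟨zero_le_one, le_rfl⟩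
  have hw : p.1 * (u 1 - u 0) + p.2 * (v 1 - v 0) = 2 * π * I := by
    obtain ⟨r, s, hr, hs, -, -, -, -, -, hU, -⟩ := h
    have hc : 0 < r ^ p.1 * s ^ p.2 := by positivity
    obtain ⟨k, hk⟩ := eq_add_of_exp_eq_exp (S := Icc (0 : ℝ) 1) isPreconnected_Icc
      (f := fun t => p.1 * (u t + π * I) + p.2 * (v t + π * I))
      (g := fun t : ℝ => rlog (r ^ p.1 * s ^ p.2) + 2 * π * t * I)
      ((continuousOn_const.mul (hu.continuousOn.add continuousOn_const)).add
        (continuousOn_const.mul (hv.continuousOn.add continuousOn_const)))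
      (by fun_prop) (fun t ht => by
        rw [exp_add, exp_add, exp_int_mul, exp_int_mul, exp_add, exp_add, (huv t ht).1,
          (huv t ht).2, exp_pi_mul_I, neg_mul_neg, neg_mul_neg, mul_one, mul_one, hU t ht,
          ← ofReal_exp, Real.exp_log hc]) ⟨0, h0⟩
    have e0 := hk 0 h0
    have e1 := hk 1 h1
    push_cast at e0 e1
    linear_combination e1 - e0
  refine ⟨x, y, h, fun t => 1 * u t + 0 * v t + 2 * π * I * (n * p.2),
    fun t => 0 * u t + 1 * v t + -(2 * π * I * (n * p.1)), by fun_prop, by fun_prop,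
    fun t ht => ?_, ?_⟩
  · have e : ∀ k : ℤ, exp (2 * π * I * k) = 1 := fun k => by rw [mul_comm, exp_int_mul_two_pi_mul_I]
    have e1 := e (n * p.2)
    have e2 := e (n * p.1)
    push_cast at e1 e2
    simp only [one_mul, zero_mul, add_zero, zero_add, exp_add, exp_neg, e1, e2, inv_one, mul_one]
    exact huv t ht
  · refine Eq.trans ?_ (regulator_linear hu hv (by norm_num) _ _).symm
    linear_combination -(2 * π * I * n) * hw

/-- A monomial change of coordinates carries cycles to cycles, and regulator periods to regulator
periods. -/
lemma IsRegulatorPeriod.monomial_map {F G : Laurent2 ℝ} {k m' P Q p q : ℤ × ℤ}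
    (hdet : p.1 * q.2 - p.2 * q.1 = 1) (hFG : ∀ x y : ℂ, x ≠ 0 → y ≠ 0 → F.eval x y =
      x ^ k.1 * y ^ k.2 * G.eval (x ^ p.1 * y ^ p.2) (x ^ q.1 * y ^ q.2)) {R : ℂ}
    (h : IsRegulatorPeriod G m' P Q R) : IsRegulatorPeriod F
      (k.1 + p.1 * m'.1 + q.1 * m'.2, k.2 + p.2 * m'.1 + q.2 * m'.2)
      (p.1 * P.1 + q.1 * P.2, p.2 * P.1 + q.2 * P.2)
      (p.1 * Q.1 + q.1 * Q.2, p.2 * Q.1 + q.2 * Q.2) R := by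
  suffices H : ∃ n : ℤ, IsRegulatorPeriod F _ _ _ (R + (2 * π * I) ^ 2 * n) by
    obtain ⟨n, hn⟩ := H
    simpa using hn.add_int (-n)
  obtain ⟨x, y, ⟨r, s, hr, hs, hlog, hxc, hyc, hx1, hy1, hU, hiff⟩, u, v, hu, hv, huv, rfl⟩ := h
  have key : ∀ {K : Type} [Field K] {x y : K}, x ≠ 0 → y ≠ 0 → ∀ P : ℤ × ℤ,
      (x ^ q.2 * y ^ (-p.2)) ^ (p.1 * P.1 + q.1 * P.2) *
        (x ^ (-q.1) * y ^ p.1) ^ (p.2 * P.1 + q.2 * P.2) = x ^ P.1 * y ^ P.2 := by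
    intro K _ x y hx hy P
    rw [zpow_mul_zpow_comp hx hy]
    congr 2
    · linear_combination P.1 * hdet
    · linear_combination P.2 * hdet
  have hx : ∀ t ∈ Icc (0 : ℝ) 1, x t = exp (u t + π * I) := fun t ht => by
    rw [exp_add, (huv t ht).1, exp_pi_mul_I, neg_mul_neg, mul_one]
  have hy : ∀ t ∈ Icc (0 : ℝ) 1, y t = exp (v t + π * I) := fun t ht => by
    rw [exp_add, (huv t ht).2, exp_pi_mul_I, neg_mul_neg, mul_one]
  have hx0 : ∀ t ∈ Icc (0 : ℝ) 1, x t ≠ 0 := fun t ht => (hx t ht).trans_ne (exp_ne_zero _)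
  have hy0 : ∀ t ∈ Icc (0 : ℝ) 1, y t ≠ 0 := fun t ht => (hy t ht).trans_ne (exp_ne_zero _)
  have h0 : (0 : ℝ) ∈ Icc (0 : ℝ) 1 := ⟨le_rfl, zero_le_one⟩
  have h1 : (1 : ℝ) ∈ Icc (0 : ℝ) 1 := ⟨zero_le_one, le_rfl⟩
  obtain ⟨i, hi⟩ := sub_eq_int_mul_of_exp_eq (a := u 1) (b := u 0) (by
    rw [(huv 1 h1).1, (huv 0 h0).1, hx1])
  obtain ⟨j, hj⟩ := sub_eq_int_mul_of_exp_eq (a := v 1) (b := v 0) (by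
    rw [(huv 1 h1).2, (huv 0 h0).2, hy1])
  have hpar : ∀ α β γ δ i j : ZMod 2, δ * α - γ * β = 1 → α * γ * i ^ 2 + β * δ * j ^ 2 +
      2 * (β * γ * i * j) + (α + β + 1) * (γ * i + δ * j) - (γ + δ + 1) * (α * i + β * j) = 0 := by
    decide
  obtain ⟨n, hn⟩ : Even (q.2 * -q.1 * i ^ 2 + -p.2 * p.1 * j ^ 2 + 2 * (-p.2 * -q.1 * i * j) +
      (q.2 + -p.2 + 1) * (-q.1 * i + p.1 * j) - (-q.1 + p.1 + 1) * (q.2 * i + -p.2 * j)) := by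
    have := congrArg (Int.cast : ℤ → ZMod 2) hdet
    push_cast at this
    rw [← ZMod.intCast_eq_zero_iff_even]
    push_cast
    exact hpar _ _ _ _ _ _ (by rw [← this]; ring)
  obtain ⟨u', hu'⟩ : ∃ u' : ℝ → ℂ, u' = fun t => (q.2 : ℂ) * u t + (-p.2 : ℂ) * v t +
    (q.2 + -p.2 + 1) * (π * I) := ⟨_, rfl⟩
  obtain ⟨v', hv'⟩ : ∃ v' : ℝ → ℂ, v' = fun t => (-q.1 : ℂ) * u t + (p.1 : ℂ) * v t +
    (-q.1 + p.1 + 1) * (π * I) := ⟨_, rfl⟩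
  have hud : ContDiffOn ℝ 1 u' (Icc 0 1) := by rw [hu']; fun_prop
  have hvd : ContDiffOn ℝ 1 v' (Icc 0 1) := by rw [hv']; fun_prop
  have hexp : ∀ (a b : ℤ), ∀ t ∈ Icc (0 : ℝ) 1,
      exp (a * u t + b * v t + (a + b + 1) * (π * I)) = -(x t ^ a * y t ^ b) := by
    intro a b t ht
    rw [hx t ht, hy t ht, ← exp_int_mul, ← exp_int_mul, ← exp_add, ← mul_neg_one, ← exp_pi_mul_I,
      ← exp_add]
    congr 1; ring
  have hux : ∀ t ∈ Icc (0 : ℝ) 1, exp (u' t) = -(x t ^ q.2 * y t ^ (-p.2)) := fun t ht => by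
    rw [← hexp _ _ t ht, hu']; push_cast; rfl
  have hvy : ∀ t ∈ Icc (0 : ℝ) 1, exp (v' t) = -(x t ^ (-q.1) * y t ^ p.1) := fun t ht => by
    rw [← hexp _ _ t ht, hv']; push_cast; rfl
  refine ⟨n, fun t => x t ^ q.2 * y t ^ (-p.2), fun t => x t ^ (-q.1) * y t ^ p.1,
    ⟨r ^ q.2 * s ^ (-p.2), r ^ (-q.1) * s ^ p.1, by positivity, by positivity,
      HasLogOnTorus.of_monomial_map (by positivity) (by positivity) hFG ⟨rfl, rfl⟩ ?_,
      hud.cexp.neg.congr fun t ht => by rw [hux t ht, neg_neg],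
      hvd.cexp.neg.congr fun t ht => by rw [hvy t ht, neg_neg],
      by simp only [hx1, hy1], by simp only [hx1, hy1], ?_, ?_⟩,
    u', v', hud, hvd, fun t ht => ⟨hux t ht, hvy t ht⟩, ?_⟩
  · rwa [(zpow_mul_zpow_cancel' hr.ne' hs.ne' hdet).1, (zpow_mul_zpow_cancel' hr.ne' hs.ne' hdet).2]
  · intro t ht
    rw [key (hx0 t ht) (hy0 t ht), key hr.ne' hs.ne', hU t ht]
  · intro X Y hX hY
    have hXY := mul_ne_zero (zpow_ne_zero k.1 hX) (zpow_ne_zero k.2 hY)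
    have := hiff (X ^ p.1 * Y ^ p.2) (X ^ q.1 * Y ^ q.2) (by positivity) (by positivity)
    rw [zpow_mul_zpow_comp hX hY, zpow_mul_zpow_comp hX hY] at this
    rw [key hr.ne' hs.ne', key hr.ne' hs.ne', hFG X Y hX hY, mul_eq_zero, or_iff_right hXY, this]
    refine exists_congr fun t => and_congr_right fun ht => ⟨fun ⟨h1, h2⟩ => ?_, ?_⟩
    · simp only [← h1, ← h2]
      exact (zpow_mul_zpow_cancel hX hY hdet).imp Eq.symm Eq.symm
    · rintro ⟨rfl, rfl⟩
      exact zpow_mul_zpow_cancel' (hx0 t ht) (hy0 t ht) hdet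
  · rw [hu', hv']
    have hn' := congrArg (Int.cast : ℤ → ℂ) hn
    have hd := congrArg (Int.cast : ℤ → ℂ) hdet
    push_cast at hn' hd
    refine Eq.trans ?_ (regulator_linear hu hv (by linear_combination hd) _ _).symm
    rw [hi, hj]
    linear_combination -((2 * π * I) ^ 2 / 2) * hn'

section transfer

variable {k : ℕ} (a : Fin (k + 1) → ℝ)

lemma isRegulatorPeriod_famHyp_iff {R : ℂ} :
    IsRegulatorPeriod (famHyp (k + 1) 1 (a ∘ rev)) (0, 0) (1, 0) (0, 1) R ↔
      IsRegulatorPeriod (famGG (k + 1) 1 a) (1 - ((k + 1 : ℕ) : ℤ), 1 - ((k + 1 : ℕ) : ℤ)) (-1, -1)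
        (((k + 1 : ℕ) : ℤ), ((k + 1 : ℕ) : ℤ) - 1) R := by
  constructor <;> intro h
  · convert h.monomial_map (k := (-k, -k)) (p := (-1, -1)) (q := ((k + 1 : ℕ), k))
      (by push_cast; ring) (eval_famGG_eq_famHyp a) using 2 <;> simp
  · convert h.monomial_map (k := (-k, 0)) (p := (k, 1)) (q := (-(k + 1), -1)) (by ring)
      (fun x y hx hy => by simpa using eval_famHyp_eq_famGG a hx hy) using 2 <;> push_cast <;> ring

end transfer

lemma isRegulatorPeriodAt_famGG_top {g : ℕ} (hg : 0 < g) :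
    (∃ R, IsRegulatorPeriodAt (famGG g 1) (1 - (g : ℤ), 1 - (g : ℤ)) (-1, -1)
      ((g : ℤ), (g : ℤ) - 1) (weightGG g) (chebCoeff g) R) ∧
      ∀ R, IsRegulatorPeriodAt (famGG g 1) (1 - (g : ℤ), 1 - (g : ℤ)) (-1, -1)
          ((g : ℤ), (g : ℤ) - 1) (weightGG g) (chebCoeff g) R →
        CongrModQ1 (1 / (2 * π * I) * R) (conifoldValue (2 * g - 1) 1) := by
  obtain ⟨k, rfl⟩ := Nat.exists_eq_add_one.2 hg
  have hrev : ∀ τ : ℝ, (fun i => τ ^ weightHyp (k + 1) i * chebCoeff (k + 1) (rev i)) =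
      (fun i => τ ^ weightGG (k + 1) i * chebCoeff (k + 1) i) ∘ rev := by
    intro τ
    funext i
    rw [Function.comp]
    congr 2
    rw [weightGG, weightHyp, val_rev, Nat.cast_sub (by omega)]
    push_cast; ring
  have h := isRegulatorPeriodAt_famHyp hg
  simpa only [IsRegulatorPeriodAt, Function.comp_apply, hrev, isRegulatorPeriod_famHyp_iff] using h

lemma hasSum_circMean {E : Type*} [NormedAddCommGroup E] [NormedSpace ℝ E] [CompleteSpace E]
    {f : ℕ → ℝ → E} {F : ℝ → E} {b : ℕ → ℝ} (hf : ∀ n, Continuous (f n)) (hb : Summable b)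
    (hfb : ∀ n t, ‖f n t‖ ≤ b n) (h : ∀ t, HasSum (fun n => f n t) (F t)) :
    HasSum (fun n => circMean (f n)) (circMean F) := by
  refine HasSum.const_smul _ ?_
  exact intervalIntegral.hasSum_integral_of_dominated_convergence (fun n _ => b n)
    (fun n => (hf n).aestronglyMeasurable) (fun n => .of_forall fun t _ => hfb n t)
    (.of_forall fun t _ => hb) intervalIntegrable_const (.of_forall fun t _ => h t)

lemma norm_circMean_le {E : Type*} [NormedAddCommGroup E] [NormedSpace ℝ E] {f : ℝ → E} {b : ℝ}
    (h : ∀ t, ‖f t‖ ≤ b) : ‖circMean f‖ ≤ b := by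
  rw [circMean, norm_smul, norm_inv, norm_of_nonneg two_pi_pos.le]
  have := intervalIntegral.norm_integral_le_of_norm_le_const (a := 0) (b := 2 * π)
    (f := f) (C := b) fun t _ => h t
  rw [sub_zero, abs_of_pos two_pi_pos] at this
  rw [inv_mul_le_iff₀ two_pi_pos]
  linarith

lemma hasSum_circMean_circMean {f : ℕ → ℝ → ℝ → ℂ} {F : ℝ → ℝ → ℂ} {b : ℕ → ℝ}
    (hf : ∀ n, Continuous fun z : ℝ × ℝ => f n z.1 z.2) (hb : Summable b)
    (hfb : ∀ n α β, ‖f n α β‖ ≤ b n) (h : ∀ α β, HasSum (fun n => f n α β) (F α β)) :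
    HasSum (fun n => circMean fun α => circMean (f n α)) (circMean fun α => circMean (F α)) :=
  hasSum_circMean (fun n => continuous_circMean (hf n)) hb
    (fun n α => norm_circMean_le (hfb n α)) fun α =>
      hasSum_circMean (fun n => (hf n).comp (by fun_prop : Continuous fun β : ℝ => (α, β))) hb
        (fun n β => hfb n α β) (h α)

lemma circMean_exp_int_mul (n : ℤ) :
    circMean (fun β : ℝ => exp ((n * β : ℝ) * I)) = if n = 0 then 1 else 0 := by
  split_ifs with h
  · subst h
    simp [circMean_const]
  · have hn : ((n : ℂ) * I) ≠ 0 := mul_ne_zero (Int.cast_ne_zero.2 h) I_ne_zero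
    rw [circMean]
    have : ∀ β : ℝ, exp ((n * β : ℝ) * I) = exp ((n * I) * β) := fun β => by
      congr 1; push_cast; ring
    simp only [this]
    rw [integral_exp_mul_complex hn]
    have : (n : ℂ) * I * ((2 * π : ℝ) : ℂ) = n * (2 * π * I) := by push_cast; ring
    rw [this, exp_int_mul_two_pi_mul_I]
    simp

namespace Laurent2

lemma eval_pow {x y : ℂ} (hx : x ≠ 0) (hy : y ≠ 0) (F : Laurent2 ℝ) (n : ℕ) :
    (F ^ n).eval x y = F.eval x y ^ n := by rw [← evalHom_apply hx hy, map_pow, evalHom_apply]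

lemma eval_mul {x y : ℂ} (hx : x ≠ 0) (hy : y ≠ 0) (F G : Laurent2 ℝ) :
    (F * G).eval x y = F.eval x y * G.eval x y := by
  rw [← evalHom_apply hx hy, map_mul, evalHom_apply, evalHom_apply]

lemma eval_sub_single_zero {x y : ℂ} (hx : x ≠ 0) (hy : y ≠ 0) (F : Laurent2 ℝ) (c : ℝ) :
    (F - single 0 c).eval x y = F.eval x y - c := by
  rw [← evalHom_apply hx hy, map_sub, evalHom_apply, evalHom_apply, eval, eval, deltaEval_single]
  simp

lemma circMean_circMean_onTorus (F : Laurent2 ℝ) {r s : ℝ} (hr : 0 < r) (hs : 0 < s) :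
    circMean (fun α => circMean fun β => F.onTorus 0 0 r s α β) = (F.coeff 0 : ℂ) := by
  have e : ∀ α β, F.onTorus 0 0 r s α β = ∑ m ∈ F.coeff.support,
      ((F.coeff m : ℂ) * ((r : ℂ) ^ m.1 * (s : ℂ) ^ m.2)) *
        (exp ((m.1 * α : ℝ) * I) * exp ((m.2 * β : ℝ) * I)) := fun α β => by
    rw [onTorus_eq]
    refine sum_congr rfl fun m _ => ?_
    rw [add_mul, exp_add]
    push_cast; ring
  simp only [e]
  have h1 : ∀ α : ℝ, circMean (fun β : ℝ => ∑ m ∈ F.coeff.support,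
      ((F.coeff m : ℂ) * ((r : ℂ) ^ m.1 * (s : ℂ) ^ m.2)) *
        (exp ((m.1 * α : ℝ) * I) * exp ((m.2 * β : ℝ) * I))) = ∑ m ∈ F.coeff.support,
      ((F.coeff m : ℂ) * ((r : ℂ) ^ m.1 * (s : ℂ) ^ m.2) * (if m.2 = 0 then 1 else 0)) *
        exp ((m.1 * α : ℝ) * I) := fun α => by
    rw [circMean_sum _ (f := fun m (β : ℝ) =>
      ((F.coeff m : ℂ) * ((r : ℂ) ^ m.1 * (s : ℂ) ^ m.2)) *
        (exp ((m.1 * α : ℝ) * I) * exp ((m.2 * β : ℝ) * I))) fun m _ => by fun_prop]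
    refine sum_congr rfl fun m _ => ?_
    rw [circMean_const_mul, circMean_const_mul, circMean_exp_int_mul]
    ring
  rw [circMean_congr h1, circMean_sum _ (f := fun m (α : ℝ) =>
    ((F.coeff m : ℂ) * ((r : ℂ) ^ m.1 * (s : ℂ) ^ m.2) * (if m.2 = 0 then 1 else 0)) *
        exp ((m.1 * α : ℝ) * I)) fun m _ => by fun_prop]
  simp only [circMean_const_mul, circMean_exp_int_mul]
  rw [sum_eq_single 0]
  · simp
  · simp_all
  · intro h
    rw [Finsupp.notMem_support_iff] at h
    rw [h]; simp

lemma hasSum_coeff_zero_of_norm_le {F : Laurent2 ℝ} {c b : ℝ} (hb : b < |c|)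
    (hF : ∀ x y : ℂ, ‖x‖ = 1 → ‖y‖ = 1 → ‖F.eval x y - c‖ ≤ b) :
    HasSum (fun k : ℕ => (-1) ^ (k + 1) / ((k : ℝ) + 1) *
      ((F - single 0 c) ^ (k + 1)).coeff 0 / c ^ (k + 1))
      (rlog |c| - F.torusMean 1 1) ∧ ∃ L, IsTorusLog F 1 1 L := by
  have hb0 : 0 ≤ b := (norm_nonneg _).trans (hF 1 1 (by simp) (by simp))
  have hc0 : 0 < |c| := hb0.trans_lt hb
  have hc : c ≠ 0 := abs_pos.1 hc0
  have hc' : (c : ℂ) ≠ 0 := mod_cast hc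
  have hne : ∀ α : ℝ, ((1 : ℝ) : ℂ) * cis α ≠ 0 := fun α => mul_ne_zero (by simp) (exp_ne_zero _)
  have hn : ∀ α : ℝ, ‖((1 : ℝ) : ℂ) * cis α‖ = 1 := fun α => norm_mul_exp one_pos α
  set w : ℝ → ℝ → ℂ := fun α β => (F.onTorus 0 0 1 1 α β - c) / c with hw
  clear_value w
  have hwc : Continuous fun z : ℝ × ℝ => w z.1 z.2 := by
    rw [hw]; exact ((F.continuous_onTorus 0 0 1 1).sub continuous_const).div_const _
  have hwb : ∀ α β, ‖w α β‖ ≤ b / |c| := fun α β => by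
    rw [hw, norm_div, norm_real, norm_eq_abs]
    exact div_le_div_of_nonneg_right (hF _ _ (hn α) (hn β)) hc0.le
  have hq : b / |c| < 1 := (div_lt_one hc0).2 hb
  have hw1 : ∀ α β, ‖w α β‖ < 1 := fun α β => (hwb α β).trans_lt hq
  refine ⟨?_, exists_isTorusLog_of_norm_sub_lt (G := fun _ _ => log c) continuous_const
    (fun _ _ => ⟨rfl, rfl⟩) fun α β => ?_⟩
  swap
  · rw [exp_log hc', norm_real, norm_eq_abs]
    exact (hF _ _ (hn α) (hn β)).trans_lt hb
  have hlogc : Continuous fun z : ℝ × ℝ => log (1 + w z.1 z.2) :=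
    Continuous.clog (by fun_prop) fun z => one_add_mem_slitPlane_of_norm_lt_one (hw1 _ _)
  have hsum := hasSum_circMean_circMean (f := fun k α β => (-w α β) ^ (k + 1) / ((k : ℂ) + 1))
    (F := fun α β => -log (1 + w α β)) (b := fun k => (b / |c|) ^ (k + 1)) (fun k => by fun_prop)
    ((summable_nat_add_iff 1).2 (summable_geometric_of_lt_one (by positivity) hq)) (fun k α β => by
      have hk : ‖((k : ℂ) + 1)‖ = k + 1 := by
        rw [show ((k : ℂ) + 1) = ((k + 1 : ℕ) : ℂ) by push_cast; rfl, norm_natCast]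
        push_cast; rfl
      rw [norm_div, norm_pow, norm_neg, hk]
      calc _ ≤ ‖w α β‖ ^ (k + 1) := div_le_self (by positivity) (by simp)
        _ ≤ _ := pow_le_pow_left₀ (norm_nonneg _) (hwb α β) _)
    (fun α β => by
      have h := hasSum_taylorSeries_neg_log (z := -w α β) (by rw [norm_neg]; exact hw1 α β)
      rw [sub_neg_eq_add] at h
      have h2 := (hasSum_nat_add_iff' (f := fun n : ℕ => (-w α β) ^ n / (n : ℂ)) 1).2 h
      simpa using h2)
  have hre := hasSum_re hsum
  convert hre using 1
  · funext k
    have : ∀ α β, (-w α β) ^ (k + 1) / ((k : ℂ) + 1) =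
        (((-1) ^ (k + 1) / ((k : ℝ) + 1) / c ^ (k + 1) : ℝ) : ℂ) *
          ((F - single 0 c) ^ (k + 1)).onTorus 0 0 1 1 α β := fun α β => by
      rw [onTorus, ← eval, eval_pow (hne α) (hne β), eval_sub_single_zero (hne α) (hne β),
        neg_pow, hw, div_pow, onTorus, ← eval]
      push_cast
      ring
    simp only [this, circMean_const_mul, circMean_circMean_onTorus _ one_pos one_pos]
    rw [← ofReal_mul, ofReal_re]
    ring
  · have hlogm : Continuous fun α => circMean fun β => -log (1 + w α β) :=
      continuous_circMean (f := fun α β => -log (1 + w α β)) hlogc.neg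
    rw [circMean_re hlogm, torusMean]
    have h1 : ∀ α, (circMean fun β => -log (1 + w α β)).re =
        rlog |c| - circMean fun β => rlog ‖F.onTorus 0 0 1 1 α β‖ := fun α => by
      have hcβ : Continuous fun β => -log (1 + w α β) :=
        hlogc.neg.comp (by fun_prop : Continuous fun β : ℝ => (α, β))
      rw [circMean_re hcβ]
      have : ∀ β, (-log (1 + w α β)).re = rlog |c| - rlog ‖F.onTorus 0 0 1 1 α β‖ := by
        intro β
        have h0 : 1 + w α β ≠ 0 :=
          slitPlane_ne_zero (one_add_mem_slitPlane_of_norm_lt_one (hw1 _ _))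
        have hF' : F.onTorus 0 0 1 1 α β = c * (1 + w α β) := by rw [hw]; field_simp; ring
        rw [hF', norm_mul, Real.log_mul (norm_ne_zero_iff.2 hc') (norm_ne_zero_iff.2 h0), norm_real,
          norm_eq_abs, neg_re, log_re]
        ring
      have hcF : Continuous fun β => rlog ‖F.onTorus 0 0 1 1 α β‖ := by
        have : (fun β => rlog ‖F.onTorus 0 0 1 1 α β‖) =
            fun β => rlog |c| - (-log (1 + w α β)).re := by funext β; rw [this]; ring
        rw [this]
        exact continuous_const.sub (continuous_re.comp hcβ)
      rw [circMean_congr this, circMean_sub continuous_const hcF, circMean_const]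
    rw [circMean_congr h1, circMean_sub continuous_const, circMean_const]
    have : (fun α => circMean fun β => rlog ‖F.onTorus 0 0 1 1 α β‖) =
        fun α => rlog |c| - (circMean fun β => -log (1 + w α β)).re := by funext α; rw [h1]; ring
    rw [this]
    fun_prop

end Laurent2

lemma exists_hasSum_of_dominant {F : Laurent2 ℝ} {n : ℕ} (hF : F.IsMonicInSecond n) {c b : ℝ}
    (hb : b < |c|) (h : ∀ x y : ℂ, ‖x‖ = 1 → ‖y‖ = 1 → ‖F.eval x y - c‖ ≤ b) :
    ∃ S : ℝ, HasSum (fun k : ℕ => (-1) ^ (k + 1) / ((k : ℝ) + 1) *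
        ((F - single 0 c) ^ (k + 1)).coeff 0 / c ^ (k + 1)) S ∧
      (∃ R, IsRegulatorPeriod F (0, 0) (1, 0) (0, 1) R) ∧
      ∀ R, IsRegulatorPeriod F (0, 0) (1, 0) (0, 1) R →
        CongrModQ1 (1 / (2 * π * I) * R) ((-rlog |c| + S : ℝ) : ℂ) := by
  obtain ⟨hS, L, hL⟩ := hasSum_coeff_zero_of_norm_le hb h
  refine ⟨_, hS, ⟨_, hL.isRegulatorPeriod hF one_pos one_pos⟩, fun R hR => ?_⟩
  obtain ⟨k, hk⟩ := HasTorusMean.eq_of_isRegulatorPeriod hF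
    ⟨1, 1, one_pos, one_pos, L, hL, rfl, rfl⟩ hR
  have := congrModQ1_of_eq hk
  rwa [neg_add_eq_sub, sub_sub_cancel_left]

section dominant

variable {g : ℕ} (hg : 0 < g) (a : Fin g → ℝ) {x y : ℂ}

lemma norm_sum_erase_le {f : Fin g → ℂ} (hf : ∀ i, ‖f i‖ = 1) (h0 : f ⟨0, hg⟩ = 1) :
    ‖(∑ i, (a i : ℂ) * f i) - a ⟨0, hg⟩‖ ≤ ∑ i ∈ Finset.univ.erase ⟨0, hg⟩, |a i| := by
  rw [← Finset.add_sum_erase _ _ (Finset.mem_univ (⟨0, hg⟩ : Fin g)), h0, mul_one,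
    add_sub_cancel_left]
  refine (norm_sum_le _ _).trans (Finset.sum_le_sum fun i _ => ?_)
  simp_all

lemma norm_add_add_add_sub_le {x y z s c : ℂ} {b : ℝ} (hx : ‖x‖ = 1) (hy : ‖y‖ = 1)
    (hz : ‖z‖ = 1) (hs : ‖s - c‖ ≤ b) : ‖x + y + z + s - c‖ ≤ 3 + b := by
  have h1 := norm_add_le (x + y + z) (s - c)
  have h2 := norm_add₃_le (a := x) (b := y) (c := z)
  rw [← add_sub_assoc] at h1
  linarith

lemma norm_eval_famGG_sub_le (hx : ‖x‖ = 1) (hy : ‖y‖ = 1) :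
    ‖(famGG g 1 a).eval x y - a ⟨0, hg⟩‖ ≤ 3 + ∑ i ∈ Finset.univ.erase ⟨0, hg⟩, |a i| := by
  rw [eval_famGG]
  refine norm_add_add_add_sub_le hx hy (by simp [hx, hy])
    (norm_sum_erase_le hg a (fun i => by simp [hx, hy]) (by simp))

lemma norm_eval_famHyp_sub_le (hx : ‖x‖ = 1) (hy : ‖y‖ = 1) :
    ‖(famHyp g 1 a).eval x y - a ⟨0, hg⟩‖ ≤ 3 + ∑ i ∈ Finset.univ.erase ⟨0, hg⟩, |a i| := by
  rw [eval_famHyp]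
  refine norm_add_add_add_sub_le hx hy (by simp [hx, hy])
    (norm_sum_erase_le hg a (fun i => by simp [hx]) (by simp))

end dominant

section gradedTerm

open Polynomial

lemma coeff_coeff_single_add_pow (B : Laurent2 ℝ) (k n : ℕ) (hn : n ≤ k) :
    (((single ((1, 0) : ℤ × ℤ) (X : ℝ[X]) +
      mapRingHom (ℤ × ℤ) (C : ℝ →+* ℝ[X]) B) ^ k).coeff 0).coeff n =
      k.choose n * (single ((1, 0) : ℤ × ℤ) (1 : ℝ) ^ n * B ^ (k - n)).coeff 0 := by
  have h : ∀ i : ℕ, (((single ((1, 0) : ℤ × ℤ) (X : ℝ[X]) ^ i *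
      mapRingHom (ℤ × ℤ) (C : ℝ →+* ℝ[X]) B ^ (k - i) * (k.choose i : ℕ) :
        Laurent2 ℝ[X])).coeff 0).coeff n = if n = i then
      k.choose i * (single ((1, 0) : ℤ × ℤ) (1 : ℝ) ^ i * B ^ (k - i)).coeff 0
      else 0 := by
    intro i
    rw [← map_pow, single_pow, single_pow, one_pow,
      ← nsmul_eq_mul', AddMonoidAlgebra.coeff_smul, Finsupp.smul_apply,
      coeff_single_mul_eq_mul_coeff (m₂ := -(i • ((1, 0) : ℤ × ℤ)))
        (fun m _ => by rw [eq_neg_iff_add_eq_zero, add_comm]),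
      coeff_single_mul_eq_mul_coeff (m₂ := -(i • ((1, 0) : ℤ × ℤ)))
        (fun m _ => by rw [eq_neg_iff_add_eq_zero, add_comm]),
      AddMonoidAlgebra.coeff_mapRingHom, one_mul, nsmul_eq_mul, ← C_eq_natCast, coeff_C_mul,
      coeff_X_pow_mul', coeff_C]
    grind
  rw [add_pow]
  simp_all

end gradedTerm

lemma Laurent2.eval_single_one_zero (x y : ℂ) :
    Laurent2.eval (single ((1, 0) : ℤ × ℤ) (1 : ℝ)) x y = x := by
  rw [Laurent2.eval, deltaEval_single]; simp

lemma hasSum_circMean_choose {u w : ℝ → ℝ → ℂ} (hu : Continuous fun z : ℝ × ℝ => u z.1 z.2)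
    (hw : Continuous fun z : ℝ × ℝ => w z.1 z.2) {U q : ℝ} (huU : ∀ α β, ‖u α β‖ ≤ U)
    (hwq : ∀ α β, ‖w α β‖ ≤ q) (hq : q < 1) (n : ℕ) :
    HasSum (fun j => circMean fun α => circMean fun β =>
      u α β ^ (n + 1) * (((j + n).choose n : ℂ) * w α β ^ j))
      (circMean fun α => circMean fun β => (u α β / (1 - w α β)) ^ (n + 1)) := by
  have hq0 : 0 ≤ q := (norm_nonneg _).trans (hwq 0 0)
  have h1 : ∀ j, Continuous fun z : ℝ × ℝ =>
      u z.1 z.2 ^ (n + 1) * (((j + n).choose n : ℂ) * w z.1 z.2 ^ j) :=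
    fun j => (hu.pow _).mul (continuous_const.mul (hw.pow _))
  have h2 : Summable fun j : ℕ => U ^ (n + 1) * (((j + n).choose n : ℝ) * q ^ j) := by
    have h : Summable fun j : ℕ => ((j + n).choose n : ℝ) * q ^ j :=
      summable_choose_mul_geometric_of_norm_lt_one (R := ℝ) n (r := q)
        (by rw [norm_of_nonneg hq0]; exact hq)
    exact h.mul_left _
  have h3 : ∀ (j : ℕ) (α β : ℝ), ‖u α β ^ (n + 1) * (((j + n).choose n : ℂ) * w α β ^ j)‖ ≤
      U ^ (n + 1) * (((j + n).choose n : ℝ) * q ^ j) := fun j α β => by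
    rw [norm_mul, norm_pow, norm_mul, norm_pow, norm_natCast]
    exact mul_le_mul (pow_le_pow_left₀ (norm_nonneg _) (huU α β) _)
      (mul_le_mul_of_nonneg_left (pow_le_pow_left₀ (norm_nonneg _) (hwq α β) _) (Nat.cast_nonneg _))
      (by positivity) (pow_nonneg ((norm_nonneg _).trans (huU 0 0)) _)
  refine hasSum_circMean_circMean h1 h2 h3 fun α β => ?_
  rw [div_pow, div_eq_mul_one_div]
  exact (hasSum_choose_mul_geometric_of_norm_lt_one n ((hwq α β).trans_lt hq)).mul_left _

section gradedMean

variable {g : ℕ} {fam : Polynomial ℝ → (Fin g → Polynomial ℝ) → Laurent2 (Polynomial ℝ)}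
  {i₀ : Fin g} {a : Fin g → ℝ} {B : Laurent2 ℝ} {k : ℕ}

lemma succ_mul_gradedTerm_eq_sum {ε M : ℝ} (hfam : fam Polynomial.X (fun i => Polynomial.C (a i))
      - single 0 (Polynomial.C (a i₀)) = single ((1, 0) : ℤ × ℤ) (Polynomial.X : Polynomial ℝ) +
      mapRingHom (ℤ × ℤ) (Polynomial.C : ℝ →+* Polynomial ℝ) B) (n : ℕ) :
    (n + 1) * gradedTerm fam i₀ a ε M (n + 1) = ∑ j ∈ range (2 * (n + 1) + 1),
      ((j + n).choose n : ℝ) * (ε / M) ^ (n + 1 + j) *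
        (single ((1, 0) : ℤ × ℤ) (1 : ℝ) ^ (n + 1) * B ^ j).coeff 0 := by
  rw [gradedTerm, mul_sum, hfam]
  refine Finset.sum_nbij' (fun k => k - (n + 1)) (fun j => n + 1 + j) (fun k hk => ?_)
    (fun j hj => ?_) (fun k hk => ?_) (fun j hj => ?_) (fun k hk => ?_)
  · grind
  · rw [mem_range] at hj; rw [Finset.mem_Icc]; omega
  · rw [Finset.mem_Icc] at hk; omega
  · omega
  · rw [Finset.mem_Icc] at hk
    obtain ⟨j, rfl⟩ := Nat.exists_eq_add_of_le hk.1
    rw [coeff_coeff_single_add_pow B _ _ hk.1, Nat.add_sub_cancel_left, div_pow]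
    have h : ((n + 1 + j : ℕ) : ℝ) * ((j + n).choose n : ℝ) =
        ((n + 1 + j).choose (n + 1) : ℝ) * (n + 1) := by
      have := Nat.add_one_mul_choose_eq (j + n) n
      rw [show j + n + 1 = n + 1 + j by ring] at this
      exact_mod_cast this
    have h0 : ((n + 1 + j : ℕ) : ℝ) ≠ 0 := mod_cast (by omega)
    grind

lemma norm_coeff_zero_le {K : ℝ} (hK : ∀ t : ℝ, 1 ≤ t → ∀ x y : ℂ, ‖x‖ = t ^ 2 → ‖y‖ = (t ^ k)⁻¹ →
      ‖B.eval x y‖ ≤ K / t) {t : ℝ} (ht : 1 ≤ t) (n j : ℕ) :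
    |(single ((1, 0) : ℤ × ℤ) (1 : ℝ) ^ n * B ^ j).coeff 0| ≤ (t ^ 2) ^ n * (K / t) ^ j := by
  have ht0 : 0 < t := one_pos.trans_le ht
  have ht2 : 0 < t ^ 2 := by positivity
  have hti : 0 < (t ^ k)⁻¹ := by positivity
  rw [← norm_eq_abs, ← norm_real, ← circMean_circMean_onTorus _ ht2 hti]
  refine norm_circMean_le fun α => norm_circMean_le fun β => ?_
  have hx : ((t ^ 2 : ℝ) : ℂ) * cis α ≠ 0 := mul_ne_zero (mod_cast ht2.ne') (exp_ne_zero _)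
  have hy : (((t ^ k)⁻¹ : ℝ) : ℂ) * cis β ≠ 0 := mul_ne_zero (mod_cast hti.ne') (exp_ne_zero _)
  rw [onTorus, ← Laurent2.eval, Laurent2.eval_mul hx hy, Laurent2.eval_pow hx hy,
    Laurent2.eval_pow hx hy, Laurent2.eval, deltaEval_single, norm_mul, norm_pow, norm_pow]
  refine mul_le_mul ?_ ?_ (by positivity) (by positivity)
  · simp
  · exact pow_le_pow_left₀ (norm_nonneg _) (hK t ht _ _ (norm_mul_exp ht2 _) (norm_mul_exp hti _)) _

lemma coeff_zero_eq_zero {K : ℝ} (hK : ∀ t : ℝ, 1 ≤ t → ∀ x y : ℂ, ‖x‖ = t ^ 2 → ‖y‖ = (t ^ k)⁻¹ →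
      ‖B.eval x y‖ ≤ K / t) {n j : ℕ} (hj : 2 * n < j) :
    (single ((1, 0) : ℤ × ℤ) (1 : ℝ) ^ n * B ^ j).coeff 0 = 0 := by
  have h : Tendsto (fun t : ℝ => K ^ j * (t ^ (j - 2 * n))⁻¹) Filter.atTop (nhds 0) := by
    have := (tendsto_inv_atTop_zero.comp (Filter.tendsto_pow_atTop (α := ℝ) (n := j - 2 * n) (by omega)))
    simpa using this.const_mul (K ^ j)
  rw [← abs_nonpos_iff]
  refine ge_of_tendsto h ?_
  filter_upwards [Filter.eventually_ge_atTop 1] with t ht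
  refine (norm_coeff_zero_le hK ht n j).trans (le_of_eq ?_)
  have ht0 : t ≠ 0 := (one_pos.trans_le ht).ne'
  obtain ⟨i, rfl⟩ := Nat.exists_eq_add_of_le hj.le
  rw [Nat.add_sub_cancel_left, div_pow, ← pow_mul, pow_add t]
  field_simp

/-- The graded terms as mean values over a torus. -/
lemma succ_mul_gradedTerm {ε M c : ℝ} (hfam : fam Polynomial.X (fun i => Polynomial.C (a i))
      - single 0 (Polynomial.C (a i₀)) = single ((1, 0) : ℤ × ℤ) (Polynomial.X : Polynomial ℝ) +
      mapRingHom (ℤ × ℤ) (Polynomial.C : ℝ →+* Polynomial ℝ) B) (hc : c ≠ 0) (hε : ε / M = -1 / c)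
    {K : ℝ} (hK : ∀ t : ℝ, 1 ≤ t → ∀ x y : ℂ, ‖x‖ = t ^ 2 → ‖y‖ = (t ^ k)⁻¹ → ‖B.eval x y‖ ≤ K / t)
    (n : ℕ) {t : ℝ} (ht : 1 ≤ t) (hKt : K / t < |c|) :
    (((n + 1) * gradedTerm fam i₀ a ε M (n + 1) : ℝ) : ℂ) =
      circMean fun α : ℝ => circMean fun β : ℝ =>
        (-((t ^ 2 : ℝ) * cis α) / (c + B.eval ((t ^ 2 : ℝ) * cis α)
          (((t ^ k)⁻¹ : ℝ) * cis β))) ^ (n + 1) := by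
  have ht0 : 0 < t := one_pos.trans_le ht
  have ht2 : 0 < t ^ 2 := by positivity
  have hti : 0 < (t ^ k)⁻¹ := by positivity
  have hx : ∀ α : ℝ, ((t ^ 2 : ℝ) : ℂ) * cis α ≠ 0 := fun α =>
    mul_ne_zero (mod_cast ht2.ne') (exp_ne_zero _)
  have hy : ∀ β : ℝ, (((t ^ k)⁻¹ : ℝ) : ℂ) * cis β ≠ 0 := fun β =>
    mul_ne_zero (mod_cast hti.ne') (exp_ne_zero _)
  have hc' : (c : ℂ) ≠ 0 := mod_cast hc
  have hc0 : 0 < |c| := abs_pos.2 hc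
  have hK0 : 0 ≤ K / t := (norm_nonneg _).trans
    (hK t ht _ _ (norm_mul_exp ht2 0) (norm_mul_exp hti 0))
  obtain ⟨w, hw⟩ : ∃ w : ℝ → ℝ → ℂ, w = fun α β => -(B.onTorus 0 0 (t ^ 2) (t ^ k)⁻¹ α β) / c := ⟨_, rfl⟩
  have hwc : Continuous fun z : ℝ × ℝ => w z.1 z.2 := by
    rw [hw]; exact (B.continuous_onTorus 0 0 _ _).neg.div_const _
  have hwq : ∀ α β, ‖w α β‖ ≤ K / t / |c| := fun α β => by
    rw [hw, norm_div, norm_neg, norm_real, norm_eq_abs]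
    exact div_le_div_of_nonneg_right (hK t ht _ _ (norm_mul_exp ht2 _) (norm_mul_exp hti _)) hc0.le
  have hwv : ∀ α β : ℝ, w α β = -(B.eval ((t ^ 2 : ℝ) * cis α)
      (((t ^ k)⁻¹ : ℝ) * cis β)) / c := fun α β => by rw [hw]; rfl
  have hq1 : K / t / |c| < 1 := (div_lt_one hc0).2 hKt
  have hsum := hasSum_circMean_choose (u := fun α _ => -((t ^ 2 : ℝ) * cis α) / c) (w := w)
    (U := t ^ 2 / |c|) (by fun_prop) hwc (fun α _ => by simp) hwq hq1 n
  have hterm : ∀ j, (circMean fun α : ℝ => circMean fun β : ℝ =>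
      (-((t ^ 2 : ℝ) * cis α) / c) ^ (n + 1) * (((j + n).choose n : ℂ) * w α β ^ j)) =
      ((((j + n).choose n : ℝ) * (ε / M) ^ (n + 1 + j) *
        (single ((1, 0) : ℤ × ℤ) (1 : ℝ) ^ (n + 1) * B ^ j).coeff 0 : ℝ) : ℂ) := by
    intro j
    rw [ofReal_mul, ← circMean_circMean_onTorus _ ht2 hti, ← circMean_const_mul]
    refine circMean_congr fun α => ?_
    rw [← circMean_const_mul]
    refine circMean_congr fun β => ?_
    rw [onTorus, ← Laurent2.eval, Laurent2.eval_mul (hx α) (hy β),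
      Laurent2.eval_pow (hx α) (hy β), Laurent2.eval_pow (hx α) (hy β), hwv,
      eval_single_one_zero, hε]
    push_cast
    rw [pow_add (-1 / (c : ℂ)), neg_div, neg_pow (_ / (c : ℂ)), neg_div, neg_pow (_ / (c : ℂ)) j,
      neg_div, neg_pow (1 / (c : ℂ)), neg_pow (1 / (c : ℂ)) j]
    simp only [div_pow, one_pow]
    ring
  simp only [hterm] at hsum
  rw [succ_mul_gradedTerm_eq_sum hfam, ofReal_sum]
  have hzero : ∀ j ∉ range (2 * (n + 1) + 1), ((((j + n).choose n : ℝ) * (ε / M) ^ (n + 1 + j) *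
        (single ((1, 0) : ℤ × ℤ) (1 : ℝ) ^ (n + 1) * B ^ j).coeff 0 : ℝ) : ℂ) = 0 := by
    intro j hj
    rw [mem_range, not_lt] at hj
    rw [coeff_zero_eq_zero hK (by omega), mul_zero, ofReal_zero]
  rw [(hasSum_sum_of_ne_finset_zero hzero).unique hsum]
  refine circMean_congr fun α => circMean_congr fun β => ?_
  have h1 : 1 - w α β ≠ 0 := by
    intro h
    have := hwq α β
    rw [← sub_eq_zero.1 h, norm_one] at this
    linarith
  have h2 : (c : ℂ) + B.eval ((t ^ 2 : ℝ) * cis α) (((t ^ k)⁻¹ : ℝ) * cis β) = c * (1 - w α β) := by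
    rw [hwv]; field_simp; ring
  rw [h2, div_div]

end gradedMean

section setup

open Polynomial in
lemma famGG_eq_single_add (g : ℕ) (a : Fin g → ℝ) (i₀ : Fin g) :
    famGG g (X : ℝ[X]) (fun i => C (a i)) - single 0 (C (a i₀)) =
      single ((1, 0) : ℤ × ℤ) (X : ℝ[X]) + mapRingHom (ℤ × ℤ) (C : ℝ →+* ℝ[X])
        (famGG g 0 a - single 0 (a i₀)) := by
  simp only [famGG, map_sub, map_add, map_sum, mapRingHom_single, map_one,
    single_zero, zero_add]
  abel

open Polynomial in
lemma famHyp_eq_single_add (g : ℕ) (a : Fin g → ℝ) (i₀ : Fin g) :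
    famHyp g (X : ℝ[X]) (fun i => C (a i)) - single 0 (C (a i₀)) =
      single ((1, 0) : ℤ × ℤ) (X : ℝ[X]) + mapRingHom (ℤ × ℤ) (C : ℝ →+* ℝ[X])
        (famHyp g 0 a - single 0 (a i₀)) := by
  simp only [famHyp, map_sub, map_add, map_sum, mapRingHom_single, map_one,
    single_zero, zero_add]
  abel

variable {g : ℕ} (a : Fin g → ℝ) {x y : ℂ}

lemma Laurent2.eval_sub {x y : ℂ} (F G : Laurent2 ℝ) (hx : x ≠ 0) (hy : y ≠ 0) :
    (F - G).eval x y = F.eval x y - G.eval x y := by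
  rw [← evalHom_apply hx hy, map_sub, evalHom_apply, evalHom_apply]

lemma eval_famGG_zero_sub (i₀ : Fin g) (hx : x ≠ 0) (hy : y ≠ 0) :
    (famGG g 0 a - single 0 (a i₀)).eval x y = (famGG g 1 a).eval x y - x - a i₀ := by
  have h : famGG g 0 a = famGG g 1 a - single ((1, 0) : ℤ × ℤ) (1 : ℝ) := by
    simp only [famGG, single_zero, zero_add]; abel
  rw [h, eval_sub_single_zero hx hy, eval_sub _ _ hx hy, eval_single_one_zero]

lemma eval_famHyp_zero_sub (i₀ : Fin g) (hx : x ≠ 0) (hy : y ≠ 0) :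
    (famHyp g 0 a - single 0 (a i₀)).eval x y = (famHyp g 1 a).eval x y - x - a i₀ := by
  have h : famHyp g 0 a = famHyp g 1 a - single ((1, 0) : ℤ × ℤ) (1 : ℝ) := by
    simp only [famHyp, single_zero, zero_add]; abel
  rw [h, eval_sub_single_zero hx hy, eval_sub _ _ hx hy, eval_single_one_zero]

lemma inv_pow_le_inv {t : ℝ} (ht : 1 ≤ t) {n : ℕ} (hn : n ≠ 0) : (t ^ n)⁻¹ ≤ t⁻¹ :=
  inv_anti₀ (one_pos.trans_le ht) (le_self_pow₀ ht hn)

lemma norm_sum_sub_le_div {t : ℝ} (ht : 1 ≤ t) (hg : 0 < g) {f : Fin g → ℂ}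
    (hf : ∀ i, i ≠ ⟨0, hg⟩ → ‖f i‖ ≤ t⁻¹) (h0 : f ⟨0, hg⟩ = 1) :
    ‖(∑ i, (a i : ℂ) * f i) - a ⟨0, hg⟩‖ ≤ (∑ i, |a i|) / t := by
  have ht0 : 0 < t := one_pos.trans_le ht
  rw [← Finset.add_sum_erase _ _ (Finset.mem_univ (⟨0, hg⟩ : Fin g)), h0, mul_one,
    add_sub_cancel_left, div_eq_mul_inv]
  calc _ ≤ ∑ i ∈ Finset.univ.erase ⟨0, hg⟩, |a i| * t⁻¹ :=
        (norm_sum_le _ _).trans (Finset.sum_le_sum fun i hi => by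
          rw [norm_mul, norm_real, norm_eq_abs]
          exact mul_le_mul_of_nonneg_left (hf i (Finset.ne_of_mem_erase hi)) (abs_nonneg _))
    _ ≤ _ := by
      rw [← Finset.sum_mul]
      simp_all

lemma norm_eval_famGG_zero_sub_le (hg : 0 < g) {t : ℝ} (ht : 1 ≤ t) (hx : ‖x‖ = t ^ 2)
    (hy : ‖y‖ = t⁻¹) : ‖(famGG g 0 a - single 0 (a ⟨0, hg⟩)).eval x y‖ ≤ (2 + ∑ i, |a i|) / t := by
  have ht0 : 0 < t := one_pos.trans_le ht
  have hx0 : x ≠ 0 := norm_pos_iff.1 (by rw [hx]; positivity)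
  have hy0 : y ≠ 0 := norm_pos_iff.1 (by rw [hy]; positivity)
  have hn : ∀ i : ℕ, ‖x ^ (-(i : ℤ)) * y ^ (-(i : ℤ))‖ = (t ^ i)⁻¹ := fun i => by
    rw [← mul_zpow, norm_zpow, norm_mul, hx, hy, zpow_neg, zpow_natCast]
    congr 2; field_simp
  rw [eval_famGG_zero_sub a _ hx0 hy0, eval_famGG]
  have h1 := norm_sum_sub_le_div a ht hg (f := fun i => x ^ (-(i : ℤ)) * y ^ (-(i : ℤ)))
    (fun i hi => by rw [hn]; exact inv_pow_le_inv ht (fun h => hi (Fin.ext h))) (by simp)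
  have h2 : ‖x ^ (-(g : ℤ)) * y ^ (-(g : ℤ))‖ ≤ t⁻¹ := by rw [hn]; exact inv_pow_le_inv ht hg.ne'
  have h3 := norm_add₃_le (a := y) (b := x ^ (-(g : ℤ)) * y ^ (-(g : ℤ)))
    (c := (∑ i, (a i : ℂ) * (x ^ (-(i : ℤ)) * y ^ (-(i : ℤ)))) - a ⟨0, hg⟩)
  grind

lemma norm_eval_famHyp_zero_sub_le (hg : 0 < g) {t : ℝ} (ht : 1 ≤ t) (hx : ‖x‖ = t ^ 2)
    (hy : ‖y‖ = (t ^ (2 * g - 1))⁻¹) :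
    ‖(famHyp g 0 a - single 0 (a ⟨0, hg⟩)).eval x y‖ ≤ (2 + ∑ i, |a i|) / t := by
  have ht0 : 0 < t := one_pos.trans_le ht
  have hx0 : x ≠ 0 := norm_pos_iff.1 (by rw [hx]; positivity)
  have hy0 : y ≠ 0 := norm_pos_iff.1 (by rw [hy]; positivity)
  have hn : ∀ i : ℕ, ‖x ^ (-(i : ℤ))‖ = (t ^ (2 * i))⁻¹ := fun i => by
    rw [norm_zpow, hx, zpow_neg, zpow_natCast, ← pow_mul]
  rw [eval_famHyp_zero_sub a _ hx0 hy0, eval_famHyp]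
  have h1 := norm_sum_sub_le_div a ht hg (f := fun i => x ^ (-(i : ℤ))) (fun i hi => by
      rw [hn]; exact inv_pow_le_inv ht (fun h => hi (Fin.ext (by
        change (i : ℕ) = 0; omega)))) (by simp)
  have hy1 : ‖y‖ ≤ t⁻¹ := by rw [hy]; exact inv_pow_le_inv ht (by omega)
  have h2 : ‖x ^ (1 - 2 * (g : ℤ)) * y⁻¹‖ ≤ t⁻¹ := by
    refine le_trans (le_of_eq ?_) hy1
    rw [norm_mul, norm_zpow, norm_inv, hx, hy, inv_inv,
      show (1 - 2 * (g : ℤ)) = -((2 * g - 1 : ℕ) : ℤ) by omega, zpow_neg, zpow_natCast, ← pow_mul,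
      mul_comm 2, pow_mul, sq]
    field_simp
  have h3 := norm_add₃_le (a := y) (b := x ^ (1 - 2 * (g : ℤ)) * y⁻¹)
    (c := (∑ i, (a i : ℂ) * x ^ (-(i : ℤ))) - a ⟨0, hg⟩)
  calc _ = ‖y + x ^ (1 - 2 * (g : ℤ)) * y⁻¹ +
        ((∑ i, (a i : ℂ) * x ^ (-(i : ℤ))) - a ⟨0, hg⟩)‖ := by congr 1; ring
    _ ≤ t⁻¹ + t⁻¹ + (∑ i, |a i|) / t := by linarith
    _ = _ := by field_simp; ring

end setup

section extremeCoeff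

open Polynomial

variable {g : ℕ}

lemma chebCoeff_zero (hg : 0 < g) : chebCoeff g ⟨0, hg⟩ = (-1) ^ g * (2 * g + 1) := by
  have h1 := oddPoly_coeff_odd g (chebCoeff g) ⟨0, hg⟩
  have h2 := derivative_chebyshevC_eval_cos (2 * (g : ℤ) + 1) (π / 2 : ℂ)
  have h3 : ((2 * (g : ℤ) + 1 : ℤ) : ℂ) * (π / 2) = π / 2 + g * π := by push_cast; ring
  rw [h3, Complex.sin_antiperiodic.add_nat_mul_eq, sin_pi_div_two, cos_pi_div_two, mul_zero, mul_one, mul_one,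
    ← oddPoly_chebCoeff, ← coeff_zero_eq_eval_zero, coeff_derivative] at h2
  simp only [mul_zero, zero_add, Nat.cast_zero, mul_one] at h1 h2
  rw [h1] at h2
  have : ((chebCoeff g ⟨0, hg⟩ : ℝ) : ℂ) = (((-1) ^ g * (2 * g + 1) : ℝ) : ℂ) := by
    rw [h2]; push_cast; ring
  exact_mod_cast this

lemma chebCoeff_last (hg : 0 < g) : chebCoeff g (rev ⟨0, hg⟩) = -(2 * g + 1) := by
  obtain ⟨k, rfl⟩ := Nat.exists_eq_add_of_lt hg
  have h1 := oddPoly_coeff_odd _ (chebCoeff (0 + k + 1)) (rev ⟨0, hg⟩)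
  have h2 := coeff_of_ode (oddPoly_chebCoeff_ode (g := 0 + k + 1)) (2 * k + 1)
  have h3 := oddPoly_coeff_top (0 + k + 1) (chebCoeff (0 + k + 1))
  rw [show 2 * (((rev (⟨0, hg⟩ : Fin (0 + k + 1)) : Fin (0 + k + 1)) : ℕ)) + 1 = 2 * k + 1 by
    rw [val_rev]; simp] at h1
  rw [show 2 * (0 + k + 1) + 1 = 2 * k + 1 + 2 by ring] at h3
  rw [h1, h3] at h2
  push_cast at h2
  have h4 : (8 * ((k : ℂ) + 1)) ≠ 0 := by
    have : ((k : ℂ) + 1) ≠ 0 := by norm_cast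
    exact mul_ne_zero (by norm_num) this
  have : ((chebCoeff (0 + k + 1) (rev ⟨0, hg⟩) : ℝ) : ℂ) =
      ((-(2 * ((0 + k + 1 : ℕ) : ℝ) + 1) : ℝ) : ℂ) := by
    apply mul_left_cancel₀ h4
    push_cast
    linear_combination h2
  exact_mod_cast this

end extremeCoeff

section means

lemma circMean_shear {f : ℝ → ℝ → ℂ} (hf : Continuous fun z : ℝ × ℝ => f z.1 z.2)
    (h₁ : ∀ α β, f (α + 2 * π) β = f α β) :
    circMean (fun α => circMean (f α)) = circMean fun γ => circMean fun β => f (γ - β) β := by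
  rw [circMean_comm hf, circMean_comm (f := fun γ β => f (γ - β) β)
    (hf.comp (by fun_prop : Continuous fun z : ℝ × ℝ => (z.1 - z.2, z.2)))]
  refine circMean_congr fun β => ?_
  rw [← circMean_add_left_periodic (fun α => h₁ α β) (-β)]
  grind

lemma circMean_div_mul_add_pow {z P : ℂ} {s : ℝ} (hs : 0 < s) (hsP : s < ‖P‖) (n : ℕ) :
    circMean (fun β : ℝ => (z / (s * cis β * (s * cis β + P))) ^ (n + 1)) =
      ((2 * n + 1).choose n : ℂ) * (-z / P ^ 2) ^ (n + 1) := by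
  have hP0 : 0 < ‖P‖ := hs.trans hsP
  have hP : P ≠ 0 := norm_pos_iff.1 hP0
  have hs' : (s : ℂ) ≠ 0 := mod_cast hs.ne'
  have hq : s / ‖P‖ < 1 := (div_lt_one hP0).2 hsP
  have hy : ∀ β : ℝ, ‖-(s * cis β) / P‖ = s / ‖P‖ := fun β => by
    rw [norm_div, norm_neg, norm_mul_exp hs]
  have hsummable : Summable fun j : ℕ =>
      ‖z / (s * P)‖ ^ (n + 1) * (((j + n).choose n : ℝ) * (s / ‖P‖) ^ j) := by
    have h : Summable fun j : ℕ => ((j + n).choose n : ℝ) * (s / ‖P‖) ^ j :=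
      summable_choose_mul_geometric_of_norm_lt_one (R := ℝ) n
        (by rw [norm_of_nonneg (by positivity)]; exact hq)
    exact h.mul_left _
  have hsum := hasSum_circMean (f := fun j (β : ℝ) => (z / (s * cis β * P)) ^ (n + 1) *
      (((j + n).choose n : ℂ) * (-(s * cis β) / P) ^ j))
    (F := fun β : ℝ => (z / (s * cis β * (s * cis β + P))) ^ (n + 1))
    (b := fun j => ‖z / (s * P)‖ ^ (n + 1) * (((j + n).choose n : ℝ) * (s / ‖P‖) ^ j))
    (fun j => by
      have : ∀ β : ℝ, (s : ℂ) * cis β * P ≠ 0 := fun β =>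
        mul_ne_zero (mul_ne_zero hs' (exp_ne_zero _)) hP
      fun_prop (disch := exact this _))
    hsummable
    (fun j β => le_of_eq (by
      rw [norm_mul, norm_pow, norm_mul (((j + n).choose n : ℕ) : ℂ), norm_pow, norm_natCast, hy,
        norm_div, norm_div, norm_mul (s * cis β) P, norm_mul (s : ℂ) P, norm_mul_exp hs,
        norm_real, norm_of_nonneg hs.le]))
    (fun β => by
      have h := (hasSum_choose_mul_geometric_of_norm_lt_one n (r := -(s * cis β) / P)
        (by rw [hy]; exact hq)).mul_left ((z / (s * cis β * P)) ^ (n + 1))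
      have h1 : P * (1 - -(s * cis β) / P) = s * cis β + P := by field_simp; ring
      rw [← div_eq_mul_one_div, ← div_pow, div_div, mul_assoc (s * cis β) P, h1] at h
      exact h)
  have hterm : ∀ j : ℕ, circMean (fun β : ℝ => (z / (s * cis β * P)) ^ (n + 1) *
      (((j + n).choose n : ℂ) * (-(s * cis β) / P) ^ j)) =
      (z / (s * P)) ^ (n + 1) * ((j + n).choose n : ℂ) * (-s / P) ^ j *
        if (j : ℤ) - (n + 1) = 0 then 1 else 0 := by
    intro j
    rw [← circMean_exp_int_mul, ← circMean_const_mul]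
    refine circMean_congr fun β => ?_
    have : exp ((((j : ℤ) - (n + 1) : ℤ) * β : ℝ) * I) = cis β ^ j * ((cis β) ^ (n + 1))⁻¹ := by
      rw [← exp_nat_mul, ← exp_nat_mul, ← exp_neg, ← exp_add]
      congr 1; push_cast; ring
    rw [this]
    have he := exp_ne_zero (β * I)
    simp only [div_pow, mul_pow, neg_pow (_ * _ : ℂ) j, neg_pow (s : ℂ) j]
    field_simp
  simp only [hterm] at hsum
  have h0 : ∀ j ≠ n + 1, (z / (s * P)) ^ (n + 1) * ((j + n).choose n : ℂ) * (-s / P) ^ j *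
        (if (j : ℤ) - (n + 1) = 0 then 1 else 0) = 0 := fun j hj => by
    rw [if_neg (by omega), mul_zero]
  rw [hsum.unique (hasSum_single (n + 1) h0), if_pos (by push_cast; ring), mul_one,
    show n + 1 + n = 2 * n + 1 by ring, mul_right_comm, ← mul_pow, mul_comm]
  congr 2
  field_simp

end means

section dominated

lemma ae_sin_ne_zero : ∀ᵐ t : ℝ, rsin t ≠ 0 := by
  have h : {t : ℝ | ¬rsin t ≠ 0} = Set.range fun n : ℤ => (n : ℝ) * π := by
    ext t; simp [Real.sin_eq_zero_iff]
  rw [MeasureTheory.ae_iff, h]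
  exact (Set.countable_range _).measure_zero _

/-- Termwise integration where the terms are dominated by `(1 + κ sin²) ^ (-n) / n`. -/
lemma hasSum_circMean_of_sin_sq {f : ℕ → ℝ → ℝ} {F : ℝ → ℝ} {C κ : ℝ} (hκ : 0 < κ)
    (hf : ∀ n, Continuous (f n))
    (hb : ∀ n t, rsin t ≠ 0 → |f n t| ≤ C * ((1 + κ * rsin t ^ 2)⁻¹ ^ (n + 1) / (n + 1)))
    (h : ∀ t, rsin t ≠ 0 → HasSum (fun n => f n t) (F t)) :
    HasSum (fun n => circMean (f n)) (circMean F) := by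
  have hsum : ∀ t, rsin t ≠ 0 → HasSum (fun n : ℕ => C * ((1 + κ * rsin t ^ 2)⁻¹ ^ (n + 1) /
      (n + 1))) (C * (rlog (1 + κ * rsin t ^ 2) - (rlog κ + 2 * rlog (rsin t)))) := by
    intro t ht
    have h0 : 0 < κ * rsin t ^ 2 := by positivity
    have h1 : |(1 + κ * rsin t ^ 2)⁻¹| < 1 := by
      rw [abs_of_pos (by positivity)]
      exact inv_lt_one_of_one_lt₀ (by linarith)
    have := (Real.hasSum_pow_div_log_of_abs_lt_one h1).mul_left C
    rwa [show 1 - (1 + κ * rsin t ^ 2)⁻¹ =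
        κ * rsin t ^ 2 * (1 + κ * rsin t ^ 2)⁻¹ by field_simp; ring,
      Real.log_mul h0.ne' (by positivity), Real.log_inv, Real.log_mul hκ.ne' (by positivity),
      Real.log_pow, neg_add, neg_neg, neg_add_eq_sub, Nat.cast_ofNat] at this
  refine HasSum.const_smul _ ?_
  refine intervalIntegral.hasSum_integral_of_dominated_convergence
    (fun (n : ℕ) t => C * ((1 + κ * rsin t ^ 2)⁻¹ ^ (n + 1) / (n + 1)))
    (fun n => (hf n).aestronglyMeasurable) (fun n => ?_) ?_ ?_ ?_
  · filter_upwards [ae_sin_ne_zero] with t ht _ using hb n t ht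
  · filter_upwards [ae_sin_ne_zero] with t ht _ using (hsum t ht).summable
  · have hI : IntervalIntegrable (fun t => C * (rlog (1 + κ * rsin t ^ 2) -
        (rlog κ + 2 * rlog (rsin t)))) volume 0 (2 * π) := by
      refine IntervalIntegrable.const_mul (IntervalIntegrable.sub ?_
        (intervalIntegrable_const.add (intervalIntegrable_log_sin.const_mul 2))) C
      refine Continuous.intervalIntegrable (Continuous.log (by fun_prop) fun t => ?_) _ _
      positivity
    refine hI.congr_ae (MeasureTheory.ae_restrict_of_ae ?_)
    filter_upwards [ae_sin_ne_zero] with t ht using (hsum t ht).tsum_eq.symm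
  · filter_upwards [ae_sin_ne_zero] with t ht _ using h t ht

end dominated

section annulus

lemma circMean_eq_of_annulus {f : ℂ → ℂ} {r R : ℝ} (hr : 0 < r) (hrR : r ≤ R)
    (hd : ∀ z : ℂ, r ≤ ‖z‖ → ‖z‖ ≤ R → DifferentiableAt ℂ f z) :
    circMean (fun β : ℝ => f (r * cis β)) = circMean fun β : ℝ => f (R * cis β) := by
  have h := Complex.circleIntegral_sub_center_inv_smul_eq_of_differentiable_on_annulus_off_countable
    (c := 0) hr hrR (f := f) Set.countable_empty (fun z hz => by
      simp only [Set.mem_sdiff, Metric.mem_closedBall, dist_zero_right, Metric.mem_ball, not_lt] at hz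
      exact (hd z hz.2 hz.1).continuousAt.continuousWithinAt)
    (fun z hz => by
      simp only [Set.sdiff_empty, Set.mem_sdiff, Metric.mem_closedBall, dist_zero_right,
        Metric.mem_ball, not_le] at hz
      exact hd z hz.2.le hz.1.le)
  have key : ∀ ρ : ℝ, 0 < ρ → (∮ z in C(0, ρ), (z - 0)⁻¹ • f z) =
      I * ∫ β in (0 : ℝ)..2 * π, f (ρ * cis β) := by
    intro ρ hρ
    rw [circleIntegral, ← integral_const_mul]
    refine integral_congr fun β _ => ?_
    have h0 : (ρ : ℂ) * cis β ≠ 0 := mul_ne_zero (mod_cast hρ.ne') (exp_ne_zero _)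
    have h1 : (ρ : ℂ) ≠ 0 := mod_cast hρ.ne'
    simp only [deriv_circleMap, circleMap, zero_add, sub_zero, smul_eq_mul]
    field_simp
  rw [key r hr, key R (hr.trans_le hrR)] at h
  rw [circMean, circMean, mul_left_cancel₀ I_ne_zero h]

lemma circMean_two_mul_cos_pow (n : ℕ) :
    circMean (fun φ : ℝ => ((2 * rcos φ : ℝ) : ℂ) ^ (2 * n)) = ((2 * n).choose n : ℂ) := by
  have h : ∀ φ : ℝ, ((2 * rcos φ : ℝ) : ℂ) ^ (2 * n) = ∑ k ∈ range (2 * n + 1),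
      ((2 * n).choose k : ℂ) * exp ((((2 * k : ℤ) - 2 * n : ℤ) * φ : ℝ) * I) := by
    intro φ
    rw [ofReal_mul, ofReal_ofNat, ← exp_add_inv_exp, add_pow]
    refine sum_congr rfl fun k hk => ?_
    rw [mem_range, Nat.lt_succ_iff] at hk
    obtain ⟨j, hj⟩ := Nat.exists_eq_add_of_le hk
    rw [mul_comm, hj, Nat.add_sub_cancel_left, ← exp_neg, ← exp_nat_mul, ← exp_nat_mul, ← exp_add]
    congr 2
    have : (2 * n : ℂ) = k + j := mod_cast hj
    push_cast
    rw [this]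
    ring
  rw [circMean_congr h, circMean_sum _ fun k _ => by fun_prop]
  simp only [circMean_const_mul, circMean_exp_int_mul]
  rw [sum_eq_single n]
  · simp
  · grind
  · intro hn
    exact absurd (mem_range.2 (by omega)) hn

lemma choose_two_mul_succ (n : ℕ) : (2 * (n + 1)).choose (n + 1) = 2 * (2 * n + 1).choose n := by
  rw [show 2 * (n + 1) = 2 * n + 1 + 1 by ring, Nat.choose_succ_succ,
    Nat.choose_symm_of_eq_add (show 2 * n + 1 = n + 1 + n by ring)]
  ring

end annulus

section gradedGG

open Filter

variable {g : ℕ}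

lemma halfPoly_eval_ne_zero {u : ℂ} (hu : ‖u‖ ≤ critRadius g g ^ 2) : (chebHalf g).eval u ≠ 0 := by
  rw [halfPoly_eval_eq_prod]
  refine prod_ne_zero_iff.2 fun k hk h => ?_
  rw [sub_eq_zero] at h
  have h1 := chebZero_gt (mem_range.1 hk) le_rfl
  rw [h, norm_pow, norm_real, norm_eq_abs, sq_abs] at hu
  have h2 := critRadius_pos (le_refl g)
  nlinarith

lemma halfPoly_eval_zero (hg : 0 < g) : (chebHalf g).eval 0 = (chebCoeff g ⟨0, hg⟩ : ℂ) := by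
  rw [halfPoly_eval, zero_pow hg.ne', zero_add,
    sum_eq_single (⟨0, hg⟩ : Fin g) (fun i _ hi => ?_) (by simp)]
  · simp
  · rw [zero_pow (fun h => hi (Fin.ext h)), mul_zero]

lemma circMean_inv_halfPoly {r : ℝ} (hr : 0 < r) (hrσ : r ≤ critRadius g g ^ 2) (n : ℕ) :
    circMean (fun γ : ℝ => (((r * exp ((-γ : ℝ) * I)) *
      (chebHalf g).eval (r * exp ((-γ : ℝ) * I)) ^ 2)⁻¹) ^ (n + 1)) = circMean fun θ : ℝ =>
        (((chebOdd g).eval ((critRadius g g : ℂ) * cis θ) ^ 2)⁻¹) ^ (n + 1) := by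
  set P := chebHalf g with hP
  have hσ := critRadius_pos (le_refl g)
  have hd : ∀ z : ℂ, r ≤ ‖z‖ → ‖z‖ ≤ critRadius g g ^ 2 →
      DifferentiableAt ℂ (fun u : ℂ => ((u * P.eval u ^ 2)⁻¹) ^ (n + 1)) z := by
    intro z h1 h2
    have h3 : z * P.eval z ^ 2 ≠ 0 := mul_ne_zero (norm_pos_iff.1 (hr.trans_le h1))
      (pow_ne_zero _ (halfPoly_eval_ne_zero h2))
    fun_prop
  have h1 := circMean_neg_periodic (f := fun γ : ℝ => ((r * cis γ *
    P.eval (r * cis γ) ^ 2)⁻¹) ^ (n + 1)) (fun γ => by simp only [exp_add_two_pi_mul_I])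
  rw [h1, circMean_eq_of_annulus hr hrσ hd, ← circMean_nat_mul_periodic (n := 2) (fun γ => by
    simp only [exp_add_two_pi_mul_I]) ?_ two_ne_zero]
  · refine circMean_congr fun θ => ?_
    have : ((critRadius g g : ℂ) * cis θ) ^ 2 =
        (critRadius g g ^ 2 : ℝ) * exp (((2 : ℕ) * θ : ℝ) * I) := by
      rw [mul_pow, ← exp_nat_mul]; push_cast; ring_nf
    rw [← mul_halfPoly_eval_sq, mul_pow, this]
  · rw [continuous_iff_continuousAt]
    intro β
    have hn := norm_mul_exp (pow_pos hσ 2) β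
    exact ContinuousAt.comp (f := fun β : ℝ => ((critRadius g g ^ 2 : ℝ) : ℂ) * cis β)
      (hd _ (by rw [hn]; exact hrσ) hn.le).continuousAt (by fun_prop)

lemma exists_large_radius (hg : 0 < g) : ∃ t : ℝ, 1 ≤ t ∧
      (2 + ∑ i, |chebCoeff g i|) / t < |chebCoeff g ⟨0, hg⟩| ∧
      (∀ u : ℂ, ‖u‖ = t⁻¹ → t⁻¹ < ‖(chebHalf g).eval u‖) ∧ t⁻¹ ≤ critRadius g g ^ 2 := by
  have hc : chebCoeff g ⟨0, hg⟩ ≠ 0 := by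
    rw [chebCoeff_zero hg]; exact mul_ne_zero (pow_ne_zero _ (by norm_num)) (by positivity)
  have h1 : Tendsto (fun t : ℝ => (2 + ∑ i, |chebCoeff g i|) / t) atTop (nhds 0) :=
    tendsto_const_nhds.div_atTop tendsto_id
  have h2 : ∀ᶠ u : ℂ in nhds 0, ‖u‖ < ‖(chebHalf g).eval u‖ := by
    refine ContinuousAt.eventually_lt (by fun_prop) ((chebHalf g).continuous.norm.continuousAt) ?_
    rw [norm_zero, norm_pos_iff, halfPoly_eval_zero hg]
    exact mod_cast hc
  obtain ⟨δ, hδ, h2⟩ := Metric.eventually_nhds_iff.1 h2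
  obtain ⟨t, h3, h4, h5, h6⟩ := ((eventually_ge_atTop 1).and
    ((h1.eventually (gt_mem_nhds (abs_pos.2 hc))).and
    ((tendsto_inv_atTop_zero.eventually (gt_mem_nhds hδ)).and (tendsto_inv_atTop_zero.eventually
      (ge_mem_nhds (pow_pos (critRadius_pos (le_refl g)) 2)))))).exists
  exact ⟨t, h3, h4, fun u hu => by rw [← hu]; exact h2 (by rwa [dist_zero_right, hu]), h6⟩

lemma circMean_div_add_halfPoly {P : Polynomial ℂ} {t : ℝ} (ht : 0 < t)
    (hPt : ∀ u : ℂ, ‖u‖ = t⁻¹ → t⁻¹ < ‖P.eval u‖) (n : ℕ) :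
    (circMean fun α : ℝ => circMean fun β : ℝ =>
      (-((t ^ 2 : ℝ) * cis α) / ((t⁻¹ : ℝ) * cis β +
        P.eval ((t⁻¹ : ℝ) * (cis α * cis β)⁻¹))) ^ (n + 1)) =
    ((2 * n + 1).choose n : ℂ) * circMean fun γ : ℝ =>
      ((((t⁻¹ : ℝ) * exp ((-γ : ℝ) * I)) * P.eval ((t⁻¹ : ℝ) * exp ((-γ : ℝ) * I)) ^ 2)⁻¹) ^ (n + 1) := by
  have hti : 0 < t⁻¹ := inv_pos.2 ht
  have ht' : (t : ℂ) ≠ 0 := mod_cast ht.ne'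
  have hexp : ∀ γ : ℝ, cis γ ≠ 0 := fun γ => exp_ne_zero _
  have hne : ∀ α β : ℝ, ((t⁻¹ : ℝ) : ℂ) * cis β + P.eval ((t⁻¹ : ℝ) * (cis α * cis β)⁻¹) ≠ 0 := by
    intro α β h
    have h1 := hPt ((t⁻¹ : ℝ) * (cis α * cis β)⁻¹) (by
      rw [norm_mul, norm_inv, norm_mul, norm_exp_ofReal_mul_I, norm_exp_ofReal_mul_I, mul_one,
        inv_one, mul_one, norm_real, norm_of_nonneg hti.le])
    rw [eq_neg_of_add_eq_zero_right h, norm_neg, norm_mul_exp hti] at h1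
    exact lt_irrefl _ h1
  have hc1 : Continuous fun z : ℝ × ℝ => -(((t ^ 2 : ℝ) : ℂ) * cis z.1) := by fun_prop
  have hc3 : Continuous fun z : ℝ × ℝ => (cis z.1 * cis z.2)⁻¹ :=
    Continuous.inv₀ (by fun_prop) fun z => mul_ne_zero (hexp _) (hexp _)
  have hc2 : Continuous fun z : ℝ × ℝ => ((t⁻¹ : ℝ) : ℂ) * cis z.2 +
      P.eval ((t⁻¹ : ℝ) * (cis z.1 * cis z.2)⁻¹) := by fun_prop
  rw [circMean_shear (f := fun α β : ℝ => (-((t ^ 2 : ℝ) * cis α) / ((t⁻¹ : ℝ) * cis β +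
        P.eval ((t⁻¹ : ℝ) * (cis α * cis β)⁻¹))) ^ (n + 1)), ← circMean_const_mul]
  · refine circMean_congr fun γ => ?_
    have hz : - -(t * cis γ) = ((t⁻¹ : ℝ) * exp ((-γ : ℝ) * I))⁻¹ := by
      rw [neg_neg, ofReal_neg, neg_mul, exp_neg]; push_cast; field_simp
    rw [mul_inv, ← div_eq_mul_inv, ← hz,
      ← circMean_div_mul_add_pow (z := -(t * cis γ)) hti (hPt _ (norm_mul_exp hti _)) n]
    refine circMean_congr fun β => ?_
    have h1 : exp ((γ - β : ℝ) * I) = cis γ * (cis β)⁻¹ := by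
      rw [← exp_neg, ← exp_add]; congr 1; push_cast; ring
    have h2 : (exp ((γ - β : ℝ) * I) * cis β)⁻¹ = exp ((-γ : ℝ) * I) := by
      rw [h1, inv_mul_cancel_right₀ (hexp β), ← exp_neg]; congr 1; push_cast; ring
    rw [h2, h1, ← div_div]
    congr 2
    push_cast
    have := hexp β
    field_simp
  · exact (hc1.div hc2 fun z => hne z.1 z.2).pow (n + 1)
  · intro α β
    simp only [exp_add_two_pi_mul_I]

lemma succ_mul_gradedTerm_famGG (hg : 0 < g) (n : ℕ) :
    (((n + 1) * gradedTerm (famGG g) ⟨0, hg⟩ (chebCoeff g) ((-1) ^ (g + 1)) (2 * (g : ℝ) + 1)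
      (n + 1) : ℝ) : ℂ) = ((2 * n + 1).choose n : ℂ) * circMean fun θ : ℝ =>
        (((chebOdd g).eval ((critRadius g g : ℂ) * cis θ) ^ 2)⁻¹) ^ (n + 1) := by
  have hN : (2 * (g : ℝ) + 1) ≠ 0 := by positivity
  have hc : chebCoeff g ⟨0, hg⟩ ≠ 0 := by
    rw [chebCoeff_zero hg]; exact mul_ne_zero (pow_ne_zero _ (by norm_num)) hN
  have hε : (-1 : ℝ) ^ (g + 1) / (2 * g + 1) = -1 / chebCoeff g ⟨0, hg⟩ := by
    rw [chebCoeff_zero hg, pow_succ]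
    rcases neg_one_pow_eq_or ℝ g with h | h <;> rw [h] <;> field_simp
  obtain ⟨t, ht, hKt, hPt, htσ⟩ := exists_large_radius hg
  have ht0 : 0 < t := one_pos.trans_le ht
  have hti : 0 < t⁻¹ := inv_pos.2 ht0
  have ht' : (t : ℂ) ≠ 0 := mod_cast ht0.ne'
  rw [succ_mul_gradedTerm (k := 1) (famGG_eq_single_add g (chebCoeff g) ⟨0, hg⟩) hc hε
    (fun t ht x y hx hy => norm_eval_famGG_zero_sub_le _ hg ht hx (by rw [hy, pow_one])) n ht hKt,
    ← circMean_inv_halfPoly hti htσ, ← circMean_div_add_halfPoly ht0 hPt]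
  refine circMean_congr fun α => circMean_congr fun β => ?_
  have hx : ((t ^ 2 : ℝ) : ℂ) * cis α ≠ 0 := mul_ne_zero (mod_cast (by positivity)) (exp_ne_zero _)
  have hy : ((t⁻¹ : ℝ) : ℂ) * cis β ≠ 0 := mul_ne_zero (mod_cast hti.ne') (exp_ne_zero _)
  have hev := eval_famGG_scaled (chebCoeff g) one_ne_zero hx hy
  simp only [one_pow, one_mul, ofReal_one] at hev
  rw [pow_one, eval_famGG_zero_sub _ _ hx hy, hev]
  have h1 : ((t ^ 2 : ℝ) * cis α * ((t⁻¹ : ℝ) * cis β))⁻¹ = (t⁻¹ : ℝ) * (cis α * cis β)⁻¹ := by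
    push_cast; field_simp
  rw [h1]
  congr 2
  ring

end gradedGG

section sumGG

variable {g : ℕ}

lemma hasSum_pow_succ_div_neg_log {z : ℂ} (hz : ‖z‖ < 1) :
    HasSum (fun n : ℕ => z ^ (n + 1) / ((n : ℂ) + 1)) (-log (1 - z)) := by
  have h := (hasSum_nat_add_iff' 1).2 (Complex.hasSum_taylorSeries_neg_log hz)
  simpa using h

lemma circMean_log_norm_oddPoly (hg : 0 < g) : circMean (fun θ : ℝ => rlog ‖(chebOdd g).eval
      ((critRadius g g : ℂ) * cis θ)‖) = rlog (critRadius g g) + rlog (2 * g + 1) := by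
  have hσ := critRadius_pos (le_refl g)
  have hσ2 : 0 < critRadius g g ^ 2 := pow_pos hσ 2
  have hne : ∀ β : ℝ, ∀ k ∈ range g, (critRadius g g ^ 2 : ℝ) * cis β -
      ((chebZero g k ^ 2 : ℝ) : ℂ) ≠ 0 := by
    intro β k hk h
    have := halfPoly_eval_ne_zero (norm_mul_exp hσ2 β).le
    rw [halfPoly_eval_eq_prod] at this
    refine prod_ne_zero_iff.1 this k hk ?_
    rw [← h]; push_cast; rfl
  have hc : ∀ k ∈ range g, Continuous fun β : ℝ => rlog
      ‖(critRadius g g ^ 2 : ℝ) * cis β - ((chebZero g k ^ 2 : ℝ) : ℂ)‖ := fun k hk =>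
    (Continuous.norm (by fun_prop)).log fun β => norm_ne_zero_iff.2 (hne β k hk)
  have hmean : ∀ k ∈ range g, circMean (fun β : ℝ => rlog
      ‖(critRadius g g ^ 2 : ℝ) * cis β - ((chebZero g k ^ 2 : ℝ) : ℂ)‖) =
      rlog (chebZero g k ^ 2) := by
    intro k hk
    have h1 := chebZero_gt (mem_range.1 hk) (le_refl g)
    rw [circMean_log_norm_sub hσ2, abs_of_pos (pow_pos (chebZero_pos (mem_range.1 hk)) 2),
      max_eq_right (pow_le_pow_left₀ hσ.le h1.le 2)]
  have hzero : ∑ k ∈ range g, rlog (chebZero g k ^ 2) = rlog (2 * g + 1) := by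
    have h1 : |chebCoeff g ⟨0, hg⟩| = ∏ k ∈ range g, chebZero g k ^ 2 := by
      have h := congrArg norm ((halfPoly_eval_zero hg).symm.trans (halfPoly_eval_eq_prod 0))
      simp_all
    rw [← log_prod fun k hk => (pow_pos (chebZero_pos (mem_range.1 hk)) 2).ne', ← h1,
      chebCoeff_zero hg, abs_mul, abs_pow, abs_neg, abs_one, one_pow, one_mul,
      abs_of_pos (by positivity)]
  have hlog : ∀ θ : ℝ, rlog ‖(chebOdd g).eval
      ((critRadius g g : ℂ) * cis θ)‖ = rlog (critRadius g g) +
      ∑ k ∈ range g, rlog ‖(critRadius g g ^ 2 : ℝ) * exp (((2 : ℕ) * θ : ℝ) * I) -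
        ((chebZero g k ^ 2 : ℝ) : ℂ)‖ := by
    intro θ
    have h1 : ((critRadius g g : ℂ) * cis θ) ^ 2 =
        (critRadius g g ^ 2 : ℝ) * exp (((2 : ℕ) * θ : ℝ) * I) := by
      rw [mul_pow, ← exp_nat_mul]; push_cast; ring_nf
    rw [← mul_halfPoly_eval_sq, norm_mul, norm_mul_exp hσ, h1, halfPoly_eval_eq_prod, norm_prod,
      Real.log_mul hσ.ne', log_prod]
    · simp only [ofReal_pow]
    · intro k hk
      have := hne ((2 : ℕ) * θ) k hk
      simp_all
    · rw [← norm_prod, ← halfPoly_eval_eq_prod]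
      exact norm_ne_zero_iff.2 (halfPoly_eval_ne_zero (norm_mul_exp hσ2 _).le)
  have hcs : Continuous fun β : ℝ => ∑ k ∈ range g, rlog
      ‖(critRadius g g ^ 2 : ℝ) * cis β - ((chebZero g k ^ 2 : ℝ) : ℂ)‖ := continuous_finsetSum _ hc
  rw [circMean_congr hlog, circMean_add (g := fun β : ℝ => ∑ k ∈ range g,
      rlog ‖(critRadius g g ^ 2 : ℝ) * exp (((2 : ℕ) * β : ℝ) * I) - ((chebZero g k ^ 2 : ℝ) : ℂ)‖)
      continuous_const (hcs.comp (continuous_const_mul ((2 : ℕ) : ℝ))), circMean_const, circMean_nat_mul_periodic (f := fun β : ℝ => ∑ k ∈ range g, rlog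
      ‖(critRadius g g ^ 2 : ℝ) * cis β - ((chebZero g k ^ 2 : ℝ) : ℂ)‖)
      (fun β => by simp only [exp_add_two_pi_mul_I]) hcs two_ne_zero, circMean_sum _ hc,
    sum_congr rfl hmean, hzero]

lemma chebMean_zero (hg : 0 < g) : chebMean g g 0 = rlog (critRadius g g) + rlog (2 * g + 1) := by
  rw [← circMean_log_norm_oddPoly hg, ← circMean_log_norm_oddPoly_add (le_refl g) (by simp)]
  simp

lemma hasSum_cos_pow_mul {X : ℝ} (hX : |X| < 2) :
    HasSum (fun n : ℕ => X ^ (2 * (n + 1)) / (2 * ((n : ℝ) + 1)) * (circMean fun θ : ℝ =>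
        (((chebOdd g).eval ((critRadius g g : ℂ) * cis θ) ^ 2)⁻¹) ^ (n + 1)).re)
      (chebMean g g 0 - (chebMean g g X + chebMean g g (-X)) / 2) := by
  set O : ℝ → ℂ := fun θ => (chebOdd g).eval ((critRadius g g : ℂ) * cis θ) with hO
  have hσ := critRadius_pos (le_refl g)
  have hOc : Continuous O := (chebOdd g).continuous.comp (by fun_prop)
  have hO2 : ∀ θ, 2 ≤ ‖O θ‖ := fun θ => two_le_norm_oddPoly_eval (le_refl g) (norm_mul_exp hσ θ)
  have hO0 : ∀ θ, O θ ≠ 0 := fun θ => norm_pos_iff.1 (two_pos.trans_le (hO2 θ))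
  have hadd : ∀ x : ℝ, |x| < 2 → ∀ θ, O θ + x ≠ 0 := fun x hx θ =>
    oddPoly_add_ne_zero (le_refl g) (by rwa [norm_real]) (norm_mul_exp hσ θ)
  have hX' : |-X| < 2 := by rwa [abs_neg]
  set z : ℝ → ℂ := fun θ => (X / O θ) ^ 2 with hz
  have hzc : Continuous z := (continuous_const.div hOc hO0).pow 2
  have hq : (|X| / 2) ^ 2 < 1 := by
    rw [sq_lt_one_iff_abs_lt_one, abs_of_nonneg (by positivity)]; linarith
  have hzq : ∀ θ, ‖z θ‖ ≤ (|X| / 2) ^ 2 := fun θ => by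
    rw [hz, norm_pow, norm_div, norm_real, norm_eq_abs]
    exact pow_le_pow_left₀ (by positivity) (div_le_div_of_nonneg_left (abs_nonneg _) two_pos (hO2 θ)) 2
  have hslit : ∀ θ, 1 - z θ ∈ slitPlane := fun θ => by
    rw [sub_eq_add_neg]
    exact one_add_mem_slitPlane_of_norm_lt_one (by rw [norm_neg]; exact (hzq θ).trans_lt hq)
  have hlogc : Continuous fun θ => log (1 - z θ) := (continuous_const.sub hzc).clog hslit
  have h1 : HasSum (fun n : ℕ => circMean fun θ => z θ ^ (n + 1) / ((n : ℂ) + 1))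
      (circMean fun θ => -log (1 - z θ)) := by
    refine hasSum_circMean (b := fun n => ((|X| / 2) ^ 2) ^ (n + 1)) (fun n => by fun_prop)
      ((summable_nat_add_iff 1).2 (summable_geometric_of_lt_one (by positivity) hq))
      (fun n θ => ?_) fun θ => hasSum_pow_succ_div_neg_log ((hzq θ).trans_lt hq)
    rw [norm_div, norm_pow, show ((n : ℂ) + 1) = ((n + 1 : ℕ) : ℂ) by push_cast; rfl, norm_natCast]
    refine (div_le_self (by positivity) (by norm_cast; omega)).trans ?_
    exact pow_le_pow_left₀ (norm_nonneg _) (hzq θ) _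
  have h2 := (hasSum_re h1).mul_left (1 / 2)
  have hcl : ∀ x : ℝ, |x| < 2 → Continuous fun θ => rlog ‖O θ + x‖ := fun x hx =>
    (Continuous.norm (by fun_prop)).log fun θ => norm_ne_zero_iff.2 (hadd x hx θ)
  have h3 : (circMean fun θ => -log (1 - z θ)).re =
      2 * chebMean g g 0 - (chebMean g g X + chebMean g g (-X)) := by
    rw [circMean_re (f := fun θ => -log (1 - z θ)) hlogc.neg, ← circMean_log_norm_oddPoly_add (le_refl g) hX,
      ← circMean_log_norm_oddPoly_add (le_refl g) hX',
      ← circMean_log_norm_oddPoly_add (le_refl g) (x := 0) (by simp), ← circMean_const_mul_real,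
      ← circMean_add (hcl X hX) (hcl (-X) hX'),
      ← circMean_sub (f := fun θ => 2 * rlog ‖O θ + (0 : ℝ)‖)
        (g := fun θ => rlog ‖O θ + X‖ + rlog ‖O θ + (-X : ℝ)‖)
        ((hcl 0 (by simp)).const_mul 2) ((hcl X hX).add (hcl (-X) hX'))]
    refine circMean_congr fun θ => ?_
    have e1 : 1 - z θ = (O θ + X) * (O θ + (-X : ℝ)) / O θ ^ 2 := by
      have := hO0 θ
      simp only [hz]; push_cast; field_simp; ring
    rw [neg_re, log_re, e1, norm_div, norm_mul, norm_pow, Real.log_div, Real.log_mul, Real.log_pow]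
    · simp [hO]
    · exact norm_ne_zero_iff.2 (hadd X hX θ)
    · exact norm_ne_zero_iff.2 (hadd (-X) hX' θ)
    · exact mul_ne_zero (norm_ne_zero_iff.2 (hadd X hX θ)) (norm_ne_zero_iff.2 (hadd (-X) hX' θ))
    · simp_all
  rw [h3] at h2
  have h4 : ∀ n : ℕ, 1 / 2 * (circMean fun θ => z θ ^ (n + 1) / ((n : ℂ) + 1)).re =
      X ^ (2 * (n + 1)) / (2 * ((n : ℝ) + 1)) * (circMean fun θ => ((O θ ^ 2)⁻¹) ^ (n + 1)).re := by
    intro n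
    have e2 : (circMean fun θ => z θ ^ (n + 1) / ((n : ℂ) + 1)) =
        ((X ^ (2 * (n + 1)) / ((n : ℝ) + 1) : ℝ) : ℂ) * circMean fun θ => ((O θ ^ 2)⁻¹) ^ (n + 1) := by
      rw [← circMean_const_mul]
      refine circMean_congr fun θ => ?_
      simp only [hz, div_pow, inv_pow, ← pow_mul]
      push_cast
      ring
    rw [e2, re_ofReal_mul]
    field_simp
  grind

lemma hasSum_gradedTerm_famGG (hg : 0 < g) :
    HasSum (fun n : ℕ => gradedTerm (famGG g) ⟨0, hg⟩ (chebCoeff g) ((-1) ^ (g + 1))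
        (2 * (g : ℝ) + 1) (n + 1))
      (rlog (2 * g + 1) - (2 * g + 1) / π * blochWigner (1 + zetaRoot (2 * g + 1) ^ g)) := by
  set A : ℕ → ℝ := fun n => (circMean fun θ : ℝ =>
    (((chebOdd g).eval ((critRadius g g : ℂ) * cis θ) ^ 2)⁻¹) ^ (n + 1)).re with hA
  have hσ := critRadius_pos (le_refl g)
  have hAb : ∀ n, |A n| ≤ (1 / 4) ^ (n + 1) := by
    intro n
    refine (abs_re_le_norm _).trans (norm_circMean_le fun θ => ?_)
    rw [norm_pow, norm_inv, norm_pow]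
    refine pow_le_pow_left₀ (by positivity) ?_ _
    have h2 := two_le_norm_oddPoly_eval (le_refl g) (norm_mul_exp hσ θ)
    rw [← one_div]
    exact one_div_le_one_div_of_le (by norm_num) (by nlinarith)
  have hterm : ∀ n : ℕ, gradedTerm (famGG g) ⟨0, hg⟩ (chebCoeff g) ((-1) ^ (g + 1))
      (2 * (g : ℝ) + 1) (n + 1) = circMean fun φ : ℝ =>
        (2 * rcos φ) ^ (2 * (n + 1)) / (2 * ((n : ℝ) + 1)) * A n := by
    intro n
    have h1 := congrArg re (succ_mul_gradedTerm_famGG hg n)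
    rw [ofReal_re, ← ofReal_natCast, re_ofReal_mul] at h1
    have h2 : circMean (fun φ : ℝ => (2 * rcos φ) ^ (2 * (n + 1))) =
        2 * ((2 * n + 1).choose n : ℝ) := by
      have h3 := congrArg re (circMean_two_mul_cos_pow (n + 1))
      rw [circMean_re (by fun_prop)] at h3
      simp only [← ofReal_pow, ofReal_re] at h3
      rw [h3, choose_two_mul_succ]
      simp
    have h4 : ∀ φ : ℝ, (2 * rcos φ) ^ (2 * (n + 1)) / (2 * ((n : ℝ) + 1)) * A n =
        A n / (2 * ((n : ℝ) + 1)) * (2 * rcos φ) ^ (2 * (n + 1)) := fun φ => by ring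
    rw [circMean_congr h4, circMean_const_mul_real, h2]
    grind
  have hsum := hasSum_circMean_of_sin_sq (f := fun n (φ : ℝ) =>
      (2 * rcos φ) ^ (2 * (n + 1)) / (2 * ((n : ℝ) + 1)) * A n)
    (F := fun φ : ℝ => chebMean g g 0 - (chebMean g g (2 * rcos φ) +
      chebMean g g (-(2 * rcos φ))) / 2) (C := 1 / 2) one_pos (fun n => by fun_prop)
    (fun n φ _ => ?_) fun φ hφ => hasSum_cos_pow_mul ?_
  · simp only [← hterm] at hsum
    convert hsum using 1
    have hc := continuous_chebMean (le_refl g)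
    have hc1 : Continuous fun φ : ℝ => chebMean g g (2 * rcos φ) := hc.comp (by fun_prop)
    have h1 : circMean (fun φ : ℝ => chebMean g g (-(2 * rcos φ))) =
        circMean fun φ : ℝ => chebMean g g (2 * rcos φ) := by
      rw [← circMean_add_left_periodic (f := fun φ : ℝ => chebMean g g (2 * rcos φ))
        (fun φ => by simp only [Real.cos_add_two_pi]) π]
      refine circMean_congr fun φ => ?_
      rw [add_comm, Real.cos_add_pi, mul_neg]
    have h2 : ∀ φ : ℝ, chebMean g g 0 - (chebMean g g (2 * rcos φ) +
        chebMean g g (-(2 * rcos φ))) / 2 = chebMean g g 0 - 1 / 2 *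
        (chebMean g g (2 * rcos φ) + chebMean g g (-(2 * rcos φ))) := fun φ => by ring
    have h3 := mul_circMean_logMaxCos_sub (le_refl g)
    have hc2 : Continuous fun φ : ℝ => chebMean g g (-(2 * rcos φ)) := hc.comp (by fun_prop)
    rw [circMean_congr h2, circMean_sub (g := fun φ : ℝ => 1 / 2 *
        (chebMean g g (2 * rcos φ) + chebMean g g (-(2 * rcos φ)))) continuous_const
      (continuous_const.mul (hc1.add hc2)), circMean_const,
      circMean_const_mul_real, circMean_add hc1 hc2, h1, chebMean_zero hg,
      circMean_chebMean_two_mul_cos (le_refl g), blochWigner_one_add_zetaRoot_pow hg le_rfl]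
    linear_combination h3
  · rw [abs_mul, abs_div, abs_pow, abs_of_pos (by positivity : 0 < 2 * ((n : ℝ) + 1)), pow_mul,
      sq_abs]
    have h0 : (0 : ℝ) < (n : ℝ) + 1 := by positivity
    have hcos : rcos φ ^ 2 ≤ (1 + 1 * rsin φ ^ 2)⁻¹ := by
      rw [← one_div, le_div_iff₀ (by positivity)]
      nlinarith [Real.sin_sq_add_cos_sq φ, sq_nonneg (rsin φ ^ 2)]
    calc _ ≤ ((2 * rcos φ) ^ 2) ^ (n + 1) / (2 * ((n : ℝ) + 1)) * (1 / 4) ^ (n + 1) :=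
          mul_le_mul_of_nonneg_left (hAb n) (by positivity)
      _ = 1 / 2 * ((rcos φ ^ 2) ^ (n + 1) / ((n : ℝ) + 1)) := by
          rw [mul_pow 2, mul_pow, show (2 : ℝ) ^ 2 = 4 by norm_num, one_div_pow]
          field_simp
      _ ≤ _ := by gcongr
  · have h1 : |rcos φ| < 1 := by
      rw [← sq_lt_one_iff_abs_lt_one, Real.cos_sq']
      have : 0 < rsin φ ^ 2 := by positivity
      linarith
    rw [abs_mul, abs_two]; linarith

end sumGG

def chebRoot (g : ℕ) (ϑ : ℝ) (k : ℕ) : ℝ := 2 * rcos ((π - ϑ + 2 * π * k) / (2 * g + 1))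

def rootProd (g : ℕ) (ϑ : ℝ) (v : ℂ) : ℂ := ∏ k ∈ range (2 * g + 1), (1 - chebRoot g ϑ k * v)

/-- The inverse of `-x₁ / (F_{2g-1,1} - x₁)` in the coordinates `x₁ = v⁻²` and
`x₂ = v ^ (2g-1) e^{iϑ}`. -/
def hypMap (g : ℕ) (ϑ : ℝ) (v : ℂ) : ℂ := 1 - rootProd g ϑ v

section hypMap

variable {g : ℕ}

lemma continuous_chebRoot (g k : ℕ) : Continuous fun ϑ => chebRoot g ϑ k := by
  unfold chebRoot; fun_prop

lemma continuous_hypMap (g : ℕ) : Continuous fun z : ℝ × ℂ => hypMap g z.1 z.2 := by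
  unfold hypMap rootProd
  refine continuous_const.sub (continuous_finsetProd _ fun k _ => ?_)
  have := (continuous_chebRoot g k).comp (continuous_fst (X := ℝ) (Y := ℂ))
  fun_prop

lemma differentiable_hypMap (g : ℕ) (ϑ : ℝ) : Differentiable ℂ (hypMap g ϑ) := by
  unfold hypMap rootProd
  fun_prop

lemma hypMap_conj (ϑ : ℝ) (v : ℂ) : hypMap g ϑ (conj v) = conj (hypMap g ϑ v) := by
  simp [hypMap, rootProd, map_prod]

lemma hypMap_zero (ϑ : ℝ) : hypMap g ϑ 0 = 0 := by simp [hypMap, rootProd]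

lemma oddPoly_add_two_cos_eq_prod (ϑ : ℝ) (S : ℂ) : (chebOdd g).eval S + 2 * rcos ϑ =
      ∏ k ∈ range (2 * g + 1), (S - chebRoot g ϑ k) := by
  have hn' : ((2 * g + 1 : ℕ) : ℝ) ≠ 0 := Nat.cast_ne_zero.2 (Nat.succ_ne_zero _)
  have h := chebyshevC_sub_eq_prod (Nat.succ_pos (2 * g)) S ((π - ϑ) / (2 * g + 1 : ℕ))
  rw [mul_div_cancel₀ _ hn', Real.cos_pi_sub] at h
  rw [oddPoly_chebCoeff]
  push_cast at h ⊢
  rw [mul_neg, sub_neg_eq_add] at h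
  rw [h]
  refine prod_congr rfl fun k _ => ?_
  rw [chebRoot]
  push_cast
  rw [add_div]

lemma rootProd_inv (ϑ : ℝ) {l : ℂ} (hl : l ≠ 0) :
    l ^ (2 * g + 1) * rootProd g ϑ l⁻¹ = (chebOdd g).eval l + 2 * rcos ϑ := by
  rw [oddPoly_add_two_cos_eq_prod, rootProd, ← Finset.card_range (2 * g + 1), ← Finset.prod_const,
    Finset.card_range, ← prod_mul_distrib]
  grind

lemma hypMap_pi_sub (ϑ : ℝ) (v : ℂ) : hypMap g (π - ϑ) v = hypMap g ϑ (-v) := by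
  rcases eq_or_ne v 0 with rfl | hv
  · rw [neg_zero, hypMap_zero, hypMap_zero]
  · have h1 := rootProd_inv (g := g) (π - ϑ) (inv_ne_zero hv)
    have h2 := rootProd_inv (g := g) ϑ (neg_ne_zero.2 (inv_ne_zero hv))
    rw [oddPoly_eval_neg, Odd.neg_pow ⟨g, rfl⟩, inv_neg, inv_inv] at h2
    rw [Real.cos_pi_sub, inv_inv] at h1
    rw [ofReal_neg] at h1
    rw [hypMap, hypMap, sub_right_inj]
    apply mul_left_cancel₀ (pow_ne_zero (2 * g + 1) (inv_ne_zero hv))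
    linear_combination h1 + h2

lemma oddPoly_chebCoeff_eval_add_inv {p : ℂ} (hp : p ≠ 0) :
    (chebOdd g).eval (p + p⁻¹) = p ^ (2 * g + 1) + (p ^ (2 * g + 1))⁻¹ := by
  have h := Polynomial.Chebyshev.C_two_mul_complex_cos (-(I * log p)) (2 * (g : ℤ) + 1)
  have hcos : ∀ w : ℂ, 2 * cos w = cis w + exp (-(w * I)) := fun w => by rw [cos, neg_mul]; ring
  have e1 : -(I * log p) * I = log p := by linear_combination -(log p) * I_mul_I
  have e2 : ((2 * (g : ℤ) + 1 : ℤ) : ℂ) * -(I * log p) * I = ((2 * g + 1 : ℕ) : ℂ) * log p := by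
    rw [mul_assoc, e1]; push_cast; rfl
  rw [hcos, hcos, e1, e2, exp_neg, exp_neg, exp_nat_mul, exp_log hp] at h
  rw [oddPoly_chebCoeff, h]

lemma rootProd_div (ϑ : ℝ) {p : ℂ} (h : 1 + p ^ 2 ≠ 0) :
    (1 + p ^ 2) ^ (2 * g + 1) * rootProd g ϑ (p / (1 + p ^ 2)) =
      1 + 2 * rcos ϑ * p ^ (2 * g + 1) + (p ^ (2 * g + 1)) ^ 2 := by
  rcases eq_or_ne p 0 with rfl | hp
  · simp [rootProd]
  · have h1 : p / (1 + p ^ 2) = (p + p⁻¹)⁻¹ := by rw [← inv_div]; congr 1; field_simp; ring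
    have h2 : p + p⁻¹ = (1 + p ^ 2) / p := by field_simp; ring
    have h3 : p + p⁻¹ ≠ 0 := by rw [h2]; exact div_ne_zero h hp
    have h4 := rootProd_inv (g := g) ϑ h3
    rw [oddPoly_chebCoeff_eval_add_inv hp] at h4
    rw [h1]
    have h5 : (1 + p ^ 2) ^ (2 * g + 1) = p ^ (2 * g + 1) * (p + p⁻¹) ^ (2 * g + 1) := by
      rw [← mul_pow, h2, mul_div_cancel₀ _ hp]
    rw [h5, mul_assoc, h4]
    have := pow_ne_zero (2 * g + 1) hp
    field_simp
    ring

lemma eval_famHyp_sub (hg : 0 < g) {l : ℂ} (hl : l ≠ 0) (ϑ : ℝ) :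
    (famHyp g 1 (chebCoeff g ∘ rev)).eval (l ^ 2) (l ^ (1 - 2 * (g : ℤ)) * cis ϑ) - l ^ 2 =
      -(l ^ 2 * hypMap g ϑ l⁻¹) := by
  have h := eval_famHyp_param hg (chebCoeff g) one_ne_zero hl (exp_ne_zero (ϑ * I))
  simp only [one_pow, one_mul, ofReal_one] at h
  have h1 := rootProd_inv (g := g) ϑ hl
  have h2 : l ^ (1 - 2 * (g : ℤ)) * l ^ (2 * g + 1) = l ^ 2 := by
    rw [← zpow_natCast, ← zpow_add₀ hl, ← zpow_natCast]; congr 1; push_cast; ring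
  have h3 : chebCoeff g ∘ rev = fun i => chebCoeff g (rev i) := rfl
  rw [h3, h, exp_add_inv_exp, hypMap]
  linear_combination -(l ^ (1 - 2 * (g : ℤ))) * h1 + rootProd g ϑ l⁻¹ * h2

lemma chebCoeff_rev_sum_nonneg (g : ℕ) : 0 ≤ ∑ i, |(chebCoeff g ∘ rev) i| :=
  Finset.sum_nonneg fun _ _ => abs_nonneg _

/-- A radius below which the only zero of `hypMap` is the origin. -/
def hypRadius (g : ℕ) : ℝ := (3 + ∑ i, |(chebCoeff g ∘ rev) i|)⁻¹

lemma hypRadius_pos (g : ℕ) : 0 < hypRadius g :=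
  inv_pos.2 (by linarith [chebCoeff_rev_sum_nonneg g])

lemma hypRadius_inv_bounds (hg : 0 < g) {t : ℝ} (ht : (hypRadius g)⁻¹ ≤ t) :
    1 ≤ t ∧ (2 + ∑ i, |(chebCoeff g ∘ rev) i|) / t < |(chebCoeff g ∘ rev) ⟨0, hg⟩| := by
  have h0 := chebCoeff_rev_sum_nonneg g
  rw [hypRadius, inv_inv] at ht
  have h1 : 1 ≤ t := by linarith
  refine ⟨h1, ?_⟩
  have h2 : (chebCoeff g ∘ rev) ⟨0, hg⟩ = -(2 * g + 1) := chebCoeff_last hg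
  rw [h2, abs_neg, abs_of_pos (by positivity), div_lt_iff₀ (by linarith)]
  have : (0 : ℝ) ≤ 2 * g * t := by positivity
  linarith

lemma norm_torus_mean_le (hg : 0 < g) {l : ℂ} (hl : (hypRadius g)⁻¹ ≤ ‖l‖) (ϑ : ℝ) :
    ‖(famHyp g 0 (chebCoeff g ∘ rev) - single 0
      ((chebCoeff g ∘ rev) ⟨0, hg⟩)).eval (l ^ 2) (l ^ (1 - 2 * (g : ℤ)) * cis ϑ)‖ ≤
      (2 + ∑ i, |(chebCoeff g ∘ rev) i|) / ‖l‖ := by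
  refine norm_eval_famHyp_zero_sub_le _ hg (hypRadius_inv_bounds hg hl).1 (norm_pow _ _) ?_
  rw [norm_mul, norm_exp_ofReal_mul_I, mul_one, norm_zpow, ← zpow_natCast, ← zpow_neg]
  congr 1
  omega

lemma hypMap_ne_zero_of_norm_le (hg : 0 < g) (ϑ : ℝ) {v : ℂ} (hv : v ≠ 0)
    (h : ‖v‖ ≤ hypRadius g) : hypMap g ϑ v ≠ 0 := by
  intro h0
  have hl : v⁻¹ ≠ 0 := inv_ne_zero hv
  have hlr : (hypRadius g)⁻¹ ≤ ‖v⁻¹‖ := by rw [norm_inv]; exact inv_anti₀ (norm_pos_iff.2 hv) h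
  have h1 := norm_torus_mean_le hg hlr ϑ
  have h2 := (hypRadius_inv_bounds hg hlr).2
  rw [eval_famHyp_zero_sub _ _ (pow_ne_zero 2 hl) (mul_ne_zero (zpow_ne_zero _ hl) (exp_ne_zero _)),
    eval_famHyp_sub hg hl, inv_inv, h0, mul_zero, neg_zero, zero_sub, norm_neg, norm_real,
    norm_eq_abs] at h1
  linarith

lemma succ_mul_gradedTerm_famHyp (hg : 0 < g) (n : ℕ) {r : ℝ} (hr : 0 < r) (hr' : r ≤ hypRadius g) :
    (((n + 1) * gradedTerm (famHyp g) ⟨0, hg⟩ (chebCoeff g ∘ rev) 1 (2 * (g : ℝ) + 1)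
      (n + 1) : ℝ) : ℂ) = circMean fun ϑ : ℝ => circMean fun α : ℝ =>
        (hypMap g ϑ (r * cis α))⁻¹ ^ (n + 1) := by
  obtain ⟨t, rfl⟩ : ∃ t, r = t⁻¹ := ⟨r⁻¹, (inv_inv r).symm⟩
  have ht0 : 0 < t := inv_pos.1 hr
  have ht' : (hypRadius g)⁻¹ ≤ t := inv_le_of_inv_le₀ ht0 hr'
  obtain ⟨ht, hKt⟩ := hypRadius_inv_bounds hg ht'
  have hc : (chebCoeff g ∘ rev) ⟨0, hg⟩ = -(2 * g + 1) := chebCoeff_last hg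
  have hN : (2 * (g : ℝ) + 1) ≠ 0 := by positivity
  have hexp : ∀ γ : ℝ, cis γ ≠ 0 := fun γ => exp_ne_zero _
  have htc : (t : ℂ) ≠ 0 := mod_cast ht0.ne'
  have hl : ∀ α : ℝ, (t : ℂ) * cis α ≠ 0 := fun α => mul_ne_zero htc (hexp _)
  rw [succ_mul_gradedTerm (k := 2 * g - 1) (famHyp_eq_single_add g _ ⟨0, hg⟩)
    (by rw [hc]; exact neg_ne_zero.2 hN) (by rw [hc, neg_div_neg_eq])
    (fun t ht x y hx hy => norm_eval_famHyp_zero_sub_le _ hg ht hx hy) n ht hKt]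
  set B := famHyp g 0 (chebCoeff g ∘ rev) - single 0 ((chebCoeff g ∘ rev) ⟨0, hg⟩) with hB
  set c := (chebCoeff g ∘ rev) ⟨0, hg⟩ with hcd
  have hval : ∀ α ϑ : ℝ, -((t ^ 2 : ℝ) * exp (((2 : ℕ) * α : ℝ) * I)) / (c + B.eval
      ((t ^ 2 : ℝ) * exp (((2 : ℕ) * α : ℝ) * I))
      (((t ^ (2 * g - 1))⁻¹ : ℝ) * exp (((1 - 2 * (g : ℤ) : ℤ) * α + ϑ : ℝ) * I))) =
      (hypMap g ϑ ((t⁻¹ : ℝ) * exp ((-α : ℝ) * I)))⁻¹ := by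
    intro α ϑ
    have e1 : ((t ^ 2 : ℝ) : ℂ) * exp (((2 : ℕ) * α : ℝ) * I) = (t * cis α) ^ 2 := by
      rw [mul_pow, ← exp_nat_mul]; push_cast; ring_nf
    have e2 : (((t ^ (2 * g - 1))⁻¹ : ℝ) : ℂ) * exp (((1 - 2 * (g : ℤ) : ℤ) * α + ϑ : ℝ) * I) =
        (t * cis α) ^ (1 - 2 * (g : ℤ)) * cis ϑ := by
      rw [mul_zpow, ← exp_int_mul, mul_assoc, ← exp_add]
      congr 1
      · rw [show (1 - 2 * (g : ℤ)) = -((2 * g - 1 : ℕ) : ℤ) by omega, zpow_neg, zpow_natCast]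
        push_cast; rfl
      · congr 1; push_cast; ring
    have e3 : (t * cis α)⁻¹ = (t⁻¹ : ℝ) * exp ((-α : ℝ) * I) := by
      rw [mul_inv, ← exp_neg]; push_cast; ring_nf
    rw [e1, e2, hB, eval_famHyp_zero_sub _ _ (pow_ne_zero 2 (hl α))
      (mul_ne_zero (zpow_ne_zero _ (hl α)) (hexp _)), eval_famHyp_sub hg (hl α), e3, ← hcd,
      add_sub_cancel, neg_div_neg_eq]
    grind
  have hcont : Continuous fun z : ℝ × ℝ => -((t ^ 2 : ℝ) * cis z.1) / (c + B.eval
      ((t ^ 2 : ℝ) * cis z.1) (((t ^ (2 * g - 1))⁻¹ : ℝ) * cis z.2)) := by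
    have h1 : Continuous fun z : ℝ × ℝ => B.eval ((t ^ 2 : ℝ) * cis z.1)
      (((t ^ (2 * g - 1))⁻¹ : ℝ) * cis z.2) := B.continuous_onTorus 0 0 _ _
    refine Continuous.div (by fun_prop) (continuous_const.add h1) fun z hz => ?_
    have h2 := norm_eval_famHyp_zero_sub_le (chebCoeff g ∘ rev) hg ht
      (norm_mul_exp (pow_pos ht0 2) z.1) (norm_mul_exp (inv_pos.2 (pow_pos ht0 (2 * g - 1))) z.2)
    rw [← hB, eq_neg_of_add_eq_zero_right hz, norm_neg, norm_real, norm_eq_abs] at h2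
    linarith
  have hper : ∀ α : ℝ, circMean (fun β : ℝ => (-((t ^ 2 : ℝ) * cis α) / (c + B.eval
      ((t ^ 2 : ℝ) * cis α) (((t ^ (2 * g - 1))⁻¹ : ℝ) * cis β))) ^ (n + 1)) =
      circMean (fun β : ℝ => (-((t ^ 2 : ℝ) * exp (((α + 2 * π : ℝ)) * I)) / (c + B.eval
      ((t ^ 2 : ℝ) * exp ((α + 2 * π : ℝ) * I))
        (((t ^ (2 * g - 1))⁻¹ : ℝ) * cis β))) ^ (n + 1)) := fun α => by rw [exp_add_two_pi_mul_I]
  rw [← circMean_nat_mul_periodic (n := 2) (fun α => (hper α).symm)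
    (continuous_circMean (hcont.pow (n + 1))) two_ne_zero]
  have hin : ∀ α : ℝ, circMean (fun β : ℝ => (-((t ^ 2 : ℝ) * exp (((2 : ℕ) * α : ℝ) * I)) /
      (c + B.eval ((t ^ 2 : ℝ) * exp (((2 : ℕ) * α : ℝ) * I))
        (((t ^ (2 * g - 1))⁻¹ : ℝ) * cis β))) ^ (n + 1)) =
      circMean fun ϑ : ℝ => (hypMap g ϑ ((t⁻¹ : ℝ) * exp ((-α : ℝ) * I)))⁻¹ ^ (n + 1) := by
    intro α
    rw [← circMean_add_left_periodic (fun β => by simp only [exp_add_two_pi_mul_I])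
      ((1 - 2 * (g : ℤ) : ℤ) * α : ℝ)]
    exact circMean_congr fun ϑ => by rw [hval]
  have hne : ∀ ϑ α : ℝ, hypMap g ϑ ((t⁻¹ : ℝ) * cis α) ≠ 0 := fun ϑ α =>
    hypMap_ne_zero_of_norm_le hg ϑ (mul_ne_zero (mod_cast hr.ne') (hexp _))
      (by rw [norm_mul_exp hr]; exact hr')
  have hcm : Continuous fun z : ℝ × ℝ => (hypMap g z.2 ((t⁻¹ : ℝ) * cis z.1))⁻¹ ^ (n + 1) :=
    (((continuous_hypMap g).comp (by fun_prop : Continuous fun z : ℝ × ℝ =>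
      (z.2, ((t⁻¹ : ℝ) : ℂ) * cis z.1))).inv₀ fun z => hne _ _).pow _
  rw [circMean_congr hin, circMean_neg_periodic (f := fun α : ℝ => circMean fun ϑ : ℝ =>
    (hypMap g ϑ ((t⁻¹ : ℝ) * cis α))⁻¹ ^ (n + 1))
    (fun α => by simp only [exp_add_two_pi_mul_I]), circMean_comm hcm]

end hypMap

section homotopy


/-- Invariance of the integral of a holomorphic function under the linear homotopy of two paths,
up to the contributions of the end points. -/
lemma integral_sub_integral_of_linear_homotopy {U : Set ℂ} (hU : IsOpen U) {k : ℂ → ℂ}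
    (hk : DifferentiableOn ℂ k U) {τ₀ τ₁ τ₀' τ₁' : ℝ → ℂ} {a b : ℝ} (hab : a ≤ b)
    (h₀ : ∀ t ∈ Icc a b, HasDerivAt τ₀ (τ₀' t) t) (h₁ : ∀ t ∈ Icc a b, HasDerivAt τ₁ (τ₁' t) t)
    (hc₀ : ContinuousOn τ₀' (Icc a b)) (hc₁ : ContinuousOn τ₁' (Icc a b))
    (hmem : ∀ t ∈ Icc a b, ∀ s ∈ Icc (0 : ℝ) 1, τ₀ t + s * (τ₁ t - τ₀ t) ∈ U) :
    (∫ t in a..b, k (τ₁ t) * τ₁' t) - (∫ t in a..b, k (τ₀ t) * τ₀' t) =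
      (∫ s in (0 : ℝ)..1, k (τ₀ b + s * (τ₁ b - τ₀ b)) * (τ₁ b - τ₀ b)) -
        ∫ s in (0 : ℝ)..1, k (τ₀ a + s * (τ₁ a - τ₀ a)) * (τ₁ a - τ₀ a) := by
  set H : ℝ × ℝ → ℂ := fun z => τ₀ z.1 + z.2 * (τ₁ z.1 - τ₀ z.1) with hH
  set D : ℝ × ℝ → ℂ := fun z => deriv k (H z) * (τ₁ z.1 - τ₀ z.1) * (τ₀' z.1 + z.2 * (τ₁' z.1 - τ₀' z.1)) +
    k (H z) * (τ₁' z.1 - τ₀' z.1) with hD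
  have hR : ∀ z ∈ Icc a b ×ˢ Icc (0 : ℝ) 1, H z ∈ U := fun z hz => hmem _ hz.1 _ hz.2
  have hkd : ∀ w ∈ U, HasDerivAt k (deriv k w) w := fun w hw =>
    (hk.differentiableAt (hU.mem_nhds hw)).hasDerivAt
  have hdc : ContinuousOn (deriv k) U := (hk.deriv hU).continuousOn
  have h₀c : ContinuousOn τ₀ (Icc a b) := fun t ht => (h₀ t ht).continuousAt.continuousWithinAt
  have h₁c : ContinuousOn τ₁ (Icc a b) := fun t ht => (h₁ t ht).continuousAt.continuousWithinAt
  have hfst : ∀ {f : ℝ → ℂ}, ContinuousOn f (Icc a b) →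
      ContinuousOn (fun z : ℝ × ℝ => f z.1) (Icc a b ×ˢ Icc (0 : ℝ) 1) := fun hf =>
    hf.comp continuousOn_fst fun z hz => hz.1
  have hs : ContinuousOn (fun z : ℝ × ℝ => (z.2 : ℂ)) (Icc a b ×ˢ Icc (0 : ℝ) 1) := by fun_prop
  have hHc : ContinuousOn H (Icc a b ×ˢ Icc (0 : ℝ) 1) :=
    (hfst h₀c).add (hs.mul ((hfst h₁c).sub (hfst h₀c)))
  have hDc : ContinuousOn D (Icc a b ×ˢ Icc (0 : ℝ) 1) :=
    (((hdc.comp hHc hR).mul ((hfst h₁c).sub (hfst h₀c))).mul ((hfst hc₀).add (hs.mul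
      ((hfst hc₁).sub (hfst hc₀))))).add
      ((hk.continuousOn.comp hHc hR).mul ((hfst hc₁).sub (hfst hc₀)))
  have hDt : ∀ t ∈ Icc a b, ContinuousOn (fun s : ℝ => D (t, s)) (Icc 0 1) := fun t ht =>
    hDc.comp (by fun_prop) fun s hs => ⟨ht, hs⟩
  have hDs : ∀ s ∈ Icc (0 : ℝ) 1, ContinuousOn (fun t : ℝ => D (t, s)) (Icc a b) :=
    fun s hs => hDc.comp (by fun_prop) fun t ht => ⟨ht, hs⟩
  have hds : ∀ t ∈ Icc a b, ∀ s ∈ Icc (0 : ℝ) 1, HasDerivAt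
      (fun s : ℝ => k (H (t, s)) * (τ₀' t + s * (τ₁' t - τ₀' t))) (D (t, s)) s := by
    intro t ht s hs
    have e1 : HasDerivAt (fun s : ℝ => (s : ℂ)) 1 s := ofRealCLM.hasDerivAt
    have e2 : HasDerivAt (fun s : ℝ => H (t, s)) (1 * (τ₁ t - τ₀ t)) s :=
      (e1.mul_const (τ₁ t - τ₀ t)).const_add (τ₀ t)
    refine (((hkd _ (hR (t, s) ⟨ht, hs⟩)).comp s e2).mul
      ((e1.mul_const (τ₁' t - τ₀' t)).const_add (τ₀' t))).congr_deriv ?_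
    simp only [hD, Function.comp_apply]
    ring
  have hdt : ∀ s ∈ Icc (0 : ℝ) 1, ∀ t ∈ Icc a b, HasDerivAt
      (fun t : ℝ => k (H (t, s)) * (τ₁ t - τ₀ t)) (D (t, s)) t := by
    intro s hs t ht
    have e2 : HasDerivAt (fun t : ℝ => H (t, s)) (τ₀' t + s * (τ₁' t - τ₀' t)) t :=
      (h₀ t ht).add (((h₁ t ht).sub (h₀ t ht)).const_mul (s : ℂ))
    refine (((hkd _ (hR (t, s) ⟨ht, hs⟩)).comp t e2).mul ((h₁ t ht).sub (h₀ t ht))).congr_deriv ?_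
    simp only [hD, Function.comp_apply, Pi.sub_apply]
    ring
  have hI1 : ∀ t ∈ Icc a b, ∫ s in (0 : ℝ)..1, D (t, s) = k (τ₁ t) * τ₁' t - k (τ₀ t) * τ₀' t := by
    intro t ht
    rw [integral_eq_sub_of_hasDerivAt
      (f := fun s : ℝ => k (H (t, s)) * (τ₀' t + s * (τ₁' t - τ₀' t)))
      (fun s hs => hds t ht s (by rwa [uIcc_of_le zero_le_one] at hs))
      (ContinuousOn.intervalIntegrable (by rw [uIcc_of_le zero_le_one]; exact hDt t ht))]
    simp [hH]
  have hI2 : ∀ s ∈ Icc (0 : ℝ) 1, ∫ t in a..b, D (t, s) =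
      k (H (b, s)) * (τ₁ b - τ₀ b) - k (H (a, s)) * (τ₁ a - τ₀ a) := by
    intro s hs
    rw [integral_eq_sub_of_hasDerivAt (f := fun t : ℝ => k (H (t, s)) * (τ₁ t - τ₀ t))
      (fun t ht => hdt s hs t (by rwa [uIcc_of_le hab] at ht))
      (ContinuousOn.intervalIntegrable (by rw [uIcc_of_le hab]; exact hDs s hs))]
  have hswap : ∫ t in a..b, ∫ s in (0 : ℝ)..1, D (t, s) = ∫ s in (0 : ℝ)..1, ∫ t in a..b, D (t, s) := by
    apply intervalIntegral_intervalIntegral_swap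
    rw [uIoc_of_le hab, uIoc_of_le zero_le_one]
    exact (hDc.integrableOn_compact (isCompact_Icc.prod isCompact_Icc)).mono_set
      (prod_mono Ioc_subset_Icc_self Ioc_subset_Icc_self)
  have hUs : ∀ t ∈ Icc a b, τ₀ t ∈ U ∧ τ₁ t ∈ U := fun t ht =>
    ⟨by simpa using hmem t ht 0 (by simp), by simpa using hmem t ht 1 (by simp)⟩
  have hint : ∀ {τ τ' : ℝ → ℂ}, ContinuousOn τ (Icc a b) → ContinuousOn τ' (Icc a b) →
      (∀ t ∈ Icc a b, τ t ∈ U) → IntervalIntegrable (fun t => k (τ t) * τ' t) volume a b :=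
    fun h h' hu => ContinuousOn.intervalIntegrable (by
      rw [uIcc_of_le hab]; exact (hk.continuousOn.comp h hu).mul h')
  have hend : ∀ t ∈ Icc a b, IntervalIntegrable
      (fun s : ℝ => k (H (t, s)) * (τ₁ t - τ₀ t)) volume 0 1 := fun t ht =>
    ContinuousOn.intervalIntegrable (by
      rw [uIcc_of_le zero_le_one]
      exact (hk.continuousOn.comp (hHc.comp (by fun_prop) fun s hs => ⟨ht, hs⟩)
        fun s hs => hR (t, s) ⟨ht, hs⟩).mul continuousOn_const)
  rw [← integral_sub (hint h₁c hc₁ fun t ht => (hUs t ht).2)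
    (hint h₀c hc₀ fun t ht => (hUs t ht).1), ← integral_sub (hend b (Set.right_mem_Icc.2 hab))
      (hend a (Set.left_mem_Icc.2 hab))]
  rw [← integral_congr (f := fun t => ∫ s in (0 : ℝ)..1, D (t, s))
    (fun t ht => hI1 t (by rwa [uIcc_of_le hab] at ht)), hswap]
  exact integral_congr fun s hs => hI2 s (by rwa [uIcc_of_le zero_le_one] at hs)

end homotopy

section zeroFree

variable {g : ℕ}

lemma im_log_one_sub_mul_div_neg {v : ℂ} (hv : 0 < v.im) {r : ℝ} (hr : r ≠ 0) :
    (log (1 - r * v) / v).im < 0 := by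
  have hv0 : v ≠ 0 := fun h => by rw [h] at hv; simp at hv
  have hr' : (r : ℂ) ≠ 0 := mod_cast hr
  have him : ∀ t : ℝ, (1 - r * v * t).im = -(r * t * v.im) := fun t => by simp; ring
  have hs : 1 - r * v ∈ slitPlane := by
    right
    have := him 1
    simp only [ofReal_one, mul_one] at this
    grind
  have hne : ∀ t : ℝ, 1 - r * v * t ≠ 0 := fun t h => by
    have h1 := congrArg im h
    rw [him] at h1
    rcases eq_or_ne t 0 with rfl | ht
    · simp at h
    · simp_all
  have hc : Continuous fun t : ℝ => 1 / (1 - r * v * t) := continuous_const.div (by fun_prop) hne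
  have h1 := integral_one_div_one_sub_mul hs (mul_ne_zero hr' hv0)
  have h2 : log (1 - r * v) / v = -(r * ∫ t in (0 : ℝ)..1, 1 / (1 - r * v * t)) := by
    rw [h1]; field_simp
  have h3 : (∫ t in (0 : ℝ)..1, 1 / (1 - r * v * t)).im =
      ∫ t in (0 : ℝ)..1, (1 / (1 - r * v * t)).im :=
    (imCLM.intervalIntegral_comp_comm (hc.intervalIntegrable _ _)).symm
  rw [h2, neg_im, im_ofReal_mul, h3, ← integral_const_mul, neg_lt_zero]
  refine intervalIntegral.intervalIntegral_pos_of_pos_on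
    ((continuous_const.mul (continuous_im.comp hc)).intervalIntegrable _ _) (fun t ht => ?_) one_pos
  rw [one_div, inv_im, him, neg_neg, mul_div_assoc']
  have : 0 < normSq (1 - r * v * t) := normSq_pos.2 (hne t)
  have h4 : 0 < r * (r * t * v.im) := by
    have : 0 < r ^ 2 := by positivity
    have := mul_pos this (mul_pos ht.1 hv)
    nlinarith
  positivity

lemma im_div_one_add_sq_pos {p : ℂ} (him : 0 < p.im) (hp : ‖p‖ < 1) : 0 < (p / (1 + p ^ 2)).im := by
  have h0 : 1 + p ^ 2 ≠ 0 := slitPlane_ne_zero (one_add_mem_slitPlane_of_norm_lt_one (by simp_all))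
  have h1 : 0 < normSq (1 + p ^ 2) := normSq_pos.2 h0
  have h2 : p.re * p.re + p.im * p.im < 1 := by
    rw [← normSq_apply, ← Complex.sq_norm]; exact pow_lt_one₀ (norm_nonneg _) hp two_ne_zero
  rw [div_im, ← sub_div]
  refine div_pos ?_ h1
  have h3 : p.im * (1 + p ^ 2).re - p.re * (1 + p ^ 2).im =
      p.im * (1 - (p.re * p.re + p.im * p.im)) := by simp [sq]; ring
  rw [h3]
  exact mul_pos him (by linarith)

lemma one_sub_mul_mem_slitPlane_of_im_pos {v : ℂ} (hv : 0 < v.im) (r : ℝ) :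
    1 - r * v ∈ slitPlane := by
  rcases eq_or_ne r 0 with rfl | hr
  · simp
  · right
    simp [hr, hv.ne']

lemma sum_log_eq (ϑ : ℝ) {p : ℂ} (hre : 0 < p.re) (him : 0 < p.im) (hp : ‖p‖ < 1) :
    ∑ k ∈ range (2 * g + 1), log (1 - chebRoot g ϑ k * (p / (1 + p ^ 2))) =
      log (1 + cis ϑ * p ^ (2 * g + 1)) + log (1 + (cis ϑ)⁻¹ * p ^ (2 * g + 1)) -
        (2 * g + 1 : ℕ) * log (1 + p ^ 2) := by
  set D : Set ℂ := {q | ‖q‖ < 1 ∧ (0 < q.re ∧ 0 < q.im ∨ q = 0)} with hD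
  have h0D : (0 : ℂ) ∈ D := ⟨by rw [norm_zero]; exact one_pos, Or.inr rfl⟩
  have hpD : p ∈ D := ⟨hp, Or.inl ⟨hre, him⟩⟩
  have hDc : IsPreconnected D := by
    have hstar : StarConvex ℝ 0 D := by
      rw [starConvex_zero_iff]
      intro q hq t ht0 ht1
      rcases ht0.eq_or_lt with rfl | ht
      · simpa using h0D
      · refine ⟨?_, ?_⟩
        · change ‖t • q‖ < 1
          rw [norm_smul, norm_of_nonneg ht0]
          exact (mul_le_of_le_one_left (norm_nonneg _) ht1).trans_lt hq.1
        · rcases hq.2 with h | h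
          · simp_all
          · right; rw [h, smul_zero]
    exact (hstar.isPathConnected h0D).isConnected.isPreconnected
  have hexp : ∀ x : ℝ, ‖cis x‖ = 1 := norm_exp_ofReal_mul_I
  have hpow : ∀ q ∈ D, ∀ c : ℂ, ‖c‖ = 1 → ∀ n : ℕ, n ≠ 0 → 1 + c * q ^ n ∈ slitPlane :=
    fun q hq c hc n hn => one_add_mem_slitPlane_of_norm_lt_one (by
      rw [norm_mul, hc, one_mul, norm_pow]; exact pow_lt_one₀ (norm_nonneg _) hq.1 hn)
  have hsq : ∀ q ∈ D, 1 + q ^ 2 ∈ slitPlane := fun q hq => by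
    simpa using hpow q hq 1 norm_one 2 two_ne_zero
  have hinv : ‖(cis ϑ)⁻¹‖ = 1 := by rw [norm_inv, hexp, inv_one]
  have hv : ∀ q ∈ D, ∀ k, 1 - chebRoot g ϑ k * (q / (1 + q ^ 2)) ∈ slitPlane := by
    intro q hq k
    rcases hq.2 with h | rfl
    · exact one_sub_mul_mem_slitPlane_of_im_pos (im_div_one_add_sq_pos h.2 hq.1) _
    · simp
  have hc1 : ContinuousOn (fun q : ℂ => ∑ k ∈ range (2 * g + 1),
      log (1 - chebRoot g ϑ k * (q / (1 + q ^ 2)))) D :=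
    continuousOn_finsetSum _ fun k _ => ContinuousOn.clog (continuousOn_const.sub
      (continuousOn_const.mul (ContinuousOn.div (by fun_prop) (by fun_prop)
        fun q hq => slitPlane_ne_zero (hsq q hq)))) fun q hq => hv q hq k
  have hc2 : ContinuousOn (fun q : ℂ => log (1 + cis ϑ * q ^ (2 * g + 1)) +
      log (1 + (cis ϑ)⁻¹ * q ^ (2 * g + 1)) - (2 * g + 1 : ℕ) * log (1 + q ^ 2)) D := by
    refine ContinuousOn.sub (ContinuousOn.add ?_ ?_) (continuousOn_const.mul ?_)
    · exact ContinuousOn.clog (by fun_prop) fun q hq => hpow q hq _ (hexp _) _ (Nat.succ_ne_zero _)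
    · exact ContinuousOn.clog (by fun_prop) fun q hq => hpow q hq _ hinv _ (Nat.succ_ne_zero _)
    · exact ContinuousOn.clog (by fun_prop) fun q hq => hsq q hq
  obtain ⟨k, hk⟩ := eq_add_of_exp_eq_exp hDc hc1 hc2 (fun q hq => by
    have h1 := slitPlane_ne_zero (hsq q hq)
    have h2 := rootProd_div (g := g) ϑ h1
    have h3 : cis ϑ + (cis ϑ)⁻¹ = 2 * rcos ϑ := exp_add_inv_exp ϑ
    rw [exp_sum, exp_sub, exp_add, exp_nat_mul, exp_log h1,
      exp_log (slitPlane_ne_zero (hpow q hq _ (hexp ϑ) _ (Nat.succ_ne_zero _))),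
      exp_log (slitPlane_ne_zero (hpow q hq _ hinv _ (Nat.succ_ne_zero _))),
      prod_congr rfl fun k _ => exp_log (slitPlane_ne_zero (hv q hq k)), ← rootProd,
      eq_div_iff (pow_ne_zero _ h1), mul_comm, h2, ← h3]
    grind) ⟨0, h0D⟩
  have h0 := hk 0 h0D
  simp_all

lemma exists_chebRoot_ne_zero (hg : 0 < g) (ϑ : ℝ) :
    ∃ k ∈ range (2 * g + 1), chebRoot g ϑ k ≠ 0 := by
  by_contra! h
  have h1 := hypRadius_pos g
  refine hypMap_ne_zero_of_norm_le hg ϑ (ofReal_ne_zero.2 h1.ne')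
    (by rw [norm_real, norm_of_nonneg h1.le]) ?_
  rw [hypMap, rootProd, prod_congr rfl fun k hk => by rw [h k hk]]
  simp

lemma sum_log_div_im_neg (hg : 0 < g) (ϑ : ℝ) {v : ℂ} (hv : 0 < v.im) :
    ((∑ k ∈ range (2 * g + 1), log (1 - chebRoot g ϑ k * v)) / v).im < 0 := by
  rw [Finset.sum_div, im_sum]
  obtain ⟨k, hk, hk0⟩ := exists_chebRoot_ne_zero hg ϑ
  refine Finset.sum_neg' (fun i _ => ?_) ⟨k, hk, im_log_one_sub_mul_div_neg hv hk0⟩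
  rcases eq_or_ne (chebRoot g ϑ i) 0 with h | h
  · simp [h]
  · exact (im_log_one_sub_mul_div_neg hv h).le

lemma hypMap_ne_zero_of_arg_le (hg : 0 < g) (ϑ : ℝ) {p : ℂ} (hre : 0 < p.re) (him : 0 < p.im)
    (hp : ‖p‖ < 1) (harg : (2 * g + 1) * arg (1 + p ^ 2) ≤ π) :
    hypMap g ϑ (p / (1 + p ^ 2)) ≠ 0 := by
  intro h0
  set v := p / (1 + p ^ 2) with hv
  have hvim : 0 < v.im := im_div_one_add_sq_pos him hp
  have hsum := sum_log_eq (g := g) ϑ hre him hp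
  rw [← hv] at hsum
  have hneg := sum_log_div_im_neg hg ϑ hvim
  have hexp : exp (∑ k ∈ range (2 * g + 1), log (1 - chebRoot g ϑ k * v)) = 1 := by
    rw [exp_sum, prod_congr rfl fun k _ => exp_log (slitPlane_ne_zero
      (one_sub_mul_mem_slitPlane_of_im_pos hvim _)), ← rootProd]
    rw [hypMap, sub_eq_zero] at h0
    exact h0.symm
  obtain ⟨n, hn⟩ := exp_eq_one_iff.1 hexp
  have harg1 : ∀ c : ℂ, ‖c‖ = 1 → |arg (1 + c * p ^ (2 * g + 1))| < π / 2 := by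
    intro c hc
    rw [abs_arg_lt_pi_div_two_iff]
    left
    have h1 : ‖c * p ^ (2 * g + 1)‖ < 1 := by
      rw [norm_mul, hc, one_mul, norm_pow]
      exact pow_lt_one₀ (norm_nonneg _) hp (Nat.succ_ne_zero _)
    have h2 := (abs_le.1 (abs_re_le_norm (c * p ^ (2 * g + 1)))).1
    rw [add_re, one_re]; linarith
  have hpos : 0 ≤ arg (1 + p ^ 2) := by
    rw [arg_nonneg_iff]
    simp only [add_im, one_im, sq, mul_im, zero_add]
    positivity
  have h1 := harg1 (cis ϑ) (norm_exp_ofReal_mul_I _)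
  have h2 := harg1 (cis ϑ)⁻¹ (by rw [norm_inv, norm_exp_ofReal_mul_I, inv_one])
  have h3 := congrArg im (hn.symm.trans hsum)
  have h4 : ((2 * g + 1 : ℕ) * log (1 + p ^ 2) : ℂ).im = (2 * g + 1) * arg (1 + p ^ 2) := by
    rw [← ofReal_natCast, im_ofReal_mul, log_im]; push_cast; rfl
  have h5 : ((n : ℂ) * (2 * π * I)).im = n * (2 * π) := by simp
  rw [sub_im, add_im, log_im, log_im, h4, h5] at h3
  have hπ := pi_pos
  rw [abs_lt] at h1 h2
  have h6 : (0 : ℝ) ≤ (2 * g + 1) * arg (1 + p ^ 2) := by positivity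
  have hn0 : n = 0 := by
    have e1 : (n : ℝ) < 1 := by nlinarith
    have e2 : (-1 : ℝ) < n := by nlinarith
    have e1' : n < 1 := mod_cast e1
    have e2' : -1 < n := mod_cast e2
    omega
  rw [hn, hn0] at hneg
  simp at hneg

lemma hypMap_eq (ϑ : ℝ) {p : ℂ} (h : 1 + p ^ 2 ≠ 0) : hypMap g ϑ (p / (1 + p ^ 2)) =
    1 - (1 + 2 * rcos ϑ * p ^ (2 * g + 1) + (p ^ (2 * g + 1)) ^ 2) / (1 + p ^ 2) ^ (2 * g + 1) := by
  rw [hypMap, ← rootProd_div ϑ h, mul_div_cancel_left₀ _ (pow_ne_zero _ h)]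

lemma hypMap_div_ne_zero_of_norm_lt (ϑ : ℝ) {p : ℂ} (h : 1 + p ^ 2 ≠ 0)
    (hlt : (1 + ‖p‖ ^ (2 * g + 1)) ^ 2 < ‖1 + p ^ 2‖ ^ (2 * g + 1)) :
    hypMap g ϑ (p / (1 + p ^ 2)) ≠ 0 := by
  rw [hypMap_eq ϑ h, sub_ne_zero]
  intro h1
  rw [eq_div_iff (pow_ne_zero _ h), one_mul] at h1
  rw [← norm_pow, ← norm_pow (1 + p ^ 2), h1, add_sq, one_pow, mul_one] at hlt
  refine absurd hlt (not_lt.2 ((norm_add₃_le).trans ?_))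
  rw [norm_one, norm_mul, norm_mul, norm_real, norm_eq_abs, norm_pow (p ^ (2 * g + 1)),
    Complex.norm_ofNat]
  gcongr
  have := mul_le_mul_of_nonneg_left (abs_cos_le_one ϑ) zero_le_two
  linarith

lemma arg_le_of_im_nonpos {z : ℂ} {φ : ℝ} (hφ : φ ∈ Ioo 0 π) (hz : 0 < z.im)
    (h : z.im * rcos φ ≤ z.re * rsin φ) : arg z ≤ φ := by
  have h0 : 0 < ‖z‖ := norm_pos_iff.2 fun h0 => by simp [h0] at hz
  by_contra! hlt
  have h1 := sin_pos_of_pos_of_lt_pi (sub_pos.2 hlt) (by linarith [arg_le_pi z, hφ.1])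
  rw [Real.sin_sub] at h1
  have h2 := mul_pos h0 h1
  rw [mul_sub, ← mul_assoc, ← mul_assoc, norm_mul_sin_arg, norm_mul_cos_arg] at h2
  linarith

lemma one_add_exp_re_im (x α : ℝ) : (1 + exp (x + α * I) ^ 2).re = 1 + rexp (2 * x) * rcos (2 * α) ∧
    (1 + exp (x + α * I) ^ 2).im = rexp (2 * x) * rsin (2 * α) := by
  have h : exp (x + α * I) ^ 2 = exp ((2 * x : ℝ) + (2 * α : ℝ) * I) := by
    rw [← exp_nat_mul]; push_cast; ring_nf
  rw [h, add_re, add_im, exp_re, exp_im]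
  simp

/-- The critical angle bounding the zero-free region. -/
def critAngle (g : ℕ) : ℝ := π / (2 * g + 1)

lemma critAngle_pos (g : ℕ) : 0 < critAngle g := by
  have := pi_pos
  rw [critAngle]; positivity

lemma critAngle_le (hg : 2 ≤ g) : critAngle g ≤ π / 5 := by
  have h : (2 : ℝ) ≤ g := mod_cast hg
  exact div_le_div_of_nonneg_left pi_pos.le (by norm_num) (by linarith)

lemma four_lt_two_mul_cos_pow (hg : 2 ≤ g) {α : ℝ} (h0 : 0 ≤ α) (hα : α ≤ critAngle g) :
    4 < (2 * rcos α) ^ (2 * g + 1) := by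
  have h1 := hα.trans (critAngle_le hg)
  have h2 := one_sub_sq_div_two_le_cos (x := α)
  have h3 := Real.pi_lt_d2
  have h4 : (1.6 : ℝ) ≤ 2 * rcos α := by nlinarith
  calc (4 : ℝ) < 1.6 ^ 5 := by norm_num
    _ ≤ 1.6 ^ (2 * g + 1) := pow_le_pow_right₀ (by norm_num) (by omega)
    _ ≤ _ := pow_le_pow_left₀ (by norm_num) h4 _

/-- The region, in the coordinate `log p`, on which `hypMap` has no zero. -/
def zeroFreeRegion (g : ℕ) : Set (ℝ × ℝ) := {z | 0 ≤ z.2 ∧ z.2 ≤ π / 2 ∧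
  (z.1 = 0 ∧ z.2 ≤ critAngle g ∨
    z.1 < 0 ∧ rexp (2 * z.1) * rsin (2 * z.2 - critAngle g) ≤ rsin (critAngle g))}

lemma one_add_ne_zero_of_mem (hg : 2 ≤ g) {x α : ℝ} (h : (x, α) ∈ zeroFreeRegion g) :
    1 + exp (x + α * I) ^ 2 ≠ 0 := by
  obtain ⟨h0, h1, ⟨rfl, h2⟩ | ⟨hx, h2⟩⟩ := h
  · intro hz
    have h3 := congrArg re hz
    rw [(one_add_exp_re_im 0 α).1, mul_zero, Real.exp_zero, one_mul, zero_re, Real.cos_two_mul] at h3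
    have h4 : 0 < rcos α := cos_pos_of_mem_Ioo ⟨by linarith [pi_pos], by
      linarith [critAngle_le hg, pi_pos]⟩
    nlinarith
  · refine slitPlane_ne_zero (one_add_mem_slitPlane_of_norm_lt_one ?_)
    rw [norm_pow, norm_exp]
    simp_all

lemma hypMap_exp_ne_zero (hg : 2 ≤ g) (ϑ : ℝ) {x α : ℝ} (h : (x, α) ∈ zeroFreeRegion g) :
    hypMap g ϑ (exp (x + α * I) / (1 + exp (x + α * I) ^ 2)) ≠ 0 := by
  have hne := one_add_ne_zero_of_mem hg h
  obtain ⟨hre, him⟩ := one_add_exp_re_im x α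
  have hnorm : ‖exp (x + α * I)‖ = rexp x := by rw [norm_exp]; simp
  have hN : 2 * g + 1 ≠ 0 := Nat.succ_ne_zero _
  obtain ⟨h0, h1, ⟨rfl, h2⟩ | ⟨hx, h2⟩⟩ := h
  · refine hypMap_div_ne_zero_of_norm_lt ϑ hne ?_
    rw [hnorm, Real.exp_zero, one_pow]
    refine lt_of_lt_of_le (by norm_num; exact four_lt_two_mul_cos_pow hg h0 h2) (pow_le_pow_left₀ ?_ ?_ _)
    · exact mul_nonneg zero_le_two (Real.cos_nonneg_of_neg_pi_div_two_le_of_le (by linarith) h1)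
    · refine abs_le_of_sq_le_sq' ?_ (norm_nonneg _) |>.2
      rw [Complex.sq_norm, normSq_apply, hre, him, mul_zero, Real.exp_zero]
      nlinarith [Real.sin_sq_add_cos_sq (2 * α), Real.cos_two_mul α]
  · have hlt : rexp x < 1 := by rw [← Real.exp_zero]; exact Real.exp_lt_exp.2 hx
    have hpos := Real.exp_pos x
    have hsq : rexp x ^ 2 < 1 := pow_lt_one₀ hpos.le hlt two_ne_zero
    have hle : rexp x ^ (2 * g + 1) ≤ rexp x ^ 2 := pow_le_pow_of_le_one hpos.le hlt.le (by omega)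
    rcases h0.eq_or_lt with rfl | h0
    · refine hypMap_div_ne_zero_of_norm_lt ϑ hne ?_
      have e : 1 + exp (x + (0 : ℝ) * I) ^ 2 = ((1 + rexp x ^ 2 : ℝ) : ℂ) := by push_cast; simp
      rw [hnorm, e, norm_real, norm_of_nonneg (by positivity)]
      calc (1 + rexp x ^ (2 * g + 1)) ^ 2 ≤ (1 + rexp x ^ 2) ^ 2 := by gcongr
        _ < _ := pow_lt_pow_right₀ (by linarith [pow_pos hpos 2]) (by omega)
    rcases h1.eq_or_lt with rfl | h1
    · have e : exp (x + (π / 2 : ℝ) * I) = rexp x * I := by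
        rw [exp_add]; push_cast; rw [exp_pi_div_two_mul_I]
      rw [hypMap_eq ϑ hne, sub_ne_zero]
      intro h3
      rw [eq_div_iff (pow_ne_zero _ hne), one_mul] at h3
      have e2 : 1 + exp (x + (π / 2 : ℝ) * I) ^ 2 = ((1 - rexp x ^ 2 : ℝ) : ℂ) := by
        rw [e, mul_pow, I_sq]; push_cast; ring
      have e3 : exp (x + (π / 2 : ℝ) * I) ^ (2 * g + 1) =
          (((-1) ^ g * rexp x ^ (2 * g + 1) : ℝ) : ℂ) * I := by
        rw [e, mul_pow, pow_succ I, pow_mul I, I_sq]; push_cast; ring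
      have h4 := congrArg re h3
      have e4 : ((-1 : ℝ) ^ g) ^ 2 = 1 := by rw [← pow_mul, mul_comm, pow_mul]; simp
      rw [e2, ← ofReal_pow, ofReal_re, e3, mul_pow, I_sq, ← ofReal_pow, mul_pow, e4] at h4
      have e5 : (1 + 2 * rcos ϑ * (((-1) ^ g * rexp x ^ (2 * g + 1) : ℝ) * I) +
          ((1 * (rexp x ^ (2 * g + 1)) ^ 2 : ℝ) : ℂ) * -1).re = 1 - (rexp x ^ (2 * g + 1)) ^ 2 := by
        generalize (-1 : ℝ) ^ g * rexp x ^ (2 * g + 1) = A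
        rw [add_re, add_re, ← mul_assoc, mul_neg_one, neg_re, ofReal_re]
        simp [sub_eq_add_neg]
      rw [e5] at h4
      have h5 : (1 - rexp x ^ 2) ^ (2 * g + 1) < (1 - rexp x ^ 2) ^ 1 :=
        pow_lt_pow_right_of_lt_one₀ (by linarith) (by linarith [pow_pos hpos 2]) (by omega)
      have h6 : (rexp x ^ (2 * g + 1)) ^ 2 ≤ rexp x ^ 2 :=
        (pow_le_of_le_one (by positivity) (hle.trans hsq.le) two_ne_zero).trans hle
      linarith
    · have hc : 0 < rcos α := cos_pos_of_mem_Ioo ⟨by linarith, h1⟩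
      have hs : 0 < rsin α := sin_pos_of_pos_of_lt_pi h0 (by linarith)
      refine hypMap_ne_zero_of_arg_le (by omega) ϑ ?_ ?_ (by rwa [hnorm]) ?_
      · rw [exp_re]; simp; positivity
      · rw [exp_im]; simp; positivity
      · have h3 : arg (1 + exp (x + α * I) ^ 2) ≤ critAngle g := by
          refine arg_le_of_im_nonpos ⟨critAngle_pos g, by linarith [critAngle_le hg, pi_pos]⟩ ?_ ?_
          · rw [him]
            exact mul_pos (Real.exp_pos _) (by rw [Real.sin_two_mul]; positivity)
          · rw [hre, him]
            rw [Real.sin_sub] at h2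
            linarith
        rw [critAngle, le_div_iff₀ (by positivity)] at h3
        linarith

end zeroFree

section contour

open ComplexConjugate

variable {g : ℕ}

def joukInv (τ : ℂ) : ℂ := exp τ / (1 + exp τ ^ 2)

def evenPow (g : ℕ) (ϑ : ℝ) (n : ℕ) (v : ℂ) : ℂ := (hypMap g ϑ v)⁻¹ ^ n + (hypMap g ϑ (-v))⁻¹ ^ n

/-- The pull-back of `evenPow · dv / v` along `joukInv`. -/
def hypKernel (g : ℕ) (ϑ : ℝ) (n : ℕ) (τ : ℂ) : ℂ :=
  evenPow g ϑ n (joukInv τ) * ((1 - exp τ ^ 2) / (1 + exp τ ^ 2))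

lemma evenPow_neg (ϑ : ℝ) (n : ℕ) (v : ℂ) : evenPow g ϑ n (-v) = evenPow g ϑ n v := by
  rw [evenPow, evenPow, neg_neg, add_comm]

lemma evenPow_conj (ϑ : ℝ) (n : ℕ) (v : ℂ) : evenPow g ϑ n (conj v) = conj (evenPow g ϑ n v) := by
  simp only [evenPow, map_add, map_pow, map_inv₀, ← hypMap_conj, map_neg]

lemma joukInv_conj (τ : ℂ) : joukInv (conj τ) = conj (joukInv τ) := by
  simp only [joukInv, map_div₀, map_add, map_one, map_pow, exp_conj]

lemma hypKernel_conj (ϑ : ℝ) (n : ℕ) (τ : ℂ) :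
    hypKernel g ϑ n (conj τ) = conj (hypKernel g ϑ n τ) := by
  simp only [hypKernel, joukInv_conj, evenPow_conj, map_mul, map_div₀, map_add, map_sub, map_one,
    map_pow, exp_conj]

lemma hypKernel_sub_pi_mul_I (ϑ : ℝ) (n : ℕ) (τ : ℂ) :
    hypKernel g ϑ n (τ - π * I) = hypKernel g ϑ n τ := by
  have h : exp (τ - π * I) = -exp τ := by rw [exp_sub, exp_pi_mul_I, div_neg, div_one]
  rw [hypKernel, hypKernel, joukInv, joukInv, h, neg_sq, neg_div, evenPow_neg]

lemma hypKernel_neg (ϑ : ℝ) (n : ℕ) (τ : ℂ) : hypKernel g ϑ n (-τ) = -hypKernel g ϑ n τ := by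
  have h0 := exp_ne_zero τ
  have h1 : joukInv (-τ) = joukInv τ := by
    rw [joukInv, joukInv, exp_neg, ← mul_div_mul_left _ (1 + (exp τ)⁻¹ ^ 2) (pow_ne_zero 2 h0)]
    congr 1 <;> · field_simp; try ring
  have h2 : (1 - exp (-τ) ^ 2) / (1 + exp (-τ) ^ 2) = -((1 - exp τ ^ 2) / (1 + exp τ ^ 2)) := by
    rw [exp_neg, ← neg_div, ← mul_div_mul_left _ (1 + (exp τ)⁻¹ ^ 2) (pow_ne_zero 2 h0)]
    congr 1 <;> · field_simp; try ring
  rw [hypKernel, hypKernel, h1, h2, mul_neg]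

lemma im_eq_zero_of_conj_eq {z : ℂ} (h : z = conj z) : z.im = 0 := by
  have := congrArg im h
  rw [conj_im] at this
  linarith

lemma hypKernel_ofReal_im (ϑ : ℝ) (n : ℕ) (x : ℝ) : (hypKernel g ϑ n x).im = 0 :=
  im_eq_zero_of_conj_eq (by rw [← hypKernel_conj, conj_ofReal])

lemma hypKernel_add_pi_div_two_im (ϑ : ℝ) (n : ℕ) (x : ℝ) :
    (hypKernel g ϑ n (x + (π / 2 : ℝ) * I)).im = 0 := by
  refine im_eq_zero_of_conj_eq ?_
  rw [← hypKernel_conj, ← hypKernel_sub_pi_mul_I]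
  congr 1
  simp only [map_add, map_mul, conj_ofReal, conj_I]
  push_cast
  ring

lemma hypKernel_mul_I_im (ϑ : ℝ) (n : ℕ) (α : ℝ) : (hypKernel g ϑ n (α * I) * I).im = 0 := by
  refine im_eq_zero_of_conj_eq ?_
  rw [map_mul, conj_I, ← hypKernel_conj, map_mul, conj_ofReal, conj_I, mul_neg (α : ℂ), hypKernel_neg,
    neg_mul_neg]

def hypDomain (g : ℕ) (ϑ : ℝ) : Set ℂ := {τ | 1 + exp τ ^ 2 ≠ 0 ∧
  hypMap g ϑ (joukInv τ) * hypMap g ϑ (-joukInv τ) ≠ 0}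

lemma differentiableOn_joukInv : DifferentiableOn ℂ joukInv {τ | 1 + exp τ ^ 2 ≠ 0} := by
  refine DifferentiableOn.div ?_ ?_ fun τ hτ => hτ <;> fun_prop

lemma isOpen_hypDomain (ϑ : ℝ) : IsOpen (hypDomain g ϑ) := by
  have h1 : IsOpen {τ : ℂ | 1 + exp τ ^ 2 ≠ 0} := isOpen_ne_fun (by fun_prop) continuous_const
  have hc := (differentiable_hypMap g ϑ).continuous
  have h2 : ContinuousOn (fun τ => hypMap g ϑ (joukInv τ) * hypMap g ϑ (-joukInv τ))
      {τ : ℂ | 1 + exp τ ^ 2 ≠ 0} :=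
    (hc.comp_continuousOn differentiableOn_joukInv.continuousOn).mul
      (hc.comp_continuousOn differentiableOn_joukInv.continuousOn.neg)
  exact h2.isOpen_inter_preimage h1 isOpen_ne

lemma differentiableOn_evenPow (ϑ : ℝ) (n : ℕ) : DifferentiableOn ℂ (evenPow g ϑ n)
    {v | hypMap g ϑ v * hypMap g ϑ (-v) ≠ 0} := by
  have h := (differentiable_hypMap g ϑ).differentiableOn (s := {v | hypMap g ϑ v * hypMap g ϑ (-v) ≠ 0})
  refine ((h.inv fun v hv => left_ne_zero_of_mul hv).pow n).add
    (((((differentiable_hypMap g ϑ).comp differentiable_neg).differentiableOn).inv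
      fun v hv => right_ne_zero_of_mul hv).pow n)

lemma differentiableOn_hypKernel (ϑ : ℝ) (n : ℕ) :
    DifferentiableOn ℂ (hypKernel g ϑ n) (hypDomain g ϑ) := by
  refine DifferentiableOn.mul ?_ (DifferentiableOn.div (by fun_prop) (by fun_prop) fun τ hτ => hτ.1)
  exact (differentiableOn_evenPow ϑ n).comp (differentiableOn_joukInv.mono fun τ hτ => hτ.1)
    fun τ hτ => hτ.2

lemma mem_hypDomain (hg : 2 ≤ g) (ϑ : ℝ) {x α : ℝ} (h : (x, α) ∈ zeroFreeRegion g) :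
    (x + α * I : ℂ) ∈ hypDomain g ϑ := by
  refine ⟨one_add_ne_zero_of_mem hg h, mul_ne_zero (hypMap_exp_ne_zero hg ϑ h) ?_⟩
  rw [← hypMap_pi_sub]
  exact hypMap_exp_ne_zero hg _ h

lemma zeroFreeRegion_mono (hg : 2 ≤ g) {x y α : ℝ} (h : (x, α) ∈ zeroFreeRegion g) (hy : y ≤ x) :
    (y, α) ∈ zeroFreeRegion g := by
  rcases hy.eq_or_lt with rfl | hy
  · exact h
  obtain ⟨h0, h1, h2⟩ := h
  have hφ := critAngle_pos g
  have hφ' := critAngle_le hg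
  have hπ := pi_pos
  have hs : 0 < rsin (critAngle g) := sin_pos_of_pos_of_lt_pi hφ (by linarith)
  refine ⟨h0, h1, Or.inr ?_⟩
  simp only at h0 h1 h2 ⊢
  rcases le_or_gt (rsin (2 * α - critAngle g)) 0 with hneg | hpos
  · refine ⟨?_, (mul_nonpos_of_nonneg_of_nonpos (Real.exp_pos _).le hneg).trans hs.le⟩
    grind
  rcases h2 with ⟨rfl, h⟩ | ⟨hx, h⟩
  · refine ⟨hy, ?_⟩
    have h3 : rexp (2 * y) ≤ 1 := Real.exp_le_one_iff.2 (by linarith)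
    have h4 : rsin (2 * α - critAngle g) ≤ rsin (critAngle g) :=
      Real.sin_le_sin_of_le_of_le_pi_div_two (by linarith) (by linarith) (by linarith)
    exact (mul_le_of_le_one_left hpos.le h3).trans h4
  · refine ⟨hy.trans hx, le_trans ?_ h⟩
    gcongr

def radialTerm (g : ℕ) (ϑ : ℝ) (n : ℕ) (y x α : ℝ) : ℂ :=
  ∫ s in (0 : ℝ)..1, hypKernel g ϑ n (y + α * I + s * (x + α * I - (y + α * I))) *
    (x + α * I - (y + α * I))

lemma integral_hypKernel_sub (hg : 2 ≤ g) (ϑ : ℝ) (n : ℕ) {x x' : ℝ → ℝ} {a b y : ℝ} (hab : a ≤ b)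
    (hx : ∀ t ∈ Icc a b, HasDerivAt x (x' t) t) (hc : ContinuousOn x' (Icc a b))
    (hmem : ∀ t ∈ Icc a b, (x t, t) ∈ zeroFreeRegion g) (hy : ∀ t ∈ Icc a b, y ≤ x t) :
    (∫ t in a..b, hypKernel g ϑ n (x t + t * I) * (x' t + I)) -
      (∫ t in a..b, hypKernel g ϑ n (y + t * I) * I) =
      radialTerm g ϑ n y (x b) b - radialTerm g ϑ n y (x a) a := by
  have hI : ∀ t : ℝ, HasDerivAt (fun t : ℝ => (t : ℂ) * I) I t := fun t => by
    simpa using (ofRealCLM.hasDerivAt (x := t)).mul_const I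
  refine integral_sub_integral_of_linear_homotopy (isOpen_hypDomain ϑ)
    (differentiableOn_hypKernel ϑ n) (τ₀ := fun t : ℝ => (y : ℂ) + t * I)
    (τ₁ := fun t : ℝ => (x t : ℂ) + t * I) (τ₀' := fun _ => I) (τ₁' := fun t => x' t + I) hab
    (fun t _ => (hI t).const_add _) (fun t ht => (hx t ht).ofReal_comp.add (hI t))
    continuousOn_const (((continuous_ofReal.comp_continuousOn hc)).add continuousOn_const)
    fun t ht s hs => ?_
  have h := mem_hypDomain hg ϑ (zeroFreeRegion_mono hg (hmem t ht) (y := y + s * (x t - y)) (by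
    nlinarith [hy t ht, hs.1, hs.2]))
  convert h using 1
  push_cast
  ring

lemma im_integral_mul_eq_zero {f : ℝ → ℂ} (hf : ∀ t, (f t).im = 0) (a b : ℝ) :
    (∫ t in a..b, f t).im = 0 := by
  have : f = fun t => ((f t).re : ℂ) := funext fun t => Complex.ext rfl (hf t)
  rw [this, intervalIntegral.integral_ofReal, ofReal_im]

lemma radialTerm_zero_im (ϑ : ℝ) (n : ℕ) (y x : ℝ) : (radialTerm g ϑ n y x 0).im = 0 := by
  refine im_integral_mul_eq_zero (fun s => ?_) _ _
  have h1 : (y : ℂ) + (0 : ℝ) * I + s * (x + (0 : ℝ) * I - (y + (0 : ℝ) * I)) =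
    ((y + s * (x - y) : ℝ) : ℂ) := by push_cast; ring
  have h2 : (x : ℂ) + (0 : ℝ) * I - (y + (0 : ℝ) * I) = ((x - y : ℝ) : ℂ) := by push_cast; ring
  rw [h1, h2, im_mul_ofReal, hypKernel_ofReal_im, zero_mul]

lemma radialTerm_pi_div_two_im (ϑ : ℝ) (n : ℕ) (y x : ℝ) :
    (radialTerm g ϑ n y x (π / 2)).im = 0 := by
  refine im_integral_mul_eq_zero (fun s => ?_) _ _
  have h2 : (x : ℂ) + (π / 2 : ℝ) * I - (y + (π / 2 : ℝ) * I) = ((x - y : ℝ) : ℂ) := by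
    push_cast; ring
  have h1 : (y : ℂ) + (π / 2 : ℝ) * I + s * ((x - y : ℝ) : ℂ) =
    ((y + s * (x - y) : ℝ) : ℂ) + (π / 2 : ℝ) * I := by push_cast; ring
  rw [h2, h1, im_mul_ofReal, hypKernel_add_pi_div_two_im, zero_mul]

def rayLog (g : ℕ) (α : ℝ) : ℝ :=
  (rlog (rsin (critAngle g)) - rlog (rsin (2 * α - critAngle g))) / 2

lemma sin_lt_sin_of_lt_of_lt_pi_sub {a b : ℝ} (hb : 0 ≤ b) (hab : b < a) (ha : a < π - b) :
    rsin b < rsin a := by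
  rcases le_or_gt a (π / 2) with h | h
  · exact Real.sin_lt_sin_of_lt_of_le_pi_div_two (by linarith [pi_pos]) h hab
  · rw [← Real.sin_pi_sub a]
    exact Real.sin_lt_sin_of_lt_of_le_pi_div_two (by linarith [pi_pos]) (by linarith) (by linarith)

lemma sin_critAngle_pos (hg : 2 ≤ g) : 0 < rsin (critAngle g) :=
  sin_pos_of_pos_of_lt_pi (critAngle_pos g) (by linarith [critAngle_le hg, pi_pos])

lemma sin_critAngle_le (hg : 2 ≤ g) {α : ℝ} (hα : α ∈ Icc (critAngle g) (5 * π / 12)) :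
    rsin (critAngle g) ≤ rsin (2 * α - critAngle g) := by
  rcases hα.1.eq_or_lt with h | h
  · rw [← h]; ring_nf; rfl
  · exact (sin_lt_sin_of_lt_of_lt_pi_sub (critAngle_pos g).le (by linarith)
      (by linarith [hα.2, pi_pos])).le

lemma exp_two_mul_rayLog (hg : 2 ≤ g) {α : ℝ} (hα : α ∈ Icc (critAngle g) (5 * π / 12)) :
    rexp (2 * rayLog g α) = rsin (critAngle g) / rsin (2 * α - critAngle g) := by
  have h1 := sin_critAngle_pos hg
  rw [rayLog, mul_div_cancel₀ _ two_ne_zero, Real.exp_sub, Real.exp_log h1,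
    Real.exp_log (h1.trans_le (sin_critAngle_le hg hα))]

lemma hasDerivAt_rayLog (hg : 2 ≤ g) {α : ℝ}
    (hα : α ∈ Icc (critAngle g) (5 * π / 12)) : HasDerivAt (rayLog g)
      (-(rcos (2 * α - critAngle g) / rsin (2 * α - critAngle g))) α := by
  have h1 := (sin_critAngle_pos hg).trans_le (sin_critAngle_le hg hα)
  have h2 : HasDerivAt (fun α => 2 * α - critAngle g) (2 * 1) α :=
    ((hasDerivAt_id α).const_mul 2).sub_const _
  refine ((((h2.sin.log h1.ne').const_sub _).div_const 2)).congr_deriv ?_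
  ring

lemma rayLog_mem (hg : 2 ≤ g) {α : ℝ} (hα : α ∈ Icc (critAngle g) (5 * π / 12)) :
    (rayLog g α, α) ∈ zeroFreeRegion g := by
  have hs := sin_critAngle_pos hg
  have hφ := critAngle_pos g
  refine ⟨hφ.le.trans hα.1, hα.2.trans (by linarith [pi_pos]), ?_⟩
  rcases hα.1.eq_or_lt with h | h
  · left
    refine ⟨?_, h.ge⟩
    rw [rayLog, ← h, two_mul, add_sub_cancel_right, sub_self, zero_div]
  · right
    have h1 := sin_lt_sin_of_lt_of_lt_pi_sub (a := 2 * α - critAngle g) hφ.le (by linarith)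
      (by linarith [hα.2, pi_pos])
    refine ⟨?_, ?_⟩
    · exact div_neg_of_neg_of_pos (sub_neg.2 (Real.log_lt_log hs h1)) two_pos
    · rw [exp_two_mul_rayLog hg hα, div_mul_cancel₀ _ (hs.trans h1).ne']

lemma cap_mem_Icc (hg : 2 ≤ g) : 5 * π / 12 ∈ Icc (critAngle g) (5 * π / 12) :=
  ⟨by linarith [critAngle_le hg, pi_pos], le_rfl⟩

lemma capLog_mem (hg : 2 ≤ g) {α : ℝ} (hα : α ∈ Icc (5 * π / 12) (π / 2)) :
    (rayLog g (5 * π / 12), α) ∈ zeroFreeRegion g := by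
  have hs := sin_critAngle_pos hg
  have hπ := pi_pos
  have hφ' := critAngle_le hg
  have h1 := sin_lt_sin_of_lt_of_lt_pi_sub (a := 2 * (5 * π / 12) - critAngle g)
    (critAngle_pos g).le (by linarith) (by linarith)
  refine ⟨by linarith [hα.1], hα.2, Or.inr ⟨?_, ?_⟩⟩
  · exact div_neg_of_neg_of_pos (sub_neg.2 (Real.log_lt_log hs h1)) two_pos
  · rw [exp_two_mul_rayLog hg (cap_mem_Icc hg), div_mul_eq_mul_div, div_le_iff₀ (hs.trans h1)]
    refine mul_le_mul_of_nonneg_left ?_ hs.le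
    rw [← Real.sin_pi_sub, ← Real.sin_pi_sub (2 * (5 * π / 12) - critAngle g)]
    exact Real.sin_le_sin_of_le_of_le_pi_div_two (by linarith [hα.2, critAngle_pos g]) (by linarith)
      (by linarith [hα.1])

lemma axis_mem (hg : 2 ≤ g) {α : ℝ} (hα : α ∈ Icc 0 (critAngle g)) : (0, α) ∈ zeroFreeRegion g :=
  ⟨hα.1, by linarith [hα.2, critAngle_le hg, pi_pos], Or.inl ⟨rfl, hα.2⟩⟩

def contourIntegral (g : ℕ) (ϑ : ℝ) (n : ℕ) : ℂ :=
  (∫ t in critAngle g..5 * π / 12, hypKernel g ϑ n (rayLog g t + t * I) *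
    ((-(rcos (2 * t - critAngle g) / rsin (2 * t - critAngle g)) : ℝ) + I)) +
  ∫ t in 5 * π / 12..π / 2, hypKernel g ϑ n (rayLog g (5 * π / 12) + t * I) * I

lemma im_integral_hypKernel (hg : 2 ≤ g) (ϑ : ℝ) (n : ℕ) {y : ℝ}
    (hy : rexp (2 * y) ≤ rsin (critAngle g)) :
    (∫ t in (0 : ℝ)..π / 2, hypKernel g ϑ n (y + t * I) * I).im = (contourIntegral g ϑ n).im := by
  have hs := sin_critAngle_pos hg
  have hy0 : y ≤ 0 := by have := Real.exp_le_one_iff.1 (hy.trans (Real.sin_le_one _)); linarith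
  have hyr : ∀ t ∈ Icc (critAngle g) (5 * π / 12), y ≤ rayLog g t := fun t ht => by
    have h1 := hs.trans_le (sin_critAngle_le hg ht)
    have : rexp (2 * y) ≤ rexp (2 * rayLog g t) := by
      rw [exp_two_mul_rayLog hg ht]
      exact hy.trans ((le_div_iff₀ h1).2 (mul_le_of_le_one_right hs.le (Real.sin_le_one _)))
    linarith [Real.exp_le_exp.1 this]
  have hφ := critAngle_pos g
  have hπ := pi_pos
  have hcap := cap_mem_Icc hg
  have hr0 : rayLog g (critAngle g) = 0 := by
    rw [rayLog, two_mul, add_sub_cancel_right, sub_self, zero_div]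
  have e1 := integral_hypKernel_sub hg ϑ n (x := fun _ => 0) (x' := fun _ => 0) (y := y) hφ.le
    (fun t _ => hasDerivAt_const t 0) continuousOn_const (fun t ht => axis_mem hg ht) (fun _ _ => hy0)
  have e2 := integral_hypKernel_sub hg ϑ n (y := y) hcap.1
    (fun t ht => hasDerivAt_rayLog hg ht) (ContinuousOn.neg (ContinuousOn.div (by fun_prop)
      (by fun_prop) fun t ht => (hs.trans_le (sin_critAngle_le hg ht)).ne'))
    (fun t ht => rayLog_mem hg ht) hyr
  have e3 := integral_hypKernel_sub hg ϑ n (x := fun _ => rayLog g (5 * π / 12))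
    (x' := fun _ => 0) (y := y) (show 5 * π / 12 ≤ π / 2 by linarith)
    (fun t _ => hasDerivAt_const t _) continuousOn_const (fun t ht => capLog_mem hg ht)
    (fun _ _ => hyr _ hcap)
  simp only [ofReal_zero, zero_add] at e1 e3
  rw [hr0] at e2
  have h1 := congrArg im e1
  have h2 := congrArg im e2
  have h3 := congrArg im e3
  rw [sub_im, sub_im, im_integral_mul_eq_zero (fun t => hypKernel_mul_I_im ϑ n t),
    radialTerm_zero_im] at h1
  rw [sub_im, sub_im] at h2 h3
  rw [radialTerm_pi_div_two_im] at h3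
  have hmem : ∀ t ∈ Icc 0 (π / 2), (y, t) ∈ zeroFreeRegion g := fun t ht => by
    rcases le_total t (critAngle g) with h | h
    · exact zeroFreeRegion_mono hg (axis_mem hg ⟨ht.1, h⟩) hy0
    rcases le_total t (5 * π / 12) with h' | h'
    · exact zeroFreeRegion_mono hg (rayLog_mem hg ⟨h, h'⟩) (hyr t ⟨h, h'⟩)
    · exact zeroFreeRegion_mono hg (capLog_mem hg ⟨h', ht.2⟩) (hyr _ hcap)
  have hint : ∀ a b : ℝ, 0 ≤ a → a ≤ b → b ≤ π / 2 →
      IntervalIntegrable (fun t : ℝ => hypKernel g ϑ n (y + t * I) * I) volume a b := by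
    intro a b ha hab hb
    refine ContinuousOn.intervalIntegrable (ContinuousOn.mul ?_ continuousOn_const)
    rw [uIcc_of_le hab]
    exact (differentiableOn_hypKernel ϑ n).continuousOn.comp (by fun_prop)
      fun t ht => mem_hypDomain hg ϑ (hmem t ⟨ha.trans ht.1, ht.2.trans hb⟩)
  have hadd : (∫ t in (0 : ℝ)..π / 2, hypKernel g ϑ n (y + t * I) * I) =
      (∫ t in (0 : ℝ)..critAngle g, hypKernel g ϑ n (y + t * I) * I) +
      (∫ t in critAngle g..5 * π / 12, hypKernel g ϑ n (y + t * I) * I) +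
      ∫ t in 5 * π / 12..π / 2, hypKernel g ϑ n (y + t * I) * I := by
    rw [integral_add_adjacent_intervals (hint _ _ le_rfl hφ.le (by linarith [hcap.1]))
      (hint _ _ hφ.le hcap.1 (by linarith)),
      integral_add_adjacent_intervals (hint _ _ le_rfl (by linarith) (by linarith))
      (hint _ _ (by linarith) (by linarith) le_rfl)]
  rw [hadd, contourIntegral, add_im, add_im, add_im]
  linarith

lemma evenPow_ofReal_im (ϑ : ℝ) (n : ℕ) (x : ℝ) : (evenPow g ϑ n x).im = 0 :=
  im_eq_zero_of_conj_eq (by rw [← evenPow_conj, conj_ofReal])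

lemma evenPow_ofReal_mul_I_im (ϑ : ℝ) (n : ℕ) (x : ℝ) : (evenPow g ϑ n (x * I)).im = 0 :=
  im_eq_zero_of_conj_eq (by rw [← evenPow_conj, map_mul, conj_ofReal, conj_I, mul_neg, evenPow_neg])

lemma hypMap_mul_neg_ne_zero (hg : 0 < g) (ϑ : ℝ) {v : ℂ} (hv : v ≠ 0) (h : ‖v‖ ≤ hypRadius g) :
    hypMap g ϑ v * hypMap g ϑ (-v) ≠ 0 := mul_ne_zero (hypMap_ne_zero_of_norm_le hg ϑ hv h)
    (hypMap_ne_zero_of_norm_le hg ϑ (neg_ne_zero.2 hv) (by rwa [norm_neg]))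

lemma im_integral_hypKernel_eq_evenPow (hg : 0 < g) (ϑ : ℝ) (n : ℕ) {y : ℝ}
    (hy : rexp y ≤ 1 / 2) (hy' : rexp y ≤ hypRadius g / 2) :
    (∫ t in (0 : ℝ)..π / 2, hypKernel g ϑ n (y + t * I) * I).im =
      (∫ t in (0 : ℝ)..π / 2, evenPow g ϑ n (hypRadius g * cis t) * I).im := by
  have hr := hypRadius_pos g
  set r := hypRadius g with hrd
  have hy0 : 0 < rexp y := Real.exp_pos y
  have hsm : ∀ t : ℝ, ‖exp (y + t * I) ^ 2‖ ≤ 1 / 2 := fun t => by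
    rw [norm_pow, norm_exp]; simp only [add_re, ofReal_re, mul_re, I_re, mul_zero, ofReal_im, I_im,
      mul_one, sub_self, add_zero]
    nlinarith
  have hsl : ∀ t : ℝ, 1 + exp (y + t * I) ^ 2 ∈ slitPlane := fun t =>
    one_add_mem_slitPlane_of_norm_lt_one ((hsm t).trans_lt (by norm_num))
  have hne : ∀ t : ℝ, 1 + exp (y + t * I) ^ 2 ≠ 0 := fun t => slitPlane_ne_zero (hsl t)
  set τ₀ : ℝ → ℂ := fun t => (rlog r : ℝ) + t * I with hτ₀
  set τ₁ : ℝ → ℂ := fun t => y + t * I - log (1 + exp (y + t * I) ^ 2) with hτ₁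
  have hexp₀ : ∀ t, exp (τ₀ t) = r * cis t := fun t => by
    rw [hτ₀, exp_add, ← ofReal_exp, Real.exp_log hr]
  have hexp₁ : ∀ t, exp (τ₁ t) = joukInv (y + t * I) := fun t => by
    rw [hτ₁, exp_sub, exp_log (hne t)]; rfl
  have hI : ∀ t : ℝ, HasDerivAt (fun t : ℝ => (t : ℂ) * I) I t := fun t => by
    simpa using (ofRealCLM.hasDerivAt (x := t)).mul_const I
  have hd₁ : ∀ t : ℝ, HasDerivAt τ₁ ((1 - exp (y + t * I) ^ 2) / (1 + exp (y + t * I) ^ 2) * I) t := by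
    intro t
    have h1 : HasDerivAt (fun t : ℝ => (y : ℂ) + t * I) I t := (hI t).const_add _
    refine (h1.sub ((((h1.cexp).pow 2).const_add 1).clog_real (hsl t))).congr_deriv ?_
    have := hne t
    simp only [Pi.pow_apply]
    grind
  have hcd : Continuous fun t : ℝ => (1 - exp (y + t * I) ^ 2) / (1 + exp (y + t * I) ^ 2) * I :=
    Continuous.mul (Continuous.div (by fun_prop) (by fun_prop) hne) continuous_const
  have hre₁ : ∀ t, (τ₁ t).re ≤ rlog r := by
    intro t
    rw [Real.le_log_iff_exp_le hr, ← norm_exp, hexp₁, joukInv, norm_div, norm_exp,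
      div_le_iff₀ (norm_pos_iff.2 (hne t))]
    have h2 : 1 / 2 ≤ ‖1 + exp (y + t * I) ^ 2‖ := by
      have := norm_sub_le_norm_add 1 (exp (y + t * I) ^ 2)
      rw [norm_one] at this
      linarith [hsm t]
    have h3 : (y + t * I : ℂ).re = y := by simp
    rw [h3]
    nlinarith
  have hko : IsOpen {σ : ℂ | hypMap g ϑ (exp σ) * hypMap g ϑ (-exp σ) ≠ 0} := by
    have hc := (differentiable_hypMap g ϑ).continuous
    exact isOpen_ne_fun ((hc.comp continuous_exp).mul (hc.comp continuous_exp.neg)) continuous_const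
  have hk : DifferentiableOn ℂ (fun σ => evenPow g ϑ n (exp σ))
      {σ : ℂ | hypMap g ϑ (exp σ) * hypMap g ϑ (-exp σ) ≠ 0} :=
    (differentiableOn_evenPow ϑ n).comp differentiable_exp.differentiableOn fun σ hσ => hσ
  have key := integral_sub_integral_of_linear_homotopy hko hk (τ₀ := τ₀) (τ₁ := τ₁)
    (τ₀' := fun _ => I) (show 0 ≤ π / 2 by positivity)
    (fun t _ => (hI t).const_add _) (fun t _ => hd₁ t) continuousOn_const hcd.continuousOn
    fun t _ s hs => by
      refine hypMap_mul_neg_ne_zero hg ϑ (exp_ne_zero _) ?_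
      rw [norm_exp, ← Real.le_log_iff_exp_le hr]
      have h0 : (τ₀ t).re = rlog r := by simp [hτ₀]
      rw [add_re, re_ofReal_mul, sub_re, h0]
      nlinarith [hre₁ t, hs.1]
  have hend : ∀ t : ℝ, (∀ x : ℝ, (evenPow g ϑ n (x * cis t)).im = 0) →
      (τ₁ t - τ₀ t).im = 0 → (∫ s in (0 : ℝ)..1,
        evenPow g ϑ n (exp (τ₀ t + s * (τ₁ t - τ₀ t))) * (τ₁ t - τ₀ t)).im = 0 := by
    intro t h1 h2
    refine im_integral_mul_eq_zero (fun s => ?_) _ _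
    have h3 : τ₁ t - τ₀ t = ((τ₁ t - τ₀ t).re : ℝ) := Complex.ext rfl h2
    generalize (τ₁ t - τ₀ t).re = d at h3
    rw [h3, im_mul_ofReal, exp_add, hexp₀, mul_right_comm, ← ofReal_mul, ← ofReal_exp, ← ofReal_mul,
      h1, zero_mul]
  have hlog : ∀ t : ℝ, (exp (y + t * I) ^ 2).im = 0 → (τ₁ t - τ₀ t).im = 0 := by
    intro t ht
    have h1 : exp (y + t * I) ^ 2 = ((exp (y + t * I) ^ 2).re : ℝ) := Complex.ext rfl ht
    have h2 : 0 ≤ 1 + (exp (y + t * I) ^ 2).re := by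
      linarith [(abs_le.1 ((abs_re_le_norm _).trans (hsm t))).1]
    have h3 : (log (1 + exp (y + t * I) ^ 2)).im = 0 := by
      rw [log_im, h1, ← ofReal_one, ← ofReal_add, arg_ofReal_of_nonneg h2]
    simp only [hτ₁, hτ₀, sub_im, h3]
    simp
  have h1 := congrArg im key
  rw [sub_im, sub_im, hend (π / 2) (fun x => ?_) (hlog _ ?_), hend 0 (fun x => ?_) (hlog _ ?_),
    sub_zero, sub_eq_zero] at h1
  · simp only [hexp₀, hexp₁] at h1
    rw [← h1]
    simp only [hypKernel, mul_assoc]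
  · rw [ofReal_zero, zero_mul, add_zero, ← ofReal_exp, ← ofReal_pow, ofReal_im]
  · rw [ofReal_zero, zero_mul, exp_zero, mul_one, evenPow_ofReal_im]
  · push_cast
    rw [exp_add, exp_pi_div_two_mul_I, mul_pow, I_sq, ← ofReal_exp, ← ofReal_pow, mul_neg_one,
      neg_im, ofReal_im, neg_zero]
  · push_cast; rw [exp_pi_div_two_mul_I, evenPow_ofReal_mul_I_im]

lemma circMean_hypMap_re (hg : 2 ≤ g) (ϑ : ℝ) (n : ℕ) :
    (circMean fun α : ℝ => (hypMap g ϑ (hypRadius g * cis α))⁻¹ ^ n).re =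
      (contourIntegral g ϑ n).im / π := by
  have hr := hypRadius_pos g
  have hs := sin_critAngle_pos hg
  set h : ℝ → ℂ := fun α => (hypMap g ϑ (hypRadius g * cis α))⁻¹ ^ n with hh
  have hne : ∀ α : ℝ, hypMap g ϑ (hypRadius g * cis α) ≠ 0 := fun α =>
    hypMap_ne_zero_of_norm_le (by omega) ϑ (mul_ne_zero (mod_cast hr.ne') (exp_ne_zero _))
      (norm_mul_exp hr α).le
  have hc : Continuous h := (((differentiable_hypMap g ϑ).continuous.comp (by fun_prop)).inv₀ hne).pow n
  have hper : Periodic h (2 * π) := fun α => by simp only [hh, exp_add_two_pi_mul_I]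
  have hev : ∀ α : ℝ, h α + h (α + π) = evenPow g ϑ n (hypRadius g * cis α) := by
    intro α
    have : exp ((α + π : ℝ) * I) = -cis α := by
      push_cast; rw [add_mul, exp_add, exp_pi_mul_I, mul_neg_one]
    simp only [hh, evenPow, this, mul_neg]
  have hcj : ∀ α : ℝ, h (-α) = conj (h α) := by
    intro α
    have : (hypRadius g : ℂ) * exp ((-α : ℝ) * I) = conj (hypRadius g * cis α) := by
      rw [map_mul, conj_ofReal, ← exp_conj, map_mul, conj_ofReal, conj_I]; push_cast; ring_nf
    simp only [hh, this, hypMap_conj, map_pow, map_inv₀]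
  have hi : ∀ a b, IntervalIntegrable h volume a b := fun a b => hc.intervalIntegrable a b
  have hsh : ∀ a b : ℝ, ∫ α in a..b, h (α + π) = ∫ α in a + π..b + π, h α :=
    fun a b => intervalIntegral.integral_comp_add_right h _
  have hcπ : Continuous fun α => h (α + π) := hc.comp (continuous_add_const π)
  have e1 : ∫ α in (0 : ℝ)..2 * π, h α = ∫ α in -(π / 2)..π / 2, (h α + h (α + π)) := by
    rw [integral_add (hi _ _) (hcπ.intervalIntegrable _ _), hsh, show -(π / 2) + π = π / 2 by ring,
      integral_add_adjacent_intervals (hi _ _) (hi _ _)]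
    have := hper.intervalIntegral_add_eq 0 (-(π / 2))
    grind
  set K : ℝ → ℂ := fun α => h α + h (α + π) with hK
  have hKc : Continuous K := hc.add hcπ
  have hKi : ∀ a b, IntervalIntegrable K volume a b := fun a b => hKc.intervalIntegrable a b
  have hKn : ∀ α, (K (-α)).re = (K α).re := fun α => by
    have h1 : h (-α + π) = conj (h (α + π)) := by rw [← hcj, ← hper (-(α + π))]; congr 1; ring
    simp only [hK, h1, hcj, ← map_add, conj_re]
  have hre : ∀ (f : ℝ → ℂ) a b, IntervalIntegrable f volume a b →
      (∫ t in a..b, f t).re = ∫ t in a..b, (f t).re := fun f a b hf =>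
    (reCLM.intervalIntegral_comp_comm hf).symm
  have e2 : (∫ α in (0 : ℝ)..2 * π, h α).re = 2 * ∫ α in (0 : ℝ)..π / 2, (K α).re := by
    rw [e1, hre K _ _ (hKi _ _)]
    have hri : ∀ a b, IntervalIntegrable (fun t => (K t).re) volume a b := fun a b =>
      (continuous_re.comp hKc).intervalIntegrable a b
    rw [← integral_add_adjacent_intervals (hri _ 0) (hri 0 _)]
    have := integral_comp_neg (a := 0) (b := π / 2) (fun t => (K t).re)
    rw [neg_zero] at this
    rw [← this]
    simp only [hKn]
    ring
  have e3 : ∫ α in (0 : ℝ)..π / 2, (K α).re = (contourIntegral g ϑ n).im := by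
    obtain ⟨y, hy⟩ : ∃ y, y = rlog (min (1 / 2) (min (hypRadius g / 2) (rsin (critAngle g)))) :=
      ⟨_, rfl⟩
    have hpos : 0 < min (1 / 2) (min (hypRadius g / 2) (rsin (critAngle g))) := by positivity
    have hye : rexp y = min (1 / 2) (min (hypRadius g / 2) (rsin (critAngle g))) := by
      rw [hy, Real.exp_log hpos]
    have h1 : rexp y ≤ 1 / 2 := hye.trans_le (min_le_left _ _)
    have h2 : rexp y ≤ hypRadius g / 2 := hye.trans_le ((min_le_right _ _).trans (min_le_left _ _))
    have h3 : rexp y ≤ rsin (critAngle g) :=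
      hye.trans_le ((min_le_right _ _).trans (min_le_right _ _))
    rw [← im_integral_hypKernel hg ϑ n (y := y) (by
      rw [two_mul, Real.exp_add]; nlinarith [Real.exp_pos y]),
      im_integral_hypKernel_eq_evenPow (by omega) ϑ n h1 h2, intervalIntegral.integral_mul_const,
      mul_I_im, ← hre _ _ _ (hKi _ _)]
    simp only [hK, hev]
  have hπ := pi_ne_zero
  rw [circMean, Complex.smul_re, e2, e3, smul_eq_mul]
  field_simp

end contour

section contourBound


variable {g : ℕ}

lemma sin_sq_div_four_le {ϑ μ ν : ℝ} (hμ : 0 ≤ μ)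
    (h : μ ^ 2 ≤ 1 / 2 ∨ (0 ≤ ν ∧ ν ≤ 1 / 2 ∧ μ * (1 + ν) ≤ 1)) :
    rsin ϑ ^ 2 / 4 ≤ 1 - 2 * rcos ϑ * (μ * rcos ν) + μ ^ 2 * rcos (2 * ν) := by
  set a := μ * rcos ν with ha
  have e1 : μ ^ 2 * rcos (2 * ν) = 2 * a ^ 2 - μ ^ 2 := by rw [Real.cos_two_mul, ha]; ring
  have key : 1 / 2 ≤ 1 + 2 * a ^ 2 - μ ^ 2 ∧ 2 * |a| ≤ 1 + 2 * a ^ 2 - μ ^ 2 := by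
    rcases h with h | ⟨h0, h1, h2⟩
    · exact ⟨by nlinarith, by nlinarith [sq_nonneg (2 * |a| - 1), sq_abs a]⟩
    · have hb0 : 0 ≤ rsin ν := Real.sin_nonneg_of_nonneg_of_le_pi h0 (by linarith [pi_gt_three])
      have hb1 : rsin ν ≤ ν := sin_le h0
      have hc0 : 0 ≤ rcos ν := Real.cos_nonneg_of_neg_pi_div_two_le_of_le
        (by linarith [pi_gt_three]) (by linarith [pi_gt_three])
      have ha0 : 0 ≤ a := mul_nonneg hμ hc0
      have hab : a + μ * rsin ν ≤ 1 := by
        have : a ≤ μ * 1 := mul_le_mul_of_nonneg_left (cos_le_one ν) hμ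
        nlinarith
      have hm : μ ^ 2 = a ^ 2 + (μ * rsin ν) ^ 2 := by rw [ha]; nlinarith [Real.sin_sq_add_cos_sq ν]
      have hb : 0 ≤ μ * rsin ν := mul_nonneg hμ hb0
      have hb' : μ * rsin ν ≤ 1 / 2 := by nlinarith
      rw [abs_of_nonneg ha0, hm]
      exact ⟨by nlinarith, by nlinarith⟩
  have hc := abs_cos_le_one ϑ
  have h1 : 2 * rcos ϑ * a ≤ |rcos ϑ| * (2 * |a|) := by
    have := le_abs_self (rcos ϑ * a)
    rw [abs_mul] at this
    linarith
  have h2 := mul_le_mul_of_nonneg_left key.2 (abs_nonneg (rcos ϑ))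
  have h3 := mul_le_mul_of_nonneg_left key.1 (sub_nonneg.2 hc)
  have h4 : rsin ϑ ^ 2 = (1 - |rcos ϑ|) * (1 + |rcos ϑ|) := by rw [Real.sin_sq, ← sq_abs]; ring
  rw [e1, h4]
  nlinarith [abs_nonneg (rcos ϑ)]

lemma critAngle_lt (hg : 2 ≤ g) : critAngle g < 0.63 := by linarith [critAngle_le hg, Real.pi_lt_d2]

lemma cos_critAngle_gt (hg : 2 ≤ g) : 0.8 < rcos (critAngle g) := by
  have h2 := one_sub_sq_div_two_le_cos (x := critAngle g)
  nlinarith [critAngle_lt hg, critAngle_pos g]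

lemma one_add_mul_sin_le (hg : 2 ≤ g) {x : ℝ} (hx : 0 ≤ x) (hx' : x ≤ 1 / 5) :
    (1 + x) * rsin (critAngle g) ≤ rsin (critAngle g + x) := by
  have hs := sin_critAngle_pos hg
  have h1 := one_sub_sq_div_two_le_cos (x := x)
  have h2 : x - x ^ 3 / 4 ≤ rsin x := by
    rcases hx.eq_or_lt with rfl | h
    · simp
    · linarith [Real.sin_gt_sub_cube h, pow_pos h 3]
  have h3 : 1.25 * rsin (critAngle g) ≤ rcos (critAngle g) := by
    have := sin_le (critAngle_pos g).le
    linarith [cos_critAngle_gt hg, critAngle_lt hg]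
  have h4 : 0 ≤ x - x ^ 3 / 4 := by nlinarith [sq_nonneg x]
  rw [Real.sin_add]
  have h5 : 1.25 * rsin (critAngle g) * (x - x ^ 3 / 4) ≤ rcos (critAngle g) * rsin x :=
    mul_le_mul h3 h2 h4 (by linarith)
  have h6 := mul_le_mul_of_nonneg_left h1 hs.le
  have h7 : 0 ≤ rsin (critAngle g) * (x * (0.25 - x / 2 - 1.25 * x ^ 2 / 4)) :=
    mul_nonneg hs.le (mul_nonneg hx (by nlinarith))
  nlinarith

lemma two_mul_add_one_mul_critAngle (g : ℕ) : (2 * g + 1) * critAngle g = π := by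
  rw [critAngle]; field_simp

lemma ray_dichotomy (hg : 2 ≤ g) {α : ℝ} (hα : α ∈ Icc (critAngle g) (5 * π / 12)) :
    (rexp (rayLog g α) ^ (2 * g + 1)) ^ 2 ≤ 1 / 2 ∨
      (0 ≤ (2 * g + 1) * (α - critAngle g) ∧ (2 * g + 1) * (α - critAngle g) ≤ 1 / 2 ∧
        rexp (rayLog g α) ^ (2 * g + 1) * (1 + (2 * g + 1) * (α - critAngle g)) ≤ 1) := by
  have hs := sin_critAngle_pos hg
  have hg' : (2 : ℝ) ≤ g := mod_cast hg
  have hρ : (rexp (rayLog g α) ^ (2 * g + 1)) ^ 2 =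
      (rsin (critAngle g) / rsin (2 * α - critAngle g)) ^ (2 * g + 1) := by
    rw [← exp_two_mul_rayLog hg hα, ← pow_mul, mul_comm, pow_mul, ← Real.exp_nat_mul]; norm_num
  have hs' := hs.trans_le (sin_critAngle_le hg hα)
  obtain ⟨x, hx⟩ : ∃ x, x = 2 * (α - critAngle g) := ⟨_, rfl⟩
  have hx0 : 0 ≤ x := by linarith [hα.1]
  have hax : 2 * α - critAngle g = critAngle g + x := by rw [hx]; ring
  have hν : (2 * g + 1) * (α - critAngle g) = g * x + x / 2 := by rw [hx]; ring
  have hb : ∀ z : ℝ, 0 ≤ z → (1 + z) * rsin (critAngle g) ≤ rsin (critAngle g + x) →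
      (rexp (rayLog g α) ^ (2 * g + 1)) ^ 2 * (1 + z) ^ (2 * g + 1) ≤ 1 := by
    intro z hz h
    rw [hρ, ← mul_pow, hax]
    rw [hax] at hs'
    refine pow_le_one₀ (by positivity) ?_
    rw [div_mul_eq_mul_div, div_le_one hs']
    linarith
  have h5 : (1 : ℝ) / (2 * g + 1) ≤ 1 / 5 := one_div_le_one_div_of_le (by norm_num) (by linarith)
  rcases le_total x (1 / (2 * g + 1)) with h | h
  · right
    rw [hν]
    have h6 : g * x + x / 2 ≤ 1 / 2 := by rw [le_div_iff₀ (by positivity)] at h; linarith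
    refine ⟨by positivity, h6, ?_⟩
    have h7 := hb x hx0 (one_add_mul_sin_le hg hx0 (h.trans h5))
    have h8 : 1 + g * x ≤ (1 + x) ^ g := one_add_mul_le_pow (by linarith) g
    have h9 : (1 + (g * x + x / 2)) ^ 2 ≤ (1 + x) ^ (2 * g + 1) := by
      have e : (1 + x) ^ (2 * g + 1) = ((1 + x) ^ g) ^ 2 * (1 + x) := by
        rw [pow_succ, mul_comm 2 g, pow_mul]
      have h10 : (1 + g * x) ^ 2 ≤ ((1 + x) ^ g) ^ 2 := pow_le_pow_left₀ (by positivity) h8 2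
      rw [e]
      refine le_trans ?_ (mul_le_mul_of_nonneg_right h10 (by linarith))
      have : 0 ≤ x ^ 2 * (g * (1 + g * x) - 1 / 4) :=
        mul_nonneg (sq_nonneg x) (by have : (0:ℝ) ≤ g * (g * x) := by positivity
                                     linarith)
      nlinarith
    have h10 : (rexp (rayLog g α) ^ (2 * g + 1) * (1 + (g * x + x / 2))) ^ 2 ≤ 1 := by
      rw [mul_pow]
      exact (mul_le_mul_of_nonneg_left h9 (sq_nonneg _)).trans h7
    exact (abs_le_of_sq_le_sq' (by simpa using h10) zero_le_one).2
  · left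
    have hz : (0 : ℝ) ≤ 1 / (2 * g + 1) := by positivity
    have h6 := hb _ hz ((one_add_mul_sin_le hg hz h5).trans (by
      rcases h.eq_or_lt with h | h
      · rw [h]
      · refine (sin_lt_sin_of_lt_of_lt_pi_sub ?_ (by linarith) ?_).le
        · linarith [critAngle_pos g]
        · linarith [hα.2, pi_gt_three]))
    have h7 : 2 ≤ (1 + 1 / (2 * g + 1) : ℝ) ^ (2 * g + 1) := by
      refine le_trans (le_of_eq ?_) (one_add_mul_le_pow (by linarith) (2 * g + 1))
      push_cast
      field_simp
      norm_num
    have := mul_le_mul_of_nonneg_left h7 (sq_nonneg (rexp (rayLog g α) ^ (2 * g + 1)))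
    linarith

/-- The rate of exponential growth of `hypMap` along the contour. -/
def growthRate (g : ℕ) (ϑ : ℝ) : ℝ := 1 + (2 ^ (2 * g + 3))⁻¹ * rsin ϑ ^ 2

lemma growthRate_le_norm_ray (hg : 2 ≤ g) (ϑ : ℝ) {α : ℝ}
    (hα : α ∈ Icc (critAngle g) (5 * π / 12)) :
    growthRate g ϑ ≤ ‖hypMap g ϑ (joukInv (rayLog g α + α * I))‖ := by
  have hs := sin_critAngle_pos hg
  have hs' := hs.trans_le (sin_critAngle_le hg hα)
  have hne := one_add_ne_zero_of_mem hg (rayLog_mem hg hα)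
  obtain ⟨hre, him⟩ := one_add_exp_re_im (rayLog g α) α
  rw [exp_two_mul_rayLog hg hα] at hre him
  set l := rsin (2 * α) / rsin (2 * α - critAngle g) with hl
  set μ := rexp (rayLog g α) ^ (2 * g + 1) with hμ
  have hl0 : 0 < l := div_pos (sin_pos_of_pos_of_lt_pi (by linarith [critAngle_pos g, hα.1])
    (by linarith [hα.2, pi_pos])) hs'
  have e1 : 1 + exp (rayLog g α + α * I) ^ 2 = l * exp (critAngle g * I) := by
    refine Complex.ext ?_ ?_
    · rw [hre, re_ofReal_mul, exp_ofReal_mul_I_re, hl]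
      field_simp
      rw [Real.sin_sub]
      ring
    · rw [him, im_ofReal_mul, exp_ofReal_mul_I_im, hl]; ring
  have e2 : (1 + exp (rayLog g α + α * I) ^ 2) ^ (2 * g + 1) = -((l ^ (2 * g + 1) : ℝ) : ℂ) := by
    rw [e1, mul_pow, ← exp_nat_mul, ← mul_assoc, ← ofReal_natCast, ← ofReal_mul]
    have := two_mul_add_one_mul_critAngle g
    simp_all
  have e3 : exp (rayLog g α + α * I) ^ (2 * g + 1) =
      -(μ * exp (((2 * g + 1) * (α - critAngle g) : ℝ) * I)) := by
    rw [hμ, ofReal_pow, ofReal_exp, ← exp_nat_mul, ← exp_nat_mul, ← exp_add, ← mul_neg_one (exp _),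
      ← exp_pi_mul_I, ← exp_add]
    congr 1
    have : ((2 * g + 1) * (α - critAngle g) : ℝ) = (2 * g + 1) * α - π := by
      rw [mul_sub, two_mul_add_one_mul_critAngle]
    rw [this]
    push_cast
    ring
  have hQ := sin_sq_div_four_le (ϑ := ϑ) (μ := μ) (by positivity) (ray_dichotomy hg hα)
  set ν := (2 * g + 1) * (α - critAngle g) with hν
  set Q := 1 - 2 * rcos ϑ * (μ * rcos ν) + μ ^ 2 * rcos (2 * ν) with hQd
  have hre' : (hypMap g ϑ (joukInv (rayLog g α + α * I))).re = 1 + Q / l ^ (2 * g + 1) := by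
    rw [joukInv, hypMap_eq ϑ hne, e2, div_neg, sub_neg_eq_add, add_re, one_re, div_ofReal_re, e3]
    congr 2
    have e4 : (-(μ * cis ν)) ^ 2 = ((μ ^ 2 : ℝ) : ℂ) * exp ((2 * ν : ℝ) * I) := by
      rw [neg_sq, mul_pow, ← exp_nat_mul]; push_cast; ring_nf
    have e5 : 2 * (rcos ϑ : ℂ) * -(μ * cis ν) = ((-(2 * rcos ϑ * μ) : ℝ) : ℂ) * cis ν := by
      push_cast; ring
    rw [e4, e5, add_re, add_re, re_ofReal_mul, re_ofReal_mul, exp_ofReal_mul_I_re,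
      exp_ofReal_mul_I_re, one_re, hQd]
    ring
  have hl2 : l ≤ 2 := by
    have h1 : ‖1 + exp (rayLog g α + α * I) ^ 2‖ = l := by rw [e1, norm_mul_exp hl0]
    rw [← h1]
    refine (norm_add_le _ _).trans ?_
    rw [norm_one, norm_pow, norm_exp]
    have h2 : (rayLog g α + α * I : ℂ).re ≤ 0 := by
      obtain ⟨-, -, h | h⟩ := rayLog_mem hg hα
      · simpa using h.1.le
      · simpa using h.1.le
    have := pow_le_one₀ (n := 2) (Real.exp_pos _).le (Real.exp_le_one_iff.2 h2)
    linarith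
  refine le_trans ?_ ((le_abs_self _).trans (abs_re_le_norm _))
  rw [hre', growthRate]
  gcongr
  rw [inv_mul_eq_div, div_le_div_iff₀ (by positivity) (by positivity)]
  have h1 := pow_le_pow_left₀ hl0.le hl2 (2 * g + 1)
  have h2 : (2 : ℝ) ^ (2 * g + 3) = 4 * 2 ^ (2 * g + 1) := by rw [pow_add _ (2 * g) 3, pow_succ]; ring
  rw [h2]
  calc _ ≤ rsin ϑ ^ 2 * 2 ^ (2 * g + 1) := by gcongr
    _ = (rsin ϑ ^ 2 / 4) * (4 * 2 ^ (2 * g + 1)) := by ring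
    _ ≤ _ := by gcongr

lemma growthRate_le_norm_cap (hg : 2 ≤ g) (ϑ : ℝ) {α : ℝ} (hα : α ∈ Icc (5 * π / 12) (π / 2)) :
    growthRate g ϑ ≤ ‖hypMap g ϑ (joukInv (rayLog g (5 * π / 12) + α * I))‖ := by
  have hne := one_add_ne_zero_of_mem hg (capLog_mem hg hα)
  obtain ⟨hre, him⟩ := one_add_exp_re_im (rayLog g (5 * π / 12)) α
  have hφ := critAngle_pos g
  have hφ' := critAngle_lt hg
  have hs := sin_critAngle_pos hg
  have hc := cos_critAngle_gt hg
  have hs1 := sin_le hφ.le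
  have hs2 := Real.sin_gt_sub_cube hφ
  have hc1 := one_sub_sq_div_two_le_cos (x := critAngle g)
  have hsc := Real.sin_sq_add_cos_sq (critAngle g)
  have h3 : √3 ^ 2 = 3 := Real.sq_sqrt (by norm_num)
  have h3' : 1.73 < √3 := Real.lt_sqrt_of_sq_lt (by norm_num)
  have hsin : 2 * rsin (2 * (5 * π / 12) - critAngle g) =
      rcos (critAngle g) + √3 * rsin (critAngle g) := by
    rw [show 2 * (5 * π / 12) - critAngle g = π - (π / 6 + critAngle g) by ring,
      Real.sin_pi_sub, Real.sin_add, Real.sin_pi_div_six, Real.cos_pi_div_six]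
    ring
  have hexp := exp_two_mul_rayLog hg (cap_mem_Icc hg)
  set s := rsin (critAngle g) with hsd
  set c := rcos (critAngle g) with hcd
  set φ := critAngle g with hφd
  obtain ⟨L, hL⟩ : ∃ L, L = c + √3 * s := ⟨_, rfl⟩
  have hL0 : 0 < L := by rw [hL]; positivity
  have hρ : rexp (2 * rayLog g (5 * π / 12)) = 2 * s / L := by rw [hexp, hL, ← hsin]; field_simp
  set y := rayLog g (5 * π / 12) with hy
  rw [hρ] at hre him
  set ρ := 2 * s / L with hρd
  have hρ0 : 0 < ρ := by positivity
  have hρL : ρ * L = 2 * s := div_mul_cancel₀ _ hL0.ne'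
  have hρ1 : ρ ≤ 0.67 := by
    rw [hρd, div_le_iff₀ hL0, hL]
    linarith [mul_le_mul_of_nonneg_right h3'.le hs.le]
  have hnorm : ‖exp (y + α * I)‖ ^ 2 = ρ := by rw [← hρ, norm_exp, two_mul, Real.exp_add, sq]; simp
  obtain ⟨μ, hμ⟩ : ∃ μ, μ = ‖exp (y + α * I) ^ (2 * g + 1)‖ := ⟨_, rfl⟩
  have hμ0 : 0 ≤ μ := hμ ▸ norm_nonneg _
  have hμ1 : μ ≤ 0.37 := by
    have h1 : μ ^ 2 = ρ ^ (2 * g + 1) := by rw [hμ, norm_pow, ← hnorm]; exact pow_right_comm _ _ _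
    have h2 : ρ ^ (2 * g + 1) ≤ 0.67 ^ 5 := (pow_le_pow_of_le_one hρ0.le (by linarith)
      (by omega : 5 ≤ 2 * g + 1)).trans (pow_le_pow_left₀ hρ0.le hρ1 5)
    exact le_of_sq_le_sq (by rw [h1]; exact h2.trans (by norm_num)) (by norm_num)
  have hden : ‖1 + exp (y + α * I) ^ 2‖ * L ≤ 1 := by
    refine (abs_le_of_sq_le_sq' (b := 1) ?_ zero_le_one).2
    have hcos : rcos (2 * α) ≤ -(√3 / 2) := by
      rw [← Real.cos_pi_div_six, ← Real.cos_pi_sub]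
      exact cos_le_cos_of_nonneg_of_le_pi (by linarith [pi_pos]) (by linarith [hα.2])
        (by linarith [hα.1])
    rw [mul_pow, Complex.sq_norm, normSq_apply, hre, him]
    have e : (1 + ρ * rcos (2 * α)) * (1 + ρ * rcos (2 * α)) +
        ρ * rsin (2 * α) * (ρ * rsin (2 * α)) = 1 + 2 * ρ * rcos (2 * α) + ρ ^ 2 := by
      linear_combination ρ ^ 2 * Real.sin_sq_add_cos_sq (2 * α)
    rw [e]
    have e2 : 1 + 2 * ρ * rcos (2 * α) + ρ ^ 2 ≤ 1 - √3 * ρ + ρ ^ 2 := by nlinarith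
    refine (mul_le_mul_of_nonneg_right e2 (sq_nonneg L)).trans (le_of_eq ?_)
    grind
  have hLN : 6.5 ≤ L ^ (2 * g + 1) := by
    have hg' : (2 : ℝ) ≤ g := mod_cast hg
    have h1 : 1.243 * φ ≤ L - 1 := by
      have e1 : φ ^ 2 ≤ 0.63 * φ := by rw [sq]; exact mul_le_mul_of_nonneg_right hφ'.le hφ.le
      have e2 : φ ^ 3 ≤ 0.63 * (0.63 * φ) := by
        rw [pow_succ']; exact mul_le_mul hφ'.le e1 (sq_nonneg φ) (by norm_num)
      have e3 : 1.73 * s ≤ √3 * s := mul_le_mul_of_nonneg_right h3'.le hs.le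
      rw [hL]; linarith
    have h2 : 1 + g * (L - 1) ≤ L ^ g := by
      have := one_add_mul_le_pow (a := L - 1) (by linarith) g
      rwa [add_sub_cancel] at this
    have h4 : 0.4 * ((2 * g + 1) * φ) ≤ g * φ := by
      rw [← mul_assoc]; exact mul_le_mul_of_nonneg_right (by linarith) hφ.le
    rw [two_mul_add_one_mul_critAngle] at h4
    have h5 : 2.56 ≤ L ^ g := by
      have := mul_le_mul_of_nonneg_left h1 (by linarith : (0 : ℝ) ≤ g)
      linarith [Real.pi_gt_d2]
    calc (6.5 : ℝ) ≤ 2.56 ^ 2 * 1 := by norm_num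
      _ ≤ (L ^ g) ^ 2 * L := by gcongr; linarith
      _ = _ := by ring
  have hnum : 0.39 ≤ ‖1 + 2 * rcos ϑ * exp (y + α * I) ^ (2 * g + 1) +
      (exp (y + α * I) ^ (2 * g + 1)) ^ 2‖ := by
    have e : 1 + 2 * rcos ϑ * exp (y + α * I) ^ (2 * g + 1) +
        (exp (y + α * I) ^ (2 * g + 1)) ^ 2 = (1 + cis ϑ * exp (y + α * I) ^ (2 * g + 1)) *
        (1 + (cis ϑ)⁻¹ * exp (y + α * I) ^ (2 * g + 1)) := by
      rw [← exp_add_inv_exp]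
      have := exp_ne_zero (ϑ * I)
      field_simp
      ring
    have h1 : ∀ z : ℂ, ‖z‖ = 1 → 0.63 ≤ ‖1 + z * exp (y + α * I) ^ (2 * g + 1)‖ := fun z hz => by
      have := norm_sub_le_norm_add 1 (z * exp (y + α * I) ^ (2 * g + 1))
      rw [norm_one, norm_mul, hz, one_mul, ← hμ] at this
      linarith
    rw [e, norm_mul]
    calc (0.39 : ℝ) ≤ 0.63 * 0.63 := by norm_num
      _ ≤ _ := mul_le_mul (h1 _ (norm_exp_ofReal_mul_I _))
        (h1 _ (by rw [norm_inv, norm_exp_ofReal_mul_I, inv_one])) (by norm_num) (norm_nonneg _)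
  have hP : 2.5 ≤ ‖(1 + 2 * rcos ϑ * exp (y + α * I) ^ (2 * g + 1) +
      (exp (y + α * I) ^ (2 * g + 1)) ^ 2) / (1 + exp (y + α * I) ^ 2) ^ (2 * g + 1)‖ := by
    rw [norm_div, norm_pow, le_div_iff₀ (pow_pos (norm_pos_iff.2 hne) _)]
    have h1 := pow_le_one₀ (n := 2 * g + 1) (by positivity) hden
    rw [mul_pow] at h1
    have h2 : 0 < ‖1 + exp (y + α * I) ^ 2‖ ^ (2 * g + 1) := pow_pos (norm_pos_iff.2 hne) _
    nlinarith
  rw [joukInv, hypMap_eq ϑ hne]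
  have h1 := norm_sub_norm_le ((1 + 2 * rcos ϑ * exp (y + α * I) ^ (2 * g + 1) +
      (exp (y + α * I) ^ (2 * g + 1)) ^ 2) / (1 + exp (y + α * I) ^ 2) ^ (2 * g + 1)) 1
  rw [norm_one, norm_sub_rev] at h1
  have h2 : growthRate g ϑ ≤ 1 + 1 / 2 * 1 := by
    rw [growthRate]
    gcongr
    · rw [inv_eq_one_div]
      refine one_div_le_one_div_of_le two_pos ?_
      simpa using pow_le_pow_right₀ (one_le_two (α := ℝ)) (by omega : 1 ≤ 2 * g + 3)
    · exact Real.sin_sq_le_one ϑ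
  linarith

lemma growthRate_pos (ϑ : ℝ) : 0 < growthRate g ϑ := by rw [growthRate]; positivity

lemma norm_evenPow_le {ϑ : ℝ} {v : ℂ} (n : ℕ) (h1 : growthRate g ϑ ≤ ‖hypMap g ϑ v‖)
    (h2 : growthRate g (π - ϑ) ≤ ‖hypMap g (π - ϑ) v‖) :
    ‖evenPow g ϑ n v‖ ≤ 2 * (growthRate g ϑ)⁻¹ ^ n := by
  have h0 := growthRate_pos (g := g) ϑ
  rw [growthRate, Real.sin_pi_sub, ← growthRate, hypMap_pi_sub] at h2
  refine (norm_add_le _ _).trans ?_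
  rw [norm_pow, norm_pow, norm_inv, norm_inv, two_mul]
  gcongr

lemma exists_abs_contourIntegral_im_le (hg : 2 ≤ g) : ∃ C, ∀ ϑ n,
    |(contourIntegral g ϑ n).im| ≤ C * (growthRate g ϑ)⁻¹ ^ n := by
  have key : ∀ (x x' : ℝ → ℝ) (a b : ℝ), a ≤ b → ContinuousOn x (Icc a b) →
      ContinuousOn x' (Icc a b) → (∀ t ∈ Icc a b, (x t, t) ∈ zeroFreeRegion g) →
      (∀ ϑ, ∀ t ∈ Icc a b, growthRate g ϑ ≤ ‖hypMap g ϑ (joukInv (x t + t * I))‖) →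
      ∃ C, ∀ ϑ n, ‖∫ t in a..b, hypKernel g ϑ n (x t + t * I) * (x' t + I)‖ ≤
        C * (growthRate g ϑ)⁻¹ ^ n := by
    intro x x' a b hab hx hx' hmem hgr
    set W : ℝ → ℝ := fun t => ‖(1 - exp (x t + t * I) ^ 2) / (1 + exp (x t + t * I) ^ 2) * (x' t + I)‖
    have hxc : ContinuousOn (fun t => (x t : ℂ) + t * I) (Icc a b) :=
      (continuous_ofReal.comp_continuousOn hx).add (by fun_prop)
    have hW : ContinuousOn W (Icc a b) := by
      refine ContinuousOn.norm (ContinuousOn.mul (ContinuousOn.div (continuousOn_const.sub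
        (hxc.cexp.pow 2)) (continuousOn_const.add (hxc.cexp.pow 2)) fun t ht =>
          one_add_ne_zero_of_mem hg (hmem t ht)) ?_)
      fun_prop
    refine ⟨2 * ∫ t in a..b, W t, fun ϑ n => ?_⟩
    have hWi : IntervalIntegrable W volume a b :=
      ContinuousOn.intervalIntegrable (by rwa [uIcc_of_le hab])
    refine (intervalIntegral.norm_integral_le_of_norm_le hab (.of_forall
      fun t ht => ?_) (hWi.const_mul (2 * (growthRate g ϑ)⁻¹ ^ n))).trans (le_of_eq ?_)
    · have ht' := Ioc_subset_Icc_self ht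
      rw [hypKernel, mul_assoc, norm_mul]
      exact mul_le_mul_of_nonneg_right (norm_evenPow_le n (hgr _ t ht') (hgr _ t ht')) (norm_nonneg _)
    · rw [integral_const_mul]; ring
  obtain ⟨C₁, h₁⟩ := key (rayLog g)
    (fun t => -(rcos (2 * t - critAngle g) / rsin (2 * t - critAngle g))) _ _
    (cap_mem_Icc hg).1 (fun t ht => (hasDerivAt_rayLog hg ht).continuousAt.continuousWithinAt)
    (ContinuousOn.neg (ContinuousOn.div (by fun_prop) (by fun_prop)
      fun t ht => ((sin_critAngle_pos hg).trans_le (sin_critAngle_le hg ht)).ne'))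
    (fun t ht => rayLog_mem hg ht) fun ϑ t ht => growthRate_le_norm_ray hg ϑ ht
  obtain ⟨C₂, h₂⟩ := key (fun _ => rayLog g (5 * π / 12)) (fun _ => 0)
    (5 * π / 12) (π / 2) (by linarith [pi_pos]) continuousOn_const
    continuousOn_const (fun t ht => capLog_mem hg ht) fun ϑ t ht => growthRate_le_norm_cap hg ϑ ht
  simp only [ofReal_zero, zero_add] at h₂
  refine ⟨C₁ + C₂, fun ϑ n => (abs_im_le_norm _).trans ((norm_add_le _ _).trans ?_)⟩
  grind

end contourBound

section hypInverse

variable {g : ℕ}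

def hypReal (g : ℕ) (ϑ v : ℝ) : ℝ := 1 - ∏ k ∈ range (2 * g + 1), (1 - chebRoot g ϑ k * v)

lemma ofReal_hypReal (ϑ v : ℝ) : (hypReal g ϑ v : ℂ) = hypMap g ϑ v := by
  simp [hypReal, hypMap, rootProd]

lemma exists_hypMap_eq_sq_mul (hg : 2 ≤ g) (ϑ : ℝ) : ∃ A : ℂ → ℂ, Differentiable ℂ A ∧
    A 0 = 2 * g + 1 ∧ ∀ v, hypMap g ϑ v = v ^ 2 * A v := by
  refine ⟨fun v => -(∑ i : Fin g, chebCoeff g (rev i) * v ^ (2 * (i : ℕ))) -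
    2 * rcos ϑ * v ^ (2 * g - 1), by fun_prop, ?_, fun v => ?_⟩
  · have h0 : 0 < g := by omega
    beta_reduce
    rw [sum_eq_single ⟨0, h0⟩ (fun i _ hi => ?_) (by simp)]
    · rw [chebCoeff_last h0, zero_pow (by omega : 2 * g - 1 ≠ 0)]
      simp
    · rw [zero_pow, mul_zero]
      grind
  · rcases eq_or_ne v 0 with rfl | hv
    · simp [hypMap_zero]
    have h := rootProd_inv (g := g) ϑ (inv_ne_zero hv)
    rw [inv_inv, inv_pow, inv_mul_eq_iff_eq_mul₀ (pow_ne_zero _ hv)] at h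
    rw [hypMap, h, oddPoly, Polynomial.eval_add, Polynomial.eval_finsetSum, ← Equiv.sum_comp revPerm]
    simp only [Polynomial.eval_mul, Polynomial.eval_pow, Polynomial.eval_X, Polynomial.eval_C,
      revPerm_apply]
    rw [mul_add, mul_add, inv_pow, mul_inv_cancel₀ (pow_ne_zero _ hv), mul_sum, mul_sub,
      mul_neg, mul_sum]
    have e1 : ∀ i : Fin g, v ^ (2 * g + 1) * (chebCoeff g (rev i) * v⁻¹ ^ (2 * ((rev i : Fin g) : ℕ) + 1)) =
        v ^ 2 * (chebCoeff g (rev i) * v ^ (2 * (i : ℕ))) := fun i => by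
      have e : 2 * g + 1 = (2 * ((rev i : Fin g) : ℕ) + 1) + (2 + 2 * (i : ℕ)) := by
        rw [val_rev]; omega
      have := pow_ne_zero (2 * ((rev i : Fin g) : ℕ) + 1) hv
      rw [e, pow_add v _ (2 + _), pow_add v 2, inv_pow]
      field_simp
    have e2 : v ^ (2 * g + 1) = v ^ 2 * v ^ (2 * g - 1) := by rw [← pow_add]; congr 1; omega
    simp only [e1]
    rw [e2]
    ring

lemma hasDerivAt_hypReal (ϑ v : ℝ) : HasDerivAt (hypReal g ϑ)
    (∑ i ∈ range (2 * g + 1), (∏ j ∈ (range (2 * g + 1)).erase i,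
      (1 - chebRoot g ϑ j * v)) * chebRoot g ϑ i) v := by
  have h := HasDerivAt.fun_finsetProd (u := range (2 * g + 1))
    (f := fun k v => 1 - chebRoot g ϑ k * v) (f' := fun k => -(chebRoot g ϑ k * 1)) (x := v)
    fun k _ => ((hasDerivAt_id v).const_mul _).const_sub 1
  refine (h.const_sub 1).congr_deriv ?_
  simp

lemma sum_chebRoot (hg : 2 ≤ g) (ϑ : ℝ) : ∑ k ∈ range (2 * g + 1), chebRoot g ϑ k = 0 := by
  obtain ⟨A, hA, -, h⟩ := exists_hypMap_eq_sq_mul hg ϑ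
  have h1 := (hasDerivAt_hypReal (g := g) ϑ 0).ofReal_comp
  have h2 : HasDerivAt (fun v : ℂ => v ^ 2 * A v) 0 ((0 : ℝ) : ℂ) := by
    rw [ofReal_zero]
    refine (((hasDerivAt_id (0 : ℂ)).pow 2).mul (hA 0).hasDerivAt).congr_deriv ?_
    simp
  have h3 := h1.unique (h2.comp_ofReal.congr_of_eventuallyEq (.of_forall fun v => by
    simp only [← h, ← ofReal_hypReal]))
  simpa using ofReal_injective h3

lemma cos_div_le_of_abs_le {ϑ x : ℝ} (h0 : 0 ≤ ϑ) (h : ϑ ≤ |x|) (hx : |x| ≤ (2 * g + 1) * π) :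
    rcos (x / (2 * g + 1)) ≤ rcos (ϑ / (2 * g + 1)) := by
  have hN : (0 : ℝ) < 2 * g + 1 := by positivity
  rw [← Real.cos_abs (x / _), abs_div, abs_of_pos hN]
  refine cos_le_cos_of_nonneg_of_le_pi (by positivity) ?_ (by gcongr)
  rw [div_le_iff₀ hN]; linarith

lemma chebRoot_le {ϑ : ℝ} (hϑ : ϑ ∈ Icc 0 π) {k : ℕ} (hk : k ∈ range (2 * g + 1)) :
    chebRoot g ϑ k ≤ chebRoot g ϑ 0 := by
  have hπ := pi_pos
  have hN : (0 : ℝ) < 2 * g + 1 := by positivity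
  have hk' : (k : ℝ) ≤ 2 * g := mod_cast Nat.lt_succ_iff.1 (mem_range.1 hk)
  simp only [chebRoot, Nat.cast_zero, mul_zero, add_zero]
  refine mul_le_mul_of_nonneg_left ?_ zero_le_two
  rcases le_or_gt k g with h | h
  · have hk'' : (k : ℝ) ≤ g := mod_cast h
    have h1 : 0 ≤ π - ϑ + 2 * π * k := by
      have := hϑ.2; have : 0 ≤ 2 * π * k := by positivity
      linarith
    refine cos_div_le_of_abs_le (by linarith [hϑ.2]) ?_ ?_
    · rw [abs_of_nonneg h1]; have : 0 ≤ 2 * π * k := by positivity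
      linarith
    · rw [abs_of_nonneg h1]; nlinarith [hϑ.1]
  · have hk'' : (g : ℝ) + 1 ≤ k := mod_cast h
    have e : rcos ((π - ϑ + 2 * π * k) / (2 * g + 1)) =
        rcos ((π - ϑ + 2 * π * k - (2 * g + 1) * (2 * π)) / (2 * g + 1)) := by
      rw [sub_div _ ((2 * g + 1) * (2 * π)), mul_div_cancel_left₀ _ hN.ne', Real.cos_sub_two_pi]
    have h1 : π - ϑ + 2 * π * k - (2 * g + 1) * (2 * π) ≤ -(π - ϑ) := by nlinarith [hϑ.1]
    rw [e]
    refine cos_div_le_of_abs_le (by linarith [hϑ.2]) ?_ ?_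
    · grind
    · rw [abs_of_nonpos (by linarith [hϑ.2])]; nlinarith [hϑ.2]

lemma chebRoot_zero_pos (hg : 0 < g) {ϑ : ℝ} (hϑ : ϑ ∈ Icc 0 π) : 0 < chebRoot g ϑ 0 := by
  have hπ := pi_pos
  have hg' : (1 : ℝ) ≤ g := mod_cast hg
  simp only [chebRoot, Nat.cast_zero, mul_zero, add_zero]
  refine mul_pos two_pos (cos_pos_of_mem_Ioo ⟨?_, ?_⟩)
  · have : 0 ≤ (π - ϑ) / (2 * g + 1) := div_nonneg (by linarith [hϑ.2]) (by positivity)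
    linarith
  · rw [div_lt_iff₀ (by positivity)]; nlinarith [hϑ.1]

lemma one_sub_chebRoot_mul_pos (hg : 0 < g) {ϑ v : ℝ} (hϑ : ϑ ∈ Icc 0 π) (hv : 0 ≤ v)
    (hv' : v < (chebRoot g ϑ 0)⁻¹) {k : ℕ} (hk : k ∈ range (2 * g + 1)) :
    0 < 1 - chebRoot g ϑ k * v := by
  have h0 := chebRoot_zero_pos hg hϑ
  have h1 := mul_lt_mul_of_pos_left hv' h0
  rw [mul_inv_cancel₀ h0.ne'] at h1
  linarith [mul_le_mul_of_nonneg_right (chebRoot_le hϑ hk) hv]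

lemma deriv_hypReal_pos (hg : 2 ≤ g) {ϑ v : ℝ} (hϑ : ϑ ∈ Icc 0 π) (hv : 0 < v)
    (hv' : v < (chebRoot g ϑ 0)⁻¹) : 0 < deriv (hypReal g ϑ) v := by
  have hpos := fun k hk => one_sub_chebRoot_mul_pos (by omega : 0 < g) hϑ hv.le hv' (k := k) hk
  have e : ∀ i ∈ range (2 * g + 1), (∏ j ∈ (range (2 * g + 1)).erase i,
      (1 - chebRoot g ϑ j * v)) * chebRoot g ϑ i = (∏ j ∈ range (2 * g + 1),
      (1 - chebRoot g ϑ j * v)) * (chebRoot g ϑ i + chebRoot g ϑ i ^ 2 * v / (1 - chebRoot g ϑ i * v)) := by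
    intro i hi
    have := (hpos i hi).ne'
    rw [← Finset.mul_prod_erase _ _ hi, mul_add, mul_comm (1 - _), mul_assoc, mul_assoc, ← mul_add]
    congr 1
    field_simp
    ring
  rw [(hasDerivAt_hypReal ϑ v).deriv, sum_congr rfl e, ← mul_sum,
    sum_add_distrib, sum_chebRoot hg, zero_add]
  refine mul_pos (Finset.prod_pos hpos) ?_
  obtain ⟨k, hk, hk0⟩ := exists_chebRoot_ne_zero (by omega : 0 < g) ϑ
  refine Finset.sum_pos' (fun i hi => ?_) ⟨k, hk, ?_⟩
  · have := hpos i hi; positivity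
  · have := hpos k hk; positivity

lemma strictMonoOn_hypReal (hg : 2 ≤ g) {ϑ : ℝ} (hϑ : ϑ ∈ Icc 0 π) :
    StrictMonoOn (hypReal g ϑ) (Icc 0 (chebRoot g ϑ 0)⁻¹) := by
  refine strictMonoOn_of_deriv_pos (convex_Icc _ _)
    (fun v _ => (hasDerivAt_hypReal ϑ v).continuousAt.continuousWithinAt) fun v hv => ?_
  rw [interior_Icc] at hv
  exact deriv_hypReal_pos hg hϑ hv.1 hv.2

lemma hypReal_zero (ϑ : ℝ) : hypReal g ϑ 0 = 0 := by simp [hypReal]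

lemma hypReal_inv (hg : 0 < g) {ϑ : ℝ} (hϑ : ϑ ∈ Icc 0 π) : hypReal g ϑ (chebRoot g ϑ 0)⁻¹ = 1 := by
  rw [hypReal, sub_eq_self]
  refine prod_eq_zero (mem_range.2 (Nat.succ_pos (2 * g))) ?_
  rw [mul_inv_cancel₀ (chebRoot_zero_pos hg hϑ).ne', sub_self]

lemma analyticAt_hypReal (ϑ v : ℝ) : AnalyticAt ℝ (hypReal g ϑ) v := by
  unfold hypReal
  fun_prop

lemma exists_inverse_hypReal (hg : 2 ≤ g) {ϑ : ℝ} (hϑ : ϑ ∈ Icc 0 π) : ∃ V : ℝ → ℝ,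
    (∀ s ∈ Ioo (0 : ℝ) 1, V s ∈ Ioo 0 (chebRoot g ϑ 0)⁻¹ ∧ hypReal g ϑ (V s) = s) ∧
    AnalyticOnNhd ℝ V (Ioo 0 1) ∧ Tendsto V (nhdsWithin 1 (Iio 1)) (nhds (chebRoot g ϑ 0)⁻¹) := by
  have hg0 : 0 < g := by omega
  have hR := inv_pos.2 (chebRoot_zero_pos hg0 hϑ)
  have hmono := strictMonoOn_hypReal hg hϑ
  set R := (chebRoot g ϑ 0)⁻¹ with hRd
  have hcont : ContinuousOn (hypReal g ϑ) (Icc 0 R) :=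
    fun v _ => (hasDerivAt_hypReal ϑ v).continuousAt.continuousWithinAt
  have hex : ∀ s ∈ Ioo (0 : ℝ) 1, ∃ v ∈ Ioo 0 R, hypReal g ϑ v = s := fun s hs => by
    have := intermediate_value_Ioo hR.le hcont
    rw [hypReal_zero, hypReal_inv hg0 hϑ] at this
    exact this hs
  choose! V hV hV' using hex
  have hIcc : ∀ s ∈ Ioo (0 : ℝ) 1, V s ∈ Icc 0 R := fun s hs => Ioo_subset_Icc_self (hV s hs)
  refine ⟨V, fun s hs => ⟨hV s hs, hV' s hs⟩, fun s hs => ?_, ?_⟩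
  · have ha := analyticAt_hypReal (g := g) ϑ (V s)
    have hd := (deriv_hypReal_pos hg hϑ (hV s hs).1 (hV s hs).2).ne'
    have hr := ha.analyticAt_localInverse hd
    have h0 : ha.hasStrictDerivAt.localInverse _ _ _ hd (hypReal g ϑ (V s)) = V s :=
      HasStrictFDerivAt.localInverse_apply_image ..
    have hev := HasStrictDerivAt.eventually_right_inverse ha.hasStrictDerivAt hd
    have hc := hr.continuousAt
    rw [ContinuousAt, h0] at hc
    rw [hV' s hs] at hr hev hc
    refine hr.congr ?_
    filter_upwards [hev, hc.eventually (Ioo_mem_nhds (hV s hs).1 (hV s hs).2),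
      Ioo_mem_nhds hs.1 hs.2] with t h1 h2 h3
    exact hmono.injOn (Ioo_subset_Icc_self h2) (hIcc t h3) (h1.trans (hV' t h3).symm)
  · refine tendsto_order.2 ⟨fun a ha => ?_, fun a ha => ?_⟩
    · have hm : max a 0 ∈ Icc 0 R := ⟨le_max_right _ _, max_le ha.le hR.le⟩
      have h1 : hypReal g ϑ (max a 0) < 1 := by
        rw [← hypReal_inv hg0 hϑ]
        exact hmono hm ⟨hR.le, le_rfl⟩ (max_lt ha hR)
      have h2 : 0 ≤ hypReal g ϑ (max a 0) := by
        have := hmono.monotoneOn ⟨le_rfl, hR.le⟩ hm (le_max_right _ _)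
        rwa [hypReal_zero] at this
      filter_upwards [Ioo_mem_nhdsLT h1] with s hs
      have hs' : s ∈ Ioo (0 : ℝ) 1 := ⟨h2.trans_lt hs.1, hs.2⟩
      refine (le_max_left a 0).trans_lt ((hmono.lt_iff_lt hm (hIcc s hs')).1 ?_)
      rw [hV' s hs']
      exact hs.1
    · filter_upwards [Ioo_mem_nhdsLT one_pos] with s hs
      exact (hV s hs).2.trans ha

end hypInverse

section continuation

/-- A power series with coefficients of geometric decay sums at `1` to the limit of any analytic
continuation of its sum along `(0, 1)`. -/
lemma hasSum_of_analytic_continuation {a : ℕ → ℝ} {E : ℝ → ℝ} {C q l : ℝ} (hq0 : 0 < q) (hq : q < 1)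
    (ha : ∀ n, |a n| ≤ C * q ^ (n + 1)) (hE : AnalyticOnNhd ℝ E (Ioo 0 1))
    (hlim : Tendsto E (nhdsWithin 1 (Iio 1)) (nhds l))
    (hsmall : ∀ᶠ s in nhdsWithin (0 : ℝ) (Ioi 0), HasSum (fun n => a n * s ^ (n + 1)) (E s)) :
    HasSum a l := by
  obtain ⟨ρ, hρ1, hρ⟩ := exists_between (one_lt_inv_iff₀.2 ⟨hq0, hq⟩)
  have hρ0 : 0 < ρ := by linarith
  have hqρ : q * ρ < 1 := by
    have := mul_lt_mul_of_pos_left hρ hq0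
    rwa [mul_inv_cancel₀ hq0.ne'] at this
  have hu : Summable fun n : ℕ => C * (q * ρ) ^ (n + 1) :=
    ((summable_nat_add_iff 1).2 (summable_geometric_of_lt_one (by positivity) hqρ)).mul_left C
  have hle : ∀ (n : ℕ) (z : ℂ), z ∈ Metric.ball (0 : ℂ) ρ → ‖(a n : ℂ) * z ^ (n + 1)‖ ≤ C * (q * ρ) ^ (n + 1) := by
    intro n z hz
    rw [norm_mul, norm_real, norm_eq_abs, norm_pow, mul_pow, ← mul_assoc]
    exact mul_le_mul (ha n) (pow_le_pow_left₀ (norm_nonneg _) (mem_ball_zero_iff.1 hz).le _)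
      (by positivity) ((abs_nonneg _).trans (ha n))
  set G : ℂ → ℂ := fun z => ∑' n, (a n : ℂ) * z ^ (n + 1) with hG
  have hGa : AnalyticOnNhd ℂ G (Metric.ball 0 ρ) := (differentiableOn_tsum_of_summable_norm hu
    (fun n => by fun_prop) Metric.isOpen_ball hle).analyticOnNhd Metric.isOpen_ball
  have hsum : ∀ s : ℝ, |s| < ρ → HasSum (fun n => a n * s ^ (n + 1)) (G s).re := fun s hs => by
    have h1 := (hu.of_norm_bounded (hle · s (by simpa using hs))).hasSum
    refine (hasSum_re h1).congr_fun fun n => ?_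
    rw [← ofReal_pow, ← ofReal_mul, ofReal_re]
  have hga : ∀ s : ℝ, |s| < ρ → AnalyticAt ℝ (fun s : ℝ => (G s).re) s := fun s hs =>
    (hGa s (by simpa using hs)).re_ofReal
  obtain ⟨ε, hε, hεs⟩ := mem_nhdsGT_iff_exists_Ioo_subset.1 hsmall
  have hε' : 0 < min ε 1 := lt_min hε one_pos
  have heq : Set.EqOn (fun s : ℝ => (G s).re) E (Ioo 0 1) := by
    refine AnalyticOnNhd.eqOn_of_preconnected_of_eventuallyEq (z₀ := min ε 1 / 2)
      (fun s hs => hga s ?_) hE isPreconnected_Ioo ⟨by linarith, by linarith [min_le_right ε 1]⟩ ?_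
    · grind
    · filter_upwards [Ioo_mem_nhds (half_pos hε') (half_lt_self hε')] with s hs
      refine (hsum s ?_).unique (hεs ⟨hs.1, hs.2.trans_le (min_le_left _ _)⟩)
      grind
  have h1 : |(1 : ℝ)| < ρ := by rwa [abs_one]
  have h2 : Tendsto E (nhdsWithin 1 (Iio 1)) (nhds (G (1 : ℝ)).re) := by
    refine ((hga 1 h1).continuousAt.tendsto.mono_left nhdsWithin_le_nhds).congr' ?_
    filter_upwards [Ioo_mem_nhdsLT one_pos] with s hs using heq hs
  have h3 := hsum 1 h1
  rw [← tendsto_nhds_unique hlim h2] at h3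
  simpa using h3

end continuation

section hypSum

open ComplexConjugate

variable {g : ℕ}

lemma exists_radius_im_eq_zero (hg : 0 < g) (ϑ : ℝ) : ∃ δ > 0, ∀ v : ℂ, ‖v‖ < δ →
    ∀ s ∈ Ioo (0 : ℝ) 1, hypMap g ϑ v = s → v.im = 0 := by
  set L : ℂ → ℂ := fun v => ∑ k ∈ range (2 * g + 1), log (1 - chebRoot g ϑ k * v) with hL
  have hc : ContinuousAt L 0 := tendsto_finsetSum _ fun k _ =>
    ContinuousAt.clog (by fun_prop) (by simp)
  have hL0 : (L 0).im = 0 := by simp [hL]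
  have hev : ∀ᶠ v in nhds 0, |(L v).im| < 2 * π :=
    (continuous_abs.comp continuous_im).continuousAt.comp hc |>.eventually_lt_const (by
      simp [hL0, pi_pos])
  obtain ⟨δ, hδ, h⟩ := Metric.eventually_nhds_iff.1 hev
  have key : ∀ v : ℂ, ‖v‖ < δ → ∀ s ∈ Ioo (0 : ℝ) 1, hypMap g ϑ v = s → ¬ 0 < v.im := by
    intro v hv s hs hsv him
    have h1 : rootProd g ϑ v = ((1 - s : ℝ) : ℂ) := by
      rw [hypMap] at hsv; push_cast; rw [← hsv]; ring
    have h2 : exp (L v) = exp (rlog (1 - s) : ℝ) := by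
      rw [← ofReal_exp, Real.exp_log (by linarith [hs.2]), ← h1, hL, exp_sum]
      refine prod_congr rfl fun k hk => exp_log ?_
      exact prod_ne_zero_iff.1 (h1.trans_ne (mod_cast (by linarith [hs.2]))) k hk
    obtain ⟨n, hn⟩ := exp_eq_exp_iff_exists_int.1 h2
    have h3 := h (by simpa using hv : dist v 0 < δ)
    have h4 : (L v).im = n * (2 * π) := by rw [hn]; simp
    have hπ := pi_pos
    rw [h4, abs_lt] at h3
    have hn0 : n = 0 := by
      have e1 : (n : ℝ) < 1 := by nlinarith
      have e2 : (-1 : ℝ) < n := by nlinarith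
      have e1' : n < 1 := mod_cast e1
      have e2' : -1 < n := mod_cast e2
      omega
    have h5 := sum_log_div_im_neg hg ϑ him
    change (L v / v).im < 0 at h5
    rw [hn, hn0, Int.cast_zero, zero_mul, add_zero, div_im, ofReal_im, ofReal_re, zero_mul, zero_div,
      zero_sub, neg_lt_zero] at h5
    have h6 : rlog (1 - s) < 0 := Real.log_neg (by linarith [hs.2]) (by linarith [hs.1])
    exact absurd h5 (not_lt.2 (div_nonpos_of_nonpos_of_nonneg
      (mul_nonpos_of_nonpos_of_nonneg h6.le him.le) (normSq_nonneg _)))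
  refine ⟨δ, hδ, fun v hv s hs hsv => le_antisymm (not_lt.1 (key v hv s hs hsv)) (not_lt.1 fun hneg => ?_)⟩
  refine key (conj v) (by rwa [norm_conj]) s hs ?_ (by rw [conj_im]; linarith)
  rw [hypMap_conj, hsv, conj_ofReal]

lemma deriv_hypMap_ne_zero (hg : 2 ≤ g) {ϑ v : ℝ} (hϑ : ϑ ∈ Icc 0 π)
    (hv : v ∈ Ioo 0 (chebRoot g ϑ 0)⁻¹) : deriv (hypMap g ϑ) v ≠ 0 := by
  have h1 := (analyticAt_hypReal (g := g) ϑ v).differentiableAt.hasDerivAt.ofReal_comp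
  have h2 := ((differentiable_hypMap g ϑ) v).hasDerivAt.comp_ofReal
  simp only [← ofReal_hypReal] at h2
  rw [h2.unique h1]
  exact mod_cast (deriv_hypReal_pos hg hϑ hv.1 hv.2).ne'

lemma deriv_hypMap_neg_ne_zero (hg : 2 ≤ g) {ϑ v : ℝ} (hϑ : π - ϑ ∈ Icc 0 π)
    (hv : v ∈ Ioo 0 (chebRoot g (π - ϑ) 0)⁻¹) : deriv (hypMap g ϑ) (-v) ≠ 0 := by
  have h := deriv_hypMap_ne_zero hg hϑ hv
  rw [show hypMap g (π - ϑ) = fun v => hypMap g ϑ (-v) from funext (hypMap_pi_sub ϑ),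
    deriv_comp_neg] at h
  exact fun h0 => h (by rw [h0, neg_zero])

lemma circMean_log_norm_of_ne_zero {f : ℂ → ℂ} (hf : Differentiable ℂ f) {r : ℝ} (hr : 0 < r)
    (h : ∀ v, ‖v‖ ≤ r → f v ≠ 0) : circMean (fun α : ℝ => rlog ‖f (r * cis α)‖) = rlog ‖f 0‖ := by
  have := AnalyticOnNhd.circleAverage_log_norm_of_ne_zero (c := 0) (R := r) (g := f)
    (fun z _ => hf.analyticAt z) fun u hu => h u (by simpa [abs_of_pos hr] using hu)
  rw [circleAverage_def] at this
  rw [circMean]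
  simpa only [circleMap, zero_add] using this

/-- A function with exactly two zeros in a disc, both simple, is a product of linear factors and a
function without zeros. -/
lemma exists_eq_mul_mul {f : ℂ → ℂ} (hf : Differentiable ℂ f) {u w : ℂ} (huw : u ≠ w) (hu : f u = 0)
    (hw : f w = 0) (hu' : deriv f u ≠ 0) (hw' : deriv f w ≠ 0) {r : ℝ}
    (h : ∀ v, ‖v‖ ≤ r → f v = 0 → v = u ∨ v = w) : ∃ B : ℂ → ℂ, Differentiable ℂ B ∧
    (∀ v, f v = (v - u) * (v - w) * B v) ∧ ∀ v, ‖v‖ ≤ r → B v ≠ 0 := by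
  have hds : ∀ {f : ℂ → ℂ} (a : ℂ), Differentiable ℂ f → Differentiable ℂ (dslope f a) :=
    fun a hf => differentiableOn_univ.1
      ((differentiableOn_dslope Filter.univ_mem).2 hf.differentiableOn)
  have e1 : ∀ v, f v = (v - u) * dslope f u v := fun v => by
    have := sub_smul_dslope f u v; rw [hu, sub_zero, smul_eq_mul] at this; exact this.symm
  have hw1 : dslope f u w = 0 := by grind
  have e2 : ∀ v, dslope f u v = (v - w) * dslope (dslope f u) w v := fun v => by
    have := sub_smul_dslope (dslope f u) w v; rw [hw1, sub_zero, smul_eq_mul] at this; exact this.symm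
  refine ⟨dslope (dslope f u) w, hds _ (hds _ hf), fun v => by rw [e1, e2 v, mul_assoc], fun v hv h0 => ?_⟩
  rcases eq_or_ne v u with rfl | hvu
  · apply hu'; rw [← dslope_same, e2, h0, mul_zero]
  rcases eq_or_ne v w with rfl | hvw
  · apply hw'
    have h1 := ((hasDerivAt_id v).sub_const u).mul ((hds u hf) v).hasDerivAt
    rw [← dslope_same, h0, hw1] at h1
    have h2 := h1.congr_of_eventuallyEq (.of_forall e1)
    rw [h2.deriv]; simp
  · grind

/-- The coefficients of the generating series for a fixed angle. -/
def hypCoeff (g : ℕ) (ϑ : ℝ) (n : ℕ) : ℝ :=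
  (circMean fun α : ℝ => (hypMap g ϑ (hypRadius g * cis α))⁻¹ ^ (n + 1)).re / (n + 1)

lemma eventually_hasSum_hypCoeff (hg : 2 ≤ g) {ϑ : ℝ} (hϑ : ϑ ∈ Icc 0 π) {V W : ℝ → ℝ}
    (hV : ∀ s ∈ Ioo (0 : ℝ) 1, V s ∈ Ioo 0 (chebRoot g ϑ 0)⁻¹ ∧ hypReal g ϑ (V s) = s)
    (hW : ∀ s ∈ Ioo (0 : ℝ) 1, W s ∈ Ioo 0 (chebRoot g (π - ϑ) 0)⁻¹ ∧ hypReal g (π - ϑ) (W s) = s) :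
    ∀ᶠ s in nhdsWithin (0 : ℝ) (Ioi 0), HasSum (fun n => hypCoeff g ϑ n * s ^ (n + 1))
      (rlog (2 * g + 1) + rlog (V s) + rlog (W s) - rlog s) := by
  have hg0 : 0 < g := by omega
  have hϑ' : π - ϑ ∈ Icc 0 π := ⟨by linarith [hϑ.2], by linarith [hϑ.1]⟩
  have hr := hypRadius_pos g
  obtain ⟨A, hA, hA0, hSA⟩ := exists_hypMap_eq_sq_mul hg ϑ
  obtain ⟨δ₀, hδ₀, him⟩ := exists_radius_im_eq_zero hg0 ϑ
  have hR₁ := inv_pos.2 (chebRoot_zero_pos hg0 hϑ)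
  have hR₂ := inv_pos.2 (chebRoot_zero_pos hg0 hϑ')
  obtain ⟨δ, hδd⟩ : ∃ δ, δ = min (min δ₀ (hypRadius g))
    (min (chebRoot g ϑ 0)⁻¹ (chebRoot g (π - ϑ) 0)⁻¹) := ⟨_, rfl⟩
  have hδ : 0 < δ := by rw [hδd]; positivity
  have hδ₁ : δ ≤ δ₀ := by rw [hδd]; exact (min_le_left _ _).trans (min_le_left _ _)
  have hδ₂ : δ ≤ hypRadius g := by rw [hδd]; exact (min_le_left _ _).trans (min_le_right _ _)
  have hδ₃ : δ ≤ (chebRoot g ϑ 0)⁻¹ := by rw [hδd]; exact (min_le_right _ _).trans (min_le_left _ _)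
  have hδ₄ : δ ≤ (chebRoot g (π - ϑ) 0)⁻¹ := by simp_all
  set r := hypRadius g with hrd
  have hSc := (differentiable_hypMap g ϑ).continuous
  obtain ⟨m, hm, hmS⟩ : ∃ m > 0, ∀ v : ℂ, δ ≤ ‖v‖ → ‖v‖ ≤ r → m ≤ ‖hypMap g ϑ v‖ := by
    have hK : IsCompact {v : ℂ | δ ≤ ‖v‖ ∧ ‖v‖ ≤ r} := by
      refine (isCompact_closedBall (0 : ℂ) r).of_isClosed_subset ?_ fun v hv => by simpa using hv.2
      exact (isClosed_le continuous_const continuous_norm).inter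
        (isClosed_le continuous_norm continuous_const)
    obtain ⟨v₀, hv₀, hmin⟩ := hK.exists_isMinOn
      ⟨(r : ℂ), by simp [abs_of_pos hr, hδ₂]⟩ hSc.norm.continuousOn
    refine ⟨_, norm_pos_iff.2 (hypMap_ne_zero_of_norm_le hg0 ϑ
      (norm_pos_iff.1 (hδ.trans_le hv₀.1)) hv₀.2), fun v h1 h2 => hmin ⟨h1, h2⟩⟩
  have hpos : ∀ {ϑ : ℝ}, ϑ ∈ Icc 0 π → δ ≤ (chebRoot g ϑ 0)⁻¹ → 0 < hypReal g ϑ δ := by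
    intro ϑ h1 h2
    have := strictMonoOn_hypReal hg h1 ⟨le_rfl, hδ.le.trans h2⟩ ⟨hδ.le, h2⟩ hδ
    rwa [hypReal_zero] at this
  have hs0 : 0 < min (min m 1) (min (hypReal g ϑ δ) (hypReal g (π - ϑ) δ)) :=
    lt_min (lt_min hm one_pos) (lt_min (hpos hϑ hδ₃) (hpos hϑ' hδ₄))
  filter_upwards [Ioo_mem_nhdsGT hs0] with s hs
  obtain ⟨hs0, hs'⟩ := hs
  simp only [lt_min_iff] at hs'
  obtain ⟨⟨hsm, hs1⟩, hsV, hsW⟩ := hs'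
  obtain ⟨hV1, hV2⟩ := hV s ⟨hs0, hs1⟩
  obtain ⟨hW1, hW2⟩ := hW s ⟨hs0, hs1⟩
  set x := V s
  set y := W s
  have hxδ : x < δ := ((strictMonoOn_hypReal hg hϑ).lt_iff_lt (Ioo_subset_Icc_self hV1)
    ⟨hδ.le, hδ₃⟩).1 (by rwa [hV2])
  have hyδ : y < δ := ((strictMonoOn_hypReal hg hϑ').lt_iff_lt (Ioo_subset_Icc_self hW1)
    ⟨hδ.le, hδ₄⟩).1 (by rwa [hW2])
  have hSx : hypMap g ϑ x = s := by rw [← ofReal_hypReal, hV2]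
  have hSy : hypMap g ϑ (-y : ℝ) = s := by rw [ofReal_neg, ← hypMap_pi_sub, ← ofReal_hypReal, hW2]
  have hzero : ∀ v : ℂ, ‖v‖ ≤ r → hypMap g ϑ v - s = 0 → v = x ∨ v = (-y : ℝ) := by
    intro v hv h0
    rw [sub_eq_zero] at h0
    have hvδ : ‖v‖ < δ := by
      by_contra! h
      have := hmS v h hv
      rw [h0, norm_real, norm_of_nonneg hs0.le] at this
      linarith
    have hvr : v = (v.re : ℝ) := Complex.ext rfl (him v (hvδ.trans_le hδ₁) s ⟨hs0, hs1⟩ h0)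
    generalize v.re = t at hvr
    subst hvr
    rw [norm_real, norm_eq_abs, abs_lt] at hvδ
    rw [← ofReal_hypReal, ofReal_inj] at h0
    rcases lt_trichotomy t 0 with ht | rfl | ht
    · right
      have h1 : hypReal g (π - ϑ) (-t) = s := by
        rw [← ofReal_inj, ofReal_hypReal, hypMap_pi_sub, ← ofReal_neg, neg_neg, ← ofReal_hypReal, h0]
      have := (strictMonoOn_hypReal hg hϑ').injOn ⟨by linarith, by linarith⟩
        (Ioo_subset_Icc_self hW1) (h1.trans hW2.symm)
      rw [← this, neg_neg]
    · rw [hypReal_zero] at h0; linarith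
    · left
      rw [(strictMonoOn_hypReal hg hϑ).injOn ⟨ht.le, by linarith⟩
        (Ioo_subset_Icc_self hV1) (h0.trans hV2.symm)]
  obtain ⟨B, hB, hSB, hB0⟩ := exists_eq_mul_mul (f := fun v => hypMap g ϑ v - s)
    ((differentiable_hypMap g ϑ).sub_const _) (u := x) (w := (-y : ℝ))
    (by rw [Ne, ofReal_inj]; linarith [hV1.1, hW1.1]) (by rw [hSx, sub_self]) (by rw [hSy, sub_self])
    (by rw [deriv_sub_const]; exact deriv_hypMap_ne_zero hg hϑ hV1)
    (by rw [deriv_sub_const, ofReal_neg]; exact deriv_hypMap_neg_ne_zero hg hϑ' hW1) (r := r) hzero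
  have hA' : ∀ v, ‖v‖ ≤ r → A v ≠ 0 := fun v hv h0 => by
    rcases eq_or_ne v 0 with rfl | hv0
    · rw [hA0] at h0; exact absurd h0 (mod_cast Nat.succ_ne_zero (2 * g))
    · exact hypMap_ne_zero_of_norm_le hg0 ϑ hv0 hv (by rw [hSA, h0, mul_zero])
  set c : ℝ → ℂ := fun α => r * cis α with hc
  have hn : ∀ α, ‖c α‖ = r := norm_mul_exp hr
  have hcc : Continuous c := by fun_prop
  have hmc : ∀ α, m ≤ ‖hypMap g ϑ (c α)‖ := fun α => hmS _ (by rw [hn]; exact hδ₂) (hn α).le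
  have hne : ∀ α, hypMap g ϑ (c α) ≠ 0 := fun α => norm_pos_iff.1 (hm.trans_le (hmc α))
  have hzb : ∀ α, ‖s / hypMap g ϑ (c α)‖ ≤ s / m := fun α => by
    rw [norm_div, norm_real, norm_of_nonneg hs0.le]
    exact div_le_div_of_nonneg_left hs0.le hm (hmc α)
  have hsm1 : s / m < 1 := (div_lt_one hm).2 hsm
  have hzc : Continuous fun α => (s : ℂ) / hypMap g ϑ (c α) :=
    continuous_const.div (hSc.comp hcc) hne
  have hsum := hasSum_circMean (f := fun n α => (s / hypMap g ϑ (c α)) ^ (n + 1) / ((n : ℂ) + 1))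
    (fun n => (hzc.pow _).div_const _) ((summable_nat_add_iff 1).2 (summable_geometric_of_lt_one
      (by positivity) hsm1)) (fun n α => by
        rw [norm_div, norm_pow, show ((n : ℂ) + 1) = ((n + 1 : ℕ) : ℂ) by push_cast; rfl, norm_natCast]
        refine (div_le_self (by positivity) (by norm_cast; omega)).trans ?_
        exact pow_le_pow_left₀ (norm_nonneg _) (hzb α) _)
    fun α => hasSum_pow_succ_div_neg_log ((hzb α).trans_lt hsm1)
  have hsl : ∀ α, 1 - s / hypMap g ϑ (c α) ∈ slitPlane := fun α => by
    rw [sub_eq_add_neg]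
    exact one_add_mem_slitPlane_of_norm_lt_one (by rw [norm_neg]; exact (hzb α).trans_lt hsm1)
  have hlogc : Continuous fun α => -log (1 - s / hypMap g ϑ (c α)) :=
    ((continuous_const.sub hzc).clog hsl).neg
  have hre := hasSum_re hsum
  rw [circMean_re hlogc] at hre
  have hxr : ∀ α, c α - x ≠ 0 ∧ c α - (-y : ℝ) ≠ 0 := fun α => by
    constructor <;> intro h <;>
    · have h1 := hn α
      rw [sub_eq_zero.1 h, norm_real, norm_eq_abs] at h1
      simp only [abs_neg, abs_of_pos hV1.1, abs_of_pos hW1.1] at h1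
      linarith
  have hpt : ∀ α, (-log (1 - s / hypMap g ϑ (c α))).re = (2 * rlog r + rlog ‖A (c α)‖) -
      (rlog ‖c α - x‖ + rlog ‖c α - (-y : ℝ)‖ + rlog ‖B (c α)‖) := by
    intro α
    have e : 1 - s / hypMap g ϑ (c α) = (hypMap g ϑ (c α) - s) / hypMap g ϑ (c α) := by
      rw [sub_div, div_self (hne α)]
    have h1 := norm_ne_zero_iff.2 (hA' (c α) (hn α).le)
    have h2 := norm_ne_zero_iff.2 (hB0 (c α) (hn α).le)
    have h3 := norm_ne_zero_iff.2 (hxr α).1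
    have h4 := norm_ne_zero_iff.2 (hxr α).2
    have h5 := hSB (c α)
    rw [neg_re, log_re, e, h5, hSA, norm_div, norm_mul, norm_mul, norm_mul, norm_pow, hn,
      Real.log_div (by positivity) (by positivity), Real.log_mul (by positivity) h2,
      Real.log_mul h3 h4, Real.log_mul (by positivity) h1, Real.log_pow]
    push_cast
    ring
  have hcA : Continuous fun α => rlog ‖A (c α)‖ := (hA.continuous.comp hcc).norm.log
    fun α => norm_ne_zero_iff.2 (hA' _ (hn α).le)
  have hcB : Continuous fun α => rlog ‖B (c α)‖ := (hB.continuous.comp hcc).norm.log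
    fun α => norm_ne_zero_iff.2 (hB0 _ (hn α).le)
  have hcx : Continuous fun α => rlog ‖c α - x‖ := (hcc.sub continuous_const).norm.log
    fun α => norm_ne_zero_iff.2 (hxr α).1
  have hcy : Continuous fun α => rlog ‖c α - (-y : ℝ)‖ := (hcc.sub continuous_const).norm.log
    fun α => norm_ne_zero_iff.2 (hxr α).2
  have hval : s = x * y * ‖B 0‖ := by
    have h1 := congrArg norm (hSB 0)
    simp only [hypMap_zero, zero_sub, norm_neg, norm_mul, norm_real, norm_of_nonneg hs0.le,
      norm_of_nonneg hV1.1.le, norm_of_nonneg hW1.1.le] at h1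
    exact h1
  rw [circMean_congr hpt, circMean_sub (f := fun α => 2 * rlog r + rlog ‖A (c α)‖) (g := fun α =>
      rlog ‖c α - x‖ + rlog ‖c α - (-y : ℝ)‖ + rlog ‖B (c α)‖)
      (continuous_const.add hcA) ((hcx.add hcy).add hcB),
    circMean_add (f := fun _ => 2 * rlog r) (g := fun α => rlog ‖A (c α)‖) continuous_const hcA,
    circMean_add (f := fun α => rlog ‖c α - x‖ + rlog ‖c α - (-y : ℝ)‖)
      (g := fun α => rlog ‖B (c α)‖) (hcx.add hcy) hcB,
    circMean_add (f := fun α => rlog ‖c α - x‖) (g := fun α => rlog ‖c α - (-y : ℝ)‖) hcx hcy,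
    circMean_const, circMean_log_norm_sub hr, circMean_log_norm_sub hr,
    circMean_log_norm_of_ne_zero hA hr hA', circMean_log_norm_of_ne_zero hB hr hB0, hA0, abs_neg,
    abs_of_pos hV1.1, abs_of_pos hW1.1, max_eq_left (hxδ.le.trans hδ₂),
    max_eq_left (hyδ.le.trans hδ₂)] at hre
  have hNn : ‖(2 * g + 1 : ℂ)‖ = 2 * g + 1 := by
    have : (2 * g + 1 : ℂ) = ((2 * g + 1 : ℕ) : ℂ) := by push_cast; rfl
    rw [this, Complex.norm_natCast]; push_cast; rfl
  have hx0 := hV1.1.ne'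
  have hy0 := hW1.1.ne'
  have hB00 := norm_ne_zero_iff.2 (hB0 0 (by simpa using hr.le))
  rw [hNn] at hre
  convert hre using 1
  · funext n
    have e : ∀ α, (s / hypMap g ϑ (c α)) ^ (n + 1) / ((n : ℂ) + 1) =
        ((s ^ (n + 1) / (n + 1) : ℝ) : ℂ) * (hypMap g ϑ (c α))⁻¹ ^ (n + 1) := fun α => by
      push_cast; rw [div_pow, inv_pow]; ring
    rw [circMean_congr e, circMean_const_mul, re_ofReal_mul, hypCoeff]
    ring
  · rw [hval, Real.log_mul (mul_ne_zero hx0 hy0) hB00, Real.log_mul hx0 hy0]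
    ring

lemma exists_abs_hypCoeff_le (hg : 2 ≤ g) : ∃ C, ∀ ϑ n,
    |hypCoeff g ϑ n| ≤ C * ((growthRate g ϑ)⁻¹ ^ (n + 1) / (n + 1)) := by
  obtain ⟨C, hC⟩ := exists_abs_contourIntegral_im_le hg
  refine ⟨C / π, fun ϑ n => ?_⟩
  have hn : (0 : ℝ) < n + 1 := by positivity
  rw [hypCoeff, circMean_hypMap_re hg, abs_div, abs_div, abs_of_pos pi_pos, abs_of_pos hn]
  calc _ ≤ C * (growthRate g ϑ)⁻¹ ^ (n + 1) / π / (n + 1) := by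
        have := pi_pos
        gcongr; exact hC ϑ (n + 1)
    _ = _ := by ring

lemma hasSum_hypCoeff (hg : 2 ≤ g) {ϑ : ℝ} (hϑ : ϑ ∈ Ioo 0 π) : HasSum (hypCoeff g ϑ)
    (rlog (2 * g + 1) - rlog (chebRoot g ϑ 0) - rlog (chebRoot g (π - ϑ) 0)) := by
  have hϑ₁ := Ioo_subset_Icc_self hϑ
  have hϑ₂ : π - ϑ ∈ Icc 0 π := ⟨by linarith [hϑ.2], by linarith [hϑ.1]⟩
  obtain ⟨V, hV, hVa, hVl⟩ := exists_inverse_hypReal hg hϑ₁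
  obtain ⟨W, hW, hWa, hWl⟩ := exists_inverse_hypReal hg hϑ₂
  obtain ⟨C, hC⟩ := exists_abs_hypCoeff_le hg
  have h0 := growthRate_pos (g := g) ϑ
  have hs := sin_pos_of_pos_of_lt_pi hϑ.1 hϑ.2
  have h1 : 1 < growthRate g ϑ := by rw [growthRate, lt_add_iff_pos_right]; positivity
  refine hasSum_of_analytic_continuation (q := (growthRate g ϑ)⁻¹) (C := |C|)
    (E := fun s => rlog (2 * g + 1) + rlog (V s) + rlog (W s) - rlog s)
    (inv_pos.2 h0) (inv_lt_one_of_one_lt₀ h1) (fun n => (hC ϑ n).trans ?_) (fun s hs => ?_) ?_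
    (eventually_hasSum_hypCoeff hg hϑ₁ hV hW)
  · refine mul_le_mul (le_abs_self C) (div_le_self (by positivity) ?_) (by positivity) (abs_nonneg C)
    simp
  · exact ((analyticAt_const.add ((hVa s hs).log (hV s hs).1.1)).add
      ((hWa s hs).log (hW s hs).1.1)).sub (analyticAt_id.log hs.1)
  · have hR₁ := (inv_pos.2 (chebRoot_zero_pos (by omega : 0 < g) hϑ₁)).ne'
    have hR₂ := (inv_pos.2 (chebRoot_zero_pos (by omega : 0 < g) hϑ₂)).ne'
    have h2 : Tendsto rlog (nhdsWithin 1 (Iio 1)) (nhds (rlog 1)) :=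
      (Real.continuousAt_log one_ne_zero).tendsto.mono_left nhdsWithin_le_nhds
    have h3 := ((tendsto_const_nhds (x := rlog (2 * g + 1))).add (hVl.log hR₁)).add (hWl.log hR₂) |>.sub h2
    simpa [Real.log_inv, sub_eq_add_neg] using h3

end hypSum

section hypMean


variable {g : ℕ}

lemma hypMap_congr_cos {ϑ ϑ' : ℝ} (h : rcos ϑ = rcos ϑ') : hypMap g ϑ = hypMap g ϑ' := by
  funext v
  rcases eq_or_ne v 0 with rfl | hv
  · rw [hypMap_zero, hypMap_zero]
  · have h1 := rootProd_inv (g := g) ϑ (inv_ne_zero hv)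
    rw [h, ← rootProd_inv (g := g) ϑ' (inv_ne_zero hv), inv_inv] at h1
    rw [hypMap, hypMap, mul_left_cancel₀ (pow_ne_zero _ (inv_ne_zero hv)) h1]

lemma chebRoot_zero (ϑ : ℝ) : chebRoot g ϑ 0 = 2 * rcos ((π - ϑ) / (2 * g + 1)) := by
  simp [chebRoot]

lemma circMean_log_chebRoot (hg : 0 < g) : circMean (fun t => rlog (2 * g + 1) -
      rlog (chebRoot g (arccos (rcos t)) 0) - rlog (chebRoot g (π - arccos (rcos t)) 0)) =
    rlog (2 * g + 1) - (2 * g + 1) / π * blochWigner (1 + zetaRoot (2 * g + 1) ^ 1) := by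
  have hπ := pi_pos
  have hN : (0 : ℝ) < 2 * g + 1 := by positivity
  have hacc : ∀ t, arccos (rcos t) ∈ Icc 0 π := fun t => ⟨Real.arccos_nonneg _, Real.arccos_le_pi _⟩
  have hacc' : ∀ t, π - arccos (rcos t) ∈ Icc 0 π := fun t =>
    ⟨sub_nonneg.2 (hacc t).2, sub_le_self _ (hacc t).1⟩
  have hcr : ∀ {f : ℝ → ℝ}, Continuous f → Continuous fun t => chebRoot g (f t) 0 := fun hf =>
    (continuous_chebRoot g 0).comp hf
  have hac : Continuous fun t => arccos (rcos t) := continuous_arccos.comp Real.continuous_cos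
  set F : ℝ → ℝ := fun t => rlog (2 * g + 1) - rlog (chebRoot g (arccos (rcos t)) 0) -
      rlog (chebRoot g (π - arccos (rcos t)) 0) with hF
  have hFc : Continuous F := (continuous_const.sub
    ((hcr hac).log fun t => (chebRoot_zero_pos hg (hacc t)).ne')).sub
    ((hcr (continuous_const.sub hac)).log fun t => (chebRoot_zero_pos hg (hacc' t)).ne')
  have hi : ∀ a b, IntervalIntegrable F volume a b := fun a b => hFc.intervalIntegrable a b
  have hsym : ∫ t in π..2 * π, F t = ∫ t in (0 : ℝ)..π, F t := by
    have := integral_comp_sub_left (a := 0) (b := π) F (2 * π)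
    rw [sub_zero, show 2 * π - π = π by ring] at this
    simp_all
  set l : ℝ → ℝ := fun x => rlog (2 * rcos x) with hl
  have hli : ∀ a b, IntervalIntegrable l volume a b := intervalIntegrable_log_two_mul_cos
  have hl1 : ∫ t in (0 : ℝ)..π, l (t / (2 * g + 1)) =
      (2 * g + 1) * ∫ t in (0 : ℝ)..π / (2 * g + 1), l t := by
    rw [intervalIntegral.integral_comp_div l hN.ne', zero_div, smul_eq_mul]
  have hl2 : ∫ t in (0 : ℝ)..π, l ((π - t) / (2 * g + 1)) =
      ∫ t in (0 : ℝ)..π, l (t / (2 * g + 1)) := by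
    have := integral_comp_sub_left (a := 0) (b := π) (fun t => l (t / (2 * g + 1))) π
    rwa [sub_self, sub_zero] at this
  have hlc : ∀ f : ℝ → ℝ, Continuous f → (∀ t ∈ Icc 0 π, f t ∈ Icc 0 π) →
      IntervalIntegrable (fun t => l (f t / (2 * g + 1))) volume 0 π := fun f hf h => by
    refine ContinuousOn.intervalIntegrable ?_
    rw [uIcc_of_le hπ.le]
    refine ContinuousOn.log (by fun_prop) fun t ht => ?_
    have := chebRoot_zero_pos hg (ϑ := π - f t) ⟨sub_nonneg.2 (h t ht).2, sub_le_self _ (h t ht).1⟩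
    rw [chebRoot_zero, sub_sub_cancel] at this
    exact this.ne'
  have hFl : ∀ t ∈ uIcc 0 π, F t = rlog (2 * g + 1) -
      l ((π - t) / (2 * g + 1)) - l (t / (2 * g + 1)) := fun t ht => by
    rw [uIcc_of_le hπ.le] at ht
    simp only [hF, hl, chebRoot_zero, Real.arccos_cos ht.1 ht.2, sub_sub_cancel]
  have hi1 := hlc (fun t => π - t) (by fun_prop) fun t ht => ⟨sub_nonneg.2 ht.2, sub_le_self _ ht.1⟩
  have hi2 := hlc (fun t => t) (by fun_prop) fun t ht => ht
  have hint : ∫ t in (0 : ℝ)..π, F t = π * rlog (2 * g + 1) -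
      2 * (2 * g + 1) * ∫ t in (0 : ℝ)..π / (2 * g + 1), l t := by
    rw [integral_congr hFl, integral_sub
      (intervalIntegrable_const.sub hi1) hi2, integral_sub intervalIntegrable_const hi1,
      hl2, hl1, integral_const, sub_zero, smul_eq_mul]
    ring
  have hb := blochWigner_one_add_zetaRoot_pow (m := 1) (g := g) one_pos hg
  rw [Nat.cast_one, mul_one] at hb
  rw [circMean, ← integral_add_adjacent_intervals (hi 0 π) (hi _ _), hsym, hint, hb, smul_eq_mul]
  field_simp
  ring

lemma continuous_hypCoeff (hg : 0 < g) (n : ℕ) : Continuous fun ϑ => hypCoeff g ϑ n := by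
  have hr := hypRadius_pos g
  have h : Continuous fun z : ℝ × ℝ => (hypMap g z.1 (hypRadius g * cis z.2))⁻¹ ^ (n + 1) :=
    (((continuous_hypMap g).comp (by fun_prop : Continuous fun z : ℝ × ℝ =>
      (z.1, (hypRadius g : ℂ) * cis z.2))).inv₀ fun z => hypMap_ne_zero_of_norm_le hg _
        (mul_ne_zero (mod_cast hr.ne') (exp_ne_zero _)) (norm_mul_exp hr _).le).pow _
  exact (continuous_re.comp (continuous_circMean h)).div_const _

lemma gradedTerm_famHyp_eq_circMean (hg : 0 < g) (n : ℕ) :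
    gradedTerm (famHyp g) ⟨0, hg⟩ (chebCoeff g ∘ rev) 1 (2 * (g : ℝ) + 1) (n + 1) =
      circMean fun ϑ => hypCoeff g ϑ n := by
  have hr := hypRadius_pos g
  have h := congrArg re (succ_mul_gradedTerm_famHyp hg n hr le_rfl)
  have hc : Continuous fun z : ℝ × ℝ => (hypMap g z.1 (hypRadius g * cis z.2))⁻¹ ^ (n + 1) :=
    (((continuous_hypMap g).comp (by fun_prop : Continuous fun z : ℝ × ℝ =>
      (z.1, (hypRadius g : ℂ) * cis z.2))).inv₀ fun z => hypMap_ne_zero_of_norm_le hg _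
        (mul_ne_zero (mod_cast hr.ne') (exp_ne_zero _)) (norm_mul_exp hr _).le).pow _
  have hn : (n : ℝ) + 1 ≠ 0 := by positivity
  rw [ofReal_re, circMean_re (continuous_circMean hc)] at h
  rw [← mul_right_inj' hn, h, ← circMean_const_mul_real]
  exact circMean_congr fun ϑ => by rw [hypCoeff, mul_div_cancel₀ _ hn]

lemma hasSum_gradedTerm_famHyp (hg : 2 ≤ g) :
    HasSum (fun n => gradedTerm (famHyp g) ⟨0, by omega⟩ (chebCoeff g ∘ rev) 1
      (2 * (g : ℝ) + 1) (n + 1))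
      (rlog (2 * g + 1) - (2 * g + 1) / π * blochWigner (1 + zetaRoot (2 * g + 1) ^ 1)) := by
  have hg0 : 0 < g := by omega
  obtain ⟨C, hC⟩ := exists_abs_hypCoeff_le hg
  rw [← circMean_log_chebRoot hg0]
  refine (hasSum_circMean_of_sin_sq (f := fun n ϑ => hypCoeff g ϑ n) (κ := (2 ^ (2 * g + 3))⁻¹)
    (by positivity) (continuous_hypCoeff hg0) (fun n t _ => hC t n) fun t ht => ?_).congr_fun
    fun n => gradedTerm_famHyp_eq_circMean hg0 n
  have hcos : rcos t = rcos (arccos (rcos t)) := (cos_arccos (neg_one_le_cos t) (cos_le_one t)).symm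
  have hsq := Real.sin_sq_add_cos_sq t
  have ht2 : 0 < rsin t ^ 2 := by positivity
  have hmem : arccos (rcos t) ∈ Ioo 0 π := by
    refine ⟨Real.arccos_pos.2 (by nlinarith), (Real.arccos_le_pi _).lt_of_ne fun h => ?_⟩
    simp_all
  have h := hasSum_hypCoeff hg hmem
  have e : ∀ n, hypCoeff g t n = hypCoeff g (arccos (rcos t)) n := fun n => by
    rw [hypCoeff, hypCoeff, hypMap_congr_cos hcos]
  simpa only [e] using h

end hypMean

end

theorem mainTheorem3 (g : ℕ) (hg : 0 < g) :
    -- the maximal conifold points of the two families exist and are unique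
    (∃! a : Fin g → ℝ, IsMaximalConifold (famGG g 1) a) ∧
    (∃! a : Fin g → ℝ, IsMaximalConifold (famHyp g 1) a) ∧
    -- the regulator periods over `γ₁` and `γ_g` on `C_{g,g}`
    (∀ a : Fin g → ℝ, IsMaximalConifold (famGG g 1) a →
      ((∃ R, IsRegulatorPeriodAt (famGG g 1) (0, 0) (1, 0) (0, 1) (weightGG g) a R) ∧
        ∀ R, IsRegulatorPeriodAt (famGG g 1) (0, 0) (1, 0) (0, 1) (weightGG g) a R →
          CongrModQ1 (1 / (2 * Real.pi * Complex.I) * R) (conifoldValue g g)) ∧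
      ((∃ R, IsRegulatorPeriodAt (famGG g 1) (1 - (g : ℤ), 1 - (g : ℤ)) (-1, -1)
          ((g : ℤ), (g : ℤ) - 1) (weightGG g) a R) ∧
        ∀ R, IsRegulatorPeriodAt (famGG g 1) (1 - (g : ℤ), 1 - (g : ℤ)) (-1, -1)
            ((g : ℤ), (g : ℤ) - 1) (weightGG g) a R →
          CongrModQ1 (1 / (2 * Real.pi * Complex.I) * R) (conifoldValue (2 * g - 1) 1))) ∧
    -- the regulator period over `γ₁` on `C_{2g-1,1}`
    (∀ a : Fin g → ℝ, IsMaximalConifold (famHyp g 1) a →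
      (∃ R, IsRegulatorPeriodAt (famHyp g 1) (0, 0) (1, 0) (0, 1) (weightHyp g) a R) ∧
        ∀ R, IsRegulatorPeriodAt (famHyp g 1) (0, 0) (1, 0) (0, 1) (weightHyp g) a R →
          CongrModQ1 (1 / (2 * Real.pi * Complex.I) * R) (conifoldValue (2 * g - 1) 1)) ∧
    -- the values
    conifoldValue g g =
      -((2 * (g : ℝ) + 1) / Real.pi * blochWigner (1 + zetaRoot (2 * g + 1) ^ g)) ∧
    conifoldValue (2 * g - 1) 1 =
      -((2 * (g : ℝ) + 1) / Real.pi * blochWigner (1 + zetaRoot (2 * g + 1))) ∧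
    -- the series for the regulator period over `γ₁` where `a₁` dominates
    (∀ a : Fin g → ℝ, 3 + ∑ i ∈ Finset.univ.erase ⟨0, hg⟩, |a i| < |a ⟨0, hg⟩| →
      (∃ S : ℝ, HasSum (fun k : ℕ => (-1) ^ (k + 1) / ((k : ℝ) + 1) *
          ((famGG g 1 a - AddMonoidAlgebra.single 0 (a ⟨0, hg⟩)) ^ (k + 1)).coeff 0 /
            a ⟨0, hg⟩ ^ (k + 1)) S ∧
        (∃ R, IsRegulatorPeriod (famGG g 1 a) (0, 0) (1, 0) (0, 1) R) ∧
        ∀ R, IsRegulatorPeriod (famGG g 1 a) (0, 0) (1, 0) (0, 1) R →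
          CongrModQ1 (1 / (2 * Real.pi * Complex.I) * R)
            ((-Real.log |a ⟨0, hg⟩| + S : ℝ) : ℂ)) ∧
      (∃ S : ℝ, HasSum (fun k : ℕ => (-1) ^ (k + 1) / ((k : ℝ) + 1) *
          ((famHyp g 1 a - AddMonoidAlgebra.single 0 (a ⟨0, hg⟩)) ^ (k + 1)).coeff 0 /
            a ⟨0, hg⟩ ^ (k + 1)) S ∧
        (∃ R, IsRegulatorPeriod (famHyp g 1 a) (0, 0) (1, 0) (0, 1) R) ∧
        ∀ R, IsRegulatorPeriod (famHyp g 1 a) (0, 0) (1, 0) (0, 1) R →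
          CongrModQ1 (1 / (2 * Real.pi * Complex.I) * R)
            ((-Real.log |a ⟨0, hg⟩| + S : ℝ) : ℂ))) ∧
    -- the series identities at the maximal conifold points
    (∀ a : Fin g → ℝ, IsMaximalConifold (famGG g 1) a →
      ∃ S : ℝ, HasSum (fun n : ℕ => gradedTerm (famGG g) ⟨0, hg⟩ a ((-1) ^ (g + 1))
          (2 * (g : ℝ) + 1) (n + 1)) S ∧
        Real.log (2 * (g : ℝ) + 1) - S =
          (2 * (g : ℝ) + 1) / Real.pi * blochWigner (1 + zetaRoot (2 * g + 1) ^ g)) ∧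
    (∀ a : Fin g → ℝ, IsMaximalConifold (famHyp g 1) a →
      ∃ S : ℝ, HasSum (fun n : ℕ => gradedTerm (famHyp g) ⟨0, hg⟩ a 1
          (2 * (g : ℝ) + 1) (n + 1)) S ∧
        Real.log (2 * (g : ℝ) + 1) - S =
          (2 * (g : ℝ) + 1) / Real.pi * blochWigner (1 + zetaRoot (2 * g + 1))) := by
  refine ⟨⟨chebCoeff g, (isMaximalConifold_famGG_iff _ hg).2 rfl,
      fun a ha => (isMaximalConifold_famGG_iff a hg).1 ha⟩,
    ⟨chebCoeff g ∘ Fin.rev, (isMaximalConifold_famHyp_iff _ hg).2 rfl,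
      fun a ha => (isMaximalConifold_famHyp_iff a hg).1 ha⟩,
    fun a ha => ?_, fun a ha => ?_, conifoldValue_gg hg, conifoldValue_hyp hg,
    fun a ha => ⟨?_, ?_⟩, fun a ha => ?_, fun a ha => ?_⟩
  · rw [(isMaximalConifold_famGG_iff a hg).1 ha]
    exact ⟨isRegulatorPeriodAt_famGG hg, isRegulatorPeriodAt_famGG_top hg⟩
  · rw [(isMaximalConifold_famHyp_iff a hg).1 ha]
    exact isRegulatorPeriodAt_famHyp hg
  · exact exists_hasSum_of_dominant (Laurent2.isMonicInSecond_famGG hg a) ha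
      fun x y hx hy => norm_eval_famGG_sub_le hg a hx hy
  · exact exists_hasSum_of_dominant (Laurent2.isMonicInSecond_famHyp g a) ha
      fun x y hx hy => norm_eval_famHyp_sub_le hg a hx hy
  · rw [(isMaximalConifold_famGG_iff a hg).1 ha]
    exact ⟨_, hasSum_gradedTerm_famGG hg, by ring⟩
  · rw [(isMaximalConifold_famHyp_iff a hg).1 ha]
    rcases Nat.lt_or_ge 1 g with h | h
    · exact ⟨_, hasSum_gradedTerm_famHyp h, by rw [pow_one]; ring⟩
    · obtain rfl : g = 1 := by omega
      refine ⟨_, ?_, sub_sub_cancel _ _⟩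
      have h1 : chebCoeff 1 ∘ Fin.rev = chebCoeff 1 := by
        funext i; rw [Subsingleton.elim i 0]; rfl
      have h2 : (famHyp 1 : Polynomial ℝ → (Fin 1 → Polynomial ℝ) → _) = famGG 1 := by
        funext c b; simp [famHyp, famGG]
      rw [h1, h2]
      simpa using hasSum_gradedTerm_famGG hg
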